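/- **Setting.** Let $T$ be a text of length $n$ over an alphabet $\Sigma=\{0,\dots,\sigma-1\}$ such that every character of $\Sigma$ occurs in $T$ and the last character of $T$ occurs nowhere else in $T$. The *LZ78 factorization* of $T$ is the factorization $T=f_1\cdots f_z$ in which $f_x=f'_x c$ for every $1\le x\le z$, where $c\in\Sigma$ and $f'_x$ is the longest string in $\{f_y : y<x\}\cup\{\varepsilon\}$ that is a prefix of $f_x f_{x+1}\cdots f_z$. A factor with $f'_x=\varepsilon$ is *fresh* and is coded by its character $c$; a factor with $f'_x=f_y$ is coded by the pair $(y,c)$. The *LZ trie* is the trie of the factors; its nodes other than the root correspond to the factors. The model is the word RAM with word size $w=w(n)$, where $w(n)\ge c_0(\lfloor\lg n\rfloor+1)$ for a constant $c_0$, and $w(n)=o(n)$ (so that a constant number of words takes $o(n)$ bits). In unit time it performs an arithmetic, shift or bitwise operation on words, a comparison, a popcount of a word, or an access to at most $w$ consecutive bits of the working memory. The *compressed suffix tree* of $T$ is loaded and read-only: nodes are identified with their pre-order numbers, and in unit time one can query the array $\psi$ ($\psi(i)$ is the rank, among the sorted suffixes, of the suffix that starts one position after the $i$-th smallest suffix,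 cyclically), the rank of the leaf of the suffix $T$, and, in the tree topology, the parent and the depth of a node, its ancestor at a given depth, its leftmost and its rightmost leaf, its $i$-th child, the number of its preceding siblings, the number of leaves preceding it, and the $i$-th leaf. There is no access to $T$ itself. The *additional space* is the number of bits of the working memory in use plus the bits of the (constantly many) registers; neither the compressed suffix tree nor a write-only output stream is counted. **Theorem.** Given the compressed suffix tree of $T$, the LZ78 factorization $f_1\cdots f_z$ of $T$ can be computed in $O(n)$ time 1. with $5n+z\lg z+o(n)$ bits of additional space, when the codes of $f_1,\dots,f_z$ are streamed in this order to the output; and 2. with $6n+z(\lg\sigma+\lg z+3)+o(n)$ bits of additional space, when the LZ trie is stored explicitly in the working memory (and this storage is counted), namely as the balanced parenthesis sequence of its topology, with the children of a node ordered by their characters, together with two arrays that give, for each node except the root in pre-order, the index of its factor and the last character of its factor. In both cases there is one program that works for all texts and all admissible word sizes; the constant in the time bound and the constant $c_0$ depend on nothing else, and for each choice of the function $w$ the $o(n)$ term depends only on $n$. -/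

import Mathlib

open Filter Asymptotics

namespace LZCics

section Factorization

variable {A : Type*}

/-- `T` is a text over exactly the characters of `A` (the alphabet is effective), and the last
character of `T` occurs nowhere else in `T`. -/
def IsText (T : List A) : Prop :=
  (∀ c : A, c ∈ T) ∧ ∃ (S : List A) (c : A), T = S ++ [c] ∧ c ∉ S

/-- `F = f₁, …, f_z` is the LZ78 factorization of `T`: `T` is the concatenation of the factors, and
each factor is `f' ++ [c]`, where `f'` is the longest string among the earlier factors and
the empty string that is a prefix of the part of `T` that is still to be parsed. -/
def IsLZ78 (T : List A) (F : List (List A)) : Prop :=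
  F.flatten = T ∧
  ∀ (x : ℕ) (hx : x < F.length), ∃ (f' : List A) (c : A),
    F[x] = f' ++ [c] ∧
    (f' = [] ∨ f' ∈ F.take x) ∧
    ∀ S ∈ F.take x, S <+: (F.drop x).flatten → S.length ≤ f'.length

/-- The coding of a factor: a fresh factor is coded by its character, a referencing factor by the
(1-based) index of the referred factor and its last character. -/
inductive Code where
  | fresh (c : ℕ)
  | ref (y c : ℕ)
  deriving DecidableEq, Repr

/-- `out` is the coding of the factors of `F`, in the order of the factor indices. -/
def IsCoding {σ : ℕ} (F : List (List (Fin σ))) (out : List Code) : Prop :=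
  out.length = F.length ∧
  ∀ (x : ℕ) (hx : x < F.length),
    (∃ c : Fin σ, F[x] = [c] ∧ out[x]? = some (Code.fresh c)) ∨
    (∃ (y : ℕ) (hy : y < x) (c : Fin σ),
      F[x] = F[y] ++ [c] ∧ out[x]? = some (Code.ref (y + 1) c))

end Factorization

section SuffixTree

variable {σ : ℕ}

/- Every node of the suffix trie, of the suffix tree and of the LZ trie is identified with the
string that is read on the path from the root to it. -/

/-- The nodes of the suffix trie of `T`: the prefixes of the suffixes of `T`. -/
def trieNodes (T : List (Fin σ)) : Finset (List (Fin σ)) :=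
  (T.tails.flatMap List.inits).toFinset

/-- The characters on the edges from the node `S` of the suffix trie to its children. -/
def trieEdges (T S : List (Fin σ)) : Finset (Fin σ) :=
  Finset.univ.filter fun c => S ++ [c] ∈ trieNodes T

/-- The nodes of the suffix tree, that is, of the compacted suffix trie: all nodes of the suffix
trie except those that have exactly one child and are not the root. -/
def nodeSet (T : List (Fin σ)) : Finset (List (Fin σ)) :=
  (trieNodes T).filter fun S => S = [] ∨ (trieEdges T S).card ≠ 1

/-- The leaves of the suffix tree. -/
def leafSet (T : List (Fin σ)) : Finset (List (Fin σ)) :=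
  (nodeSet T).filter fun S => trieEdges T S = ∅

/-- The nodes in pre-order, where siblings are ordered by the first characters of their edges; on
path labels this is the lexicographic order. -/
def nodeList (T : List (Fin σ)) : List (List (Fin σ)) := (nodeSet T).sort (· ≤ ·)

/-- The leaves in depth first order. -/
def leafList (T : List (Fin σ)) : List (List (Fin σ)) := (leafSet T).sort (· ≤ ·)

/-- The pre-order number (from 0) of a node. -/
def number (T S : List (Fin σ)) : ℕ := ((nodeSet T).filter (· < S)).card

/-- The node with a given pre-order number. -/
def nodeAt (T : List (Fin σ)) (i : ℕ) : List (Fin σ) := ((nodeList T)[i]?).getD []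

/-- The nodes on the path from the root to `S`, both included. -/
def path (T S : List (Fin σ)) : List (List (Fin σ)) := S.inits.filter (· ∈ nodeSet T)

/-- The number of edges on the path from the root to `S`. -/
def depth (T S : List (Fin σ)) : ℕ := (path T S).length - 1

/-- The ancestor of `S` at depth `d`. -/
def levelAnc (T S : List (Fin σ)) (d : ℕ) : List (Fin σ) := ((path T S)[d]?).getD []

/-- The parent of `S` (the root for the root). -/
def parent (T S : List (Fin σ)) : List (Fin σ) := levelAnc T S (depth T S - 1)

/-- The children of `S`, from left to right. -/
def children (T S : List (Fin σ)) : List (List (Fin σ)) :=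
  (nodeList T).filter fun C => C ≠ [] ∧ parent T C = S

/-- The child of `S` that has `i` preceding siblings (the root if there is none). -/
def child (T S : List (Fin σ)) (i : ℕ) : List (Fin σ) := ((children T S)[i]?).getD []

/-- The number of preceding siblings of `S`. -/
def childRank (T S : List (Fin σ)) : ℕ := ((children T (parent T S)).filter (· < S)).length

/-- The number of leaves preceding `S`. -/
def leafRank (T S : List (Fin σ)) : ℕ := ((leafSet T).filter (· < S)).card

/-- The leaf that has `i` preceding leaves. -/
def leafSelect (T : List (Fin σ)) (i : ℕ) : List (Fin σ) := ((leafList T)[i]?).getD []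

/-- The leaves in the subtree rooted at `S`, from left to right. -/
def leavesBelow (T S : List (Fin σ)) : List (List (Fin σ)) := (leafList T).filter (S <+: ·)

/-- The leftmost leaf of `S`. -/
def lmostLeaf (T S : List (Fin σ)) : List (Fin σ) := ((leavesBelow T S).head?).getD []

/-- The rightmost leaf of `S`. -/
def rmostLeaf (T S : List (Fin σ)) : List (Fin σ) := ((leavesBelow T S).getLast?).getD []

/-- The suffix array, with positions and ranks counted from 0: the label (starting position) of
the leaf that has `i` preceding leaves. -/
def suffixArray (T : List (Fin σ)) (i : ℕ) : ℕ := T.length - (leafSelect T i).length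

/-- The inverse suffix array: the rank of the suffix that starts at position `j`. -/
def invSuffixArray (T : List (Fin σ)) (j : ℕ) : ℕ := leafRank T (T.drop j)

/-- The `ψ`-array: the rank of the suffix that starts one position later (of the whole text, if
there is no later position). -/
def psi (T : List (Fin σ)) (i : ℕ) : ℕ :=
  invSuffixArray T ((suffixArray T i + 1) % T.length)

/-- The constant time queries to the compressed suffix tree: `ψ`, the stored rank of the leaf of
the whole text, and the navigation in the tree topology. There is no access to the text, and no
query for string depths, edge labels or leaf labels. -/
inductive Query where
  | psi | firstLeafRank | parent | depth | levelAnc | lmostLeaf | rmostLeaf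
  | leafSelect | leafRank | childRank | child
  deriving DecidableEq, Repr

/-- The answer to a query with arguments `a` and `b`. Nodes are passed and returned as pre-order
numbers; superfluous arguments are ignored. -/
def Query.answer (T : List (Fin σ)) (q : Query) (a b : ℕ) : ℕ :=
  match q with
  | .psi => LZCics.psi T a
  | .firstLeafRank => invSuffixArray T 0
  | .parent => number T (LZCics.parent T (nodeAt T a))
  | .depth => LZCics.depth T (nodeAt T a)
  | .levelAnc => number T (LZCics.levelAnc T (nodeAt T a) b)
  | .lmostLeaf => number T (LZCics.lmostLeaf T (nodeAt T a))
  | .rmostLeaf => number T (LZCics.rmostLeaf T (nodeAt T a))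
  | .leafSelect => number T (LZCics.leafSelect T a)
  | .leafRank => LZCics.leafRank T (nodeAt T a)
  | .childRank => LZCics.childRank T (nodeAt T a)
  | .child => number T (LZCics.child T (nodeAt T a) b)

end SuffixTree

section WordRam

/-- The binary operations on words. -/
inductive BinOp where
  | add | sub | mul | div | and | or | xor | shl | shr
  deriving DecidableEq, Repr

/-- The result of an operation on words of `w` bits; the arithmetic is modulo `2 ^ w`. -/
def BinOp.eval (w : ℕ) (o : BinOp) (a b : ℕ) : ℕ :=
  match o with
  | .add => (a + b) % 2 ^ w
  | .sub => (a + 2 ^ w - b) % 2 ^ w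
  | .mul => (a * b) % 2 ^ w
  | .div => a / b
  | .and => a &&& b
  | .or => a ||| b
  | .xor => a ^^^ b
  | .shl => (a <<< b) % 2 ^ w
  | .shr => a >>> b

/-- The number of set bits. -/
def popcount (a : ℕ) : ℕ := a.bits.count true

/-- The instructions. All arguments except the constant of `const` are names of registers. -/
inductive Instr where
  /-- set register `d` to the constant `c` -/
  | const (d c : ℕ)
  /-- apply `o` to the registers `a` and `b` -/
  | bin (o : BinOp) (d a b : ℕ)
  | popcount (d a : ℕ)
  /-- read the block of memory whose address is in `a` and whose length (in bits) is in `l` -/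
  | load (d a l : ℕ)
  /-- write the value of `v` to the block with address in `a` and length (in bits) in `l` -/
  | store (a l v : ℕ)
  /-- query the compressed suffix tree with the arguments in `a` and `b` -/
  | query (q : Query) (d a b : ℕ)
  /-- append the code of a fresh factor to the output stream -/
  | emitFresh (c : ℕ)
  /-- append the code of a referencing factor to the output stream -/
  | emitRef (y c : ℕ)

/-- Comparisons of two registers. -/
inductive Test where
  | lt (a b : ℕ)
  | eq (a b : ℕ)

/-- Programs of the word RAM, in structured form. -/
inductive Prog where
  | instr (i : Instr)
  | seq (p q : Prog)
  | ite (c : Test) (p q : Prog)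
  | while (c : Test) (p : Prog)

/-- A bound for the registers that occur in an instruction. -/
def Instr.numRegs : Instr → ℕ
  | .const d _ => d + 1
  | .bin _ d a b => max (d + 1) (max (a + 1) (b + 1))
  | .popcount d a => max (d + 1) (a + 1)
  | .load d a l => max (d + 1) (max (a + 1) (l + 1))
  | .store a l v => max (a + 1) (max (l + 1) (v + 1))
  | .query _ d a b => max (d + 1) (max (a + 1) (b + 1))
  | .emitFresh c => c + 1
  | .emitRef y c => max (y + 1) (c + 1)

def Test.numRegs : Test → ℕ
  | .lt a b => max (a + 1) (b + 1)
  | .eq a b => max (a + 1) (b + 1)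

/-- The number of registers of a program (those with a number below this one). -/
def Prog.numRegs : Prog → ℕ
  | .instr i => i.numRegs
  | .seq p q => max p.numRegs q.numRegs
  | .ite c p q => max c.numRegs (max p.numRegs q.numRegs)
  | .while c p => max c.numRegs p.numRegs

/-- A state of the machine: the registers, the working memory (a sequence of bits), the output
stream, and the number of bits of the working memory that are in use, that is, the least number
that exceeds all addresses of bits accessed so far. -/
structure State where
  reg : ℕ → ℕ
  mem : ℕ → Bool
  out : List Code
  used : ℕ

/-- At the start, all registers and the memory are zero and nothing is written. -/
def State.init : State := ⟨fun _ => 0, fun _ => false, [], 0⟩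

def State.setReg (s : State) (d v : ℕ) : State := { s with reg := Function.update s.reg d v }

/-- The number that is stored (least significant bit first) in the block of `l` bits at
address `a`. -/
def State.block (s : State) (a l : ℕ) : ℕ :=
  ∑ i ∈ Finset.range l, if s.mem (a + i) then 2 ^ i else 0

/-- Write the `l` lowest bits of `v` to the block at address `a`. -/
def State.write (s : State) (a l v : ℕ) : State :=
  { s with mem := fun j => if a ≤ j ∧ j < a + l then v.testBit (j - a) else s.mem j }

/-- Record an access to the block of `l` bits at address `a`. -/
def State.touch (s : State) (a l : ℕ) : State := { s with used := max s.used (a + l) }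

/-- The effect of an instruction on a machine with word size `w`. A memory access concerns at most
`w` consecutive bits. -/
def Instr.step {σ : ℕ} (T : List (Fin σ)) (w : ℕ) (i : Instr) (s : State) : State :=
  match i with
  | .const d c => s.setReg d (c % 2 ^ w)
  | .bin o d a b => s.setReg d (o.eval w (s.reg a) (s.reg b))
  | .popcount d a => s.setReg d (LZCics.popcount (s.reg a))
  | .load d a l =>
      (s.touch (s.reg a) (min (s.reg l) w)).setReg d (s.block (s.reg a) (min (s.reg l) w))
  | .store a l v =>
      (s.touch (s.reg a) (min (s.reg l) w)).write (s.reg a) (min (s.reg l) w) (s.reg v)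
  | .query q d a b => s.setReg d (q.answer T (s.reg a) (s.reg b) % 2 ^ w)
  | .emitFresh c => { s with out := s.out ++ [Code.fresh (s.reg c)] }
  | .emitRef y c => { s with out := s.out ++ [Code.ref (s.reg y) (s.reg c)] }

def Test.holds (s : State) : Test → Prop
  | .lt a b => s.reg a < s.reg b
  | .eq a b => s.reg a = s.reg b

/-- `Exec T w P s s' t`: on a machine with word size `w` that is given the compressed suffix tree
of `T`, the program `P`, started in the state `s`, halts in the state `s'` after `t` steps. Every
instruction and every test is one step. -/
inductive Exec {σ : ℕ} (T : List (Fin σ)) (w : ℕ) : Prog → State → State → ℕ → Prop where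
  | instr (i : Instr) (s : State) : Exec T w (.instr i) s (i.step T w s) 1
  | seq {p q : Prog} {s s' s'' : State} {t t' : ℕ} :
      Exec T w p s s' t → Exec T w q s' s'' t' → Exec T w (.seq p q) s s'' (t + t')
  | ite_true {c : Test} {p q : Prog} {s s' : State} {t : ℕ} :
      c.holds s → Exec T w p s s' t → Exec T w (.ite c p q) s s' (t + 1)
  | ite_false {c : Test} {p q : Prog} {s s' : State} {t : ℕ} :
      ¬ c.holds s → Exec T w q s s' t → Exec T w (.ite c p q) s s' (t + 1)
  | while_true {c : Test} {p : Prog} {s s' s'' : State} {t t' : ℕ} :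
      c.holds s → Exec T w p s s' t → Exec T w (.while c p) s' s'' t' →
      Exec T w (.while c p) s s'' (t + t' + 1)
  | while_false {c : Test} {p : Prog} {s : State} :
      ¬ c.holds s → Exec T w (.while c p) s s 1

/-- The working space (in bits) of a run of `P` that halts in `s`: the part of the memory that was
in use, and the registers. The compressed suffix tree and the output stream do not count. -/
def workingSpace (w : ℕ) (P : Prog) (s : State) : ℕ := s.used + P.numRegs * w

end WordRam

section StoredTrie

variable {σ : ℕ}

/-- The balanced parentheses (`true` opens, `false` closes) of the subtree, rooted at `S`, of the
LZ trie of the factors `F`, where the children of a node are ordered by the characters of their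
edges. The first argument bounds the height of the subtree (in nodes). -/
def lzTrieBP (F : List (List (Fin σ))) : ℕ → List (Fin σ) → List Bool
  | 0, _ => []
  | h + 1, S =>
      true :: (((List.finRange σ).filter fun c => S ++ [c] ∈ F).flatMap
        fun c => lzTrieBP F h (S ++ [c])) ++ [false]

/-- The nodes of the LZ trie except the root, in pre-order. -/
def lzTrieNodes (F : List (List (Fin σ))) : List (List (Fin σ)) := F.toFinset.sort (· ≤ ·)

/-- In the state `s`, the LZ trie of the factors `F` is stored explicitly: with `z` the number of
factors (in register 5), the memory contains
* at the address in register 0, the `2 (z + 1)` balanced parentheses of the trie;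
* at the address in register 1, an array with the factor index (from 1 to `z`) of each node except
  the root, in pre-order, with entries whose number of bits is in register 2;
* at the address in register 3, an array with the last character of the factor of each of these
  nodes (the label of the edge to the node), with entries whose number of bits is in register 4. -/
def StoresLZTrie (w : ℕ) (F : List (List (Fin σ))) (s : State) : Prop :=
  s.reg 5 = F.length ∧
  (s.reg 0 + 2 * (F.length + 1) ≤ s.used ∧
    ∀ i < 2 * (F.length + 1), (lzTrieBP F (F.flatten.length + 1) [])[i]? = some (s.mem (s.reg 0 + i))) ∧
  (s.reg 2 ≤ w ∧ s.reg 1 + F.length * s.reg 2 ≤ s.used ∧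
    ∀ i < F.length, ∃ (x : ℕ) (hx : x < F.length),
      (lzTrieNodes F)[i]? = some F[x] ∧ s.block (s.reg 1 + i * s.reg 2) (s.reg 2) = x + 1) ∧
  (s.reg 4 ≤ w ∧ s.reg 3 + F.length * s.reg 4 ≤ s.used ∧
    ∀ i < F.length, ∃ (f' : List (Fin σ)) (c : Fin σ),
      (lzTrieNodes F)[i]? = some (f' ++ [c]) ∧
        s.block (s.reg 3 + i * s.reg 4) (s.reg 4) = c)

end StoredTrie

end LZCics

open LZCics

/-! The LZ trie is superimposed on the suffix tree. Every factor occurs in the text, so it is a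
point on exactly one suffix tree edge, and since the factors are closed under nonempty prefixes, the
points on the edge to `v` follow each other without gaps, starting right below `parent T v`. Hence
the trie is determined by the numbers `cnt T F v`.

A point on the edge to `v` is created by a factor that starts at a leaf below `v`, and different
points come from different leaves (`IsGreedy.cnt_le_leaves`). So the count fits, in unary, into the
leaf interval of `v`. A counter is needed only while the upper end of its edge is full (or the root)
and the edge itself is not; such edges have disjoint leaf intervals. Therefore `n` bits hold all
counters, and `n` more bits mark the full inner nodes (`Edges`, `Counters.step`). The end of the
next factor is found by descending over full edges; its length is the string depth of the upper end
plus the count plus one. String depths are not available as queries: they are found by following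
`psi` from the leftmost and the rightmost leaf until the characters differ (`depthCmd_runs`), and
characters are sibling ranks at the root (`chr_rk`). These computations are charged to the lengths
of distinct factors, whose sum is `n`.

To attach data to the trie nodes in constant time, the suffix tree nodes are cut into blocks of `4 *
ell T` nodes. In a block with few trie nodes the points are laid out in level order (all first
points of the edges, all second points, and so on); one bit per point says whether its edge goes on,
and a popcount over one level leads from a point to its successor (`sum_hasNext`). A block with many
trie nodes owns so many of these bits that a plain table of prefix sums fits in their place. In the
second pass the text is walked through this structure; the first point without an index is the node
of the current factor, and the index met before is the reference (`findCmd_runs`).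

For the explicit trie, the pre-order rank of a point is the number of points on earlier edges plus
its position on its own edge (`lzTrieNodes_getElem?`, by `lt_of_edge_lt`). The layout differs from
pre-order only inside blocks with few trie nodes, so a small gap in front of the arrays allows
sorting them in place in one sweep (`psum_add_lt_slotOf`). The opening parenthesis of a node stands
at twice its pre-order rank minus its depth (`lzTrieBP_getElem?`).

Space: the bits and pointers of the blocks take `5n/2` bits, the counters (`2n` bits) share their
place with the arrays of the second pass, the successor bits take `z` bits, and the rest is
polylogarithmic. The programs are written in a small language with expressions, verified by rules
with potentials for the time, and compiled to the word RAM with a constant factor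
(`Big.exec_compile`). -/

namespace LZCics

set_option linter.constructorNameAsVariable false

/-! ### Ranks in finite subsets of a linear order. -/

section Rank

variable {α : Type*} [LinearOrder α]

/-- The number of elements of `s` below `a`. -/
def rankIn (s : Finset α) (a : α) : ℕ := (s.filter (· < a)).card

theorem getElem?_length_filter_lt {l : List α} (hl : l.Pairwise (· < ·)) {a : α} (ha : a ∈ l) :
    l[(l.filter (· < a)).length]? = some a := by
  induction l with
  | nil => simp at ha
  | cons b l ih =>
    rw [List.pairwise_cons] at hl
    rcases List.mem_cons.1 ha with rfl | h
    · have : l.filter (· < a) = [] := by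
        rw [List.filter_eq_nil_iff]
        intro c hc
        simpa using (hl.1 c hc).le
      simp [this]
    · have := hl.1 a h
      simp [this, ih hl.2 h]

theorem rankIn_eq_length (s : Finset α) (a : α) :
    rankIn s a = ((s.sort (· ≤ ·)).filter (· < a)).length := by
  rw [rankIn, ← List.toFinset_card_of_nodup ((Finset.sort_nodup s _).filter _)]
  congr 1
  ext x
  simp

theorem sort_getElem?_rankIn {s : Finset α} {a : α} (ha : a ∈ s) :
    (s.sort (· ≤ ·))[rankIn s a]? = some a := by
  rw [rankIn_eq_length]
  exact getElem?_length_filter_lt (Finset.sortedLT_sort s).pairwise ((Finset.mem_sort _).2 ha)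

theorem rankIn_lt_card {s : Finset α} {a : α} (ha : a ∈ s) : rankIn s a < s.card := by
  apply Finset.card_lt_card
  rw [Finset.ssubset_iff_of_subset (Finset.filter_subset _ _)]
  exact ⟨a, ha, by simp⟩

theorem rankIn_le_card (s : Finset α) (a : α) : rankIn s a ≤ s.card :=
  Finset.card_le_card (Finset.filter_subset _ _)

theorem rankIn_mono (s : Finset α) {a b : α} (h : a ≤ b) : rankIn s a ≤ rankIn s b := by
  apply Finset.card_le_card
  intro x hx
  simp only [Finset.mem_filter] at hx ⊢
  exact ⟨hx.1, hx.2.trans_le h⟩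

theorem rankIn_lt_of_lt {s : Finset α} {a b : α} (ha : a ∈ s) (h : a < b) :
    rankIn s a < rankIn s b := by
  apply Finset.card_lt_card
  rw [Finset.ssubset_iff_of_subset]
  · exact ⟨a, by simp [ha, h], by simp⟩
  · intro x hx
    simp only [Finset.mem_filter] at hx ⊢
    exact ⟨hx.1, hx.2.trans h⟩

theorem rankIn_lt_iff {s : Finset α} {a b : α} (ha : a ∈ s) : rankIn s a < rankIn s b ↔ a < b :=
  ⟨fun h => lt_of_not_ge fun h' => (rankIn_mono s h').not_gt h, rankIn_lt_of_lt ha⟩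

theorem rankIn_le_iff {s : Finset α} {a b : α} (hb : b ∈ s) : rankIn s a ≤ rankIn s b ↔ a ≤ b := by
  rw [← not_lt, rankIn_lt_iff hb, not_lt]

theorem rankIn_inj {s : Finset α} {a b : α} (ha : a ∈ s) (hb : b ∈ s)
    (h : rankIn s a = rankIn s b) : a = b :=
  le_antisymm ((rankIn_le_iff hb).1 h.le) ((rankIn_le_iff ha).1 h.ge)

/-- The rank is injective on `s` and takes values below `s.card`, so it hits every such value. -/
theorem exists_rankIn_eq {s : Finset α} {i : ℕ} (hi : i < s.card) : ∃ a ∈ s, rankIn s a = i := by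
  have h : Set.SurjOn (rankIn s) s (Finset.range s.card) := by
    apply Finset.surjOn_of_injOn_of_card_le
    · intro a ha
      simpa using rankIn_lt_card (Finset.mem_coe.1 ha)
    · intro a ha b hb hab
      exact rankIn_inj ha hb hab
    · simp
  obtain ⟨a, ha, h⟩ := h (Finset.mem_coe.2 (Finset.mem_range.2 hi))
  exact ⟨a, ha, h⟩

theorem rankIn_sdiff [DecidableEq α] {s t : Finset α} (h : t ⊆ s) (a : α) :
    rankIn (s \ t) a = rankIn s a - rankIn t a := by
  have : (s \ t).filter (· < a) = (s.filter (· < a)) \ (t.filter (· < a)) := by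
    ext x
    simp only [Finset.mem_filter, Finset.mem_sdiff]
    tauto
  rw [rankIn, this, Finset.card_sdiff_of_subset (Finset.filter_subset_filter _ h)]
  rfl

end Rank

/-! ### Prefixes and branching in lexicographic order. -/

section Strings

variable {α : Type*} [LinearOrder α]

theorem le_of_isPrefix {a b : List α} (h : a <+: b) : a ≤ b := by
  obtain ⟨t, rfl⟩ := h
  induction a with
  | nil => exact not_lt.1 (List.not_lt_nil _)
  | cons x a ih =>
    rw [List.cons_append]
    rcases ih.eq_or_lt with h | h
    · rw [← h]
    · exact (List.cons_lt_cons_iff.2 (Or.inr ⟨rfl, h⟩)).le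

theorem lt_of_isPrefix {a b : List α} (h : a <+: b) (hl : a.length < b.length) : a < b :=
  lt_of_le_of_ne (le_of_isPrefix h) fun e => by simp [e] at hl

theorem lt_of_append_cons {S : List α} {a b : α} {x y : List α} (h : a < b) :
    S ++ a :: x < S ++ b :: y := by
  induction S with
  | nil => exact List.cons_lt_cons_iff.2 (Or.inl h)
  | cons c S ih => exact List.cons_lt_cons_iff.2 (Or.inr ⟨rfl, ih⟩)

/-- The strings with a given prefix form an interval in lexicographic order. -/
theorem isPrefix_of_between {v a b c : List α} (ha : v <+: a) (hc : v <+: c) (hab : a ≤ b)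
    (hbc : b ≤ c) : v <+: b := by
  induction v generalizing a b c with
  | nil => exact List.nil_prefix
  | cons x v ih =>
    obtain ⟨a', rfl⟩ := ha
    obtain ⟨c', rfl⟩ := hc
    rw [List.cons_append] at hab hbc
    cases b with
    | nil => exact absurd hab (by simp)
    | cons y b =>
      have h1 : x ≤ y := by
        by_contra h
        exact hab.not_gt (List.cons_lt_cons_iff.2 (Or.inl (not_le.1 h)))
      have h2 : y ≤ x := by
        by_contra h
        exact hbc.not_gt (List.cons_lt_cons_iff.2 (Or.inl (not_le.1 h)))
      obtain rfl := le_antisymm h1 h2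
      have h3 : v ++ a' ≤ b := by
        by_contra h
        exact hab.not_gt (List.cons_lt_cons_iff.2 (Or.inr ⟨rfl, not_le.1 h⟩))
      have h4 : b ≤ v ++ c' := by
        by_contra h
        exact hbc.not_gt (List.cons_lt_cons_iff.2 (Or.inr ⟨rfl, not_le.1 h⟩))
      simpa using ih (List.prefix_append _ _) (List.prefix_append _ _) h3 h4

/-- Two strings, none of which is a prefix of the other, branch. -/
theorem exists_branch {a b : List α} (h1 : ¬ a <+: b) (h2 : ¬ b <+: a) :
    ∃ S x y, x ≠ y ∧ S ++ [x] <+: a ∧ S ++ [y] <+: b := by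
  induction a generalizing b with
  | nil => simp at h1
  | cons p a ih =>
    cases b with
    | nil => simp at h2
    | cons q b =>
      by_cases hpq : p = q
      · subst hpq
        obtain ⟨S, x, y, hxy, hx, hy⟩ := ih (b := b) (by simpa using h1) (by simpa using h2)
        exact ⟨p :: S, x, y, hxy, by simpa using hx, by simpa using hy⟩
      · exact ⟨[], p, q, hpq, by simp, by simp⟩

theorem lt_of_branch {S a b : List α} {x y : α} (ha : S ++ [x] <+: a) (hb : S ++ [y] <+: b)
    (h : x < y) : a < b := by
  obtain ⟨a', rfl⟩ := ha
  obtain ⟨b', rfl⟩ := hb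
  simpa using lt_of_append_cons h

end Strings

/-! ### Leaves and inner nodes of the suffix tree, and their number. -/

section Trie

variable {σ : ℕ} {T : List (Fin σ)}

theorem mem_trieNodes {S : List (Fin σ)} : S ∈ trieNodes T ↔ S <:+: T := by
  simp only [trieNodes, List.mem_toFinset, List.mem_flatMap, List.mem_tails, List.mem_inits]
  constructor
  · rintro ⟨a, ha, hS⟩
    exact hS.isInfix.trans ha.isInfix
  · rintro ⟨a, b, rfl⟩
    exact ⟨S ++ b, ⟨a, by simp⟩, by simp⟩

theorem mem_trieEdges {S : List (Fin σ)} {c : Fin σ} : c ∈ trieEdges T S ↔ S ++ [c] <:+: T := by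
  simp [trieEdges, mem_trieNodes]

theorem isInfix_iff_drop {S : List (Fin σ)} : S <:+: T ↔ ∃ j, S <+: T.drop j := by
  constructor
  · rintro ⟨a, b, rfl⟩
    exact ⟨a.length, by simp⟩
  · rintro ⟨j, h⟩
    exact h.isInfix.trans (List.drop_suffix _ _).isInfix

theorem isInfix_drop (j : ℕ) : T.drop j <:+: T := (List.drop_suffix _ _).isInfix

theorem IsText.ne_nil (hT : IsText T) : T ≠ [] := by
  obtain ⟨-, S, c, rfl, -⟩ := hT
  simp

theorem IsText.length_pos (hT : IsText T) : 0 < T.length := List.length_pos_iff.2 hT.ne_nil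

theorem IsText.exists_drop (hT : IsText T) {S : List (Fin σ)} (h : S <:+: T) :
    ∃ j < T.length, S <+: T.drop j := by
  obtain ⟨j, hj⟩ := isInfix_iff_drop.1 h
  by_cases hjn : j < T.length
  · exact ⟨j, hjn, hj⟩
  · rw [List.drop_eq_nil_of_le (not_lt.1 hjn), List.prefix_nil] at hj
    exact ⟨0, hT.length_pos, by simp [hj]⟩

/-- A nonempty suffix ends with the last character of the text; followed by another character, it
would make that character occur before the last position. -/
theorem IsText.drop_not_extends (hT : IsText T) {j : ℕ} (hj : j < T.length) (c : Fin σ) :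
    ¬ T.drop j ++ [c] <:+: T := by
  obtain ⟨-, S, c0, rfl, hc⟩ := hT
  rintro ⟨a, b, h⟩
  have hj' : j ≤ S.length := by simp at hj; omega
  rw [List.drop_append_of_le_length hj'] at h
  apply hc
  have h2 : a ++ (S.drop j ++ [c0]) ++ (c :: b) = S ++ [c0] := by simpa using h
  have h3 := congrArg List.dropLast h2
  rw [List.dropLast_append_of_ne_nil (by simp), List.dropLast_concat] at h3
  rw [← h3]
  simp

/-- A string without continuation in the text occurs only at its end; conversely, the uniqueness of
the last character prevents nonempty suffixes from being continued. The empty suffix is excluded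
because the root is not a leaf. -/
theorem IsText.mem_leafSet (hT : IsText T) {S : List (Fin σ)} :
    S ∈ leafSet T ↔ ∃ j < T.length, S = T.drop j := by
  simp only [leafSet, nodeSet, Finset.mem_filter, mem_trieNodes]
  constructor
  · rintro ⟨⟨h1, -⟩, h3⟩
    obtain ⟨j, hj, b, hb⟩ := hT.exists_drop h1
    refine ⟨j, hj, ?_⟩
    cases b with
    | nil => simpa using hb
    | cons c b =>
      exfalso
      have : c ∈ trieEdges T S := by
        rw [mem_trieEdges, isInfix_iff_drop]
        exact ⟨j, b, by simpa using hb⟩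
      simp [h3] at this
  · rintro ⟨j, hj, rfl⟩
    have : trieEdges T (T.drop j) = ∅ := by
      rw [Finset.eq_empty_iff_forall_notMem]
      intro c hc
      exact hT.drop_not_extends hj c (mem_trieEdges.1 hc)
    refine ⟨⟨isInfix_drop j, Or.inr (by simp [this])⟩, this⟩

theorem leafSet_subset : leafSet T ⊆ nodeSet T := Finset.filter_subset _ _

theorem IsText.drop_mem_leafSet (hT : IsText T) {j : ℕ} (hj : j < T.length) :
    T.drop j ∈ leafSet T := hT.mem_leafSet.2 ⟨j, hj, rfl⟩

theorem IsText.drop_mem_nodeSet (hT : IsText T) {j : ℕ} (hj : j < T.length) :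
    T.drop j ∈ nodeSet T := leafSet_subset (hT.drop_mem_leafSet hj)

theorem isInfix_of_mem_nodeSet {v : List (Fin σ)} (h : v ∈ nodeSet T) : v <:+: T :=
  mem_trieNodes.1 (Finset.mem_filter.1 h).1

theorem nil_mem_nodeSet : [] ∈ nodeSet T := by
  simp [nodeSet, mem_trieNodes]

theorem drop_injOn {i j : ℕ} (hi : i < T.length) (hj : j < T.length) (h : T.drop i = T.drop j) :
    i = j := by
  have := congrArg List.length h
  simp at this
  omega

theorem IsText.card_leafSet (hT : IsText T) : (leafSet T).card = T.length := by
  have : leafSet T = (Finset.range T.length).image (fun j => T.drop j) := by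
    ext S
    simp [hT.mem_leafSet, eq_comm]
  rw [this, Finset.card_image_of_injOn, Finset.card_range]
  intro i hi j hj h
  exact drop_injOn (by simpa using hi) (by simpa using hj) h

theorem mem_nodeSet_of_branch {S : List (Fin σ)} {x y : Fin σ} (hxy : x ≠ y)
    (hx : S ++ [x] <:+: T) (hy : S ++ [y] <:+: T) : S ∈ nodeSet T := by
  rw [nodeSet, Finset.mem_filter, mem_trieNodes]
  refine ⟨(List.prefix_append _ _).isInfix.trans hx, Or.inr fun h => ?_⟩
  obtain ⟨a, ha⟩ := Finset.card_eq_one.1 h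
  have h1 := mem_trieEdges.2 hx
  have h2 := mem_trieEdges.2 hy
  rw [ha, Finset.mem_singleton] at h1 h2
  exact hxy (h1.trans h2.symm)

/-- The nodes that are not leaves. -/
def innerSet (T : List (Fin σ)) : Finset (List (Fin σ)) := nodeSet T \ leafSet T

theorem mem_innerSet {v : List (Fin σ)} :
    v ∈ innerSet T ↔ v ∈ nodeSet T ∧ v ∉ leafSet T := Finset.mem_sdiff

theorem exists_branch_of_mem_innerSet {v : List (Fin σ)} (hv : v ∈ innerSet T) (h0 : v ≠ []) :
    ∃ x y, x < y ∧ v ++ [x] <:+: T ∧ v ++ [y] <:+: T := by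
  rw [mem_innerSet] at hv
  obtain ⟨h1, h2⟩ := hv
  have h3 : (trieEdges T v).card ≠ 1 := ((Finset.mem_filter.1 h1).2).resolve_left h0
  have h4 : (trieEdges T v) ≠ ∅ := fun h => h2 (Finset.mem_filter.2 ⟨h1, h⟩)
  have h5 : 1 < (trieEdges T v).card := by
    have := Finset.card_pos.2 (Finset.nonempty_iff_ne_empty.2 h4)
    omega
  obtain ⟨x, hx, y, hy, hxy⟩ := Finset.one_lt_card.1 h5
  rcases lt_or_gt_of_ne hxy with h | h
  · exact ⟨x, y, h, mem_trieEdges.1 hx, mem_trieEdges.1 hy⟩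
  · exact ⟨y, x, h, mem_trieEdges.1 hy, mem_trieEdges.1 hx⟩

/-- Double counting in the suffix trie: it has one edge less than it has nodes, and an inner node
other than the root has at least two outgoing edges. This bounds the inner nodes by the leaves, so
that `n` bits can be indexed by inner nodes. -/
theorem IsText.card_innerSet_le (hT : IsText T) : (innerSet T).card ≤ T.length := by
  classical
  -- every node of the suffix trie except the root is a child of exactly one node
  have hsum : ∑ S ∈ trieNodes T, (trieEdges T S).card = (trieNodes T).card - 1 := by
    rw [← Finset.card_erase_of_mem (mem_trieNodes.2 (List.nil_infix (l := T)))]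
    rw [Finset.card_eq_sum_card_fiberwise (f := List.dropLast) (t := trieNodes T)]
    · refine Finset.sum_congr rfl fun S hS => ?_
      refine Finset.card_bij (fun c _ => S ++ [c]) ?_ ?_ ?_
      · intro c hc
        simp only [Finset.mem_filter, Finset.mem_erase]
        exact ⟨⟨by simp, mem_trieNodes.2 (mem_trieEdges.1 hc)⟩, by simp⟩
      · intro c _ d _ h
        simpa using h
      · intro R hR
        simp only [Finset.mem_filter, Finset.mem_erase] at hR
        obtain ⟨⟨h0, h1⟩, h2⟩ := hR
        refine ⟨R.getLast h0, ?_, ?_⟩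
        · rw [mem_trieEdges, ← h2, List.dropLast_append_getLast]
          exact mem_trieNodes.1 h1
        · rw [← h2, List.dropLast_append_getLast]
    · intro R hR
      have hR' := Finset.mem_erase.1 (Finset.mem_coe.1 hR)
      exact Finset.mem_coe.2 (mem_trieNodes.2
        ((List.dropLast_prefix R).isInfix.trans (mem_trieNodes.1 hR'.2)))
  have hnil : ([] : List (Fin σ)) ∈ trieNodes T := mem_trieNodes.2 List.nil_infix
  have hI : innerSet T ⊆ trieNodes T := fun v hv =>
    (Finset.mem_filter.1 (mem_innerSet.1 hv).1).1
  have hL : leafSet T ⊆ trieNodes T := fun v hv =>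
    (Finset.mem_filter.1 (leafSet_subset hv)).1
  -- The last two terms compensate for the missing edges: a leaf has none, and the root counts as a
  -- node even if it has only one child.
  have hpt : ∀ S ∈ trieNodes T, 1 + (if S ∈ innerSet T then 1 else 0)
      ≤ (trieEdges T S).card + (if S ∈ leafSet T then 1 else 0) + (if S = [] then 1 else 0) := by
    intro S hS
    by_cases hl : S ∈ leafSet T
    · have : S ∉ innerSet T := fun h => (mem_innerSet.1 h).2 hl
      simp only [hl, this, if_true, if_false]
      omega
    · by_cases hi : S ∈ innerSet T
      · by_cases h0 : S = []
        · have : (trieEdges T S).Nonempty := by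
            rw [Finset.nonempty_iff_ne_empty]
            exact fun h => hl (Finset.mem_filter.2 ⟨(mem_innerSet.1 hi).1, h⟩)
          have := Finset.card_pos.2 this
          subst h0
          simp only [hi, hl, if_true, if_false]
          omega
        · obtain ⟨x, y, hxy, hx, hy⟩ := exists_branch_of_mem_innerSet hi h0
          have : 1 < (trieEdges T S).card :=
            Finset.one_lt_card.2 ⟨x, mem_trieEdges.2 hx, y, mem_trieEdges.2 hy, hxy.ne⟩
          simp [hi, hl, h0]
          omega
      · have : (trieEdges T S).card = 1 := by
          by_contra h
          apply hi
          rw [mem_innerSet]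
          exact ⟨Finset.mem_filter.2 ⟨hS, Or.inr h⟩, hl⟩
        simp [hi, hl, this]
  have := Finset.sum_le_sum hpt
  simp only [Finset.sum_add_distrib, hsum, Finset.sum_const, Finset.sum_ite_mem,
    Finset.inter_eq_right.2 hI, Finset.inter_eq_right.2 hL, Finset.sum_ite_eq', hnil, if_true,
    smul_eq_mul, mul_one, hT.card_leafSet] at this
  have hp := Finset.card_pos.2 ⟨_, hnil⟩
  omega

theorem IsText.card_nodeSet_le (hT : IsText T) : (nodeSet T).card ≤ 2 * T.length := by
  have h1 := hT.card_innerSet_le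
  have h2 := hT.card_leafSet
  rw [innerSet, Finset.card_sdiff_of_subset leafSet_subset] at h1
  omega

end Trie

/-! ### Root paths, parents and edges of the suffix tree. -/

section Paths

variable {σ : ℕ} {T : List (Fin σ)}

theorem path_concat (S : List (Fin σ)) (c : Fin σ) :
    path T (S ++ [c]) = path T S ++ if S ++ [c] ∈ nodeSet T then [S ++ [c]] else [] := by
  rw [path, List.inits_append, List.filter_append, path]
  congr 1
  simp [List.filter_cons]

theorem path_nil : path T [] = [[]] := by
  simp [path, nil_mem_nodeSet]

theorem mem_path {P S : List (Fin σ)} : P ∈ path T S ↔ P <+: S ∧ P ∈ nodeSet T := by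
  simp [path]

theorem pairwise_path (S : List (Fin σ)) :
    (path T S).Pairwise (fun a b => a.length < b.length) := by
  induction S using List.reverseRecOn with
  | nil => simp [path_nil]
  | append_singleton S c ih =>
    rw [path_concat, List.pairwise_append]
    refine ⟨ih, by split <;> simp, ?_⟩
    intro a ha b hb
    split at hb
    · rw [List.mem_singleton] at hb
      have := (mem_path.1 ha).1.length_le
      simp [hb]
      omega
    · simp at hb

/-- The nodes above an ancestor are those that precede it on the path. Thus depth, parent and
ancestors of all nodes on a path can be read off this one path. -/
theorem path_of_getElem? {S P : List (Fin σ)} {d : ℕ} (h : (path T S)[d]? = some P) :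
    path T P = (path T S).take (d + 1) := by
  induction S using List.reverseRecOn with
  | nil =>
    cases d with
    | zero =>
      simp [path_nil] at h
      subst h
      simp [path_nil]
    | succ d => simp [path_nil] at h
  | append_singleton S c ih =>
    have e := path_concat (T := T) S c
    by_cases hd : d < (path T S).length
    · rw [e, List.getElem?_append_left hd] at h
      rw [ih h, e, List.take_append_of_le_length (by omega)]
    · rw [e] at h
      split at h
      · rename_i hm
        rw [if_pos hm] at e
        rw [List.getElem?_append_right (by omega)] at h
        have h0 : d - (path T S).length = 0 := by
          by_contra h'
          rw [List.getElem?_eq_none (by simp; omega)] at h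
          simp at h
        rw [h0] at h
        simp at h
        rw [← h, List.take_of_length_le]
        rw [e]
        simp
        omega
      · rw [List.append_nil, List.getElem?_eq_none (by omega)] at h
        simp at h

theorem length_path_pos (S : List (Fin σ)) : 0 < (path T S).length :=
  List.length_pos_iff_exists_mem.2 ⟨[], mem_path.2 ⟨List.nil_prefix, nil_mem_nodeSet⟩⟩

theorem getElem?_path {S : List (Fin σ)} {d : ℕ} (hd : d < (path T S).length) :
    (path T S)[d]? = some (levelAnc T S d) := by
  simp [levelAnc, hd]

theorem levelAnc_mem_path {S : List (Fin σ)} {d : ℕ} (hd : d < (path T S).length) :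
    levelAnc T S d ∈ path T S :=
  List.mem_of_getElem? (getElem?_path hd)

theorem levelAnc_prefix (S : List (Fin σ)) (d : ℕ) : levelAnc T S d <+: S := by
  by_cases hd : d < (path T S).length
  · exact (mem_path.1 (levelAnc_mem_path hd)).1
  · simp [levelAnc, List.getElem?_eq_none (not_lt.1 hd)]

theorem levelAnc_mem (S : List (Fin σ)) (d : ℕ) : levelAnc T S d ∈ nodeSet T := by
  by_cases hd : d < (path T S).length
  · exact (mem_path.1 (levelAnc_mem_path hd)).2
  · simp [levelAnc, List.getElem?_eq_none (not_lt.1 hd), nil_mem_nodeSet]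

theorem length_levelAnc_lt {S : List (Fin σ)} {d e : ℕ} (hde : d < e)
    (he : e < (path T S).length) : (levelAnc T S d).length < (levelAnc T S e).length := by
  have := List.pairwise_iff_getElem.1 (pairwise_path (T := T) S) d e (by omega) he hde
  have h1 := getElem?_path (T := T) (S := S) (d := d) (by omega)
  have h2 := getElem?_path (T := T) he
  rw [List.getElem?_eq_getElem (by omega), Option.some_inj] at h1 h2
  rwa [h1, h2] at this

theorem exists_levelAnc {S Q : List (Fin σ)} (h : Q ∈ path T S) :
    ∃ d < (path T S).length, levelAnc T S d = Q := by
  obtain ⟨d, hd, h⟩ := List.getElem_of_mem h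
  refine ⟨d, hd, ?_⟩
  simp [levelAnc, hd, h]

theorem levelAnc_zero (S : List (Fin σ)) : levelAnc T S 0 = [] := by
  obtain ⟨d, hd, h⟩ := exists_levelAnc (T := T) (S := S) (Q := [])
    (mem_path.2 ⟨List.nil_prefix, nil_mem_nodeSet⟩)
  rcases Nat.eq_zero_or_pos d with rfl | h0
  · exact h
  · have := length_levelAnc_lt h0 hd
    simp [h] at this

theorem levelAnc_last {v : List (Fin σ)} (hv : v ∈ nodeSet T) :
    levelAnc T v ((path T v).length - 1) = v := by
  obtain ⟨d, hd, h⟩ := exists_levelAnc (T := T) (mem_path.2 ⟨List.prefix_rfl, hv⟩)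
  by_cases h1 : d = (path T v).length - 1
  · rw [← h1, h]
  · have := length_levelAnc_lt (T := T) (S := v) (d := d) (e := (path T v).length - 1)
      (by omega) (by omega)
    have h2 := (levelAnc_prefix (T := T) v ((path T v).length - 1)).length_le
    rw [h] at this
    omega

theorem parent_levelAnc {S : List (Fin σ)} {d : ℕ} (hd : d + 1 < (path T S).length) :
    parent T (levelAnc T S (d + 1)) = levelAnc T S d := by
  have h := path_of_getElem? (getElem?_path hd)
  have hl : (path T (levelAnc T S (d + 1))).length = d + 2 := by
    rw [h, List.length_take]
    omega
  rw [parent, depth, hl, show d + 2 - 1 - 1 = d by omega, levelAnc, h, levelAnc,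
    List.getElem?_take_of_lt (by omega)]

theorem length_path_ge_two {v : List (Fin σ)} (hv : v ∈ nodeSet T) (h0 : v ≠ []) :
    2 ≤ (path T v).length := by
  by_contra h
  have h1 := length_path_pos (T := T) v
  have h2 := levelAnc_last hv
  rw [show (path T v).length - 1 = 0 by omega, levelAnc_zero] at h2
  exact h0 h2.symm

theorem exists_levelAnc_succ {v : List (Fin σ)} (hv : v ∈ nodeSet T) (h0 : v ≠ []) :
    ∃ d, d + 2 = (path T v).length ∧ levelAnc T v (d + 1) = v ∧ parent T v = levelAnc T v d := by
  have h1 := length_path_ge_two hv h0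
  have h2 := levelAnc_last hv
  refine ⟨(path T v).length - 2, by omega, ?_, ?_⟩
  · rwa [show (path T v).length - 2 + 1 = (path T v).length - 1 by omega]
  · conv_lhs => rw [← h2, show (path T v).length - 1 = (path T v).length - 2 + 1 by omega]
    exact parent_levelAnc (by omega)

theorem parent_mem (v : List (Fin σ)) : parent T v ∈ nodeSet T := levelAnc_mem _ _

theorem parent_prefix (v : List (Fin σ)) : parent T v <+: v := levelAnc_prefix _ _

theorem length_parent_lt {v : List (Fin σ)} (hv : v ∈ nodeSet T) (h0 : v ≠ []) :
    (parent T v).length < v.length := by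
  obtain ⟨d, hd, h1, h2⟩ := exists_levelAnc_succ hv h0
  have := length_levelAnc_lt (T := T) (S := v) (Nat.lt_succ_self d) (by omega)
  rwa [h1, ← h2] at this

/-- Every node that is a prefix of `v` lies on the path to `v`, and the parent is the last entry
before `v` itself. The typical use is with a branching string `Q`, which cannot lie strictly inside
an edge. -/
theorem prefix_parent {v Q : List (Fin σ)} (hv : v ∈ nodeSet T) (hQ : Q ∈ nodeSet T)
    (h : Q <+: v) (hne : Q.length < v.length) : Q <+: parent T v := by
  have h0 : v ≠ [] := by
    rintro rfl
    simp at hne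
  obtain ⟨d, hd, h1, h2⟩ := exists_levelAnc_succ hv h0
  obtain ⟨e, he, h3⟩ := exists_levelAnc (mem_path.2 ⟨h, hQ⟩)
  have h4 : e ≤ d := by
    by_contra h
    have : e = d + 1 := by omega
    rw [this, h1] at h3
    rw [h3] at hne
    omega
  apply List.prefix_of_prefix_length_le h (parent_prefix v)
  rw [h2, ← h3]
  rcases h4.eq_or_lt with rfl | h5
  · rfl
  · exact (length_levelAnc_lt h5 (by omega)).le

/-- A leaf has no continuation in the text, whereas `v` continues its parent. -/
theorem parent_mem_innerSet (hT : IsText T) {v : List (Fin σ)} (hv : v ∈ nodeSet T)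
    (h0 : v ≠ []) : parent T v ∈ innerSet T := by
  rw [mem_innerSet]
  refine ⟨parent_mem v, fun h => ?_⟩
  obtain ⟨j, hj, h1⟩ := hT.mem_leafSet.1 h
  obtain ⟨t, ht⟩ := parent_prefix (T := T) v
  have h2 := length_parent_lt hv h0
  cases t with
  | nil =>
    rw [List.append_nil] at ht
    rw [ht] at h2
    omega
  | cons c t =>
    apply hT.drop_not_extends hj c
    rw [← h1]
    refine List.IsInfix.trans ?_ (isInfix_of_mem_nodeSet hv)
    exact List.IsPrefix.isInfix ⟨t, by simp [ht]⟩

/-- On an edge of the suffix tree, every string occurs only within occurrences of the lower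
node. -/
theorem prefix_of_edge (hT : IsText T) {v S : List (Fin σ)} {j : ℕ} (hv : v ∈ nodeSet T)
    (hS : S <+: v) (hl : (parent T v).length < S.length) (hj : j < T.length)
    (hSj : S <+: T.drop j) : v <+: T.drop j := by
  by_cases h : v <+: T.drop j
  · exact h
  exfalso
  have hv0 : v ≠ [] := by
    rintro rfl
    simp at h
  -- As a proper prefix of `v`, the suffix would be followed by a character inside the text.
  have h2 : ¬ T.drop j <+: v := by
    intro h'
    obtain ⟨t, ht⟩ := h'
    cases t with
    | nil => exact h (by simp [← ht])
    | cons c t =>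
      apply hT.drop_not_extends hj c
      refine List.IsInfix.trans ?_ (isInfix_of_mem_nodeSet hv)
      exact List.IsPrefix.isInfix ⟨t, by rw [← ht]; simp⟩
  obtain ⟨R, x, y, hxy, hx, hy⟩ := exists_branch h h2
  have hR : R ∈ nodeSet T := mem_nodeSet_of_branch hxy
    (hx.isInfix.trans (isInfix_of_mem_nodeSet hv)) (hy.isInfix.trans (isInfix_drop j))
  have hRv : R.length < v.length := by
    have := hx.length_le
    simp at this
    omega
  have h3 := (prefix_parent hv hR ((List.prefix_append _ _).trans hx) hRv).length_le
  -- the branching happens below the end of `S`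
  have h4 : R ++ [x] <+: S := List.prefix_of_prefix_length_le hx hS (by simp; omega)
  have h5 : R ++ [x] <+: T.drop j := h4.trans hSj
  have h6 := List.prefix_of_prefix_length_le h5 hy (by simp)
  have h7 := h6.eq_of_length (by simp)
  simp at h7
  exact hxy h7

end Paths

/-! ### Leaf intervals, the successor function on ranks, and access to characters. -/

section Leaves

variable {σ : ℕ} {T : List (Fin σ)}

theorem number_eq_rankIn (S : List (Fin σ)) : number T S = rankIn (nodeSet T) S := by
  rw [number, rankIn]
  congr

theorem leafRank_eq_rankIn (S : List (Fin σ)) : leafRank T S = rankIn (leafSet T) S := by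
  rw [leafRank, rankIn]
  congr

theorem nodeAt_number {v : List (Fin σ)} (hv : v ∈ nodeSet T) : nodeAt T (number T v) = v := by
  rw [nodeAt, nodeList, number_eq_rankIn, sort_getElem?_rankIn hv, Option.getD_some]

theorem exists_number_eq {i : ℕ} (hi : i < (nodeSet T).card) :
    nodeAt T i ∈ nodeSet T ∧ number T (nodeAt T i) = i := by
  obtain ⟨v, hv, h⟩ := exists_rankIn_eq hi
  rw [← number_eq_rankIn] at h
  rw [← h, nodeAt_number hv]
  exact ⟨hv, rfl⟩

theorem number_nil : number T [] = 0 := by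
  rw [number, Finset.card_eq_zero, Finset.filter_eq_empty_iff]
  intro x _
  exact List.not_lt_nil x

theorem nodeAt_zero : nodeAt T 0 = [] := by
  rw [← number_nil (T := T), nodeAt_number nil_mem_nodeSet]

theorem number_inj {u v : List (Fin σ)} (hu : u ∈ nodeSet T) (hv : v ∈ nodeSet T)
    (h : number T u = number T v) : u = v :=
  rankIn_inj hu hv (by rwa [← number_eq_rankIn, ← number_eq_rankIn])

theorem number_lt {v : List (Fin σ)} (hv : v ∈ nodeSet T) : number T v < (nodeSet T).card := by
  rw [number_eq_rankIn]
  exact rankIn_lt_card hv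

theorem leafSelect_leafRank {v : List (Fin σ)} (hv : v ∈ leafSet T) :
    leafSelect T (leafRank T v) = v := by
  rw [leafSelect, leafList, leafRank_eq_rankIn, sort_getElem?_rankIn hv, Option.getD_some]

theorem IsText.suffixArray_leafRank (hT : IsText T) {j : ℕ} (hj : j < T.length) :
    suffixArray T (leafRank T (T.drop j)) = j := by
  rw [suffixArray, leafSelect_leafRank (hT.drop_mem_leafSet hj), List.length_drop]
  omega

/-- The rank of the suffix at position `j`, where positions are counted cyclically. -/
def rk (T : List (Fin σ)) (j : ℕ) : ℕ := invSuffixArray T (j % T.length)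

theorem rk_eq {j : ℕ} (hj : j < T.length) : rk T j = leafRank T (T.drop j) := by
  rw [rk, Nat.mod_eq_of_lt hj, invSuffixArray]

/-- Positions count modulo the length, so this holds for all `j`. Walking past the end leads back to
the rank of the whole text, by which the first pass notices that the parsing is complete. -/
theorem psi_rk (hT : IsText T) (j : ℕ) : psi T (rk T j) = rk T (j + 1) := by
  rw [psi, rk, rk]
  congr 1
  conv_lhs => rw [invSuffixArray]
  rw [hT.suffixArray_leafRank (Nat.mod_lt _ hT.length_pos)]
  simp

theorem leafSelect_rk (hT : IsText T) {j : ℕ} (hj : j < T.length) :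
    leafSelect T (rk T j) = T.drop j := by
  rw [rk_eq hj, leafSelect_leafRank (hT.drop_mem_leafSet hj)]

theorem rk_inj (hT : IsText T) {i j : ℕ} (hi : i < T.length) (hj : j < T.length)
    (h : rk T i = rk T j) : i = j := by
  rw [rk_eq hi, rk_eq hj, leafRank_eq_rankIn, leafRank_eq_rankIn] at h
  exact drop_injOn hi hj (rankIn_inj (hT.drop_mem_leafSet hi) (hT.drop_mem_leafSet hj) h)

theorem exists_rk_eq (hT : IsText T) {i : ℕ} (hi : i < T.length) :
    ∃ j < T.length, rk T j = i := by
  rw [← hT.card_leafSet] at hi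
  obtain ⟨v, hv, h⟩ := exists_rankIn_eq hi
  obtain ⟨j, hj, rfl⟩ := hT.mem_leafSet.1 hv
  exact ⟨j, hj, by rw [rk_eq hj, ← h, leafRank_eq_rankIn]⟩

/-- The rank of the leftmost leaf below a node. -/
def lr (T v : List (Fin σ)) : ℕ := leafRank T (lmostLeaf T v)

/-- The rank of the rightmost leaf below a node. -/
def rr (T v : List (Fin σ)) : ℕ := leafRank T (rmostLeaf T v)

theorem mem_leavesBelow {v S : List (Fin σ)} :
    S ∈ leavesBelow T v ↔ S ∈ leafSet T ∧ v <+: S := by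
  simp [leavesBelow, leafList]

theorem leavesBelow_ne_nil (hT : IsText T) {v : List (Fin σ)} (hv : v <:+: T) :
    leavesBelow T v ≠ [] := by
  obtain ⟨j, hj, h⟩ := hT.exists_drop hv
  exact List.ne_nil_of_mem (mem_leavesBelow.2 ⟨hT.drop_mem_leafSet hj, h⟩)

theorem pairwise_leavesBelow (v : List (Fin σ)) : (leavesBelow T v).Pairwise (· < ·) :=
  List.Pairwise.filter _ (Finset.sortedLT_sort (leafSet T)).pairwise

theorem lmostLeaf_mem (hT : IsText T) {v : List (Fin σ)} (hv : v <:+: T) :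
    lmostLeaf T v ∈ leavesBelow T v := by
  rw [lmostLeaf, List.head?_eq_some_head (leavesBelow_ne_nil hT hv), Option.getD_some]
  exact List.head_mem _

theorem rmostLeaf_mem (hT : IsText T) {v : List (Fin σ)} (hv : v <:+: T) :
    rmostLeaf T v ∈ leavesBelow T v := by
  rw [rmostLeaf, List.getLast?_eq_some_getLast (leavesBelow_ne_nil hT hv), Option.getD_some]
  exact List.getLast_mem _

theorem lmostLeaf_le {v S : List (Fin σ)} (hS : S ∈ leavesBelow T v) : lmostLeaf T v ≤ S := by
  have h := pairwise_leavesBelow (T := T) v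
  rw [lmostLeaf]
  cases hl : leavesBelow T v with
  | nil => simp [hl] at hS
  | cons a l =>
    rw [hl, List.pairwise_cons] at h
    rw [hl, List.mem_cons] at hS
    rcases hS with rfl | hS
    · simp
    · simpa using (h.1 S hS).le

theorem le_rmostLeaf {v S : List (Fin σ)} (hS : S ∈ leavesBelow T v) : S ≤ rmostLeaf T v := by
  have h := pairwise_leavesBelow (T := T) v
  rw [rmostLeaf]
  have hne : leavesBelow T v ≠ [] := List.ne_nil_of_mem hS
  rw [List.getLast?_eq_some_getLast hne, Option.getD_some]
  rw [← List.dropLast_append_getLast hne] at h hS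
  rw [List.pairwise_append] at h
  rcases List.mem_append.1 hS with h1 | h1
  · exact (h.2.2 S h1 _ (by simp)).le
  · rw [List.mem_singleton] at h1
    exact h1.le

theorem lr_le_rr (hT : IsText T) {v : List (Fin σ)} (hv : v <:+: T) : lr T v ≤ rr T v := by
  rw [lr, rr, leafRank_eq_rankIn, leafRank_eq_rankIn]
  exact rankIn_mono _ (lmostLeaf_le (rmostLeaf_mem hT hv))

theorem rr_lt (hT : IsText T) {v : List (Fin σ)} (hv : v <:+: T) : rr T v < T.length := by
  rw [← hT.card_leafSet, rr, leafRank_eq_rankIn]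
  exact rankIn_lt_card (mem_leavesBelow.1 (rmostLeaf_mem hT hv)).1

/-- The strings with prefix `v` are an interval in lexicographic order (`isPrefix_of_between`), so
the two outermost leaves describe all of them. -/
theorem rk_mem_interval (hT : IsText T) {v : List (Fin σ)} (hv : v <:+: T) {j : ℕ}
    (hj : j < T.length) : lr T v ≤ rk T j ∧ rk T j ≤ rr T v ↔ v <+: T.drop j := by
  have hL := mem_leavesBelow.1 (lmostLeaf_mem hT hv)
  have hR := mem_leavesBelow.1 (rmostLeaf_mem hT hv)
  have hj' := hT.drop_mem_leafSet hj
  rw [rk_eq hj, lr, rr, leafRank_eq_rankIn, leafRank_eq_rankIn, leafRank_eq_rankIn,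
    rankIn_le_iff hj', rankIn_le_iff hR.1]
  constructor
  · rintro ⟨h1, h2⟩
    exact isPrefix_of_between hL.2 hR.2 h1 h2
  · intro h
    have := mem_leavesBelow.2 ⟨hj', h⟩
    exact ⟨lmostLeaf_le this, le_rmostLeaf this⟩

theorem exists_lr_eq (hT : IsText T) {v : List (Fin σ)} (hv : v <:+: T) :
    ∃ j < T.length, v <+: T.drop j ∧ lr T v = rk T j := by
  have hL := mem_leavesBelow.1 (lmostLeaf_mem hT hv)
  obtain ⟨j, hj, h⟩ := hT.mem_leafSet.1 hL.1
  exact ⟨j, hj, h ▸ hL.2, by rw [rk_eq hj, lr, h]⟩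

theorem exists_rr_eq (hT : IsText T) {v : List (Fin σ)} (hv : v <:+: T) :
    ∃ j < T.length, v <+: T.drop j ∧ rr T v = rk T j := by
  have hL := mem_leavesBelow.1 (rmostLeaf_mem hT hv)
  obtain ⟨j, hj, h⟩ := hT.mem_leafSet.1 hL.1
  exact ⟨j, hj, h ▸ hL.2, by rw [rk_eq hj, rr, h]⟩

/-- A suffix is not a proper prefix of another suffix. Comparing the two ranks is how the programs
tell leaves from inner nodes. -/
theorem lr_eq_rr_of_mem_leafSet (hT : IsText T) {v : List (Fin σ)} (hv : v ∈ leafSet T) :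
    lr T v = rr T v := by
  have hv' := isInfix_of_mem_nodeSet (leafSet_subset hv)
  have key : ∀ S ∈ leavesBelow T v, S = v := by
    intro S hS
    obtain ⟨h1, t, rfl⟩ := mem_leavesBelow.1 hS
    cases t with
    | nil => simp
    | cons c t =>
      obtain ⟨j, hj, rfl⟩ := hT.mem_leafSet.1 hv
      exfalso
      apply hT.drop_not_extends hj c
      refine List.IsInfix.trans ?_ (isInfix_of_mem_nodeSet (leafSet_subset h1))
      exact List.IsPrefix.isInfix ⟨t, by simp⟩
  rw [lr, rr, key _ (lmostLeaf_mem hT hv'), key _ (rmostLeaf_mem hT hv')]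

/-- The characters that follow a branching node in its leftmost and its rightmost leaf differ. -/
theorem exists_branch_leaves (hT : IsText T) {v : List (Fin σ)} (hv : v ∈ innerSet T)
    (h0 : v ≠ []) : ∃ i j x y, i < T.length ∧ j < T.length ∧ lr T v = rk T i ∧ rr T v = rk T j ∧
      v ++ [x] <+: T.drop i ∧ v ++ [y] <+: T.drop j ∧ x ≠ y := by
  have hv' := isInfix_of_mem_nodeSet (mem_innerSet.1 hv).1
  obtain ⟨i, hi, hi1, hi2⟩ := exists_lr_eq hT hv'
  obtain ⟨j, hj, hj1, hj2⟩ := exists_rr_eq hT hv'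
  have hext : ∀ k < T.length, v <+: T.drop k → ∃ x, v ++ [x] <+: T.drop k := by
    rintro k hk ⟨t, ht⟩
    cases t with
    | nil =>
      exfalso
      rw [List.append_nil] at ht
      exact (mem_innerSet.1 hv).2 (ht ▸ hT.drop_mem_leafSet hk)
    | cons x t => exact ⟨x, t, by rw [← ht]; simp⟩
  obtain ⟨x, hx⟩ := hext i hi hi1
  obtain ⟨y, hy⟩ := hext j hj hj1
  refine ⟨i, j, x, y, hi, hj, hi2, hj2, hx, hy, ?_⟩
  -- Equal characters at both ends of the leaf interval would be shared by all leaves in between,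
  -- and `v` would not branch.
  rintro rfl
  obtain ⟨a, b, hab, ha, hb⟩ := exists_branch_of_mem_innerSet hv h0
  have key : ∀ c, v ++ [c] <:+: T → c = x := by
    intro c hc
    obtain ⟨k, hk, h⟩ := hT.exists_drop hc
    have hvk : v <+: T.drop k := (List.prefix_append _ _).trans h
    have h1 := (rk_mem_interval hT hv' hk).2 hvk
    rw [hi2, hj2] at h1
    have h2 : v ++ [x] <+: T.drop k := by
      refine isPrefix_of_between hx hy ?_ ?_
      · rw [← rankIn_le_iff (hT.drop_mem_leafSet hk), ← leafRank_eq_rankIn, ← leafRank_eq_rankIn,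
          ← rk_eq hi, ← rk_eq hk]
        exact h1.1
      · rw [← rankIn_le_iff (hT.drop_mem_leafSet hj), ← leafRank_eq_rankIn, ← leafRank_eq_rankIn,
          ← rk_eq hj, ← rk_eq hk]
        exact h1.2
    have h3 := (List.prefix_of_prefix_length_le h h2 (by simp)).eq_of_length (by simp)
    simpa using h3
  exact hab.ne ((key a ha).trans (key b hb).symm)

theorem lr_lt_rr (hT : IsText T) {v : List (Fin σ)} (hv : v ∈ innerSet T) (h0 : v ≠ []) :
    lr T v < rr T v := by
  have hv' := isInfix_of_mem_nodeSet (mem_innerSet.1 hv).1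
  refine lt_of_le_of_ne (lr_le_rr hT hv') fun h => ?_
  obtain ⟨i, j, x, y, hi, hj, h1, h2, hx, hy, hxy⟩ := exists_branch_leaves hT hv h0
  obtain rfl := rk_inj hT hi hj (by rw [← h1, ← h2, h])
  have h3 := (List.prefix_of_prefix_length_le hx hy (by simp)).eq_of_length (by simp)
  simp at h3
  exact hxy h3

theorem lr_lt_rr_iff (hT : IsText T) {v : List (Fin σ)} (hv : v ∈ nodeSet T) (h0 : v ≠ []) :
    lr T v < rr T v ↔ v ∈ innerSet T := by
  refine ⟨fun h => mem_innerSet.2 ⟨hv, fun h' => ?_⟩, fun h => lr_lt_rr hT h h0⟩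
  rw [lr_eq_rr_of_mem_leafSet hT h'] at h
  exact lt_irrefl _ h

/-- The number of inner nodes preceding a node. -/
def innerRank (T v : List (Fin σ)) : ℕ := number T v - leafRank T v

theorem innerRank_eq_rankIn (v : List (Fin σ)) : innerRank T v = rankIn (innerSet T) v := by
  rw [innerRank, number_eq_rankIn, leafRank_eq_rankIn, innerSet,
    rankIn_sdiff (leafSet_subset (T := T))]

theorem leafRank_le_number (v : List (Fin σ)) : leafRank T v ≤ number T v :=
  Finset.card_le_card (Finset.filter_subset_filter _ leafSet_subset)

theorem innerRank_lt (hT : IsText T) {v : List (Fin σ)} (hv : v ∈ innerSet T) :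
    innerRank T v < T.length := by
  rw [innerRank_eq_rankIn]
  exact (rankIn_lt_card hv).trans_le hT.card_innerSet_le

theorem innerRank_le (hT : IsText T) (v : List (Fin σ)) : innerRank T v ≤ T.length := by
  rw [innerRank_eq_rankIn]
  exact (rankIn_le_card _ _).trans hT.card_innerSet_le

theorem innerRank_inj {u v : List (Fin σ)} (hu : u ∈ innerSet T) (hv : v ∈ innerSet T)
    (h : innerRank T u = innerRank T v) : u = v := by
  rw [innerRank_eq_rankIn, innerRank_eq_rankIn] at h
  exact rankIn_inj hu hv h

/-- The first character of the suffix of rank `i`, as it is obtained from the suffix tree. -/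
def chr (T : List (Fin σ)) (i : ℕ) : ℕ := childRank T (levelAnc T (leafSelect T i) 1)

/-- This replaces the missing access to the text. Since every character of the alphabet occurs, the
root has exactly one child for each character, in the order of the characters; so the sibling rank
is the character itself. -/
theorem childRank_of_parent_nil (hT : IsText T) {v : List (Fin σ)} {c : Fin σ} (hv : v ∈ nodeSet T)
    (hc : [c] <+: v) (hp : parent T v = []) : childRank T v = c := by
  classical
  have hv0 : v ≠ [] := by
    rintro rfl
    simp at hc
  -- the child of the root on the way to a leaf
  have hex : ∀ a : Fin σ, ∃ u ∈ nodeSet T, u ≠ [] ∧ parent T u = [] ∧ [a] <+: u := by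
    intro a
    have : [a] <:+: T := by
      obtain ⟨s, t, h⟩ := List.append_of_mem (hT.1 a)
      exact ⟨s, t, by simp [h]⟩
    obtain ⟨j, hj, h⟩ := hT.exists_drop this
    have hS := hT.drop_mem_nodeSet hj
    have h0 : T.drop j ≠ [] := by
      intro h'
      simp [h'] at h
    have h2 := length_path_ge_two hS h0
    refine ⟨levelAnc T (T.drop j) 1, levelAnc_mem _ _, ?_, ?_, ?_⟩
    · intro h'
      have := length_levelAnc_lt (T := T) (S := T.drop j) Nat.zero_lt_one (by omega)
      simp [h'] at this
    · rw [← zero_add 1, parent_levelAnc (by omega), levelAnc_zero]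
    · apply List.prefix_of_prefix_length_le h (levelAnc_prefix _ _)
      have := length_levelAnc_lt (T := T) (S := T.drop j) Nat.zero_lt_one (by omega)
      simp
      omega
  -- By `prefix_of_edge`, both children lie on the path to the same leaf, and neither can be a
  -- proper ancestor of the other because both hang directly below the root.
  have huniq : ∀ (a : Fin σ) (u u' : List (Fin σ)), u ∈ nodeSet T → u' ∈ nodeSet T →
      parent T u = [] → parent T u' = [] → [a] <+: u → [a] <+: u' → u = u' := by
    intro a u u' hu hu' hp hp' ha ha'
    obtain ⟨j, hj, h⟩ := hT.exists_drop (ha.isInfix.trans (isInfix_of_mem_nodeSet hu))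
    have h1 := prefix_of_edge hT hu ha (by simp [hp]) hj h
    have h2 := prefix_of_edge hT hu' ha' (by simp [hp']) hj h
    have key : ∀ x y : List (Fin σ), x ∈ nodeSet T → y ∈ nodeSet T → parent T y = [] →
        [a] <+: x → x <+: T.drop j → y <+: T.drop j → y.length ≤ x.length := by
      intro x y hx hy hpy hax h1 h2
      by_contra h
      rw [not_le] at h
      have := prefix_parent hy hx (List.prefix_of_prefix_length_le h1 h2 h.le) h
      rw [hpy, List.prefix_nil] at this
      simp [this] at hax
    have e : u.length = u'.length :=
      le_antisymm (key u' u hu' hu hp ha' h2 h1) (key u u' hu hu' hp' ha h1 h2)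
    exact (List.prefix_of_prefix_length_le h1 h2 e.le).eq_of_length e
  choose f hf1 hf2 hf3 hf4 using hex
  have hfc : f c = v := huniq c _ _ (hf1 c) hv (hf3 c) hp (hf4 c) hc
  have hlt : ∀ a b, f a < f b ↔ a < b := by
    intro a b
    have h : ∀ a b, a < b → f a < f b := fun a b h =>
      lt_of_branch (S := []) (by simpa using hf4 a) (by simpa using hf4 b) h
    refine ⟨fun h' => ?_, h a b⟩
    rcases lt_trichotomy a b with h1 | h1 | h1
    · exact h1
    · simp [h1] at h'
    · exact absurd h' (h b a h1).not_gt
  rw [childRank, hp, children, nodeList, ← List.toFinset_card_of_nodup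
    (((Finset.sort_nodup _ _).filter _).filter _)]
  have : (List.filter (fun x => decide (x < v)) (List.filter (fun C => decide (C ≠ [] ∧
      parent T C = [])) ((nodeSet T).sort (· ≤ ·)))).toFinset = (Finset.Iio c).image f := by
    ext u
    simp only [List.toFinset_filter, Finset.sort_toFinset, Finset.mem_filter, Finset.mem_image,
      decide_eq_true_eq, Finset.mem_Iio]
    constructor
    · rintro ⟨⟨h1, h2, h3⟩, h4⟩
      obtain ⟨a, t, rfl⟩ := List.exists_cons_of_ne_nil h2
      have h5 : f a = a :: t := huniq a _ _ (hf1 a) h1 (hf3 a) h3 (hf4 a) (by simp)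
      refine ⟨a, ?_, h5⟩
      rw [← hlt, h5, hfc]
      exact h4
    · rintro ⟨a, ha, rfl⟩
      refine ⟨⟨hf1 a, hf2 a, hf3 a⟩, ?_⟩
      rw [← hfc, hlt]
      exact ha
  rw [this, Finset.card_image_of_injective]
  · simp
  · intro a b hab
    rcases lt_trichotomy a b with h1 | h1 | h1
    · have := (hlt a b).2 h1
      simp [hab] at this
    · exact h1
    · have := (hlt b a).2 h1
      simp [hab] at this

theorem chr_rk (hT : IsText T) {j : ℕ} (hj : j < T.length) : chr T (rk T j) = T[j] := by
  have hS := hT.drop_mem_nodeSet hj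
  have hc : [T[j]] <+: T.drop j := by
    rw [List.drop_eq_getElem_cons hj]
    exact ⟨_, rfl⟩
  have h0 : T.drop j ≠ [] := by
    intro h'
    simp [h'] at hc
  have h2 := length_path_ge_two hS h0
  have h3 := length_levelAnc_lt (T := T) (S := T.drop j) Nat.zero_lt_one (by omega)
  rw [chr, leafSelect_rk hT hj]
  apply childRank_of_parent_nil hT (levelAnc_mem _ _)
  · exact List.prefix_of_prefix_length_le hc (levelAnc_prefix _ _) (by simp; omega)
  · rw [← zero_add 1, parent_levelAnc (by omega), levelAnc_zero]

end Leaves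

/-! ### The greedy form of the LZ78 factorization and the counts on edges. -/

section Greedy

variable {σ : ℕ} {T : List (Fin σ)} {F : List (List (Fin σ))}

/-- The incremental characterization of the LZ78 factorization: every factor is new, and all its
proper prefixes are earlier factors. -/
structure IsGreedy (T : List (Fin σ)) (F : List (List (Fin σ))) : Prop where
  flatten : F.flatten = T
  ne_nil : ∀ f ∈ F, f ≠ []
  notMem : ∀ (x : ℕ) (hx : x < F.length), F[x] ∉ F.take x
  take_mem : ∀ (x : ℕ) (hx : x < F.length) (t : ℕ), 0 < t → t < F[x].length →
    F[x].take t ∈ F.take x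

/-- The next factor is the shortest nonempty prefix of the rest `R` that is not yet a factor; by
minimality, its proper nonempty prefixes are factors. The induction is on the length of the rest. -/
theorem IsText.exists_isGreedy_aux (hT : IsText T) : ∀ (m : ℕ) (P : List (List (Fin σ)))
    (R : List (Fin σ)), R.length ≤ m → IsGreedy P.flatten P → P.flatten ++ R = T →
    ∃ F, IsGreedy T F := by
  intro m
  induction m with
  | zero =>
    intro P R hR hP h
    have : R = [] := List.eq_nil_of_length_eq_zero (by omega)
    refine ⟨P, ?_⟩
    rwa [← h, this, List.append_nil]
  | succ m ih =>
    intro P R hR hP h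
    by_cases hR0 : R = []
    · refine ⟨P, ?_⟩
      rwa [← h, hR0, List.append_nil]
    -- The rest contains the last character of the text, which no earlier factor can contain; so
    -- some prefix of the rest is new.
    have hRP : R ∉ P := by
      intro hmem
      obtain ⟨-, S, c, rfl, hc⟩ := hT
      apply hc
      have h1 := congrArg List.dropLast h
      rw [List.dropLast_append_of_ne_nil hR0, List.dropLast_concat] at h1
      have h2 := congrArg List.getLast? h
      rw [List.getLast?_append_of_ne_nil _ hR0, List.getLast?_concat] at h2
      have h3 : c ∈ R := List.mem_of_getLast? h2
      rw [← h1]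
      exact List.mem_append_left _ (List.mem_flatten.2 ⟨R, hmem, h3⟩)
    have hex : ∃ t, 0 < t ∧ R.take t ∉ P :=
      ⟨R.length, List.length_pos_iff.2 hR0, by simpa using hRP⟩
    classical
    obtain ⟨h1, h2⟩ := Nat.find_spec hex
    have h3 : Nat.find hex ≤ R.length :=
      Nat.find_min' hex ⟨List.length_pos_iff.2 hR0, by simpa using hRP⟩
    have h4 : ∀ t, 0 < t → t < Nat.find hex → R.take t ∈ P := by
      intro t ht htl
      by_contra h'
      exact Nat.find_min hex htl ⟨ht, h'⟩
    generalize Nat.find hex = L at h1 h2 h3 h4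
    refine ih (P ++ [R.take L]) (R.drop L) (by simp; omega) ⟨rfl, ?_, ?_, ?_⟩ ?_
    · intro f hf
      rw [List.mem_append, List.mem_singleton] at hf
      rcases hf with hf | rfl
      · exact hP.ne_nil f hf
      · simp [hR0]
        omega
    · intro x hx
      by_cases hxP : x < P.length
      · rw [List.getElem_append_left hxP, List.take_append_of_le_length hxP.le]
        exact hP.notMem x hxP
      · have : x = P.length := by simp at hx; omega
        subst this
        simpa using h2
    · intro x hx t ht
      by_cases hxP : x < P.length
      · rw [List.getElem_append_left hxP, List.take_append_of_le_length hxP.le]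
        exact hP.take_mem x hxP t ht
      · have : x = P.length := by simp at hx; omega
        subst this
        simp only [List.getElem_concat_length, List.take_left']
        intro htl
        rw [List.length_take] at htl
        rw [List.take_take, min_eq_left (by omega)]
        exact h4 t ht (by omega)
    · rw [← h]
      simp

theorem IsText.exists_isGreedy (hT : IsText T) : ∃ F, IsGreedy T F :=
  hT.exists_isGreedy_aux T.length [] T le_rfl
    ⟨rfl, by simp, by simp, by simp⟩ (by simp)

namespace IsGreedy

variable (hF : IsGreedy T F)
include hF

theorem nodup : F.Nodup := by
  rw [List.nodup_iff_injective_get, Function.Injective]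
  have key : ∀ i j : ℕ, ∀ (hi : i < F.length) (hj : j < F.length), i < j → F[i] ≠ F[j] := by
    intro i j hi hj hij h
    apply hF.notMem j hj
    rw [← h]
    exact List.mem_take_iff_getElem.2 ⟨i, by omega, rfl⟩
  rintro ⟨i, hi⟩ ⟨j, hj⟩ h
  simp only [List.get_eq_getElem] at h
  rcases lt_trichotomy i j with h1 | h1 | h1
  · exact absurd h (key i j hi hj h1)
  · simp [h1]
  · exact absurd h.symm (key j i hj hi h1)

/-- An earlier factor that is a prefix of the unparsed text and longer than `F[x].dropLast` has
`F[x]` as a prefix. Prefix closure then makes `F[x]` itself an earlier factor, which contradicts its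
novelty. -/
theorem isLZ78 : IsLZ78 T F := by
  refine ⟨hF.flatten, fun x hx => ?_⟩
  have h0 := hF.ne_nil _ (List.getElem_mem hx)
  refine ⟨F[x].dropLast, F[x].getLast h0, (List.dropLast_append_getLast h0).symm, ?_, ?_⟩
  · by_cases h1 : F[x].length = 1
    · left
      exact List.eq_nil_of_length_eq_zero (by simp [h1])
    · right
      have := List.length_pos_iff.2 h0
      rw [List.dropLast_eq_take]
      exact hF.take_mem x hx _ (by omega) (by omega)
  · intro S hS hSp
    by_contra h
    rw [List.length_dropLast] at h
    rw [List.drop_eq_getElem_cons hx, List.flatten_cons] at hSp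
    have h1 : F[x] <+: S :=
      List.prefix_of_prefix_length_le (List.prefix_append _ _) hSp (by omega)
    obtain ⟨y, hy, rfl⟩ := List.mem_take_iff_getElem.1 hS
    rw [List.prefix_iff_eq_take] at h1
    by_cases h2 : F[x].length < F[y].length
    · have h3 := hF.take_mem y (by omega) _ (List.length_pos_iff.2 h0) h2
      rw [← h1] at h3
      apply hF.notMem x hx
      obtain ⟨i, hi, h4⟩ := List.mem_take_iff_getElem.1 h3
      exact List.mem_take_iff_getElem.2 ⟨i, by omega, h4⟩
    · apply hF.notMem x hx
      rw [List.take_of_length_le (by omega)] at h1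
      rw [h1]
      exact hS

end IsGreedy

/-- The starting position of a factor. -/
def startPos (F : List (List (Fin σ))) (x : ℕ) : ℕ := (F.take x).flatten.length

theorem startPos_zero : startPos F 0 = 0 := by simp [startPos]

theorem startPos_succ {x : ℕ} (hx : x < F.length) :
    startPos F (x + 1) = startPos F x + F[x].length := by
  rw [startPos, startPos, List.take_succ_eq_append_getElem hx, List.flatten_append,
    List.length_append]
  simp

namespace IsGreedy

variable (hF : IsGreedy T F)
include hF

theorem startPos_length : startPos F F.length = T.length := by
  rw [startPos, List.take_length, hF.flatten]

theorem drop_startPos (x : ℕ) : T.drop (startPos F x) = (F.drop x).flatten := by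
  rw [← hF.flatten]
  conv_lhs => rw [← List.take_append_drop x F, List.flatten_append]
  rw [startPos, List.take_append_drop, List.drop_left]

theorem prefix_drop {x : ℕ} (hx : x < F.length) : F[x] <+: T.drop (startPos F x) := by
  rw [hF.drop_startPos, List.drop_eq_getElem_cons hx, List.flatten_cons]
  exact List.prefix_append _ _

theorem length_pos {x : ℕ} (hx : x < F.length) : 0 < F[x].length :=
  List.length_pos_iff.2 (hF.ne_nil _ (List.getElem_mem hx))

theorem startPos_mono {x y : ℕ} (hxy : x < y) (hy : y ≤ F.length) :
    startPos F x < startPos F y := by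
  induction y with
  | zero => omega
  | succ y ih =>
    rw [startPos_succ (by omega)]
    have := hF.length_pos (x := y) (by omega)
    rcases Nat.lt_succ_iff_lt_or_eq.1 hxy with h | rfl
    · have := ih h (by omega)
      omega
    · omega

theorem startPos_lt {x : ℕ} (hx : x < F.length) : startPos F x < T.length := by
  rw [← hF.startPos_length]
  exact hF.startPos_mono hx le_rfl

theorem startPos_add_le {x : ℕ} (hx : x < F.length) :
    startPos F x + F[x].length ≤ T.length := by
  rw [← startPos_succ hx]
  rcases Nat.eq_or_lt_of_le (Nat.succ_le_iff.2 hx) with h | h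
  · rw [Nat.succ_eq_add_one] at h
    rw [h, hF.startPos_length]
  · exact (hF.startPos_lt h).le

theorem length_le : F.length ≤ T.length := by
  have key : ∀ x ≤ F.length, x ≤ startPos F x := by
    intro x
    induction x with
    | zero => simp
    | succ x ih =>
      intro hx
      have h1 := ih (by omega)
      have h2 := hF.startPos_mono (Nat.lt_add_one x) hx
      omega
  have := key _ le_rfl
  rwa [hF.startPos_length] at this

theorem isInfix {f : List (Fin σ)} (hf : f ∈ F) : f <:+: T := by
  rw [← hF.flatten]
  obtain ⟨s, t, rfl⟩ := List.append_of_mem hf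
  exact ⟨s.flatten, t.flatten, by simp⟩

/-- The factors are distinct, so costs that are charged to the lengths of distinct factors sum up to
at most `n`. -/
theorem sum_length : ∑ f ∈ F.toFinset, f.length = T.length := by
  rw [List.sum_toFinset _ hF.nodup, ← hF.flatten, List.length_flatten]

end IsGreedy

/-- A set of nonempty strings that contains the nonempty prefixes of its elements. -/
structure PrefixClosed (P : List (List (Fin σ))) : Prop where
  nil_notMem : [] ∉ P
  take_mem : ∀ f ∈ P, ∀ t, 0 < t → f.take t ∈ P

theorem IsGreedy.prefixClosed (hF : IsGreedy T F) (x : ℕ) : PrefixClosed (F.take x) := by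
  constructor
  · intro h
    exact hF.ne_nil _ (List.mem_of_mem_take h) rfl
  · intro f hf t ht
    obtain ⟨y, hy, rfl⟩ := List.mem_take_iff_getElem.1 hf
    by_cases h : t < F[y].length
    · obtain ⟨i, hi, h4⟩ := List.mem_take_iff_getElem.1 (hF.take_mem y (by omega) t ht h)
      exact List.mem_take_iff_getElem.2 ⟨i, by omega, h4⟩
    · rwa [List.take_of_length_le (i := t) (by omega)]

theorem IsGreedy.prefixClosed_self (hF : IsGreedy T F) : PrefixClosed F := by
  simpa using hF.prefixClosed F.length

/-- The length of the longest prefix of `S` in `P`. -/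
def dep (P : List (List (Fin σ))) (S : List (Fin σ)) : ℕ :=
  Nat.findGreatest (fun t => S.take t ∈ P) S.length

theorem dep_le (P : List (List (Fin σ))) (S : List (Fin σ)) : dep P S ≤ S.length :=
  Nat.findGreatest_le _

theorem PrefixClosed.le_dep_iff {P : List (List (Fin σ))} (hP : PrefixClosed P)
    {S : List (Fin σ)} {t : ℕ} (h0 : 0 < t) (ht : t ≤ S.length) :
    t ≤ dep P S ↔ S.take t ∈ P := by
  constructor
  · intro h
    have h1 : S.take (dep P S) ∈ P :=
      Nat.findGreatest_of_ne_zero (P := fun t => S.take t ∈ P) (n := S.length) rfl (by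
        have : dep P S ≠ 0 := by omega
        exact this)
    have := hP.take_mem _ h1 t h0
    rwa [List.take_take, min_eq_left h] at this
  · intro h
    exact Nat.le_findGreatest (P := fun t => S.take t ∈ P) ht h

theorem PrefixClosed.dep_eq {P : List (List (Fin σ))} (hP : PrefixClosed P)
    {S : List (Fin σ)} {d : ℕ} (hd : d ≤ S.length) (h : ∀ t, 0 < t → t ≤ S.length →
      (S.take t ∈ P ↔ t ≤ d)) : dep P S = d := by
  apply le_antisymm
  · by_contra h'
    have h1 := dep_le P S
    have := (hP.le_dep_iff (t := dep P S) (by omega) h1).1 le_rfl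
    rw [h _ (by omega) h1] at this
    omega
  · rcases Nat.eq_zero_or_pos d with rfl | h0
    · omega
    · rw [hP.le_dep_iff h0 hd, h d h0 hd]

/-- The number of elements of `P` on the edge from the parent of `v` to `v`. -/
def cnt (T : List (Fin σ)) (P : List (List (Fin σ))) (v : List (Fin σ)) : ℕ :=
  dep P v - (parent T v).length

/-- Counts become membership of single prefixes, so two counts are compared by comparing which
prefixes belong to the sets (`eq_of_forall_lt_iff`). -/
theorem PrefixClosed.lt_cnt_iff {P : List (List (Fin σ))} (hP : PrefixClosed P)
    {v : List (Fin σ)} {k : ℕ} :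
    k < cnt T P v ↔ (parent T v).length + k + 1 ≤ v.length ∧
      v.take ((parent T v).length + k + 1) ∈ P := by
  rw [cnt, Nat.lt_sub_iff_add_lt']
  constructor
  · intro h
    have := dep_le P v
    refine ⟨by omega, ?_⟩
    rw [← hP.le_dep_iff (by omega) (by omega)]
    omega
  · rintro ⟨h1, h2⟩
    rw [← hP.le_dep_iff (by omega) h1] at h2
    omega

/-- Every point on the edge has the upper end of the edge as a prefix. -/
theorem PrefixClosed.cnt_eq_zero {P : List (List (Fin σ))} (hP : PrefixClosed P)
    {v : List (Fin σ)} (h0 : parent T v ≠ []) (h : parent T v ∉ P) : cnt T P v = 0 := by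
  by_contra h'
  obtain ⟨h1, h2⟩ := hP.lt_cnt_iff.1 (Nat.pos_of_ne_zero h')
  apply h
  have := hP.take_mem _ h2 (parent T v).length (List.length_pos_iff.2 h0)
  rwa [List.take_take, min_eq_left (by omega),
    ← List.prefix_iff_eq_take.1 (parent_prefix v)] at this

/-- How the parsing of the remaining text is related to the earlier factors. -/
theorem IsGreedy.take_mem_iff (hF : IsGreedy T F) {x : ℕ} (hx : x < F.length) {t : ℕ} (h0 : 0 < t) :
    (T.drop (startPos F x)).take t ∈ F.take x ↔ t < F[x].length := by
  have h1 := List.prefix_iff_eq_take.1 (hF.prefix_drop hx)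
  constructor
  · intro h
    by_contra h'
    have h2 := (hF.prefixClosed x).take_mem _ h F[x].length (hF.length_pos hx)
    rw [List.take_take, min_eq_left (by omega), ← h1] at h2
    exact hF.notMem x hx h2
  · intro h
    have h2 := hF.take_mem x hx t h0 h
    rwa [h1, List.take_take, min_eq_left h.le] at h2

/-- The next factor is the shortest nonempty prefix of the unparsed text that is not an earlier
factor (`IsGreedy.take_mem_iff`), so the longest earlier factor along this text lacks only its last
character. -/
theorem IsGreedy.dep_eq_of_prefix (hF : IsGreedy T F) {x : ℕ} (hx : x < F.length)
    {v : List (Fin σ)} (hv : v <+: T.drop (startPos F x)) (hvl : F[x].length ≤ v.length) :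
    dep (F.take x) v = F[x].length - 1 := by
  have h0 := hF.length_pos hx
  apply (hF.prefixClosed x).dep_eq (by omega)
  intro t ht htl
  have h1 := hv.length_le
  have h2 : v.take t = (T.drop (startPos F x)).take t := by
    rw [List.prefix_iff_eq_take.1 hv, List.take_take, min_eq_left htl]
  rw [h2, hF.take_mem_iff hx ht]
  omega

/-- Nodes of the LZ trie on or below an edge are created from different leaves. -/
theorem IsGreedy.cnt_le_leaves (hT : IsText T) (hF : IsGreedy T F) {x : ℕ} (hx : x ≤ F.length)
    {v : List (Fin σ)} (hv : v ∈ nodeSet T) (A : Finset ℕ)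
    (hA : ∀ y ∈ A, x ≤ y ∧ y < F.length ∧ v <+: T.drop (startPos F y)) :
    cnt T (F.take x) v + A.card ≤ rr T v + 1 - lr T v := by
  classical
  have hv' := isInfix_of_mem_nodeSet hv
  have hex : ∀ k, k < cnt T (F.take x) v → ∃ y, ∃ (hy : y < F.length), y < x ∧
      F[y] = v.take ((parent T v).length + k + 1) := by
    intro k hk
    obtain ⟨h1, h2⟩ := (hF.prefixClosed x).lt_cnt_iff.1 hk
    obtain ⟨y, hy, h⟩ := List.mem_take_iff_getElem.1 h2
    exact ⟨y, by omega, by omega, h⟩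
  choose! f hf1 hf2 hf3 using hex
  have hinj : Set.InjOn f (Finset.range (cnt T (F.take x) v)) := by
    intro k hk k' hk' h
    rw [Finset.mem_coe, Finset.mem_range] at hk hk'
    have h1 := hf3 k hk
    have h2 := hf3 k' hk'
    simp only [h] at h1
    rw [h1] at h2
    have h3 := congrArg List.length h2
    have h4 := ((hF.prefixClosed x).lt_cnt_iff.1 hk).1
    have h5 := ((hF.prefixClosed x).lt_cnt_iff.1 hk').1
    simp at h3
    omega
  -- The factors that created the points on the edge, together with those of `A`, which come later.
  -- All of them start at leaves below `v`, and factors have different starting positions.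
  set B := (Finset.range (cnt T (F.take x) v)).image f ∪ A with hB
  have hBspec : ∀ y ∈ B, y < F.length ∧ v <+: T.drop (startPos F y) := by
    intro y hy
    rw [hB, Finset.mem_union, Finset.mem_image] at hy
    rcases hy with ⟨k, hk, rfl⟩ | hy
    · rw [Finset.mem_range] at hk
      refine ⟨hf1 k hk, ?_⟩
      have h4 := ((hF.prefixClosed x).lt_cnt_iff.1 hk).1
      have h5 := hF.prefix_drop (hf1 k hk)
      rw [hf3 k hk] at h5
      exact prefix_of_edge hT hv (List.take_prefix _ _) (by simp; omega)
        (hF.startPos_lt (hf1 k hk)) h5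
    · exact (hA y hy).2
  have hcard : B.card = cnt T (F.take x) v + A.card := by
    rw [hB, Finset.card_union_of_disjoint, Finset.card_image_of_injOn hinj, Finset.card_range]
    rw [Finset.disjoint_left]
    intro y hy hyA
    rw [Finset.mem_image] at hy
    obtain ⟨k, hk, rfl⟩ := hy
    have := hf2 k (Finset.mem_range.1 hk)
    have := (hA _ hyA).1
    omega
  rw [← hcard, ← Nat.card_Icc]
  apply Finset.card_le_card_of_injOn (fun y => rk T (startPos F y))
  · intro y hy
    obtain ⟨h1, h2⟩ := hBspec y hy
    simp only [Finset.coe_Icc, Set.mem_Icc]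
    exact (rk_mem_interval hT hv' (hF.startPos_lt h1)).2 h2
  · intro y hy y' hy' h
    have h1 := hF.startPos_lt (hBspec y hy).1
    have h2 := hF.startPos_lt (hBspec y' hy').1
    have h3 := rk_inj hT h1 h2 h
    rcases lt_trichotomy y y' with h | h | h
    · have := hF.startPos_mono h (hBspec y' hy').1.le
      omega
    · exact h
    · have := hF.startPos_mono h (hBspec y hy).1.le
      omega

end Greedy

/-! ### LZ trie nodes as points on suffix tree edges, and their pre-order. -/

section Edges

variable {σ : ℕ} {T : List (Fin σ)} {F : List (List (Fin σ))}

/-- Take the highest node of length at least `f.length` on the path to a leaf that extends `f`; by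
minimality its parent is shorter than `f`. -/
theorem exists_edge (hT : IsText T) {f : List (Fin σ)} (hf : f <:+: T) (h0 : f ≠ []) :
    ∃ v ∈ nodeSet T, v ≠ [] ∧ (parent T v).length < f.length ∧ f <+: v := by
  obtain ⟨j, hj, h⟩ := hT.exists_drop hf
  have hS := hT.drop_mem_nodeSet hj
  have hex : ∃ d, d < (path T (T.drop j)).length ∧
      f.length ≤ (levelAnc T (T.drop j) d).length := by
    refine ⟨(path T (T.drop j)).length - 1, ?_, ?_⟩
    · have := length_path_pos (T := T) (T.drop j)
      omega
    · rw [levelAnc_last hS]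
      exact h.length_le
  classical
  obtain ⟨h1, h2⟩ := Nat.find_spec hex
  have h3 := fun d => Nat.find_min hex (m := d)
  generalize Nat.find hex = d at h1 h2 h3
  have hfl := List.length_pos_iff.2 h0
  cases d with
  | zero =>
    rw [levelAnc_zero] at h2
    simp at h2
    exact absurd h2 h0
  | succ d =>
    refine ⟨levelAnc T (T.drop j) (d + 1), levelAnc_mem _ _, ?_, ?_, ?_⟩
    · intro h'
      rw [h'] at h2
      simp at h2
      exact absurd h2 h0
    · rw [parent_levelAnc h1]
      have := h3 d (by omega)
      omega
    · exact List.prefix_of_prefix_length_le h (levelAnc_prefix _ _) h2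

/-- The strings on the edges of the suffix tree are ordered like the edges. -/
theorem lt_of_edge_lt {u v f g : List (Fin σ)} (hu : u ∈ nodeSet T) (hv : v ∈ nodeSet T)
    (hf : f <+: u) (hfl : (parent T u).length < f.length) (hg : g <+: v)
    (hgl : (parent T v).length < g.length) (huv : u < v) : f < g := by
  by_cases h : u <+: v
  · have h1 : u.length < v.length := by
      by_contra h'
      have := h.eq_of_length_le (by omega)
      exact huv.ne this
    have h2 := prefix_parent hv hu h h1
    have h3 := h2.length_le
    have h4 := hf.length_le
    exact lt_of_isPrefix (List.prefix_of_prefix_length_le (hf.trans h) hg (by omega)) (by omega)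
  · have h' : ¬ v <+: u := fun h' => (le_of_isPrefix h').not_gt huv
    obtain ⟨S, x, y, hxy, hx, hy⟩ := exists_branch h h'
    have hS := mem_nodeSet_of_branch hxy (hx.isInfix.trans (isInfix_of_mem_nodeSet hu))
      (hy.isInfix.trans (isInfix_of_mem_nodeSet hv))
    have hx' := hx.length_le
    have hy' := hy.length_le
    simp at hx' hy'
    have h1 := (prefix_parent hu hS ((List.prefix_append _ _).trans hx) (by omega)).length_le
    have h2 := (prefix_parent hv hS ((List.prefix_append _ _).trans hy) (by omega)).length_le
    have h3 : S ++ [x] <+: f := List.prefix_of_prefix_length_le hx hf (by simp; omega)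
    have h4 : S ++ [y] <+: g := List.prefix_of_prefix_length_le hy hg (by simp; omega)
    rcases lt_or_gt_of_ne hxy with h5 | h5
    · exact lt_of_branch h3 h4 h5
    · exact absurd huv (lt_of_branch hy hx h5).not_gt

/-- The number of LZ trie nodes on the edge to the `i`-th node of the suffix tree. -/
def arr (T : List (Fin σ)) (F : List (List (Fin σ))) (i : ℕ) : ℕ :=
  if i < (nodeSet T).card then cnt T F (nodeAt T i) else 0

/-- The prefix sums of `arr`. -/
def psum (T : List (Fin σ)) (F : List (List (Fin σ))) (i : ℕ) : ℕ :=
  ∑ j ∈ Finset.range i, arr T F j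

theorem arr_number {v : List (Fin σ)} (hv : v ∈ nodeSet T) : arr T F (number T v) = cnt T F v := by
  rw [arr, if_pos (number_lt hv), nodeAt_number hv]

/-- The LZ trie node with `k` predecessors on the edge to the `i`-th node of the suffix tree. -/
def edgeNode (T : List (Fin σ)) (i k : ℕ) : List (Fin σ) :=
  (nodeAt T i).take ((parent T (nodeAt T i)).length + k + 1)

theorem lt_card_of_lt_arr {i k : ℕ} (h : k < arr T F i) : i < (nodeSet T).card := by
  by_contra h'
  rw [arr, if_neg h'] at h
  omega

variable (hT : IsText T) (hF : IsGreedy T F)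
include hF

theorem edgeNode_spec {i k : ℕ} (h : k < arr T F i) :
    edgeNode T i k ∈ F ∧ (edgeNode T i k).length = (parent T (nodeAt T i)).length + k + 1 ∧
      edgeNode T i k <+: nodeAt T i := by
  have hi := lt_card_of_lt_arr h
  rw [arr, if_pos hi, hF.prefixClosed_self.lt_cnt_iff] at h
  refine ⟨h.2, ?_, List.take_prefix _ _⟩
  rw [edgeNode, List.length_take]
  omega

theorem edgeNode_lt {i k j l : ℕ} (hi : k < arr T F i) (hj : l < arr T F j)
    (h : i < j ∨ i = j ∧ k < l) : edgeNode T i k < edgeNode T j l := by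
  obtain ⟨-, h1, h2⟩ := edgeNode_spec hF hi
  obtain ⟨-, h3, h4⟩ := edgeNode_spec hF hj
  obtain ⟨h5, h6⟩ := exists_number_eq (lt_card_of_lt_arr hi)
  obtain ⟨h7, h8⟩ := exists_number_eq (lt_card_of_lt_arr hj)
  rcases h with h | ⟨rfl, h⟩
  · apply lt_of_edge_lt h5 h7 h2 (by omega) h4 (by omega)
    rw [← rankIn_lt_iff h5, ← number_eq_rankIn, ← number_eq_rankIn, h6, h8]
    exact h
  · exact lt_of_isPrefix (List.prefix_of_prefix_length_le h2 h4 (by omega)) (by omega)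

theorem edgeNode_inj {i k j l : ℕ} (hi : k < arr T F i) (hj : l < arr T F j)
    (h : edgeNode T i k = edgeNode T j l) : i = j ∧ k = l := by
  rcases lt_trichotomy i j with h1 | rfl | h1
  · exact absurd h (edgeNode_lt hF hi hj (Or.inl h1)).ne
  · rcases lt_trichotomy k l with h2 | rfl | h2
    · exact absurd h (edgeNode_lt hF hi hj (Or.inr ⟨rfl, h2⟩)).ne
    · exact ⟨rfl, rfl⟩
    · exact absurd h (edgeNode_lt hF hj hi (Or.inr ⟨rfl, h2⟩)).ne'
  · exact absurd h (edgeNode_lt hF hj hi (Or.inl h1)).ne'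

theorem lt_arr_of_edge {v f : List (Fin σ)} (hv : v ∈ nodeSet T) (hf : f ∈ F) (hfv : f <+: v)
    (hl : (parent T v).length < f.length) :
    f.length - (parent T v).length - 1 < arr T F (number T v) ∧
      edgeNode T (number T v) (f.length - (parent T v).length - 1) = f := by
  have h1 := hfv.length_le
  have h2 := List.prefix_iff_eq_take.1 hfv
  have h3 : (parent T v).length + (f.length - (parent T v).length - 1) + 1 = f.length := by omega
  rw [arr_number hv, edgeNode, nodeAt_number hv, hF.prefixClosed_self.lt_cnt_iff, h3, ← h2]
  exact ⟨⟨h1, hf⟩, rfl⟩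

include hT

theorem exists_edgeNode_eq {f : List (Fin σ)} (hf : f ∈ F) :
    ∃ i k, k < arr T F i ∧ edgeNode T i k = f := by
  obtain ⟨v, hv, h0, h1, h2⟩ := exists_edge hT (hF.isInfix hf) (hF.ne_nil f hf)
  exact ⟨_, _, lt_arr_of_edge hF hv hf h2 h1⟩

-- The points before the `k`-th one on the `i`-th edge are those on earlier edges and `k` on the
-- same edge. With `i` behind the last edge this gives the total number of factors; with
-- `edgeNode_lt` it gives the pre-order rank.
omit hT in
open Classical in
theorem card_filter_edge_lt (i k : ℕ) (hk : k ≤ arr T F i) :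
    (F.toFinset.filter fun f => ∃ j l, l < arr T F j ∧ edgeNode T j l = f ∧
      (j < i ∨ j = i ∧ l < k)).card = psum T F i + k := by
  have h1 : (F.toFinset.filter fun f => ∃ j l, l < arr T F j ∧ edgeNode T j l = f ∧
      (j < i ∨ j = i ∧ l < k)) =
      ((Finset.range i).sigma (fun j => Finset.range (arr T F j))).image
        (fun p => edgeNode T p.1 p.2) ∪ (Finset.range k).image (edgeNode T i) := by
    ext f
    simp only [Finset.mem_filter, List.mem_toFinset, Finset.mem_union, Finset.mem_image,
      Finset.mem_sigma, Finset.mem_range, Sigma.exists]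
    constructor
    · rintro ⟨-, j, l, h1, h2, h3 | ⟨rfl, h3⟩⟩
      · exact Or.inl ⟨j, l, ⟨h3, h1⟩, h2⟩
      · exact Or.inr ⟨l, h3, h2⟩
    · rintro (⟨j, l, ⟨h3, h1⟩, h2⟩ | ⟨l, h3, h2⟩)
      · exact ⟨h2 ▸ (edgeNode_spec hF h1).1, j, l, h1, h2, Or.inl h3⟩
      · exact ⟨h2 ▸ (edgeNode_spec hF (h3.trans_le hk)).1, i, l, h3.trans_le hk, h2,
          Or.inr ⟨rfl, h3⟩⟩
  rw [h1, Finset.card_union_of_disjoint, Finset.card_image_of_injOn, Finset.card_image_of_injOn,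
    Finset.card_sigma, Finset.card_range]
  · simp [psum]
  · intro a ha b hb h
    simp only [Finset.coe_range, Set.mem_Iio] at ha hb
    exact (edgeNode_inj hF (ha.trans_le hk) (hb.trans_le hk) h).2
  · rintro ⟨a, b⟩ ha ⟨c, d⟩ hc h
    simp only [Finset.coe_sigma, Set.mem_sigma_iff, Finset.coe_range, Set.mem_Iio] at ha hc
    obtain ⟨rfl, rfl⟩ := edgeNode_inj hF ha.2 hc.2 h
    rfl
  · rw [Finset.disjoint_left]
    intro f hf hf'
    simp only [Finset.mem_image, Finset.mem_sigma, Finset.mem_range, Sigma.exists] at hf hf'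
    obtain ⟨j, l, ⟨h1, h2⟩, rfl⟩ := hf
    obtain ⟨l', h3, h4⟩ := hf'
    have := (edgeNode_inj hF (h3.trans_le hk) h2 h4).1
    omega

theorem psum_card : psum T F (nodeSet T).card = F.length := by
  classical
  rw [← add_zero (psum T F _), ← card_filter_edge_lt hF _ 0 (Nat.zero_le _),
    ← List.toFinset_card_of_nodup hF.nodup]
  refine congrArg Finset.card (Finset.filter_eq_self.2 fun f hf => ?_)
  obtain ⟨i, k, h1, h2⟩ := exists_edgeNode_eq hT hF (List.mem_toFinset.1 hf)
  exact ⟨i, k, h1, h2, Or.inl (lt_card_of_lt_arr h1)⟩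

omit hF hT in
theorem psum_succ (i : ℕ) : psum T F (i + 1) = psum T F i + arr T F i :=
  Finset.sum_range_succ _ _

omit hF hT in
theorem psum_mono {i j : ℕ} (h : i ≤ j) : psum T F i ≤ psum T F j :=
  Finset.sum_le_sum_of_subset (Finset.range_subset_range.2 h)

theorem psum_of_ge {i : ℕ} (h : (nodeSet T).card ≤ i) : psum T F i = F.length := by
  induction i, h using Nat.le_induction with
  | base => exact psum_card hT hF
  | succ i hi ih =>
    rw [psum_succ, ih, arr, if_neg (by omega), add_zero]

theorem psum_le (i : ℕ) : psum T F i ≤ F.length := by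
  rcases le_total i (nodeSet T).card with h | h
  · exact (psum_mono h).trans (psum_card hT hF).le
  · exact (psum_of_ge hT hF h).le

/-- The pre-order rank of a node of the LZ trie. -/
theorem lzTrieNodes_getElem? {i k : ℕ} (h : k < arr T F i) :
    (lzTrieNodes F)[psum T F i + k]? = some (edgeNode T i k) := by
  classical
  have h1 : psum T F i + k = rankIn F.toFinset (edgeNode T i k) := by
    rw [← card_filter_edge_lt hF i k h.le, rankIn]
    refine congrArg Finset.card (Finset.ext fun f => ?_)
    simp only [Finset.mem_filter, List.mem_toFinset]
    refine and_congr_right fun hf => ?_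
    constructor
    · rintro ⟨j, l, h1, rfl, h3⟩
      exact edgeNode_lt hF h1 h h3
    · intro hlt
      obtain ⟨j, l, h1, rfl⟩ := exists_edgeNode_eq hT hF hf
      refine ⟨j, l, h1, rfl, ?_⟩
      by_contra h'
      have : (i < j ∨ i = j ∧ k < l) ∨ (i = j ∧ k = l) := by omega
      rcases this with h2 | ⟨rfl, rfl⟩
      · exact hlt.not_gt (edgeNode_lt hF h h1 h2)
      · exact lt_irrefl _ hlt
  rw [h1, lzTrieNodes]
  exact sort_getElem?_rankIn (List.mem_toFinset.2 (edgeNode_spec hF h).1)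

-- Budget for the string depths in `countCmd`: there the depth is computed only for full nodes,
-- which are distinct factors.
omit hT in
theorem sum_length_full_le : ∑ i ∈ Finset.range (nodeSet T).card,
    (if nodeAt T i ∈ F then (nodeAt T i).length else 0) ≤ T.length := by
  classical
  rw [← Finset.sum_filter, ← hF.sum_length]
  have hinj : Set.InjOn (nodeAt T)
      ((Finset.range (nodeSet T).card).filter (fun i => nodeAt T i ∈ F)) := by
    intro i hi j hj h
    simp only [Finset.coe_filter, Finset.mem_range, Set.mem_ofPred_eq] at hi hj
    rw [← (exists_number_eq hi.1).2, ← (exists_number_eq hj.1).2, h]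
  rw [← Finset.sum_image (f := List.length) hinj]
  apply Finset.sum_le_sum_of_subset
  intro f hf
  simp only [Finset.mem_image, Finset.mem_filter] at hf
  obtain ⟨i, ⟨-, h⟩, rfl⟩ := hf
  simpa using h

-- Budget for the string depths in `finish`: the topmost point on an edge is a factor that is one
-- character longer than the upper end of the edge, and different edges have different topmost
-- points.
omit hT in
theorem sum_length_parent_le : ∑ i ∈ Finset.range (nodeSet T).card,
    (if 0 < arr T F i then (parent T (nodeAt T i)).length + 1 else 0) ≤ T.length := by
  classical
  rw [← Finset.sum_filter, ← hF.sum_length]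
  have hinj : Set.InjOn (fun i => edgeNode T i 0)
      ((Finset.range (nodeSet T).card).filter (fun i => 0 < arr T F i)) := by
    intro i hi j hj h
    simp only [Finset.coe_filter, Finset.mem_range, Set.mem_ofPred_eq] at hi hj
    exact (edgeNode_inj hF hi.2 hj.2 h).1
  calc _ = ∑ i ∈ (Finset.range (nodeSet T).card).filter (fun i => 0 < arr T F i),
        (edgeNode T i 0).length := by
        refine Finset.sum_congr rfl fun i hi => ?_
        rw [(edgeNode_spec hF (Finset.mem_filter.1 hi).2).2.1, add_zero]
    _ ≤ _ := by
        rw [← Finset.sum_image (f := List.length) hinj]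
        apply Finset.sum_le_sum_of_subset
        intro f hf
        simp only [Finset.mem_image, Finset.mem_filter] at hf
        obtain ⟨i, ⟨-, h⟩, rfl⟩ := hf
        simpa using (edgeNode_spec hF h).1

end Edges

/-! ### A language with variables and expressions. -/

/-- The variables of the programs. -/
inductive V where
  -- These six constructors are listed before all others because they must be held by the registers
  -- 0 to 5 that `StoresLZTrie` reads.
  | bp | aB | wa | chB | wc | z
  | n | N | ell | K | Th | pB | qB | ptB | hB | xB | cB | eB | first | aS | cS | sg
  | p | lf | d | v | u | l | r | D | i | j | a | b | len | x | y | c | e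
  | ex | slot | st | st2 | hv | S | L | tail | h | go | t | fl
  deriving DecidableEq

/-- The register that holds a variable. -/
def V.idx (x : V) : ℕ := x.ctorIdx

theorem V.idx_injective : Function.Injective V.idx := by
  intro x y h
  have hx := V.ofNat_ctorIdx x
  have hy := V.ofNat_ctorIdx y
  rw [← hx, ← hy]
  exact congrArg V.ofNat h

theorem V.idx_lt (x : V) : x.idx < 64 := by
  cases x <;> decide

/-- States of the programs with variables. -/
structure St where
  reg : V → ℕ
  mem : ℕ → Bool
  out : List Code

def St.set (s : St) (x : V) (a : ℕ) : St := { s with reg := Function.update s.reg x a }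

@[simp] theorem St.set_reg (s : St) (x y : V) (a : ℕ) :
    (s.set x a).reg y = if y = x then a else s.reg y := by
  simp [St.set, Function.update_apply]

@[simp] theorem St.set_mem (s : St) (x : V) (a : ℕ) : (s.set x a).mem = s.mem := rfl

@[simp] theorem St.set_out (s : St) (x : V) (a : ℕ) : (s.set x a).out = s.out := rfl

/-- The number stored in a block of bits. -/
def blk (m : ℕ → Bool) (a l : ℕ) : ℕ := ∑ i ∈ Finset.range l, if m (a + i) then 2 ^ i else 0

/-- The memory after writing a number to a block of bits. -/
def wr (m : ℕ → Bool) (a l v : ℕ) : ℕ → Bool :=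
  fun j => if a ≤ j ∧ j < a + l then v.testBit (j - a) else m j

/-- Expressions over the variables; they are evaluated without overflow. -/
inductive Exp where
  | var (x : V)
  | lit (c : ℕ)
  | add (a b : Exp)
  | sub (a b : Exp)
  | mul (a b : Exp)
  | div (a b : Exp)
  | pop (a : Exp)
  | load (a l : Exp)
  | query (q : Query) (a b : Exp)

instance : Coe V Exp := ⟨Exp.var⟩
instance (n : ℕ) : OfNat Exp n := ⟨Exp.lit n⟩
instance : Add Exp := ⟨Exp.add⟩
instance : Sub Exp := ⟨Exp.sub⟩
instance : Mul Exp := ⟨Exp.mul⟩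
instance : Div Exp := ⟨Exp.div⟩

/-- Conditions. -/
inductive Cond where
  | lt (a b : Exp)
  | eq (a b : Exp)

/-- Programs with variables and expressions. -/
inductive Cmd where
  | assign (x : V) (e : Exp)
  | store (a l v : Exp)
  | emitFresh (c : Exp)
  | emitRef (y c : Exp)
  | seq (p q : Cmd)
  | ite (c : Cond) (p q : Cmd)
  | while (c : Cond) (p : Cmd)

infixr:60 " ;; " => Cmd.seq
infix:62 " ≔ " => Cmd.assign

/-! ### Overflow-free semantics and step counts. -/

section Semantics

variable {σ : ℕ} (T : List (Fin σ)) (w M : ℕ)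

def Exp.eval (s : St) : Exp → ℕ
  | .var x => s.reg x
  | .lit c => c
  | .add a b => a.eval s + b.eval s
  | .sub a b => a.eval s - b.eval s
  | .mul a b => a.eval s * b.eval s
  | .div a b => a.eval s / b.eval s
  | .pop a => LZCics.popcount (a.eval s)
  | .load a l => blk s.mem (a.eval s) (l.eval s)
  | .query q a b => q.answer T (a.eval s) (b.eval s)

/-- The evaluation of an expression does not overflow, and accesses only the first `M` bits of
the memory. -/
def Exp.Safe (s : St) : Exp → Prop
  | .var _ => True
  | .lit c => c ≤ 8
  | .add a b => a.Safe s ∧ b.Safe s ∧ a.eval T s + b.eval T s < 2 ^ w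
  | .sub a b => a.Safe s ∧ b.Safe s ∧ b.eval T s ≤ a.eval T s
  | .mul a b => a.Safe s ∧ b.Safe s ∧ a.eval T s * b.eval T s < 2 ^ w
  | .div a b => a.Safe s ∧ b.Safe s
  | .pop a => a.Safe s
  | .load a l => a.Safe s ∧ l.Safe s ∧ l.eval T s ≤ w ∧ a.eval T s + l.eval T s ≤ M
  | .query _ a b => a.Safe s ∧ b.Safe s

section simps

variable (s : St) (a b : Exp)

@[simp] theorem eval_var (x : V) : (Exp.var x).eval T s = s.reg x := rfl
@[simp] theorem eval_lit_0 : ((0 : Exp)).eval T s = 0 := rfl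
@[simp] theorem safe_lit_0 : ((0 : Exp)).Safe T w M s := by
  change 0 ≤ 8
  norm_num
@[simp] theorem eval_lit_1 : ((1 : Exp)).eval T s = 1 := rfl
@[simp] theorem safe_lit_1 : ((1 : Exp)).Safe T w M s := by
  change 1 ≤ 8
  norm_num
@[simp] theorem eval_lit_2 : ((2 : Exp)).eval T s = 2 := rfl
@[simp] theorem safe_lit_2 : ((2 : Exp)).Safe T w M s := by
  change 2 ≤ 8
  norm_num
@[simp] theorem eval_lit_4 : ((4 : Exp)).eval T s = 4 := rfl
@[simp] theorem safe_lit_4 : ((4 : Exp)).Safe T w M s := by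
  change 4 ≤ 8
  norm_num
@[simp] theorem eval_add : (a + b).eval T s = a.eval T s + b.eval T s := rfl
@[simp] theorem eval_sub : (a - b).eval T s = a.eval T s - b.eval T s := rfl
@[simp] theorem eval_mul : (a * b).eval T s = a.eval T s * b.eval T s := rfl
@[simp] theorem eval_div : (a / b).eval T s = a.eval T s / b.eval T s := rfl
@[simp] theorem eval_pop : (Exp.pop a).eval T s = LZCics.popcount (a.eval T s) := rfl
@[simp] theorem eval_load : (Exp.load a b).eval T s = blk s.mem (a.eval T s) (b.eval T s) := rfl
@[simp] theorem eval_query (q : Query) :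
    (Exp.query q a b).eval T s = q.answer T (a.eval T s) (b.eval T s) := rfl
@[simp] theorem safe_var (x : V) : (Exp.var x).Safe T w M s ↔ True := Iff.rfl
@[simp] theorem safe_add : (a + b).Safe T w M s ↔
    a.Safe T w M s ∧ b.Safe T w M s ∧ a.eval T s + b.eval T s < 2 ^ w := Iff.rfl
@[simp] theorem safe_sub : (a - b).Safe T w M s ↔
    a.Safe T w M s ∧ b.Safe T w M s ∧ b.eval T s ≤ a.eval T s := Iff.rfl
@[simp] theorem safe_mul : (a * b).Safe T w M s ↔
    a.Safe T w M s ∧ b.Safe T w M s ∧ a.eval T s * b.eval T s < 2 ^ w := Iff.rfl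
@[simp] theorem safe_div : (a / b).Safe T w M s ↔ a.Safe T w M s ∧ b.Safe T w M s := Iff.rfl
@[simp] theorem safe_pop : (Exp.pop a).Safe T w M s ↔ a.Safe T w M s := Iff.rfl
@[simp] theorem safe_load : (Exp.load a b).Safe T w M s ↔ a.Safe T w M s ∧ b.Safe T w M s ∧
    b.eval T s ≤ w ∧ a.eval T s + b.eval T s ≤ M := Iff.rfl
@[simp] theorem safe_query (q : Query) :
    (Exp.query q a b).Safe T w M s ↔ a.Safe T w M s ∧ b.Safe T w M s := Iff.rfl

end simps

def Cond.holds (s : St) : Cond → Prop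
  | .lt a b => a.eval T s < b.eval T s
  | .eq a b => a.eval T s = b.eval T s

def Cond.Safe (s : St) : Cond → Prop
  | .lt a b => a.Safe T w M s ∧ b.Safe T w M s
  | .eq a b => a.Safe T w M s ∧ b.Safe T w M s

@[simp] theorem holds_lt (s : St) (a b : Exp) :
    (Cond.lt a b).holds T s ↔ a.eval T s < b.eval T s := Iff.rfl
@[simp] theorem holds_eq (s : St) (a b : Exp) :
    (Cond.eq a b).holds T s ↔ a.eval T s = b.eval T s := Iff.rfl
@[simp] theorem cond_safe_lt (s : St) (a b : Exp) :
    (Cond.lt a b).Safe T w M s ↔ a.Safe T w M s ∧ b.Safe T w M s := Iff.rfl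
@[simp] theorem cond_safe_eq (s : St) (a b : Exp) :
    (Cond.eq a b).Safe T w M s ↔ a.Safe T w M s ∧ b.Safe T w M s := Iff.rfl

/-- Big-step semantics with costs. -/
inductive Big : Cmd → St → St → ℕ → Prop
  | assign {x : V} {e : Exp} {s : St} : e.Safe T w M s → Big (.assign x e) s (s.set x (e.eval T s)) 1
  | store {a l v : Exp} {s : St} : a.Safe T w M s → l.Safe T w M s → v.Safe T w M s →
      l.eval T s ≤ w → a.eval T s + l.eval T s ≤ M →
      Big (.store a l v) s { s with mem := wr s.mem (a.eval T s) (l.eval T s) (v.eval T s) } 1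
  | emitFresh {c : Exp} {s : St} : c.Safe T w M s →
      Big (.emitFresh c) s { s with out := s.out ++ [Code.fresh (c.eval T s)] } 1
  | emitRef {y c : Exp} {s : St} : y.Safe T w M s → c.Safe T w M s →
      Big (.emitRef y c) s { s with out := s.out ++ [Code.ref (y.eval T s) (c.eval T s)] } 1
  | seq {p q : Cmd} {s s' s'' : St} {t t' : ℕ} : Big p s s' t → Big q s' s'' t' →
      Big (.seq p q) s s'' (t + t')
  | ite_true {c : Cond} {p q : Cmd} {s s' : St} {t : ℕ} : c.Safe T w M s → c.holds T s →
      Big p s s' t → Big (.ite c p q) s s' (t + 1)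
  | ite_false {c : Cond} {p q : Cmd} {s s' : St} {t : ℕ} : c.Safe T w M s → ¬ c.holds T s →
      Big q s s' t → Big (.ite c p q) s s' (t + 1)
  | while_true {c : Cond} {p : Cmd} {s s' s'' : St} {t t' : ℕ} : c.Safe T w M s → c.holds T s →
      Big p s s' t → Big (.while c p) s' s'' t' → Big (.while c p) s s'' (t + t' + 1)
  | while_false {c : Cond} {p : Cmd} {s : St} : c.Safe T w M s → ¬ c.holds T s →
      Big (.while c p) s s 1

end Semantics

/-! ### Compilation to the word RAM. -/

section Compile

/-- The register that holds the `k`-th intermediate value. -/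
def tmp (k : ℕ) : ℕ := 64 + k

/-- Compute the value of an expression into the register `tmp k`. -/
def Exp.code : Exp → ℕ → Prog
  | .var x, k => .instr (.bin .or (tmp k) x.idx x.idx)
  | .lit c, k => .instr (.const (tmp k) c)
  | .add a b, k =>
      .seq (a.code k) (.seq (b.code (k + 1)) (.instr (.bin .add (tmp k) (tmp k) (tmp (k + 1)))))
  | .sub a b, k =>
      .seq (a.code k) (.seq (b.code (k + 1)) (.instr (.bin .sub (tmp k) (tmp k) (tmp (k + 1)))))
  | .mul a b, k =>
      .seq (a.code k) (.seq (b.code (k + 1)) (.instr (.bin .mul (tmp k) (tmp k) (tmp (k + 1)))))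
  | .div a b, k =>
      .seq (a.code k) (.seq (b.code (k + 1)) (.instr (.bin .div (tmp k) (tmp k) (tmp (k + 1)))))
  | .pop a, k => .seq (a.code k) (.instr (.popcount (tmp k) (tmp k)))
  | .load a l, k =>
      .seq (a.code k) (.seq (l.code (k + 1)) (.instr (.load (tmp k) (tmp k) (tmp (k + 1)))))
  | .query q a b, k =>
      .seq (a.code k) (.seq (b.code (k + 1)) (.instr (.query q (tmp k) (tmp k) (tmp (k + 1)))))

/-- The number of instructions that compute the value of an expression. -/
def Exp.size : Exp → ℕ
  | .var _ => 1
  | .lit _ => 1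
  | .add a b => a.size + (b.size + 1)
  | .sub a b => a.size + (b.size + 1)
  | .mul a b => a.size + (b.size + 1)
  | .div a b => a.size + (b.size + 1)
  | .pop a => a.size + 1
  | .load a b => a.size + (b.size + 1)
  | .query _ a b => a.size + (b.size + 1)

def Cond.code : Cond → Prog
  | .lt a b => .seq (a.code 0) (b.code 1)
  | .eq a b => .seq (a.code 0) (b.code 1)

def Cond.size : Cond → ℕ
  | .lt a b => a.size + b.size
  | .eq a b => a.size + b.size

def Cond.test : Cond → Test
  | .lt _ _ => .lt (tmp 0) (tmp 1)
  | .eq _ _ => .eq (tmp 0) (tmp 1)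

def Cmd.compile : Cmd → Prog
  | .assign x e => .seq (e.code 0) (.instr (.bin .or x.idx (tmp 0) (tmp 0)))
  | .store a l v => .seq (a.code 0) (.seq (l.code 1) (.seq (v.code 2)
      (.instr (.store (tmp 0) (tmp 1) (tmp 2)))))
  | .emitFresh c => .seq (c.code 0) (.instr (.emitFresh (tmp 0)))
  | .emitRef y c => .seq (y.code 0) (.seq (c.code 1) (.instr (.emitRef (tmp 0) (tmp 1))))
  | .seq p q => .seq p.compile q.compile
  | .ite c p q => .seq c.code (.ite c.test p.compile q.compile)
  -- A machine test only compares registers, so the condition is evaluated before the loop and again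
  -- at the end of each round.
  | .while c p => .seq c.code (.while c.test (.seq p.compile c.code))

/-- The greatest number of instructions in one step of a program. -/
def Cmd.cost : Cmd → ℕ
  | .assign _ e => e.size + 1
  | .store a l v => a.size + (l.size + (v.size + 1))
  | .emitFresh c => c.size + 1
  | .emitRef y c => y.size + (c.size + 1)
  | .seq p q => max p.cost q.cost
  | .ite c p q => max (c.size + 1) (max p.cost q.cost)
  | .while c p => max (c.size + 1) p.cost

/-- The relation between the states of a program and of the compiled program. -/
structure Sim (w M : ℕ) (s : St) (r : State) : Prop where
  reg : ∀ x : V, r.reg x.idx = s.reg x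
  reg_lt : ∀ x : V, s.reg x < 2 ^ w
  mem : r.mem = s.mem
  out : r.out = s.out
  used : r.used ≤ M

theorem blk_lt (m : ℕ → Bool) (a l : ℕ) : blk m a l < 2 ^ l := by
  induction l with
  | zero => simp [blk]
  | succ l ih =>
    rw [blk, Finset.sum_range_succ, pow_succ, ← blk]
    split <;> omega

theorem popcount_le (a : ℕ) : LZCics.popcount a ≤ a := by
  induction a using Nat.binaryRec with
  | zero => simp [LZCics.popcount]
  | bit b n ih =>
    by_cases hn : n = 0 ∧ b = false
    · simp [hn.1, hn.2, LZCics.popcount]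
    · have : (Nat.bit b n).bits = b :: n.bits := by
        apply Nat.bits_append_bit
        intro h
        by_contra h'
        exact hn ⟨h, by simpa using h'⟩
      rw [LZCics.popcount] at ih ⊢
      rw [this, List.count_cons, Nat.bit_val]
      cases b <;> simp <;> omega

variable {σ : ℕ} {T : List (Fin σ)} {w M : ℕ}

theorem eval_lt (h8 : 8 < 2 ^ w) (hq : ∀ q a b, Query.answer T q a b < 2 ^ w) {s : St}
    (hs : ∀ x : V, s.reg x < 2 ^ w) {e : Exp} (he : e.Safe T w M s) : e.eval T s < 2 ^ w := by
  induction e with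
  | var x => exact hs x
  | lit c => exact lt_of_le_of_lt he h8
  | add a b => exact he.2.2
  | sub a b iha ihb => exact lt_of_le_of_lt (Nat.sub_le _ _) (iha he.1)
  | mul a b => exact he.2.2
  | div a b iha ihb => exact lt_of_le_of_lt (Nat.div_le_self _ _) (iha he.1)
  | pop a iha => exact lt_of_le_of_lt (popcount_le _) (iha he)
  | load a l => exact (blk_lt _ _ _).trans_le (Nat.pow_le_pow_right (by norm_num) he.2.2.1)
  | query q a b => exact hq _ _ _

/-- What the code of an expression does. -/
structure CodeSpec (M k v : ℕ) (r r' : State) : Prop where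
  val : r'.reg (tmp k) = v
  old : ∀ i < tmp k, r'.reg i = r.reg i
  mem : r'.mem = r.mem
  out : r'.out = r.out
  used : r'.used ≤ M

theorem CodeSpec.sim {k v : ℕ} {s : St} {r r' : State} (h : CodeSpec M k v r r')
    (hs : Sim w M s r) : Sim w M s r' where
  reg x := by
    rw [h.old _ (by have := x.idx_lt; unfold tmp; omega), hs.reg]
  reg_lt := hs.reg_lt
  mem := h.mem.trans hs.mem
  out := h.out.trans hs.out
  used := h.used

/-- The second operand is computed one temporary register higher. Its code changes no lower
register, so the value of the first operand survives. -/
theorem exec_code_bin {a b : Exp} {k : ℕ} {s : St} {r : State} {i : Instr} (f : ℕ → ℕ → ℕ)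
    (hr : Sim w M s r)
    (iha : ∀ {k : ℕ} {r : State}, Sim w M s r →
      ∃ r', Exec T w (a.code k) r r' a.size ∧ CodeSpec M k (a.eval T s) r r')
    (ihb : ∀ {k : ℕ} {r : State}, Sim w M s r →
      ∃ r', Exec T w (b.code k) r r' b.size ∧ CodeSpec M k (b.eval T s) r r')
    (hi : ∀ r : State, Sim w M s r → r.reg (tmp k) = a.eval T s →
      r.reg (tmp (k + 1)) = b.eval T s →
      CodeSpec M k (f (a.eval T s) (b.eval T s)) r (i.step T w r)) :
    ∃ r', Exec T w (.seq (a.code k) (.seq (b.code (k + 1)) (.instr i))) r r'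
      (a.size + (b.size + 1)) ∧ CodeSpec M k (f (a.eval T s) (b.eval T s)) r r' := by
  obtain ⟨r1, h1, h1'⟩ := iha (k := k) hr
  have hr1 := h1'.sim hr
  obtain ⟨r2, h2, h2'⟩ := ihb (k := k + 1) hr1
  have hr2 := h2'.sim hr1
  refine ⟨_, .seq h1 (.seq h2 (.instr i r2)), ?_⟩
  have := hi r2 hr2 (by rw [h2'.old _ (by unfold tmp; omega), h1'.val]) h2'.val
  refine ⟨this.val, fun j hj => ?_, ?_, ?_, this.used⟩
  · rw [this.old j hj, h2'.old j (by unfold tmp at *; omega), h1'.old j hj]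
  · rw [this.mem, h2'.mem, h1'.mem]
  · rw [this.out, h2'.out, h1'.out]

theorem codeSpec_setReg {s : St} {r : State} (hr : Sim w M s r) (k v : ℕ) :
    CodeSpec M k v r (r.setReg (tmp k) v) where
  val := by simp [State.setReg]
  old i hi := by simp [State.setReg, hi.ne]
  mem := rfl
  out := rfl
  used := hr.used

theorem exec_code (h8 : 8 < 2 ^ w) (hq : ∀ q a b, Query.answer T q a b < 2 ^ w) {s : St}
    {e : Exp} (he : e.Safe T w M s) : ∀ {k : ℕ} {r : State}, Sim w M s r →
      ∃ r', Exec T w (e.code k) r r' e.size ∧ CodeSpec M k (e.eval T s) r r' := by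
  induction e with
  | var x =>
    intro k r hr
    refine ⟨_, .instr _ _, ?_⟩
    have := codeSpec_setReg hr k (s.reg x)
    simpa [Instr.step, BinOp.eval, hr.reg] using this
  | lit c =>
    intro k r hr
    refine ⟨_, .instr _ _, ?_⟩
    have := codeSpec_setReg hr k c
    rw [Instr.step, Nat.mod_eq_of_lt (lt_of_le_of_lt he h8)]
    exact this
  | add a b iha ihb =>
    intro k r hr
    refine exec_code_bin (fun x y => x + y) hr (iha he.1) (ihb he.2.1) fun r' hr' h1 h2 => ?_
    rw [Instr.step, h1, h2, BinOp.eval, Nat.mod_eq_of_lt he.2.2]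
    exact codeSpec_setReg hr' k _
  | sub a b iha ihb =>
    intro k r hr
    refine exec_code_bin (fun x y => x - y) hr (iha he.1) (ihb he.2.1) fun r' hr' h1 h2 => ?_
    have h3 := eval_lt h8 hq hr.reg_lt he.1
    have h4 : (a.eval T s + 2 ^ w - b.eval T s) % 2 ^ w = a.eval T s - b.eval T s := by
      have := he.2.2
      rw [show a.eval T s + 2 ^ w - b.eval T s = a.eval T s - b.eval T s + 2 ^ w by omega,
        Nat.add_mod_right, Nat.mod_eq_of_lt (by omega)]
    rw [Instr.step, h1, h2, BinOp.eval, h4]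
    exact codeSpec_setReg hr' k _
  | mul a b iha ihb =>
    intro k r hr
    refine exec_code_bin (fun x y => x * y) hr (iha he.1) (ihb he.2.1) fun r' hr' h1 h2 => ?_
    rw [Instr.step, h1, h2, BinOp.eval, Nat.mod_eq_of_lt he.2.2]
    exact codeSpec_setReg hr' k _
  | div a b iha ihb =>
    intro k r hr
    refine exec_code_bin (fun x y => x / y) hr (iha he.1) (ihb he.2) fun r' hr' h1 h2 => ?_
    rw [Instr.step, h1, h2, BinOp.eval]
    exact codeSpec_setReg hr' k _
  | pop a iha =>
    intro k r hr
    obtain ⟨r1, h1, h1'⟩ := iha he (k := k) hr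
    refine ⟨_, .seq h1 (.instr _ _), ?_⟩
    rw [Instr.step, h1'.val]
    have := codeSpec_setReg (h1'.sim hr) k (LZCics.popcount (a.eval T s))
    exact ⟨this.val, fun i hi => by rw [this.old i hi, h1'.old i hi], h1'.mem, h1'.out, this.used⟩
  | load a b iha ihb =>
    intro k r hr
    refine exec_code_bin (fun x y => blk s.mem x y) hr (iha he.1) (ihb he.2.1)
      fun r' hr' h1 h2 => ?_
    obtain ⟨-, -, h3, h4⟩ := he
    rw [Instr.step, h1, h2, min_eq_left h3]
    have hu : max r'.used (a.eval T s + b.eval T s) ≤ M := max_le hr'.used h4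
    refine ⟨?_, fun i hi => ?_, rfl, rfl, hu⟩
    · simp [State.setReg, State.block, blk, hr'.mem]
    · simp [State.setReg, hi.ne, State.touch]
  | query q a b iha ihb =>
    intro k r hr
    refine exec_code_bin (fun x y => q.answer T x y) hr (iha he.1) (ihb he.2)
      fun r' hr' h1 h2 => ?_
    rw [Instr.step, h1, h2, Nat.mod_eq_of_lt (hq _ _ _)]
    exact codeSpec_setReg hr' k _

theorem exec_cond (h8 : 8 < 2 ^ w) (hq : ∀ q a b, Query.answer T q a b < 2 ^ w) {s : St}
    {c : Cond} (hc : c.Safe T w M s) {r : State} (hr : Sim w M s r) :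
    ∃ r', Exec T w c.code r r' c.size ∧ Sim w M s r' ∧ (c.test.holds r' ↔ c.holds T s) := by
  cases c with
  | lt a b =>
    obtain ⟨r1, h1, h1'⟩ := exec_code h8 hq hc.1 (k := 0) hr
    have hr1 := h1'.sim hr
    obtain ⟨r2, h2, h2'⟩ := exec_code h8 hq hc.2 (k := 1) hr1
    refine ⟨r2, .seq h1 h2, h2'.sim hr1, ?_⟩
    have e : r2.reg (tmp 0) = a.eval T s := by rw [h2'.old _ (by simp [tmp]), h1'.val]
    simp only [Cond.test, Test.holds, Cond.holds, e, h2'.val]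
  | eq a b =>
    obtain ⟨r1, h1, h1'⟩ := exec_code h8 hq hc.1 (k := 0) hr
    have hr1 := h1'.sim hr
    obtain ⟨r2, h2, h2'⟩ := exec_code h8 hq hc.2 (k := 1) hr1
    refine ⟨r2, .seq h1 h2, h2'.sim hr1, ?_⟩
    have e : r2.reg (tmp 0) = a.eval T s := by rw [h2'.old _ (by simp [tmp]), h1'.val]
    simp only [Cond.test, Test.holds, Cond.holds, e, h2'.val]

/-- The compiled program simulates the program. -/
theorem Big.exec_compile (h8 : 8 < 2 ^ w) (hq : ∀ q a b, Query.answer T q a b < 2 ^ w) {c : Cmd}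
    {s s' : St} {t : ℕ} (h : Big T w M c s s' t) : ∀ κ, c.cost ≤ κ → ∀ r : State, Sim w M s r →
    ∃ r' t', Exec T w c.compile r r' t' ∧ t' ≤ κ * t ∧ Sim w M s' r' := by
  induction h with
  | @assign x e s he =>
    intro κ hκ r hr
    obtain ⟨r1, h1, h1'⟩ := exec_code h8 hq he (k := 0) hr
    have hr1 := h1'.sim hr
    refine ⟨_, _, .seq h1 (.instr _ _), by simpa [Cmd.cost] using hκ, ?_⟩
    have hv := eval_lt h8 hq hr.reg_lt he
    refine ⟨fun y => ?_, fun y => ?_, hr1.mem, hr1.out, hr1.used⟩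
    · simp only [Instr.step, BinOp.eval, State.setReg, Function.update_apply, h1'.val,
        St.set_reg, V.idx_injective.eq_iff, hr1.reg, Nat.or_self]
    · rw [St.set_reg]
      split
      · exact hv
      · exact hr.reg_lt y
  | @store a l v s ha hl hv hlw haM =>
    intro κ hκ r hr
    obtain ⟨r1, h1, h1'⟩ := exec_code h8 hq ha (k := 0) hr
    have hr1 := h1'.sim hr
    obtain ⟨r2, h2, h2'⟩ := exec_code h8 hq hl (k := 1) hr1
    have hr2 := h2'.sim hr1
    obtain ⟨r3, h3, h3'⟩ := exec_code h8 hq hv (k := 2) hr2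
    have hr3 := h3'.sim hr2
    refine ⟨_, _, .seq h1 (.seq h2 (.seq h3 (.instr _ _))), by simpa [Cmd.cost] using hκ, ?_⟩
    have e1 : r3.reg (tmp 0) = a.eval T s := by
      rw [h3'.old _ (by simp [tmp]), h2'.old _ (by simp [tmp]), h1'.val]
    have e2 : r3.reg (tmp 1) = l.eval T s := by rw [h3'.old _ (by simp [tmp]), h2'.val]
    rw [Instr.step, e1, e2, h3'.val, min_eq_left hlw]
    refine ⟨hr3.reg, hr3.reg_lt, ?_, hr3.out, max_le hr3.used haM⟩
    funext j
    simp [State.write, State.touch, wr, hr3.mem]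
  | @emitFresh c s hc =>
    intro κ hκ r hr
    obtain ⟨r1, h1, h1'⟩ := exec_code h8 hq hc (k := 0) hr
    have hr1 := h1'.sim hr
    refine ⟨_, _, .seq h1 (.instr _ _), by simpa [Cmd.cost] using hκ, ?_⟩
    refine ⟨hr1.reg, hr1.reg_lt, hr1.mem, ?_, hr1.used⟩
    simp [Instr.step, h1'.val, hr1.out]
  | @emitRef y c s hy hc =>
    intro κ hκ r hr
    obtain ⟨r1, h1, h1'⟩ := exec_code h8 hq hy (k := 0) hr
    have hr1 := h1'.sim hr
    obtain ⟨r2, h2, h2'⟩ := exec_code h8 hq hc (k := 1) hr1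
    have hr2 := h2'.sim hr1
    refine ⟨_, _, .seq h1 (.seq h2 (.instr _ _)), by simpa [Cmd.cost] using hκ, ?_⟩
    have e1 : r2.reg (tmp 0) = y.eval T s := by rw [h2'.old _ (by simp [tmp]), h1'.val]
    refine ⟨hr2.reg, hr2.reg_lt, hr2.mem, ?_, hr2.used⟩
    simp [Instr.step, e1, h2'.val, hr2.out]
  | @seq p q s s' s'' t t' _ _ ihp ihq =>
    intro κ hκ r hr
    rw [Cmd.cost, max_le_iff] at hκ
    obtain ⟨r1, t1, h1, ht1, hr1⟩ := ihp κ hκ.1 r hr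
    obtain ⟨r2, t2, h2, ht2, hr2⟩ := ihq κ hκ.2 r1 hr1
    exact ⟨r2, _, .seq h1 h2, by rw [mul_add]; omega, hr2⟩
  | @ite_true c p q s s' t hc hh _ ih =>
    intro κ hκ r hr
    rw [Cmd.cost, max_le_iff, max_le_iff] at hκ
    obtain ⟨r1, h1, hr1, hiff⟩ := exec_cond h8 hq hc hr
    obtain ⟨r2, t2, h2, ht2, hr2⟩ := ih κ hκ.2.1 r1 hr1
    refine ⟨r2, _, .seq h1 (.ite_true (hiff.2 hh) h2), ?_, hr2⟩
    have := hκ.1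
    rw [mul_add]
    omega
  | @ite_false c p q s s' t hc hh _ ih =>
    intro κ hκ r hr
    rw [Cmd.cost, max_le_iff, max_le_iff] at hκ
    obtain ⟨r1, h1, hr1, hiff⟩ := exec_cond h8 hq hc hr
    obtain ⟨r2, t2, h2, ht2, hr2⟩ := ih κ hκ.2.2 r1 hr1
    refine ⟨r2, _, .seq h1 (.ite_false (fun h => hh (hiff.1 h)) h2), ?_, hr2⟩
    have := hκ.1
    rw [mul_add]
    omega
  | @while_true c p s s' s'' t t' hc hh _ _ ihp ihw =>
    intro κ hκ r hr
    have hκ' := hκ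
    rw [Cmd.cost, max_le_iff] at hκ
    obtain ⟨r1, h1, hr1, hiff⟩ := exec_cond h8 hq hc hr
    obtain ⟨r2, t2, h2, ht2, hr2⟩ := ihp κ hκ.2 r1 hr1
    obtain ⟨r3, t3, h3, ht3, hr3⟩ := ihw κ hκ' r2 hr2
    -- The simulated rest of the loop begins with an evaluation of the condition. This piece is
    -- split off and attached to the end of the body, where the compiled loop has it.
    cases h3 with
    | @seq _ _ _ rm _ ta tb h4 h5 =>
      refine ⟨r3, _, .seq h1 (.while_true (hiff.2 hh) (.seq h2 h4) h5), ?_, hr3⟩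
      have := hκ.1
      rw [mul_add, mul_add]
      omega
  | @while_false c p s hc hh =>
    intro κ hκ r hr
    rw [Cmd.cost, max_le_iff] at hκ
    obtain ⟨r1, h1, hr1, hiff⟩ := exec_cond h8 hq hc hr
    refine ⟨r1, _, .seq h1 (.while_false fun h => hh (hiff.1 h)), by simpa using hκ.1, hr1⟩

end Compile

/-! ### Frames and program rules with time bounds. -/

section Runs

/-- The variables that a program assigns. -/
def Cmd.mods : Cmd → List V
  | .assign x _ => [x]
  | .seq p q => p.mods ++ q.mods
  | .ite _ p q => p.mods ++ q.mods
  | .while _ p => p.mods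
  | _ => []

/-- Whether a program writes to the memory. -/
def Cmd.stores : Cmd → Bool
  | .store _ _ _ => true
  | .seq p q => p.stores || q.stores
  | .ite _ p q => p.stores || q.stores
  | .while _ p => p.stores
  | _ => false

/-- Whether a program writes to the output. -/
def Cmd.emits : Cmd → Bool
  | .emitFresh _ => true
  | .emitRef _ _ => true
  | .seq p q => p.emits || q.emits
  | .ite _ p q => p.emits || q.emits
  | .while _ p => p.emits
  | _ => false

/-- What a program leaves unchanged. -/
structure Frame (c : Cmd) (s s' : St) : Prop where
  reg : ∀ x : V, x ∉ c.mods → s'.reg x = s.reg x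
  mem : c.stores = false → s'.mem = s.mem
  out : c.emits = false → s'.out = s.out

variable {σ : ℕ} {T : List (Fin σ)} {w M : ℕ}

theorem Big.frame {c : Cmd} {s s' : St} {t : ℕ} (h : Big T w M c s s' t) : Frame c s s' := by
  induction h with
  | assign he =>
    refine ⟨fun y hy => ?_, fun _ => rfl, fun _ => rfl⟩
    simp [Cmd.mods] at hy
    simp [hy]
  | store => exact ⟨fun _ _ => rfl, fun h => by simp [Cmd.stores] at h, fun _ => rfl⟩
  | emitFresh => exact ⟨fun _ _ => rfl, fun _ => rfl, fun h => by simp [Cmd.emits] at h⟩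
  | emitRef => exact ⟨fun _ _ => rfl, fun _ => rfl, fun h => by simp [Cmd.emits] at h⟩
  | seq _ _ ih1 ih2 =>
    refine ⟨fun y hy => ?_, fun h => ?_, fun h => ?_⟩
    · simp only [Cmd.mods, List.mem_append, not_or] at hy
      rw [ih2.reg y hy.2, ih1.reg y hy.1]
    · simp only [Cmd.stores, Bool.or_eq_false_iff] at h
      rw [ih2.mem h.2, ih1.mem h.1]
    · simp only [Cmd.emits, Bool.or_eq_false_iff] at h
      rw [ih2.out h.2, ih1.out h.1]
  | ite_true _ _ _ ih =>
    refine ⟨fun y hy => ?_, fun h => ?_, fun h => ?_⟩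
    · simp only [Cmd.mods, List.mem_append, not_or] at hy
      exact ih.reg y hy.1
    · simp only [Cmd.stores, Bool.or_eq_false_iff] at h
      exact ih.mem h.1
    · simp only [Cmd.emits, Bool.or_eq_false_iff] at h
      exact ih.out h.1
  | ite_false _ _ _ ih =>
    refine ⟨fun y hy => ?_, fun h => ?_, fun h => ?_⟩
    · simp only [Cmd.mods, List.mem_append, not_or] at hy
      exact ih.reg y hy.2
    · simp only [Cmd.stores, Bool.or_eq_false_iff] at h
      exact ih.mem h.2
    · simp only [Cmd.emits, Bool.or_eq_false_iff] at h
      exact ih.out h.2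
  | while_true _ _ _ _ ih1 ih2 =>
    refine ⟨fun y hy => ?_, fun h => ?_, fun h => ?_⟩
    · rw [ih2.reg y hy, ih1.reg y hy]
    · rw [ih2.mem h, ih1.mem h]
    · rw [ih2.out h, ih1.out h]
  | while_false => exact ⟨fun _ _ => rfl, fun _ => rfl, fun _ => rfl⟩

variable (T w M) in
/-- The program halts in a state, and after a time, that satisfy `Q`. -/
def Runs (c : Cmd) (s : St) (Q : St → ℕ → Prop) : Prop := ∃ s' t, Big T w M c s s' t ∧ Q s' t

namespace Runs

theorem mono {c : Cmd} {s : St} {Q Q' : St → ℕ → Prop} (h : Runs T w M c s Q)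
    (hQ : ∀ s' t, Q s' t → Frame c s s' → Q' s' t) : Runs T w M c s Q' := by
  obtain ⟨s', t, h1, h2⟩ := h
  exact ⟨s', t, h1, hQ s' t h2 h1.frame⟩

theorem assign {x : V} {e : Exp} {s : St} {Q : St → ℕ → Prop} (he : e.Safe T w M s)
    (h : Q (s.set x (e.eval T s)) 1) : Runs T w M (x ≔ e) s Q :=
  ⟨_, _, .assign he, h⟩

theorem store {a l v : Exp} {s : St} {Q : St → ℕ → Prop}
    (hs : a.Safe T w M s ∧ l.Safe T w M s ∧ v.Safe T w M s ∧
      l.eval T s ≤ w ∧ a.eval T s + l.eval T s ≤ M)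
    (h : Q { s with mem := wr s.mem (a.eval T s) (l.eval T s) (v.eval T s) } 1) :
    Runs T w M (.store a l v) s Q :=
  ⟨_, _, .store hs.1 hs.2.1 hs.2.2.1 hs.2.2.2.1 hs.2.2.2.2, h⟩

theorem bind {p q : Cmd} {s : St} {Q₁ Q : St → ℕ → Prop} (hp : Runs T w M p s Q₁)
    (hq : ∀ s' t, Q₁ s' t → Frame p s s' → Runs T w M q s' (fun s'' t' => Q s'' (t + t'))) :
    Runs T w M (p ;; q) s Q := by
  obtain ⟨s', t, h1, h2⟩ := hp
  obtain ⟨s'', t', h3, h4⟩ := hq s' t h2 h1.frame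
  exact ⟨s'', _, .seq h1 h3, h4⟩

theorem assign_seq {x : V} {e : Exp} {q : Cmd} {s : St} {Q : St → ℕ → Prop}
    (he : e.Safe T w M s)
    (h : Runs T w M q (s.set x (e.eval T s)) (fun s' t => Q s' (1 + t))) :
    Runs T w M (x ≔ e ;; q) s Q := by
  obtain ⟨s'', t', h3, h4⟩ := h
  exact ⟨s'', _, .seq (.assign he) h3, h4⟩

theorem store_seq {a l v : Exp} {q : Cmd} {s : St} {Q : St → ℕ → Prop}
    (hs : a.Safe T w M s ∧ l.Safe T w M s ∧ v.Safe T w M s ∧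
      l.eval T s ≤ w ∧ a.eval T s + l.eval T s ≤ M)
    (h : Runs T w M q { s with mem := wr s.mem (a.eval T s) (l.eval T s) (v.eval T s) }
      (fun s' t => Q s' (1 + t))) :
    Runs T w M (.store a l v ;; q) s Q := by
  obtain ⟨s'', t', h3, h4⟩ := h
  exact ⟨s'', _, .seq (.store hs.1 hs.2.1 hs.2.2.1 hs.2.2.2.1 hs.2.2.2.2) h3, h4⟩

theorem ite {c : Cond} {p q : Cmd} {s : St} {Q : St → ℕ → Prop} (hc : c.Safe T w M s)
    (hp : c.holds T s → Runs T w M p s (fun s' t => Q s' (t + 1)))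
    (hq : ¬ c.holds T s → Runs T w M q s (fun s' t => Q s' (t + 1))) :
    Runs T w M (.ite c p q) s Q := by
  by_cases h : c.holds T s
  · obtain ⟨s', t, h1, h2⟩ := hp h
    exact ⟨s', _, .ite_true hc h h1, h2⟩
  · obtain ⟨s', t, h1, h2⟩ := hq h
    exact ⟨s', _, .ite_false hc h h1, h2⟩

/-- The rule for loops, with an invariant and a potential. -/
theorem while_ {G : Type*} (I : G → St → Prop) (Φ : G → ℕ) {c : Cond} {p : Cmd}
    (hc : ∀ g s, I g s → c.Safe T w M s)
    (hp : ∀ g s, I g s → c.holds T s →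
      Runs T w M p s (fun s' t => ∃ g', I g' s' ∧ t + 1 + Φ g' ≤ Φ g))
    (g : G) (s : St) (hI : I g s) :
    Runs T w M (.while c p) s
      (fun s' t => ∃ g', I g' s' ∧ ¬ c.holds T s' ∧ t + Φ g' ≤ Φ g + 1) := by
  generalize hm : Φ g = m
  induction m using Nat.strong_induction_on generalizing g s with
  | _ m ih =>
    by_cases h : c.holds T s
    · obtain ⟨s', t, h1, g', h2, h3⟩ := hp g s hI h
      obtain ⟨s'', t', h4, g'', h5, h6, h7⟩ := ih (Φ g') (by omega) g' s' h2 rfl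
      exact ⟨s'', _, .while_true (hc g s hI) h h1 h4, g'', h5, h6, by omega⟩
    · exact ⟨s, 1, .while_false (hc g s hI) h, g, hI, h, by omega⟩

end Runs

end Runs

/-! ### Blocks of bits and popcounts. -/

section Memory

theorem blk_zero (m : ℕ → Bool) (a : ℕ) : blk m a 0 = 0 := by simp [blk]

theorem blk_one (m : ℕ → Bool) (a : ℕ) : blk m a 1 = (m a).toNat := by
  simp [blk]
  cases m a <;> simp

theorem blk_succ (m : ℕ → Bool) (a l : ℕ) :
    blk m a (l + 1) = Nat.bit (m a) (blk m (a + 1) l) := by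
  rw [blk, Finset.sum_range_succ', Nat.bit_val, blk, Finset.mul_sum]
  congr 1
  · refine Finset.sum_congr rfl fun i _ => ?_
    rw [show a + (i + 1) = a + 1 + i by ring]
    split <;> ring
  · cases m a <;> simp

theorem blk_congr {m m' : ℕ → Bool} {a l : ℕ} (h : ∀ i, a ≤ i → i < a + l → m i = m' i) :
    blk m a l = blk m' a l := by
  refine Finset.sum_congr rfl fun i hi => ?_
  rw [Finset.mem_range] at hi
  rw [h _ (by omega) (by omega)]

theorem blk_testBit (l : ℕ) : ∀ (m : ℕ → Bool) (a v : ℕ),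
    (∀ i < l, m (a + i) = v.testBit i) → v < 2 ^ l → blk m a l = v := by
  induction l with
  | zero =>
    intro m a v _ h2
    simp at h2
    simp [blk_zero, h2]
  | succ l ih =>
    intro m a v h1 h2
    rw [blk_succ, ih m (a + 1) (v / 2)]
    · have := h1 0 (by omega)
      rw [add_zero] at this
      rw [this, Nat.bit_val, Nat.testBit_zero]
      rcases Nat.mod_two_eq_zero_or_one v with h | h <;> simp [h] <;> omega
    · intro i hi
      rw [show a + 1 + i = a + (i + 1) by ring, h1 _ (by omega), Nat.testBit_succ]
    · rw [pow_succ] at h2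
      omega

theorem wr_of_disj {m : ℕ → Bool} {a l v j : ℕ} (h : j < a ∨ a + l ≤ j) : wr m a l v j = m j := by
  rw [wr, if_neg (by omega)]

theorem wr_one {m : ℕ → Bool} {a v j : ℕ} :
    wr m a 1 v j = if j = a then v.testBit 0 else m j := by
  rw [wr]
  by_cases h : j = a
  · rw [if_pos (by omega), if_pos h, h, Nat.sub_self]
  · rw [if_neg (by omega), if_neg h]

theorem blk_wr_same {m : ℕ → Bool} {a l v : ℕ} (hv : v < 2 ^ l) : blk (wr m a l v) a l = v := by
  apply blk_testBit l _ _ _ _ hv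
  intro i hi
  rw [wr, if_pos (by omega), Nat.add_sub_cancel_left]

theorem blk_wr_disj {m : ℕ → Bool} {a l v b k : ℕ} (h : a + l ≤ b ∨ b + k ≤ a) :
    blk (wr m a l v) b k = blk m b k := by
  apply blk_congr
  intro i h1 h2
  exact wr_of_disj (by omega)

theorem entry_le {i j l : ℕ} (h : i < j) : i * l + l ≤ j * l := by
  rw [← Nat.succ_mul]
  exact Nat.mul_le_mul_right _ h

theorem blk_wr_entry {m : ℕ → Bool} {a l v i j : ℕ} (h : i ≠ j) :
    blk (wr m (a + i * l) l v) (a + j * l) l = blk m (a + j * l) l := by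
  apply blk_wr_disj
  rcases lt_or_gt_of_ne h with h | h
  · have := entry_le (l := l) h
    omega
  · have := entry_le (l := l) h
    omega

theorem popcount_bit (b : Bool) (n : ℕ) :
    LZCics.popcount (Nat.bit b n) = LZCics.popcount n + b.toNat := by
  by_cases hn : n = 0 ∧ b = false
  · simp [hn.1, hn.2, LZCics.popcount]
  · have : (Nat.bit b n).bits = b :: n.bits := by
      apply Nat.bits_append_bit
      intro h
      by_contra h'
      exact hn ⟨h, by simpa using h'⟩
    rw [LZCics.popcount, this, List.count_cons]
    cases b <;> rfl

/-- The number of set bits in a block. -/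
def ones (m : ℕ → Bool) (a l : ℕ) : ℕ := ∑ i ∈ Finset.range l, (m (a + i)).toNat

theorem popcount_blk (l : ℕ) : ∀ (m : ℕ → Bool) (a : ℕ),
    LZCics.popcount (blk m a l) = ones m a l := by
  induction l with
  | zero => intro m a; simp [blk_zero, ones, LZCics.popcount]
  | succ l ih =>
    intro m a
    rw [blk_succ, popcount_bit, ih, ones, ones, Finset.sum_range_succ']
    congr 1
    refine Finset.sum_congr rfl fun i _ => ?_
    rw [show a + 1 + i = a + (i + 1) by ring]

end Memory

/-! ### Size of the answers of the suffix tree. -/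

section Queries

variable {σ : ℕ} {T : List (Fin σ)}

theorem length_le_of_mem_nodeSet {v : List (Fin σ)} (h : v ∈ nodeSet T) : v.length ≤ T.length :=
  (isInfix_of_mem_nodeSet h).length_le

theorem nodeAt_mem (i : ℕ) : nodeAt T i ∈ nodeSet T := by
  by_cases h : i < (nodeSet T).card
  · exact (exists_number_eq h).1
  · rw [nodeAt, nodeList, List.getElem?_eq_none (by rw [Finset.length_sort]; omega)]
    exact nil_mem_nodeSet

theorem leafSelect_mem (i : ℕ) : leafSelect T i ∈ nodeSet T := by
  rw [leafSelect]
  cases h : (leafList T)[i]? with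
  | none => exact nil_mem_nodeSet
  | some v => exact leafSet_subset ((Finset.mem_sort _).1 (List.mem_of_getElem? h))

theorem lmostLeaf_mem_nodeSet (v : List (Fin σ)) : lmostLeaf T v ∈ nodeSet T := by
  rw [lmostLeaf]
  cases h : (leavesBelow T v).head? with
  | none => exact nil_mem_nodeSet
  | some u => exact leafSet_subset (mem_leavesBelow.1 (List.mem_of_mem_head? h)).1

theorem rmostLeaf_mem_nodeSet (v : List (Fin σ)) : rmostLeaf T v ∈ nodeSet T := by
  rw [rmostLeaf]
  cases h : (leavesBelow T v).getLast? with
  | none => exact nil_mem_nodeSet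
  | some u => exact leafSet_subset (mem_leavesBelow.1 (List.mem_of_getLast? h)).1

/-- For large enough words, reducing an answer modulo `2 ^ w` does not change it. -/
theorem answer_le (hT : IsText T) (q : Query) (a b : ℕ) : q.answer T a b ≤ 2 * T.length := by
  have hn : ∀ v : List (Fin σ), number T v ≤ 2 * T.length := fun v => by
    rw [number_eq_rankIn]
    exact (rankIn_le_card _ _).trans hT.card_nodeSet_le
  have hl : ∀ v : List (Fin σ), leafRank T v ≤ 2 * T.length := fun v =>
    (leafRank_le_number v).trans (hn v)
  have hd : ∀ i, depth T (nodeAt T i) ≤ 2 * T.length := by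
    intro i
    have h1 : (path T (nodeAt T i)).length ≤ (nodeAt T i).length + 1 := by
      rw [path, ← List.length_inits]
      exact List.length_filter_le _ _
    have h2 := length_le_of_mem_nodeSet (nodeAt_mem (T := T) i)
    rw [depth]
    omega
  have hc : ∀ v : List (Fin σ), childRank T v ≤ 2 * T.length := by
    intro v
    refine le_trans ?_ hT.card_nodeSet_le
    rw [childRank, children]
    refine ((List.length_filter_le _ _).trans (List.length_filter_le _ _)).trans ?_
    rw [nodeList, Finset.length_sort]
  cases q <;> simp only [Query.answer]
  · exact hl _
  · exact hl _
  · exact hn _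
  · exact hd _
  · exact hn _
  · exact hn _
  · exact hn _
  · exact hn _
  · exact hl _
  · exact hc _
  · exact hn _

end Queries

/-! ### The algorithm. -/

section Programs

/-- The child of the root above a leaf is determined by the first character of the suffix, and its
sibling rank is this character. -/
def xchr (a : Exp) : Exp :=
  .query .childRank (.query .levelAnc (.query .leafSelect a 0) 1) 0
def xpsi (a : Exp) : Exp := .query .psi a 0
def xlr (v : Exp) : Exp := .query .leafRank (.query .lmostLeaf v 0) 0
def xrr (v : Exp) : Exp := .query .leafRank (.query .rmostLeaf v 0) 0
def xpar (v : Exp) : Exp := .query .parent v 0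
def xanc (v d : Exp) : Exp := .query .levelAnc v d
def xinner (v : Exp) : Exp := v - .query .leafRank v 0

/-- Nonzero if the edge to the node `v` is full. -/
def xfull (v : Exp) : Exp := .load (V.xB + xinner v) 1 * (xrr v - xlr v)

/-- The length of the path label of the node `u`. -/
def depthCmd : Cmd :=
  V.D ≔ 0 ;;
  .ite (.eq V.u 0) (V.D ≔ 0)
    (V.a ≔ xlr V.u ;; V.b ≔ xrr V.u ;;
      .while (.eq (xchr V.a) (xchr V.b)) (V.a ≔ xpsi V.a ;; V.b ≔ xpsi V.b ;; V.D ≔ V.D + 1))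

/-- The number of binary digits. -/
def sizeCmd (x : V) (e : Exp) : Cmd :=
  x ≔ 0 ;; V.t ≔ e ;; .while (.lt 0 V.t) (V.t ≔ V.t / 2 ;; x ≔ x + 1)

/-- From address 0 on: prefix sums of the current block, a queue, the block pointers, one bit per
suffix tree node, the marks of full inner nodes (at `xB`), and the unary counters (at `cB`). The
first two regions are scratch space of polylogarithmic size. -/
def setup : Cmd :=
  V.n ≔ xrr 0 + 1 ;; V.N ≔ .query .rmostLeaf 0 0 + 1 ;; V.first ≔ .query .firstLeafRank 0 0 ;;
  sizeCmd V.ell V.n ;;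
  V.K ≔ 4 * V.ell ;; V.Th ≔ (V.K + 1) * V.ell ;; V.pB ≔ 0 ;; V.qB ≔ V.Th ;;
  V.ptB ≔ V.qB + V.Th * V.ell ;; V.hB ≔ V.ptB + (V.N / V.K + 2) * V.ell ;;
  V.xB ≔ V.hB + V.N + V.K ;; V.cB ≔ V.xB + V.n

/-- Descend to the first edge that is not full. -/
def descend : Cmd :=
  V.lf ≔ .query .leafSelect V.p 0 ;; V.d ≔ 1 ;; V.v ≔ xanc V.lf V.d ;;
  .while (.lt 0 (xfull V.v)) (V.d ≔ V.d + 1 ;; V.v ≔ xanc V.lf V.d)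

/-- Find the first zero of the unary counter at the edge to `v`. -/
def scan : Cmd :=
  V.l ≔ xlr V.v ;; V.r ≔ xrr V.v ;; V.i ≔ V.l ;;
  .while (.lt 0 (.load (V.cB + V.i) 1)) (V.i ≔ V.i + 1)

/-- Advance by the length of the new factor. -/
def advance : Cmd :=
  V.len ≔ V.D + (V.i - V.l) + 1 ;; V.a ≔ V.l ;; V.b ≔ V.r ;; V.j ≔ 0 ;;
  .while (.lt V.j V.len) (V.p ≔ xpsi V.p ;; V.a ≔ xpsi V.a ;; V.b ≔ xpsi V.b ;; V.j ≔ V.j + 1)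

/-- Set the bit `j`, ..., `i` of the counters to zero. -/
def clearCounter : Cmd :=
  V.j ≔ V.l ;; .while (.lt V.j (V.i + 1)) (.store (V.cB + V.j) 1 0 ;; V.j ≔ V.j + 1)

/-- After `advance`, the ranks in `a` and `b` belong to the positions right behind the new factor,
in its occurrences at the outermost leaves below `v`. For an inner node these characters differ
exactly if the factor ends at `v`. The counter is then erased, because its bits are reused by the
children of `v`. -/
def updateFull : Cmd :=
  .ite (.lt V.l V.r)
    (.ite (.eq (xchr V.a) (xchr V.b)) (V.j ≔ 0)
      (.store (V.xB + xinner V.v) 1 1 ;; clearCounter))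
    (V.j ≔ 0)

/-- The first pass determines the shape of the LZ trie. -/
def pass1 : Cmd :=
  V.z ≔ 0 ;; V.p ≔ V.first ;; V.go ≔ 1 ;;
  .while (.lt 0 V.go)
    (V.z ≔ V.z + 1 ;; descend ;; V.u ≔ xpar V.v ;; depthCmd ;; scan ;;
      .store (V.cB + V.i) 1 1 ;; advance ;; updateFull ;;
      .ite (.eq V.p V.first) (V.go ≔ 0) (V.go ≔ 1))

/-- The number of LZ trie nodes on the edge to `v`. -/
def countCmd : Cmd :=
  V.c ≔ 0 ;;
  .ite (.eq V.v 0) (V.c ≔ 0)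
    (.ite (.lt 0 (xfull V.v))
      (V.u ≔ V.v ;; depthCmd ;; V.c ≔ V.D ;; V.u ≔ xpar V.v ;; depthCmd ;; V.c ≔ V.c - V.D)
      (V.u ≔ xpar V.v ;; .ite (.eq V.u 0) (V.fl ≔ 1) (V.fl ≔ xfull V.u) ;;
        .ite (.lt 0 V.fl)
          (V.l ≔ xlr V.v ;; V.r ≔ xrr V.v ;; V.i ≔ V.l ;;
            -- The second factor stops the scan behind the leaf interval: unlike in the first pass,
            -- all bits of the counter may be set, for instance at a leaf.
            .while (.lt 0 (.load (V.cB + V.i) 1 * (V.r + 1 - V.i))) (V.i ≔ V.i + 1) ;;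
            V.c ≔ V.i - V.l)
          (V.c ≔ 0)))

/-- The counts of a block of nodes. -/
def blockCounts : Cmd :=
  V.j ≔ 0 ;; V.L ≔ 0 ;; V.tail ≔ 0 ;;
  .while (.lt V.j V.K)
    (.store (V.pB + V.j * V.ell) V.ell (V.S + V.L) ;;
      V.v ≔ V.x + V.j ;; .ite (.lt V.v V.N) countCmd (V.c ≔ 0) ;;
      .ite (.lt 0 V.c)
        (.store (V.hB + V.v) 1 1 ;; .store (V.qB + V.tail * V.ell) V.ell V.c ;;
          V.tail ≔ V.tail + 1)
        (V.c ≔ 0) ;;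
      V.L ≔ V.L + V.c ;; V.j ≔ V.j + 1) ;;
  .store (V.pB + V.K * V.ell) V.ell (V.S + V.L)

/-- The chains of a block with few LZ trie nodes, in level order. -/
def lightBlock : Cmd :=
  V.h ≔ 0 ;;
  .while (.lt V.h V.L)
    (V.c ≔ .load (V.qB + V.h * V.ell) V.ell ;;
      .ite (.lt 1 V.c)
        (.store (V.eB + (V.S + V.h)) 1 1 ;; .store (V.qB + V.tail * V.ell) V.ell (V.c - 1) ;;
          V.tail ≔ V.tail + 1)
        (V.c ≔ 0) ;;
      V.h ≔ V.h + 1)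

/-- The table of the prefix sums of a block with many LZ trie nodes. -/
def heavyBlock : Cmd :=
  V.j ≔ 0 ;;
  .while (.lt V.j (V.K + 1))
    (.store (V.eB + V.S + V.j * V.ell) V.ell (.load (V.pB + V.j * V.ell) V.ell) ;;
      V.j ≔ V.j + 1)

/-- `S` is the number of LZ trie nodes before the current block. It is stored as the pointer of the
block and is also the offset of the block in the region at `eB`, in which every LZ trie node owns
one bit. -/
def build : Cmd :=
  V.S ≔ 0 ;; V.x ≔ 0 ;; V.y ≔ 0 ;;
  .while (.lt V.x V.N)
    (.store (V.ptB + V.y * V.ell) V.ell V.S ;; blockCounts ;;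
      .ite (.lt V.L V.Th) lightBlock heavyBlock ;;
      V.S ≔ V.S + V.L ;; V.x ≔ V.x + V.K ;; V.y ≔ V.y + 1) ;;
  .store (V.ptB + V.y * V.ell) V.ell V.S

def clearCmd : Cmd :=
  V.j ≔ 0 ;; .while (.lt V.j (V.n + V.n)) (.store (V.xB + V.j) 1 0 ;; V.j ≔ V.j + 1)

/-- Move the cursor to the first LZ trie node on the edge to `v`. -/
def firstCmd : Cmd :=
  V.h ≔ V.v / V.K ;; V.j ≔ V.v - V.h * V.K ;; V.S ≔ .load (V.ptB + V.h * V.ell) V.ell ;;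
  V.L ≔ .load (V.ptB + (V.h + 1) * V.ell) V.ell - V.S ;;
  .ite (.lt V.L V.Th)
    (V.hv ≔ 0 ;; V.st ≔ V.S ;; V.st2 ≔ V.S + .pop (.load (V.hB + V.h * V.K) V.K) ;;
      V.slot ≔ V.S + .pop (.load (V.hB + V.h * V.K) V.j) ;; V.ex ≔ .load (V.hB + V.v) 1)
    (V.hv ≔ 1 ;; V.slot ≔ .load (V.eB + V.S + V.j * V.ell) V.ell ;;
      V.st2 ≔ .load (V.eB + V.S + (V.j + 1) * V.ell) V.ell ;;
      .ite (.lt V.slot V.st2) (V.ex ≔ 1) (V.ex ≔ 0))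

/-- Move the cursor to the next LZ trie node on the same edge. -/
def nextCmd : Cmd :=
  .ite (.eq V.hv 0)
    (V.ex ≔ .load (V.eB + V.slot) 1 ;; V.t ≔ .pop (.load (V.eB + V.st) (V.slot - V.st)) ;;
      V.slot ≔ V.st2 + V.t ;; V.t ≔ .pop (.load (V.eB + V.st) (V.st2 - V.st)) ;;
      V.st ≔ V.st2 ;; V.st2 ≔ V.st2 + V.t)
    (V.slot ≔ V.slot + 1 ;; .ite (.lt V.slot V.st2) (V.ex ≔ 1) (V.ex ≔ 0))

/-- Find the node of the LZ trie that is created by the next factor. -/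
def findCmd : Cmd :=
  V.lf ≔ .query .leafSelect V.p 0 ;; V.d ≔ 0 ;; V.y ≔ 0 ;; V.ex ≔ 0 ;; V.go ≔ 1 ;;
  .while (.lt 0 V.go)
    (.ite (.eq V.ex 0) (V.d ≔ V.d + 1 ;; V.v ≔ xanc V.lf V.d ;; firstCmd)
      (V.e ≔ .load (V.aS + V.slot * V.wa) V.wa ;;
        .ite (.eq V.e 0) (V.go ≔ 0) (V.y ≔ V.e ;; V.p ≔ xpsi V.p ;; nextCmd)))

/-- The second pass computes the codes of the factors. -/
def pass2 : Cmd :=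
  V.x ≔ 0 ;; V.p ≔ V.first ;;
  .while (.lt V.x V.z)
    (V.x ≔ V.x + 1 ;; findCmd ;; V.c ≔ xchr V.p ;;
      .store (V.aS + V.slot * V.wa) V.wa V.x ;; .store (V.cS + V.slot * V.wc) V.wc V.c ;;
      V.p ≔ xpsi V.p ;; .ite (.eq V.y 0) (.emitFresh V.c) (.emitRef V.y V.c))

/-- When the codes are streamed, the characters need not be kept; entries of width zero make the
writes to their array void. -/
def widths0 : Cmd := sizeCmd V.wa V.z ;; V.wc ≔ 0

/-- The rightmost leaf starts with the largest character, which reveals the size of the alphabet. -/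
def widths1 : Cmd :=
  sizeCmd V.wa V.z ;; V.sg ≔ .query .childRank (xanc (.query .rmostLeaf 0 0) 1) 0 + 1 ;;
  sizeCmd V.wc V.sg

/-- The arrays start at `xB`, on top of the counters, which are obsolete once the tables are built.
The tables at `eB` are built while the counters are still read, so they must lie behind them. Each
array is preceded by a gap of `Th` entries, which `finish` needs to sort in place. -/
def layoutCmd : Cmd :=
  V.aB ≔ V.xB ;; V.aS ≔ V.xB + V.Th * V.wa ;; V.chB ≔ V.aS + V.z * V.wa ;;
  V.cS ≔ V.chB + V.Th * V.wc ;; V.eB ≔ V.cS + V.z * V.wc ;;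
  .ite (.lt V.eB (V.xB + V.n + V.n)) (V.eB ≔ V.xB + V.n + V.n) (V.j ≔ 0)

def engine (widths : Cmd) : Cmd :=
  setup ;; pass1 ;; widths ;; layoutCmd ;; build ;; clearCmd ;; pass2

/-- Move the entries of the LZ trie nodes on the edge to `v` to their final positions. -/
def moveChain : Cmd :=
  .while (.lt 0 V.ex)
    (.store (V.aB + V.i * V.wa) V.wa (.load (V.aS + V.slot * V.wa) V.wa) ;;
      .store (V.chB + V.i * V.wc) V.wc (.load (V.cS + V.slot * V.wc) V.wc) ;;
      V.i ≔ V.i + 1 ;; V.D ≔ V.D + 1 ;; .store (V.bp + (V.i + V.i - V.D)) 1 1 ;; nextCmd)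

/-- Bring the LZ trie into its final form. -/
def finish : Cmd :=
  V.bp ≔ V.eB + V.z ;; .store V.bp 1 1 ;; V.i ≔ 0 ;; V.v ≔ 0 ;;
  .while (.lt V.v V.N)
    (firstCmd ;;
      .ite (.lt 0 V.ex) (V.u ≔ xpar V.v ;; depthCmd ;; moveChain) (V.ex ≔ 0) ;;
      V.v ≔ V.v + 1) ;;
  -- Operands of the extra store at the end of `trieProg`: the address of the last parenthesis, the
  -- length 1, and the value 0.
  V.t ≔ V.bp + V.z + V.z + 1 ;; V.i ≔ 1 ;; V.j ≔ 0

end Programs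

/-! ### Values and safety of the derived expressions. -/

section Eval

variable {σ : ℕ} {T : List (Fin σ)} {w M : ℕ} {s : St} {e f : Exp}

@[simp] theorem eval_xchr : (xchr e).eval T s = chr T (e.eval T s) := by
  simp [xchr, Query.answer, nodeAt_number (leafSelect_mem _), nodeAt_number (levelAnc_mem _ _), chr]

@[simp] theorem eval_xpsi : (xpsi e).eval T s = psi T (e.eval T s) := rfl

@[simp] theorem eval_xlr : (xlr e).eval T s = lr T (nodeAt T (e.eval T s)) := by
  simp [xlr, Query.answer, nodeAt_number (lmostLeaf_mem_nodeSet _), lr]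

@[simp] theorem eval_xrr : (xrr e).eval T s = rr T (nodeAt T (e.eval T s)) := by
  simp [xrr, Query.answer, nodeAt_number (rmostLeaf_mem_nodeSet _), rr]

@[simp] theorem eval_xpar :
    (xpar e).eval T s = number T (parent T (nodeAt T (e.eval T s))) := rfl

@[simp] theorem eval_xanc :
    (xanc e f).eval T s = number T (levelAnc T (nodeAt T (e.eval T s)) (f.eval T s)) := rfl

@[simp] theorem safe_xchr : (xchr e).Safe T w M s ↔ e.Safe T w M s := by simp [xchr]
@[simp] theorem safe_xpsi : (xpsi e).Safe T w M s ↔ e.Safe T w M s := by simp [xpsi]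
@[simp] theorem safe_xlr : (xlr e).Safe T w M s ↔ e.Safe T w M s := by simp [xlr]
@[simp] theorem safe_xrr : (xrr e).Safe T w M s ↔ e.Safe T w M s := by simp [xrr]
@[simp] theorem safe_xpar : (xpar e).Safe T w M s ↔ e.Safe T w M s := by simp [xpar]
@[simp] theorem safe_xanc :
    (xanc e f).Safe T w M s ↔ e.Safe T w M s ∧ f.Safe T w M s := by simp [xanc]

theorem lr_le_rr' (hT : IsText T) {v : List (Fin σ)} (hv : v ∈ nodeSet T) : lr T v ≤ rr T v :=
  lr_le_rr hT (isInfix_of_mem_nodeSet hv)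

theorem rr_lt' (hT : IsText T) {v : List (Fin σ)} (hv : v ∈ nodeSet T) : rr T v < T.length :=
  rr_lt hT (isInfix_of_mem_nodeSet hv)

theorem eval_xinner {v : List (Fin σ)} (hv : v ∈ nodeSet T) (h : e.eval T s = number T v) :
    (xinner e).eval T s = innerRank T v := by
  simp [xinner, Query.answer, h, nodeAt_number hv, innerRank]

theorem safe_xinner {v : List (Fin σ)} (hv : v ∈ nodeSet T) (h : e.eval T s = number T v)
    (he : e.Safe T w M s) : (xinner e).Safe T w M s := by
  simp [xinner, Query.answer, h, nodeAt_number hv, he, leafRank_le_number]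

theorem eval_xfull {v : List (Fin σ)} (hv : v ∈ nodeSet T) (h : e.eval T s = number T v) :
    (xfull e).eval T s =
      (s.mem (s.reg .xB + innerRank T v)).toNat * (rr T v - lr T v) := by
  simp [xfull, eval_xinner hv h, h, nodeAt_number hv, blk_one]

/-- The test is also evaluated at leaves, for which the bit that is read is meaningless and is
multiplied by zero. There `innerRank` is only bounded by `T.length`, inclusive, which explains the
additional bit in `hx`. -/
theorem safe_xfull (hT : IsText T) {v : List (Fin σ)} (hv : v ∈ nodeSet T)
    (h : e.eval T s = number T v) (he : e.Safe T w M s) (h1 : 1 ≤ w) (hM : M < 2 ^ w)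
    (hx : s.reg .xB + T.length + 1 ≤ M) : (xfull e).Safe T w M s := by
  have h2 := innerRank_le hT v
  have h3 := rr_lt' hT hv
  have h4 := lr_le_rr' hT hv
  have h5 : (s.mem (s.reg .xB + innerRank T v)).toNat ≤ 1 := Bool.toNat_le _
  have h6 : (s.mem (s.reg .xB + innerRank T v)).toNat * (rr T v - lr T v) ≤ T.length := by
    calc _ ≤ 1 * (rr T v - lr T v) := Nat.mul_le_mul_right _ h5
      _ ≤ _ := by omega
  simp only [xfull, safe_mul, safe_load, safe_add, safe_var, safe_xinner hv h he, safe_lit_1,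
    safe_sub, safe_xrr, safe_xlr, he, eval_load, eval_var, eval_add, eval_xinner hv h,
    eval_lit_1, eval_sub, eval_xrr, eval_xlr, h, nodeAt_number hv, blk_one]
  exact ⟨⟨⟨trivial, trivial, by omega⟩, trivial, by omega, by omega⟩, ⟨trivial, trivial, h4⟩,
    by omega⟩

end Eval

/-! ### Rules for loops and assignments that keep track of the frame. -/

section Rules

variable {σ : ℕ} {T : List (Fin σ)} {w M : ℕ}

theorem Frame.refl (c : Cmd) (s : St) : Frame c s s :=
  ⟨fun _ _ => rfl, fun _ => rfl, fun _ => rfl⟩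

theorem Frame.trans {c : Cmd} {s s' s'' : St} (h : Frame c s s') (h' : Frame c s' s'') :
    Frame c s s'' :=
  ⟨fun x hx => (h'.reg x hx).trans (h.reg x hx), fun hm => (h'.mem hm).trans (h.mem hm),
    fun ho => (h'.out ho).trans (h.out ho)⟩

namespace Runs

/-- The rule for loops, with the facts that hold since the loop leaves them unchanged. -/
theorem loop {G : Type*} (I : G → St → Prop) (Φ : G → ℕ) {c : Cond} {p : Cmd} {s₀ : St}
    {Q : St → ℕ → Prop} (g : G) (hI : I g s₀)
    (hc : ∀ g s, I g s → Frame p s₀ s → c.Safe T w M s)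
    (hp : ∀ g s, I g s → Frame p s₀ s → c.holds T s →
      Runs T w M p s (fun s' t => ∃ g', I g' s' ∧ t + 1 + Φ g' ≤ Φ g))
    (hQ : ∀ s' t g', I g' s' → Frame p s₀ s' → ¬ c.holds T s' → t + Φ g' ≤ Φ g + 1 → Q s' t) :
    Runs T w M (.while c p) s₀ Q := by
  obtain ⟨s', t, h1, g', ⟨h2, h3⟩, h4, h5⟩ := while_ (T := T) (w := w) (M := M)
    (fun g s => I g s ∧ Frame p s₀ s) Φ
    (fun g s h => hc g s h.1 h.2) (fun g s h hh => (hp g s h.1 h.2 hh).mono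
      fun s' t ⟨g', h1, h2⟩ hf => ⟨g', ⟨h1, h.2.trans hf⟩, h2⟩) g s₀ ⟨hI, .refl _ _⟩
  exact ⟨s', t, h1, hQ s' t g' h2 h3 h4 h5⟩

theorem set_seq (v : ℕ) {x : V} {e : Exp} {q : Cmd} {s : St} {Q : St → ℕ → Prop}
    (hv : e.eval T s = v) (he : e.Safe T w M s)
    (h : Runs T w M q (s.set x v) (fun s' t => Q s' (1 + t))) :
    Runs T w M (x ≔ e ;; q) s Q :=
  assign_seq he (hv ▸ h)

theorem set (v : ℕ) {x : V} {e : Exp} {s : St} {Q : St → ℕ → Prop}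
    (hv : e.eval T s = v) (he : e.Safe T w M s) (h : Q (s.set x v) 1) :
    Runs T w M (x ≔ e) s Q :=
  assign he (hv ▸ h)

end Runs

end Rules

/-! ### Memory layout, constants and standing assumptions. -/

section Layout

variable {σ : ℕ} (T : List (Fin σ))

/-- The number of nodes of the suffix tree. -/
def nN : ℕ := (nodeSet T).card
/-- The number of bits of a small number. -/
def ell : ℕ := Nat.size T.length
/-- The number of nodes in a block. -/
def kk : ℕ := 4 * ell T
/-- Blocks with at least this number of LZ trie nodes are heavy. -/
def th : ℕ := (kk T + 1) * ell T
-- Starting addresses of the regions. The summand 2 in the number of pointers accounts for a last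
-- incomplete block and for the final prefix sum; the node bits are padded by `kk T` so that the
-- last block can be treated like the others.
def ptB : ℕ := th T + th T * ell T
def hB : ℕ := ptB T + (nN T / kk T + 2) * ell T
def xB : ℕ := hB T + nN T + kk T
def cB : ℕ := xB T + T.length

/-- The constants are in their registers. -/
structure Env (s : St) : Prop where
  n : s.reg .n = T.length
  N : s.reg .N = nN T
  ell : s.reg .ell = ell T
  K : s.reg .K = kk T
  Th : s.reg .Th = th T
  pB : s.reg .pB = 0
  qB : s.reg .qB = th T
  ptB : s.reg .ptB = ptB T
  hB : s.reg .hB = hB T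
  xB : s.reg .xB = xB T
  cB : s.reg .cB = cB T
  first : s.reg .first = rk T 0

def envVars : List V := [.n, .N, .ell, .K, .Th, .pB, .qB, .ptB, .hB, .xB, .cB, .first]

/-- The general assumptions. -/
structure Ok (w M : ℕ) : Prop where
  text : IsText T
  kk_le : kk T ≤ w
  -- Leaves a margin for intermediate results that exceed the addresses by a small multiple of `n`.
  big : M + 16 * T.length + 64 < 2 ^ w
  -- The additional bit is the one right behind the counters, which `countCmd` may read.
  le : xB T + 2 * T.length + 1 ≤ M

variable {T} {w M : ℕ}

theorem Env.congr {s s' : St} (h : Env T s) (hr : ∀ x ∈ envVars, s'.reg x = s.reg x) :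
    Env T s' := by
  simp only [envVars, List.forall_mem_cons] at hr
  obtain ⟨h1, h2, h3, h4, h5, h6, h7, h8, h9, h10, h11, h12, -⟩ := hr
  exact ⟨h1.trans h.n, h2.trans h.N, h3.trans h.ell, h4.trans h.K, h5.trans h.Th, h6.trans h.pB,
    h7.trans h.qB, h8.trans h.ptB, h9.trans h.hB, h10.trans h.xB, h11.trans h.cB,
    h12.trans h.first⟩

theorem Env.frame {c : Cmd} {s s' : St} (h : Env T s) (hf : Frame c s s')
    (hc : ∀ x ∈ envVars, x ∉ c.mods) : Env T s' :=
  h.congr fun x hx => hf.reg x (hc x hx)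

theorem Env.set {s : St} (h : Env T s) {x : V} (a : ℕ) (hx : x ∉ envVars) : Env T (s.set x a) :=
  h.congr fun y hy => by rw [St.set_reg, if_neg (by rintro rfl; exact hx hy)]

theorem Env.mem {s : St} (h : Env T s) (m : ℕ → Bool) : Env T { s with mem := m } :=
  h.congr fun _ _ => rfl

theorem Ok.ell_pos (ok : Ok T w M) : 0 < ell T := Nat.size_pos.2 ok.text.length_pos

theorem Ok.kk_pos (ok : Ok T w M) : 0 < kk T := by
  have := ok.ell_pos
  unfold kk
  omega

theorem Ok.one_le (ok : Ok T w M) : 1 ≤ w := ok.kk_pos.trans_le ok.kk_le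

theorem Ok.lt (ok : Ok T w M) : M < 2 ^ w := by
  have := ok.big
  omega

theorem Ok.nN_le (ok : Ok T w M) : nN T ≤ 2 * T.length := ok.text.card_nodeSet_le

theorem lt_two_pow_ell : T.length < 2 ^ ell T := Nat.lt_size_self _

theorem size_div_two {m : ℕ} (h : 0 < m) : m.size = (m / 2).size + 1 := by
  conv_lhs => rw [← Nat.bit_bodd_div2 m]
  rw [Nat.size_bit, Nat.div2_val]
  rw [Nat.bit_bodd_div2]
  omega

/-- Every node is a prefix of a leaf below it, hence not above the rightmost leaf in lexicographic
order; so this leaf is the last node in pre-order. -/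
theorem number_rmostLeaf_nil (hT : IsText T) : number T (rmostLeaf T []) + 1 = nN T := by
  have h1 : ∀ u ∈ nodeSet T, u ≤ rmostLeaf T [] := fun u hu => by
    have h2 := mem_leavesBelow.1 (rmostLeaf_mem hT (isInfix_of_mem_nodeSet hu))
    exact (le_of_isPrefix h2.2).trans
      (le_rmostLeaf (mem_leavesBelow.2 ⟨h2.1, List.nil_prefix⟩))
  have h3 : (nodeSet T).filter (· < rmostLeaf T []) = (nodeSet T).erase (rmostLeaf T []) := by
    ext u
    simp only [Finset.mem_filter, Finset.mem_erase]
    exact ⟨fun h => ⟨h.2.ne, h.1⟩, fun h => ⟨h.2, lt_of_le_of_ne (h1 u h.2) h.1⟩⟩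
  rw [number, h3, Finset.card_erase_add_one (rmostLeaf_mem_nodeSet _), nN]

theorem rr_nil (hT : IsText T) : rr T [] + 1 = T.length := by
  have h1 := rr_lt hT (List.nil_infix (l := T))
  obtain ⟨j, hj, h2⟩ := exists_rk_eq hT (i := T.length - 1) (by have := hT.length_pos; omega)
  have h3 := ((rk_mem_interval hT (List.nil_infix (l := T)) hj).2 List.nil_prefix).2
  omega

end Layout

/-! ### Binary length, string depth and initialization. -/

section Subprograms

variable {σ : ℕ} {T : List (Fin σ)} {w M : ℕ}

theorem sizeCmd_runs {x : V} {e : Exp} {s : St} {m : ℕ} (hx : x ≠ .t) (h2 : 2 * m + 64 < 2 ^ w)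
    (he : ∀ a, e.Safe T w M (s.set x a)) (hm : ∀ a, e.eval T (s.set x a) = m) :
    Runs T w M (sizeCmd x e) s fun s' t => s'.reg x = m.size ∧ t ≤ 3 * m + 3 := by
  have hs : m.size ≤ m := Nat.size_le.2 Nat.lt_two_pow_self
  refine Runs.set_seq 0 rfl (by simp) (Runs.set_seq m (hm _) (he _) ?_)
  refine Runs.loop (fun g s' => s'.reg .t = g ∧ s'.reg x + g.size = m.size) (fun g => 3 * g.size)
    m ?_ ?_ ?_ ?_
  · simp [hx]
  · intros
    simp
  · rintro g s' ⟨h3, h4⟩ - hc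
    have hg : 0 < g := by simpa [h3] using hc
    refine Runs.set_seq (g / 2) (by simp [h3]) (by simp) ?_
    refine Runs.set (s'.reg x + 1) (by simp [hx]) (by simp [hx]; omega) ?_
    refine ⟨g / 2, ⟨by simp [hx.symm], ?_⟩, ?_⟩
    · have := size_div_two hg
      simp
      omega
    · have := size_div_two hg
      omega
  · rintro s' t g ⟨h3, h4⟩ - hc ht
    have hg : g = 0 := by simpa [h3] using hc
    subst hg
    simp at h4 ht
    exact ⟨h4, by omega⟩

/-- The leftmost and the rightmost leaf below a branching node agree on exactly `u.length`
characters (`exists_branch_leaves`), so the first disagreement gives the string depth. At the root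
the loop is avoided, since the root need not branch. -/
theorem depthCmd_runs (ok : Ok T w M) {u : List (Fin σ)} (hu : u ∈ innerSet T) {s : St}
    (hs : s.reg .u = number T u) :
    Runs T w M depthCmd s fun s' t => s'.reg .D = u.length ∧ t ≤ 4 * u.length + 6 := by
  have hT := ok.text
  have hun := (mem_innerSet.1 hu).1
  refine Runs.set_seq 0 rfl (by simp) (Runs.ite (by simp) ?_ ?_)
  · intro h
    have h0 : number T u = number T [] := by simpa [hs, number_nil] using h
    obtain rfl := number_inj hun nil_mem_nodeSet h0
    exact Runs.set 0 rfl (by simp) (by simp)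
  · intro h
    have h0 : u ≠ [] := by
      rintro rfl
      simp [hs, number_nil] at h
    obtain ⟨i, j, x, y, hi, hj, hl, hr, hxi, hyj, hxy⟩ := exists_branch_leaves hT hu h0
    refine Runs.set_seq (rk T i) (by simp [hs, nodeAt_number hun, hl]) (by simp) ?_
    refine Runs.set_seq (rk T j) (by simp [hs, nodeAt_number hun, hr]) (by simp) ?_
    have hlen : u.length ≤ T.length := length_le_of_mem_nodeSet hun
    have get : ∀ {i : ℕ} {x : Fin σ}, i < T.length → u ++ [x] <+: T.drop i → ∀ k ≤ u.length,
        ∃ h : i + k < T.length, T[i + k] = (u ++ [x])[k]?.getD x := by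
      intro i x hi hx k hk
      have h1 := hx.length_le
      simp at h1
      refine ⟨by omega, ?_⟩
      have h2 := hx.getElem (i := k) (by simp; omega)
      rw [List.getElem_drop] at h2
      rw [← h2, List.getElem?_eq_getElem (by simp; omega), Option.getD_some]
    refine Runs.loop (fun k s' => k ≤ u.length ∧ s'.reg .a = rk T (i + k) ∧
      s'.reg .b = rk T (j + k) ∧ s'.reg .D = k) (fun k => 4 * (u.length - k)) 0 ?_ ?_ ?_ ?_
    · simp
    · intros
      simp
    · rintro k s' ⟨hk, ha, hb, hD⟩ - hc
      have hku : k ≠ u.length := by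
        rintro rfl
        obtain ⟨h1, h2⟩ := get hi hxi _ le_rfl
        obtain ⟨h3, h4⟩ := get hj hyj _ le_rfl
        simp [ha, hb, chr_rk hT h1, chr_rk hT h3, h2, h4, Fin.val_inj, hxy] at hc
      refine Runs.set_seq (rk T (i + k + 1)) (by simp [ha, psi_rk hT]) (by simp) ?_
      refine Runs.set_seq (rk T (j + k + 1)) (by simp [hb, psi_rk hT]) (by simp) ?_
      have := ok.big
      refine Runs.set (k + 1) (by simp [hD]) (by simp [hD]; omega) ⟨k + 1, ⟨by omega, ?_⟩, ?_⟩
      · simp [add_assoc]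
      · omega
    · rintro s' t k ⟨hk, ha, hb, hD⟩ - hc ht
      have hku : k = u.length := by
        by_contra hku
        obtain ⟨h1, h2⟩ := get hi hxi k hk
        obtain ⟨h3, h4⟩ := get hj hyj k hk
        apply hc
        have h5 : k < u.length := by omega
        simp [ha, hb, chr_rk hT h1, chr_rk hT h3, h2, h4, List.getElem?_append_left h5, h5]
      subst hku
      exact ⟨hD, by omega⟩

theorem setup_runs (ok : Ok T w M) (s : St) :
    Runs T w M setup s fun s' t => Env T s' ∧ t ≤ 3 * T.length + 20 := by
  have hT := ok.text
  have hn := ok.text.length_pos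
  have hbig := ok.big
  have hle := ok.le
  have hN := ok.nN_le
  have h1 : 2 ^ 6 < 2 ^ w := by omega
  refine Runs.set_seq T.length (by simp [nodeAt_zero, rr_nil hT]) ?_ ?_
  · simp [nodeAt_zero, rr_nil hT]
    omega
  refine Runs.set_seq (nN T) (by simp [Query.answer, nodeAt_zero, number_rmostLeaf_nil hT]) ?_ ?_
  · simp [Query.answer, nodeAt_zero, number_rmostLeaf_nil hT]
    omega
  refine Runs.set_seq (rk T 0) (by simp [Query.answer, rk]) (by simp) ?_
  refine Runs.bind (sizeCmd_runs (m := T.length) (by decide) (by omega) (by simp) (by simp)) ?_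
  rintro s1 t1 ⟨hell, ht1⟩ hf
  have e1 := hf.reg .n (by decide)
  have e2 := hf.reg .N (by decide)
  have e3 := hf.reg .first (by decide)
  simp at e1 e2 e3
  change _ = ell T at hell
  have hk : kk T = 4 * ell T := rfl
  have hth : th T = (kk T + 1) * ell T := rfl
  have h2 : ptB T = th T + th T * ell T := rfl
  have h3 : hB T = ptB T + (nN T / kk T + 2) * ell T := rfl
  have h4 : xB T = hB T + nN T + kk T := rfl
  have h5 : cB T = xB T + T.length := rfl
  have h6 : ell T ≤ T.length := Nat.size_le.2 Nat.lt_two_pow_self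
  refine Runs.set_seq (kk T) (by simp [hell, hk]) (by simp [hell]; omega) ?_
  refine Runs.set_seq (th T) (by simp [hell, hth]) (by simp [hell]; omega) ?_
  refine Runs.set_seq 0 (by simp) (by simp) ?_
  refine Runs.set_seq (th T) (by simp) (by simp) ?_
  refine Runs.set_seq (ptB T) (by simp [hell, h2]) (by simp [hell]; omega) ?_
  have h7 : nN T / kk T ≤ nN T := Nat.div_le_self _ _
  refine Runs.set_seq (hB T) (by simp [hell, e2, h3]) (by simp [hell, e2]; omega) ?_
  refine Runs.set_seq (xB T) (by simp [e2, h4]) (by simp [e2]; omega) ?_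
  refine Runs.set (cB T) (by simp [e1, h5]) (by simp [e1]; omega) ?_
  refine ⟨⟨?_, ?_, ?_, ?_, ?_, ?_, ?_, ?_, ?_, ?_, ?_, ?_⟩, by omega⟩ <;> simp [e1, e2, e3, hell]

end Subprograms

/-! ### Intersecting leaf intervals. -/

section Intervals

variable {σ : ℕ} {T : List (Fin σ)}

theorem isPrefix_of_mem_interval (hT : IsText T) {u v : List (Fin σ)} (hu : u ∈ nodeSet T)
    (hv : v ∈ nodeSet T) {i : ℕ} (h1 : lr T u ≤ i ∧ i ≤ rr T u) (h2 : lr T v ≤ i ∧ i ≤ rr T v) :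
    u <+: v ∨ v <+: u := by
  obtain ⟨j, hj, rfl⟩ := exists_rk_eq hT (h1.2.trans_lt (rr_lt' hT hu))
  exact List.prefix_or_prefix_of_prefix
    ((rk_mem_interval hT (isInfix_of_mem_nodeSet hu) hj).1 h1)
    ((rk_mem_interval hT (isInfix_of_mem_nodeSet hv) hj).1 h2)

theorem mem_interval_of_isPrefix (hT : IsText T) {u v : List (Fin σ)} (hu : u ∈ nodeSet T)
    (hv : v ∈ nodeSet T) (h : v <+: u) {i : ℕ} (h1 : lr T u ≤ i ∧ i ≤ rr T u) :
    lr T v ≤ i ∧ i ≤ rr T v := by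
  obtain ⟨j, hj, rfl⟩ := exists_rk_eq hT (h1.2.trans_lt (rr_lt' hT hu))
  exact (rk_mem_interval hT (isInfix_of_mem_nodeSet hv) hj).2
    (h.trans ((rk_mem_interval hT (isInfix_of_mem_nodeSet hu) hj).1 h1))

theorem edge_unique {u v f : List (Fin σ)} (hu : u ∈ nodeSet T) (hv : v ∈ nodeSet T)
    (h : u <+: v ∨ v <+: u) (hfu : f.length ≤ u.length) (hfv : f.length ≤ v.length)
    (hu' : (parent T u).length < f.length) (hv' : (parent T v).length < f.length) : u = v := by
  rcases h with h | h
  · by_contra hne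
    have hl : u.length < v.length :=
      lt_of_le_of_ne h.length_le fun h' => hne (h.eq_of_length h')
    have := (prefix_parent hv hu h hl).length_le
    omega
  · by_contra hne
    have hl : v.length < u.length :=
      lt_of_le_of_ne h.length_le fun h' => hne (h.eq_of_length h').symm
    have := (prefix_parent hu hv h hl).length_le
    omega

end Intervals

/-! ### First pass: full edges and unary counters. -/

section PassOne

variable {σ : ℕ} {T : List (Fin σ)} {F P : List (List (Fin σ))} {w M : ℕ}

/-- The memory stores for each edge how many of the strings in `P` end on it. -/
structure Edges (T : List (Fin σ)) (P : List (List (Fin σ))) (m : ℕ → Bool) : Prop where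
  full : ∀ v ∈ innerSet T, v ≠ [] → m (xB T + innerRank T v) = decide (v ∈ P)
  counter : ∀ v ∈ nodeSet T, v ≠ [] → (parent T v = [] ∨ parent T v ∈ P) →
    (v ∉ P ∨ v ∈ leafSet T) → ∀ i, lr T v ≤ i ∧ i ≤ rr T v →
      m (cB T + i) = decide (i - lr T v < cnt T P v)

/-- The memory in the first pass, when the factors in `P` have been processed. -/
structure Counters (T : List (Fin σ)) (P : List (List (Fin σ))) (m : ℕ → Bool) : Prop
    extends Edges T P m where
  rest : ∀ a, (a < xB T ∨ xB T + 2 * T.length ≤ a) → m a = false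

theorem cnt_nil (v : List (Fin σ)) : cnt T [] v = 0 := by
  have : dep [] v = 0 := Nat.findGreatest_eq_zero_iff.2 (by simp)
  simp [cnt, this]

theorem counters_nil (T : List (Fin σ)) : Counters T [] fun _ => false :=
  ⟨⟨by simp, by simp [cnt_nil]⟩, by simp⟩

theorem xfull_pos_iff (hT : IsText T) {m : St} (hm : Edges T P m.mem) (hx : m.reg .xB = xB T)
    {e : Exp} {v : List (Fin σ)} (hv : v ∈ nodeSet T) (h0 : v ≠ [])
    (h : e.eval T m = number T v) :
    0 < (xfull e).eval T m ↔ v ∈ P ∧ v ∉ leafSet T := by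
  rw [eval_xfull hv h, hx]
  by_cases hl : v ∈ leafSet T
  · simp [hl, lr_eq_rr_of_mem_leafSet hT hl]
  · have hi : v ∈ innerSet T := mem_innerSet.2 ⟨hv, hl⟩
    have := lr_lt_rr hT hi h0
    rw [hm.full v hi h0]
    by_cases hP : v ∈ P <;> simp [hP, hl, this]

/-- On the path to the leaf of the unparsed text, the nodes that are earlier factors are those
shorter than the next factor. So the first node that is not full is the lower end of the edge on
which the next factor ends. The string length grows with every step of the descent, which bounds the
time by the length of the factor. -/
theorem descend_runs (ok : Ok T w M) (hF : IsGreedy T F) {x : ℕ} (hx : x < F.length) {s : St}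
    (hE : Env T s) (hm : Counters T (F.take x) s.mem) (hp : s.reg .p = rk T (startPos F x)) :
    Runs T w M descend s fun s' t => ∃ v ∈ nodeSet T, v ≠ [] ∧ s'.reg .v = number T v ∧
      F[x] <+: v ∧ (parent T v).length < F[x].length ∧ v <+: T.drop (startPos F x) ∧
      t ≤ 3 * F[x].length + 4 := by
  have hT := ok.text
  have hst := hF.startPos_lt hx
  have hle := hF.startPos_add_le hx
  have hbig := ok.big
  have hMle := ok.le
  have hpos := hF.length_pos hx
  have hlen : (T.drop (startPos F x)).length = T.length - startPos F x := List.length_drop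
  have hfS := hF.prefix_drop hx
  have hleaf := hT.drop_mem_leafSet hst
  have htake := fun {t : ℕ} => hF.take_mem_iff hx (t := t)
  have hls := leafSelect_rk hT hst
  generalize T.drop (startPos F x) = S at *
  have hSn : S ∈ nodeSet T := leafSet_subset hleaf
  have hS0 : S ≠ [] := by
    rintro rfl
    simp at hlen
    omega
  have hlt := length_path_ge_two hSn hS0
  have hpl : (path T S).length ≤ T.length + 1 := by
    have h1 : (path T S).length ≤ S.length + 1 := by
      rw [path, ← List.length_inits]
      exact List.length_filter_le _ _
    omega
  refine Runs.set_seq (number T S) (by simp [hp, Query.answer, hls]) (by simp) ?_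
  refine Runs.set_seq 1 rfl (by simp) ?_
  refine Runs.set_seq (number T (levelAnc T S 1)) (by simp [nodeAt_number hSn]) (by simp) ?_
  have hne : ∀ d, 1 ≤ d → d < (path T S).length → levelAnc T S d ≠ [] := by
    intro d h1 h2 h3
    have := length_levelAnc_lt (by omega : 0 < d) h2
    rw [h3] at this
    simp at this
  have hE' : ∀ {s' : St}, Frame (V.d ≔ V.d + 1 ;; V.v ≔ xanc V.lf V.d)
      (((s.set V.lf (number T S)).set V.d 1).set V.v (number T (levelAnc T S 1))) s' →
      s'.reg .xB = xB T ∧ Counters T (F.take x) s'.mem ∧ s'.reg .lf = number T S := by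
    intro s' hf
    have h1 := hf.reg .xB (by decide)
    have h2 := hf.reg .lf (by decide)
    have h3 := hf.mem rfl
    simp at h1 h2 h3
    exact ⟨h1.trans hE.xB, h3 ▸ hm, h2⟩
  refine Runs.loop (fun d s' => 1 ≤ d ∧ d < (path T S).length ∧ s'.reg .d = d ∧
    s'.reg .v = number T (levelAnc T S d) ∧ (levelAnc T S (d - 1)).length < F[x].length ∧
    d ≤ (levelAnc T S (d - 1)).length + 1)
    (fun d => 3 * (F[x].length - d)) 1 ?_ ?_ ?_ ?_
  · simp [levelAnc_zero, hpos]
    omega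
  · rintro d s' ⟨h1, h2, h3, h4, h5, h6⟩ hf
    have hx' := (hE' hf).1
    refine ⟨by simp, safe_xfull hT (levelAnc_mem S d) (by simp [h4]) (by simp) ok.one_le ok.lt ?_⟩
    rw [hx']
    have := hT.length_pos
    omega
  · rintro d s' ⟨h1, h2, h3, h4, h5, h6⟩ hf hc
    obtain ⟨hx', hm', hlf⟩ := hE' hf
    have hc' : levelAnc T S d ∈ F.take x ∧ levelAnc T S d ∉ leafSet T :=
      (xfull_pos_iff hT hm'.toEdges hx' (levelAnc_mem S d) (hne d h1 h2) (by simp [h4])).1 hc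
    have hd : d + 1 < (path T S).length := by
      by_contra hd
      have h7 := levelAnc_last hSn
      rw [show (path T S).length - 1 = d by omega] at h7
      rw [h7] at hc'
      exact hc'.2 hleaf
    have hpre := levelAnc_prefix (T := T) S d
    have h8 : (levelAnc T S d).length < F[x].length := by
      refine (htake (List.length_pos_iff.2 (hne d h1 h2))).1 ?_
      rw [← List.prefix_iff_eq_take.1 hpre]
      exact hc'.1
    have h9 := length_levelAnc_lt (show d - 1 < d by omega) h2
    refine Runs.set_seq (d + 1) (by simp [h3]) (by simp [h3]; omega) ?_
    refine Runs.set (number T (levelAnc T S (d + 1))) (by simp [hlf, nodeAt_number hSn])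
      (by simp) ⟨d + 1, ⟨by omega, hd, by simp, by simp, by simpa using h8, by simp; omega⟩, ?_⟩
    omega
  · rintro s' t d ⟨h1, h2, h3, h4, h5, h6⟩ hf hc ht
    obtain ⟨hx', hm', hlf⟩ := hE' hf
    have hc' := mt (xfull_pos_iff hT hm'.toEdges hx' (levelAnc_mem S d) (hne d h1 h2) (by simp [h4])).2 hc
    have hpre := levelAnc_prefix (T := T) S d
    have hpar : parent T (levelAnc T S d) = levelAnc T S (d - 1) := by
      obtain ⟨e, rfl⟩ : ∃ e, d = e + 1 := ⟨d - 1, by omega⟩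
      exact parent_levelAnc h2
    have h8 : F[x].length ≤ (levelAnc T S d).length := by
      by_contra h8
      have h9 := (htake (List.length_pos_iff.2 (hne d h1 h2))).2 (by omega)
      rw [← List.prefix_iff_eq_take.1 hpre] at h9
      apply hc'
      -- A leaf on the path is the whole unparsed text, which is not shorter than the next factor.
      refine ⟨h9, fun h10 => ?_⟩
      obtain ⟨j, hj, h11⟩ := hT.mem_leafSet.1 h10
      obtain ⟨k, hk, h12⟩ := hT.mem_leafSet.1 hleaf
      have h13 : levelAnc T S d = S := by
        obtain ⟨r, hr⟩ := hpre
        cases r with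
        | nil => simpa using hr
        | cons c r =>
          exfalso
          refine hT.drop_not_extends hj c ?_
          rw [← h11]
          refine List.IsInfix.trans ?_ (isInfix_of_mem_nodeSet hSn)
          exact ⟨[], r, by simpa using hr⟩
      rw [h13] at h8
      omega
    refine ⟨levelAnc T S d, levelAnc_mem S d, hne d h1 h2, h4,
      List.prefix_of_prefix_length_le hfS hpre h8, by rw [hpar]; exact h5, hpre, ?_⟩
    omega


/-- The edge on which a factor ends. -/
structure OnEdge (T : List (Fin σ)) (F : List (List (Fin σ))) (x : ℕ) (hx : x < F.length)
    (v : List (Fin σ)) : Prop where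
  mem : v ∈ nodeSet T
  ne : v ≠ []
  pre : F[x] <+: v
  lt : (parent T v).length < F[x].length
  leaf : v <+: T.drop (startPos F x)

section

variable {x : ℕ} {hx : x < F.length} {v : List (Fin σ)}

theorem OnEdge.notMem (hF : IsGreedy T F) (h : OnEdge T F x hx v) : v ∉ F.take x := by
  intro hv
  have h1 := hF.take_mem_iff hx (t := v.length) (List.length_pos_iff.2 h.ne)
  rw [← List.prefix_iff_eq_take.1 h.leaf] at h1
  have := h1.1 hv
  have := h.pre.length_le
  omega

theorem OnEdge.parent_mem (hF : IsGreedy T F) (h : OnEdge T F x hx v) :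
    parent T v = [] ∨ parent T v ∈ F.take x := by
  by_cases h0 : parent T v = []
  · exact Or.inl h0
  · right
    have h1 := hF.take_mem_iff hx (t := (parent T v).length) (List.length_pos_iff.2 h0)
    rw [← List.prefix_iff_eq_take.1 ((parent_prefix v).trans h.leaf)] at h1
    exact h1.2 h.lt

theorem OnEdge.cnt_eq (hF : IsGreedy T F) (h : OnEdge T F x hx v) :
    (parent T v).length + cnt T (F.take x) v + 1 = F[x].length := by
  have h1 := hF.dep_eq_of_prefix hx h.leaf h.pre.length_le
  have h2 := h.lt
  rw [cnt, h1]
  omega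

/-- The leaf at which the new factor starts is below `v` and has not been used by the points already
on the edge. So the counter still contains a zero. -/
theorem OnEdge.cnt_lt (hT : IsText T) (hF : IsGreedy T F) (h : OnEdge T F x hx v) :
    lr T v + cnt T (F.take x) v ≤ rr T v := by
  have h1 := hF.cnt_le_leaves hT hx.le h.mem {x} (by simpa using ⟨hx, h.leaf⟩)
  have h2 := lr_le_rr' hT h.mem
  simp at h1
  omega

theorem take_succ_eq (hx : x < F.length) : F.take (x + 1) = F.take x ++ [F[x]] := by
  rw [List.take_succ_eq_append_getElem hx]

theorem cnt_congr {P P' : List (List (Fin σ))} (hP : PrefixClosed P) (hP' : PrefixClosed P')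
    {v : List (Fin σ)} (h : ∀ f, f <+: v → (parent T v).length < f.length → (f ∈ P ↔ f ∈ P')) :
    cnt T P v = cnt T P' v := by
  refine eq_of_forall_lt_iff fun k => ?_
  rw [hP.lt_cnt_iff, hP'.lt_cnt_iff]
  refine and_congr_right fun hk => h _ (List.take_prefix _ _) ?_
  rw [List.length_take]
  omega

theorem OnEdge.cnt_succ (hF : IsGreedy T F) (h : OnEdge T F x hx v) :
    cnt T (F.take (x + 1)) v = cnt T (F.take x) v + 1 := by
  have hP := hF.prefixClosed x
  have hP' := hF.prefixClosed (x + 1)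
  have hc := h.cnt_eq hF
  have hle := h.pre.length_le
  have hmem : ∀ g, g ∈ F.take (x + 1) ↔ g ∈ F.take x ∨ g = F[x] := fun g => by
    rw [take_succ_eq hx, List.mem_append, List.mem_singleton]
  refine eq_of_forall_lt_iff fun k => ?_
  rw [hP'.lt_cnt_iff, hmem]
  constructor
  · rintro ⟨h1, h2 | h2⟩
    · have := hP.lt_cnt_iff.2 ⟨h1, h2⟩
      omega
    · have := congrArg List.length h2
      rw [List.length_take] at this
      omega
  · intro h1
    rcases Nat.lt_succ_iff_lt_or_eq.1 h1 with h2 | rfl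
    · have := hP.lt_cnt_iff.1 h2
      exact ⟨this.1, Or.inl this.2⟩
    · refine ⟨by omega, Or.inr ?_⟩
      rw [hc]
      exact (List.prefix_iff_eq_take.1 h.pre).symm

/-- How the counters change when a factor is processed. -/
theorem Counters.step (hT : IsText T) (hF : IsGreedy T F) {m m' : ℕ → Bool}
    (hm : Counters T (F.take x) m) (h : OnEdge T F x hx v)
    (hB : ∀ u ∈ innerSet T, u ≠ [] → m' (xB T + innerRank T u) =
      (m (xB T + innerRank T u) || decide (u = F[x])))
    (hC : ∀ i < T.length, m' (cB T + i) =
      if F[x] = v ∧ v ∉ leafSet T ∧ lr T v ≤ i ∧ i ≤ lr T v + cnt T (F.take x) v then false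
      else m (cB T + i) || decide (i = lr T v + cnt T (F.take x) v))
    (hR : ∀ a, (a < xB T ∨ xB T + 2 * T.length ≤ a) → m' a = m a) :
    Counters T (F.take (x + 1)) m' := by
  have hP := hF.prefixClosed x
  have hP' := hF.prefixClosed (x + 1)
  have hmem : ∀ g, g ∈ F.take (x + 1) ↔ g ∈ F.take x ∨ g = F[x] := fun g => by
    rw [take_succ_eq hx, List.mem_append, List.mem_singleton]
  have hpm := h.parent_mem hF
  have hnm := h.notMem hF
  have hcl := h.cnt_lt hT hF
  have hmv := hm.counter v h.mem h.ne hpm (Or.inl hnm)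
  refine ⟨⟨fun u hu h0 => ?_, fun u hu h0 hpu hul i hi => ?_⟩, fun a ha => ?_⟩
  · rw [hB u hu h0, hm.full u hu h0, ← Bool.decide_or]
    exact decide_eq_decide.2 (hmem u).symm
  · have hin : i < T.length := hi.2.trans_lt (rr_lt' hT hu)
    rw [hC i hin]
    by_cases huv : u = v
    · subst huv
      have h1 : ¬ (F[x] = u ∧ u ∉ leafSet T ∧ lr T u ≤ i ∧
          i ≤ lr T u + cnt T (F.take x) u) := by
        rintro ⟨h1, h2, -⟩
        rcases hul with h3 | h3
        · exact h3 ((hmem u).2 (Or.inr h1.symm))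
        · exact h2 h3
      rw [if_neg h1, hmv i hi, h.cnt_succ hF, ← Bool.decide_or]
      refine decide_eq_decide.2 ?_
      omega
    · have hfu : ¬ (F[x] <+: u ∧ (parent T u).length < F[x].length) := by
        rintro ⟨h1, h2⟩
        have hpre : u <+: v ∨ v <+: u := by
          have hin := (rk_mem_interval hT (isInfix_of_mem_nodeSet h.mem) (hF.startPos_lt hx)).2
            h.leaf
          obtain ⟨j, hj, h3⟩ := hT.exists_drop (isInfix_of_mem_nodeSet hu)
          have h4 := prefix_of_edge hT h.mem h.pre h.lt hj (h1.trans h3)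
          exact List.prefix_or_prefix_of_prefix h3 h4
        exact huv (edge_unique hu h.mem hpre h1.length_le h.pre.length_le h2 h.lt)
      have hcu : cnt T (F.take (x + 1)) u = cnt T (F.take x) u := by
        refine cnt_congr hP' hP fun g hg hgl => ?_
        rw [hmem]
        refine or_iff_left ?_
        rintro rfl
        exact hfu ⟨hg, hgl⟩
      by_cases hpP : parent T u = [] ∨ parent T u ∈ F.take x
      -- Both counters are in use, so their intervals are disjoint: otherwise one of the nodes is
      -- above the other, hence above or equal to the full parent of the other. Then it would be
      -- full itself, or a leaf with nothing below.
      · have hdis : ¬ (lr T v ≤ i ∧ i ≤ rr T v) := by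
          intro hi'
          rcases isPrefix_of_mem_interval hT hu h.mem hi hi' with h1 | h1
          · have hl : u.length < v.length :=
              lt_of_le_of_ne h1.length_le fun h' => huv (h1.eq_of_length h')
            have h2 := prefix_parent h.mem hu h1 hl
            have h3 : u ∈ F.take x := by
              rcases hpm with h4 | h4
              · rw [h4, List.prefix_nil] at h2
                exact absurd h2 h0
              · rw [List.prefix_iff_eq_take.1 h2]
                exact hP.take_mem _ h4 _ (List.length_pos_iff.2 h0)
            rcases hul with h4 | h4
            · exact h4 ((hmem u).2 (Or.inl h3))
            · obtain ⟨k, hk, rfl⟩ := hT.mem_leafSet.1 h4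
              obtain ⟨r, hr⟩ := h1
              cases r with
              | nil => exact huv (by simpa using hr)
              | cons c r =>
                refine hT.drop_not_extends hk c (List.IsInfix.trans ?_
                  (isInfix_of_mem_nodeSet h.mem))
                exact ⟨[], r, by simpa using hr⟩
          · have hl : v.length < u.length :=
              lt_of_le_of_ne h1.length_le fun h' => huv (h1.eq_of_length h').symm
            have h2 := prefix_parent hu h.mem h1 hl
            rcases hpP with h4 | h4
            · rw [h4, List.prefix_nil] at h2
              exact h.ne h2
            · apply hnm
              rw [List.prefix_iff_eq_take.1 h2]
              exact hP.take_mem _ h4 _ (List.length_pos_iff.2 h.ne)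
        rw [if_neg (by omega), hm.counter u hu h0 hpP
          (hul.imp_left fun h1 h2 => h1 ((hmem u).2 (Or.inl h2))) i hi, hcu]
        have : i ≠ lr T v + cnt T (F.take x) v := by omega
        simp [this]
      -- The counter of `u` comes into use at this moment, as its upper end `v` has just become
      -- full. It has to be zero, and it is: the set bits in the interval of `v` have been erased.
      · have hpf : parent T u = F[x] := by
          rcases hpu with h1 | h1
          · exact absurd (Or.inl h1) hpP
          · exact ((hmem _).1 h1).resolve_left fun h2 => hpP (Or.inr h2)
        have hfn : F[x] ∈ nodeSet T := hpf ▸ LZCics.parent_mem u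
        have hfv : F[x] = v := by
          by_contra hne
          have hl : F[x].length < v.length :=
            lt_of_le_of_ne h.pre.length_le fun h' => hne (h.pre.eq_of_length h')
          have h2 := (prefix_parent h.mem hfn h.pre hl).length_le
          have := h.lt
          omega
        have hvl : v ∉ leafSet T := by
          have h1 := parent_mem_innerSet hT hu h0
          rw [hpf, hfv] at h1
          exact (mem_innerSet.1 h1).2
        have hiv := mem_interval_of_isPrefix hT hu h.mem
          (by rw [← hfv, ← hpf]; exact parent_prefix u) hi
        have hc0 : cnt T (F.take (x + 1)) u = 0 := by
          rw [hcu]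
          apply hP.cnt_eq_zero
          · rw [hpf]
            exact List.length_pos_iff.1 (hF.length_pos hx)
          · rw [hpf]
            exact hF.notMem x hx
        rw [hc0]
        simp only [hfv, hvl, hmv i hiv]
        simp
        omega
  · rw [hR a ha, hm.rest a ha]

end

end PassOne

/-! ### First pass: the program. -/

section PassOne

variable {σ : ℕ} {T : List (Fin σ)} {F P : List (List (Fin σ))} {w M : ℕ}

theorem Ok.cB_eq (T : List (Fin σ)) : cB T = xB T + T.length := rfl

/-- By `hk` the interval contains a zero, so the scan needs no test for its right end. -/
theorem scan_runs (ok : Ok T w M) {s : St} (hE : Env T s) {v : List (Fin σ)} (hv : v ∈ nodeSet T)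
    (hsv : s.reg .v = number T v) {k : ℕ} (hk : lr T v + k ≤ rr T v)
    (hC : ∀ i, lr T v ≤ i ∧ i ≤ rr T v → s.mem (cB T + i) = decide (i - lr T v < k)) :
    Runs T w M scan s fun s' t => s'.reg .l = lr T v ∧ s'.reg .r = rr T v ∧
      s'.reg .i = lr T v + k ∧ t ≤ 2 * k + 4 := by
  have hbig := ok.big
  have hle := ok.le
  have hrr := rr_lt' ok.text hv
  have hcB := Ok.cB_eq T
  refine Runs.set_seq (lr T v) (by simp [hsv, nodeAt_number hv]) (by simp) ?_
  refine Runs.set_seq (rr T v) (by simp [hsv, nodeAt_number hv]) (by simp) ?_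
  refine Runs.set_seq (lr T v) (by simp) (by simp) ?_
  refine Runs.loop (fun g s' => g ≤ k ∧ s'.reg .i = lr T v + g) (fun g => 2 * (k - g)) 0
    ⟨by omega, by simp⟩ ?_ ?_ ?_
  · rintro g s' ⟨hg, hi⟩ hf
    have e1 := hf.reg .cB (by decide)
    simp [hE.cB] at e1
    simp [e1, hi]
    have := ok.one_le
    omega
  · rintro g s' ⟨hg, hi⟩ hf hc
    have e1 := hf.reg .cB (by decide)
    have e2 := hf.mem rfl
    simp [hE.cB] at e1 e2
    have hgk : g < k := by
      by_contra hgk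
      have := hC (lr T v + g) (by omega)
      simp [e1, e2, hi, blk_one, this, hgk] at hc
    refine Runs.set (lr T v + (g + 1)) (by simp [hi, add_assoc]) (by simp [hi]; omega)
      ⟨g + 1, ⟨by omega, by simp⟩, by omega⟩
  · rintro s' t g ⟨hg, hi⟩ hf hc ht
    have e1 := hf.reg .cB (by decide)
    have e2 := hf.mem rfl
    have e3 := hf.reg .l (by decide)
    have e4 := hf.reg .r (by decide)
    simp [hE.cB] at e1 e2 e3 e4
    have hgk : g = k := by
      by_contra hgk
      have := hC (lr T v + g) (by omega)
      apply hc
      have hgk' : g < k := by omega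
      simp [e1, e2, hi, blk_one, this, hgk']
    subst hgk
    exact ⟨e3, e4, hi, by omega⟩

theorem advance_runs (ok : Ok T w M) {s : St} {D k l p a b : ℕ} (hD : s.reg .D = D)
    (hl : s.reg .l = l) (hi : s.reg .i = l + k) (hlen : D + k + 1 ≤ T.length)
    (hp : s.reg .p = rk T p) (ha : l = rk T a) (hb : s.reg .r = rk T b) :
    Runs T w M advance s fun s' t => s'.reg .p = rk T (p + (D + k + 1)) ∧
      s'.reg .a = rk T (a + (D + k + 1)) ∧ s'.reg .b = rk T (b + (D + k + 1)) ∧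
      t ≤ 5 * (D + k + 1) + 5 := by
  have hbig := ok.big
  have hT := ok.text
  refine Runs.set_seq (D + k + 1) (by simp [hD, hl, hi]) (by simp [hD, hl, hi]; omega) ?_
  refine Runs.set_seq (rk T a) (by simp [hl, ha]) (by simp) ?_
  refine Runs.set_seq (rk T b) (by simp [hb]) (by simp) ?_
  refine Runs.set_seq 0 (by simp) (by simp) ?_
  generalize D + k + 1 = L at *
  refine Runs.loop (fun g s' => g ≤ L ∧ s'.reg .j = g ∧ s'.reg .p = rk T (p + g) ∧
    s'.reg .a = rk T (a + g) ∧ s'.reg .b = rk T (b + g)) (fun g => 5 * (L - g)) 0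
    ?_ ?_ ?_ ?_
  · simp [hp]
  · intros
    simp
  · rintro g s' ⟨hg, h1, h2, h3, h4⟩ hf hc
    have e1 := hf.reg .len (by decide)
    simp at e1
    have hgL : g < L := by simpa [h1, e1] using hc
    refine Runs.set_seq (rk T (p + g + 1)) (by simp [h2, psi_rk hT]) (by simp) ?_
    refine Runs.set_seq (rk T (a + g + 1)) (by simp [h3, psi_rk hT]) (by simp) ?_
    refine Runs.set_seq (rk T (b + g + 1)) (by simp [h4, psi_rk hT]) (by simp) ?_
    refine Runs.set (g + 1) (by simp [h1]) (by simp [h1]; omega)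
      ⟨g + 1, ⟨by omega, by simp, by simp [add_assoc], by simp [add_assoc], by simp [add_assoc]⟩,
        by omega⟩
  · rintro s' t g ⟨hg, h1, h2, h3, h4⟩ hf hc ht
    have e1 := hf.reg .len (by decide)
    simp at e1
    have hgL : g = L := by
      have : ¬ g < L := by simpa [h1, e1] using hc
      omega
    subst hgL
    exact ⟨h2, h3, h4, by omega⟩

theorem clearCounter_runs (ok : Ok T w M) {s : St} (hE : Env T s) {l k : ℕ} (hl : s.reg .l = l)
    (hi : s.reg .i = l + k) (hlt : l + k < T.length) :
    Runs T w M clearCounter s fun s' t =>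
      (∀ a, s'.mem a = if cB T + l ≤ a ∧ a ≤ cB T + (l + k) then false else s.mem a) ∧
      t ≤ 3 * (k + 1) + 2 := by
  have hbig := ok.big
  have hle := ok.le
  have hcB := Ok.cB_eq T
  refine Runs.set_seq l (by simp [hl]) (by simp) ?_
  refine Runs.loop (fun g s' => g ≤ k + 1 ∧ s'.reg .j = l + g ∧
    ∀ a, s'.mem a = if cB T + l ≤ a ∧ a < cB T + (l + g) then false else s.mem a)
    (fun g => 3 * (k + 1 - g)) 0 ?_ ?_ ?_ ?_
  · refine ⟨by omega, by simp, fun a => ?_⟩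
    rw [if_neg (by omega)]
    rfl
  · rintro g s' ⟨hg, h1, h2⟩ hf
    have e1 := hf.reg .i (by decide)
    simp [hi] at e1
    simp [e1]
    omega
  · rintro g s' ⟨hg, h1, h2⟩ hf hc
    have e1 := hf.reg .i (by decide)
    have e2 := hf.reg .cB (by decide)
    simp [hi, hE.cB] at e1 e2
    have hgk : g < k + 1 := by
      have : l + g < l + k + 1 := by simpa [h1, e1] using hc
      omega
    refine Runs.store_seq ?_ ?_
    · simp [e2, h1]
      have := ok.one_le
      omega
    refine Runs.set (l + (g + 1)) (by simp [h1, add_assoc]) (by simp [h1]; omega)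
      ⟨g + 1, ⟨by omega, by simp, fun a => ?_⟩, by omega⟩
    simp only [St.set_mem, eval_add, eval_var, e2, h1, eval_lit_0, eval_lit_1, wr_one, h2]
    by_cases h3 : a = cB T + (l + g)
    · rw [if_pos h3, if_pos (by omega), Nat.zero_testBit]
    · rw [if_neg h3]
      exact if_congr (by omega) rfl rfl
  · rintro s' t g ⟨hg, h1, h2⟩ hf hc ht
    have e1 := hf.reg .i (by decide)
    simp [hi] at e1
    have hgk : g = k + 1 := by
      have : ¬ l + g < l + k + 1 := by simpa [h1, e1] using hc
      omega
    subst hgk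
    refine ⟨fun a => ?_, by omega⟩
    rw [h2]
    exact if_congr (by omega) rfl rfl

theorem updateFull_runs (ok : Ok T w M) {x : ℕ} {hx : x < F.length} {s : St}
    (hE : Env T s) {v : List (Fin σ)} (h : OnEdge T F x hx v) (hsv : s.reg .v = number T v)
    {a b k : ℕ} (ha : a < T.length) (hb : b < T.length)
    (hla : lr T v = rk T a) (hrb : rr T v = rk T b) (hl : s.reg .l = lr T v)
    (hr : s.reg .r = rr T v) (hi : s.reg .i = lr T v + k)
    (hk : lr T v + k ≤ rr T v) (hsa : s.reg .a = rk T (a + F[x].length))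
    (hsb : s.reg .b = rk T (b + F[x].length)) :
    Runs T w M updateFull s fun s' t =>
      (∀ A, s'.mem A = if F[x] = v ∧ v ∉ leafSet T ∧ cB T + lr T v ≤ A ∧ A ≤ cB T + (lr T v + k)
        then false else s.mem A || decide (F[x] = v ∧ v ∉ leafSet T ∧ A = xB T + innerRank T v)) ∧
      t ≤ 3 * (k + 1) + 6 := by
  have hbig := ok.big
  have hle := ok.le
  have hT := ok.text
  have hrr := rr_lt' hT h.mem
  refine Runs.ite (by simp) ?_ ?_
  · intro hlr
    have hvi : v ∈ innerSet T := (lr_lt_rr_iff hT h.mem h.ne).1 (by simpa [hl, hr] using hlr)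
    have hvl := (mem_innerSet.1 hvi).2
    obtain ⟨a', b', c, d, ha', hb', hla', hrb', hac, hbd, hcd⟩ := exists_branch_leaves hT hvi h.ne
    obtain rfl := rk_inj hT ha ha' (hla.symm.trans hla')
    obtain rfl := rk_inj hT hb hb' (hrb.symm.trans hrb')
    have get : ∀ {i : ℕ} {c : Fin σ}, v ++ [c] <+: T.drop i → ∀ k ≤ v.length,
        ∃ h : i + k < T.length, T[i + k] = (v ++ [c])[k]?.getD c := by
      intro i c hx k hk
      have h1 := hx.length_le
      simp at h1
      refine ⟨by omega, ?_⟩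
      have h2 := hx.getElem (i := k) (by simp; omega)
      rw [List.getElem_drop] at h2
      rw [← h2, List.getElem?_eq_getElem (by simp; omega), Option.getD_some]
    obtain ⟨h1, h2⟩ := get hac _ h.pre.length_le
    obtain ⟨h3, h4⟩ := get hbd _ h.pre.length_le
    -- Before the end of `v` both positions carry the same character of `v`; at the end they carry
    -- the two different characters by which the outermost leaves branch.
    have hiff : chr T (s.reg .a) = chr T (s.reg .b) ↔ F[x] ≠ v := by
      rw [hsa, hsb, chr_rk hT h1, chr_rk hT h3, h2, h4, Fin.val_inj]
      rcases h.pre.length_le.lt_or_eq with h5 | h5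
      · simp only [List.getElem?_append_left h5]
        simp [List.getElem?_eq_getElem h5]
        exact fun h6 => by rw [h6] at h5; omega
      · simp [h5, hcd]
        exact h.pre.eq_of_length h5
    refine Runs.ite (by simp) ?_ ?_
    · intro hc
      have hne : F[x] ≠ v := hiff.1 (by simpa using hc)
      refine Runs.set 0 rfl (by simp) ⟨?_, by omega⟩
      simp [hne]
    · intro hc
      have heq : F[x] = v := by
        by_contra hne
        exact hc (by simpa using hiff.2 hne)
      have hir := innerRank_lt hT hvi
      refine Runs.store_seq ⟨?_, by simp, by simp, by simpa using ok.one_le, ?_⟩ ?_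
      · simp only [safe_add, safe_var, true_and, eval_var, hE.xB]
        rw [eval_xinner h.mem (by simpa using hsv)]
        exact ⟨safe_xinner h.mem (by simpa using hsv) (by simp), by omega⟩
      · simp only [eval_add, eval_var, hE.xB, eval_lit_1]
        rw [eval_xinner h.mem (by simpa using hsv)]
        omega
      have key := clearCounter_runs ok (hE.mem (wr s.mem
        ((V.xB + xinner V.v : Exp).eval T s) ((1 : Exp).eval T s) ((1 : Exp).eval T s)))
        (l := lr T v) (k := k) hl hi (by omega)
      refine key.mono ?_
      rintro s' t ⟨h5, h6⟩ hf
      refine ⟨fun A => ?_, by omega⟩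
      rw [h5]
      simp only [eval_add, eval_var, hE.xB, eval_lit_1]
      rw [eval_xinner h.mem (by simpa using hsv)]
      simp only [heq, hvl, not_false_iff, true_and, wr_one]
      refine if_congr Iff.rfl rfl ?_
      by_cases hA : A = xB T + innerRank T v <;> simp [hA]
  · intro hlr
    have hvl : v ∈ leafSet T := by
      by_contra hvl
      exact hlr (by simpa [hl, hr] using lr_lt_rr hT (mem_innerSet.2 ⟨h.mem, hvl⟩) h.ne)
    refine Runs.set 0 rfl (by simp) ⟨?_, by omega⟩
    simp [hvl]

/-- Every factor takes time linear in its length, so the length of the unparsed text serves as the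
potential. -/
theorem pass1_runs (ok : Ok T w M) (hF : IsGreedy T F) {s : St} (hE : Env T s)
    (hm : ∀ a, s.mem a = false) :
    Runs T w M pass1 s fun s' t => s'.reg .z = F.length ∧ Counters T F s'.mem ∧
      t ≤ 60 * T.length + 10 := by
  have hbig := ok.big
  have hle := ok.le
  have hT := ok.text
  have hF0 : 0 < F.length := by
    by_contra h0
    have := hF.flatten
    have h1 : F = [] := List.eq_nil_of_length_eq_zero (by omega)
    rw [h1] at this
    exact hT.ne_nil this.symm
  have hzn := hF.length_le
  refine Runs.set_seq 0 rfl (by simp) ?_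
  refine Runs.set_seq (rk T 0) (by simp [hE.first]) (by simp) ?_
  refine Runs.set_seq 1 rfl (by simp) ?_
  refine Runs.loop (fun x s' => s'.reg .z = x ∧ Counters T (F.take x) s'.mem ∧
    (x < F.length ∧ s'.reg .go = 1 ∧ s'.reg .p = rk T (startPos F x) ∨
      x = F.length ∧ s'.reg .go = 0)) (fun x => 60 * (T.length - startPos F x)) 0 ?_ ?_ ?_ ?_
  · refine ⟨by simp, ?_, Or.inl ⟨hF0, by simp, by simp [startPos_zero]⟩⟩
    have : s.mem = fun _ => false := funext hm
    simp [this, counters_nil]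
  · intros
    simp
  · rintro x s0 ⟨hz, hC, hgo⟩ hf0 hc
    have hE0 := (((hE.set (x := .z) 0 (by decide)).set (x := .p) (rk T 0) (by decide)).set
      (x := .go) 1 (by decide)).frame hf0 (by decide)
    obtain ⟨hx, hp⟩ : x < F.length ∧ s0.reg .p = rk T (startPos F x) := by
      rcases hgo with h | h
      · exact ⟨h.1, h.2.2⟩
      · simp [h.2] at hc
    have hpos := hF.length_pos hx
    have hadd := hF.startPos_add_le hx
    have hss := startPos_succ hx
    refine Runs.set_seq (x + 1) (by simp [hz]) (by simp [hz]; omega) ?_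
    have hE1 := hE0.set (x := .z) (x + 1) (by decide)
    refine Runs.bind (descend_runs ok hF hx hE1 (by simpa using hC) (by simpa using hp)) ?_
    rintro s2 t2 ⟨v, hvn, hv0, hsv, h1, h2, h3, ht2⟩ hf2
    have hed : OnEdge T F x hx v := ⟨hvn, hv0, h1, h2, h3⟩
    have hE2 := hE1.frame hf2 (by decide)
    have hm2 := hf2.mem rfl
    have hz2 := hf2.reg .z (by decide)
    have hp2 := hf2.reg .p (by decide)
    simp at hm2 hz2 hp2
    have hpi := parent_mem_innerSet hT hvn hv0
    refine Runs.set_seq (number T (parent T v)) (by simp [hsv, nodeAt_number hvn]) (by simp) ?_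
    refine Runs.bind (depthCmd_runs ok hpi (by simp)) ?_
    rintro s3 t3 ⟨hD3, ht3⟩ hf3
    have hE3 := (hE2.set (x := .u) (number T (parent T v)) (by decide)).frame hf3 (by decide)
    have hm3 := hf3.mem rfl
    have hz3 := hf3.reg .z (by decide)
    have hp3 := hf3.reg .p (by decide)
    have hv3 := hf3.reg .v (by decide)
    simp [hm2, hz2, hp2, hsv] at hm3 hz3 hp3 hv3
    have hcnt := hC.counter v hvn hv0 (hed.parent_mem hF) (Or.inl (hed.notMem hF))
    have hclt := hed.cnt_lt hT hF
    have hceq := hed.cnt_eq hF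
    have hrr := rr_lt' hT hvn
    refine Runs.bind (scan_runs ok hE3 hvn hv3 hclt (by rw [hm3]; exact hcnt)) ?_
    rintro s4 t4 ⟨hl4, hr4, hi4, ht4⟩ hf4
    have hE4 := hE3.frame hf4 (by decide)
    have hm4 := hf4.mem rfl
    have hz4 := hf4.reg .z (by decide)
    have hp4 := hf4.reg .p (by decide)
    have hv4 := hf4.reg .v (by decide)
    have hD4 := hf4.reg .D (by decide)
    rw [hz3] at hz4
    rw [hp3, hp] at hp4
    rw [hv3] at hv4
    rw [hm3] at hm4
    rw [hD3] at hD4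
    have hcB := Ok.cB_eq T
    refine Runs.store_seq ?_ ?_
    · simp [hE4.cB, hi4]
      have := ok.one_le
      omega
    obtain ⟨a, ha, hva, hla⟩ := exists_lr_eq hT (isInfix_of_mem_nodeSet hvn)
    obtain ⟨b, hb, hvb, hrb⟩ := exists_rr_eq hT (isInfix_of_mem_nodeSet hvn)
    refine Runs.bind (advance_runs ok hD4 hl4 hi4 (by omega) hp4 hla
      (by exact hr4.trans hrb)) ?_
    rw [hceq]
    rintro s5 t5 ⟨hp5, ha5, hb5, ht5⟩ hf5
    have hE5 := (hE4.mem _).frame hf5 (by decide)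
    have hm5 := hf5.mem rfl
    have hz5 := hf5.reg .z (by decide)
    have hv5 := hf5.reg .v (by decide)
    have hl5 := hf5.reg .l (by decide)
    have hr5 := hf5.reg .r (by decide)
    have hi5 := hf5.reg .i (by decide)
    simp only [hz4, hv4, hl4, hr4, hi4] at hz5 hv5 hl5 hr5 hi5
    simp only [eval_add, eval_var, hE4.cB, hi4, hm4, eval_lit_1] at hm5
    refine Runs.bind (updateFull_runs ok hE5 hed hv5 ha hb hla hrb hl5 hr5 hi5 hclt ha5 hb5) ?_
    rintro s6 t6 ⟨hm6, ht6⟩ hf6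
    have hE6 := hE5.frame hf6 (by decide)
    have hz6 := hf6.reg .z (by decide)
    have hp6 := hf6.reg .p (by decide)
    rw [hz5] at hz6
    rw [hp5, ← hss] at hp6
    have hC6 : Counters T (F.take (x + 1)) s6.mem := by
      refine hC.step hT hF hed (fun u hu hu0 => ?_) (fun i hi => ?_) (fun A hA => ?_)
      · have hir := innerRank_lt hT hu
        rw [hm6, if_neg (by omega), hm5, wr_one, if_neg (by omega)]
        congr 1
        refine decide_eq_decide.2 ⟨?_, ?_⟩
        · rintro ⟨h4, h5, h6⟩
          rw [h4]
          exact innerRank_inj hu (mem_innerSet.2 ⟨hvn, h5⟩) (by omega)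
        · intro h4
          have hfn : F[x] ∈ nodeSet T := h4 ▸ (mem_innerSet.1 hu).1
          have hfv : F[x] = v := by
            by_contra hne
            have hl : F[x].length < v.length :=
              lt_of_le_of_ne h1.length_le fun h' => hne (h1.eq_of_length h')
            have h2 := (prefix_parent hvn hfn h1 hl).length_le
            have := hed.lt
            omega
          rw [← hfv, ← h4]
          exact ⟨rfl, (mem_innerSet.1 hu).2, rfl⟩
      · have hir : F[x] = v ∧ v ∉ leafSet T → innerRank T v < T.length :=
          fun h4 => innerRank_lt hT (mem_innerSet.2 ⟨hvn, h4.2⟩)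
        rw [hm6]
        refine if_congr (by simp [add_le_add_iff_left]) rfl ?_
        have h5 : decide (F[x] = v ∧ v ∉ leafSet T ∧ cB T + i = xB T + innerRank T v) = false := by
          rw [decide_eq_false_iff_not]
          rintro ⟨h4, h5, h6⟩
          have := hir ⟨h4, h5⟩
          omega
        rw [h5, Bool.or_false, hm5, wr_one]
        by_cases h6 : i = lr T v + cnt T (F.take x) v <;> simp [h6]
      · have hir : F[x] = v ∧ v ∉ leafSet T → innerRank T v < T.length :=
          fun h4 => innerRank_lt hT (mem_innerSet.2 ⟨hvn, h4.2⟩)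
        have h5 : decide (F[x] = v ∧ v ∉ leafSet T ∧ A = xB T + innerRank T v) = false := by
          rw [decide_eq_false_iff_not]
          rintro ⟨h4, h5, h6⟩
          have := hir ⟨h4, h5⟩
          omega
        rw [hm6, if_neg (by omega), h5, Bool.or_false, hm5, wr_one, if_neg (by omega)]
    have htime : t2 + t3 + t4 + t5 + t6 ≤ 17 * F[x].length + 30 := by
      have := h2
      omega
    -- Ranks are injective on the positions of the text, so the rank of position 0 can return only
    -- by wrapping around at the end.
    have hp0 : s6.reg .p = rk T 0 ↔ x + 1 = F.length := by
      rw [hp6]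
      constructor
      · intro h4
        by_contra h5
        have h6 : x + 1 < F.length := by omega
        have h7 := rk_inj hT (hF.startPos_lt h6) hT.length_pos h4
        omega
      · intro h4
        rw [h4, hF.startPos_length, rk, rk, Nat.mod_self, Nat.zero_mod]
    refine Runs.ite (by simp) ?_ ?_
    · intro hc
      have h4 : x + 1 = F.length := hp0.1 (by simpa [hE6.first] using hc)
      refine Runs.set 0 rfl (by simp) ⟨x + 1, ⟨by simp [hz6], by simpa using hC6,
        Or.inr ⟨h4, by simp⟩⟩, ?_⟩
      omega
    · intro hc
      have h4 : x + 1 ≠ F.length := fun h4 => hc (by simpa [hE6.first] using hp0.2 h4)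
      refine Runs.set 1 rfl (by simp) ⟨x + 1, ⟨by simp [hz6], by simpa using hC6,
        Or.inl ⟨by omega, by simp, by simp [hp6]⟩⟩, ?_⟩
      omega
  · rintro s' t x ⟨hz, hC, hgo⟩ hf hc ht
    have hx : x = F.length := by
      rcases hgo with h | h
      · simp [h.2.1] at hc
      · exact h.1
    subst hx
    rw [List.take_length] at hC
    exact ⟨hz, hC, by omega⟩

end PassOne

/-! ### Level order of a family of chains. -/

section LevelOrder

variable (a : ℕ → ℕ) (K : ℕ)

/-- The number of chains before the chain `u` that reach beyond the level `k`. -/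
def lc (k u : ℕ) : ℕ := ∑ t ∈ Finset.range u, if k < a t then 1 else 0

/-- The number of chain members before the level `k`. -/
def lv (k : ℕ) : ℕ := ∑ t ∈ Finset.range k, lc a t K

/-- The position in level order of the member of the chain `u` at level `k`. -/
def pos (k u : ℕ) : ℕ := lv a K k + lc a k u

variable {a K}

theorem lc_zero (k : ℕ) : lc a k 0 = 0 := rfl

theorem lc_succ (k u : ℕ) : lc a k (u + 1) = lc a k u + if k < a u then 1 else 0 :=
  Finset.sum_range_succ _ _

theorem lc_mono {k u u' : ℕ} (h : u ≤ u') : lc a k u ≤ lc a k u' :=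
  Finset.sum_le_sum_of_subset (Finset.range_mono h)

theorem lc_le (k u : ℕ) : lc a k u ≤ u := by
  refine (Finset.sum_le_card_nsmul _ _ 1 fun t _ => ?_).trans (by simp)
  split <;> omega

theorem lv_zero : lv a K 0 = 0 := rfl

theorem lv_succ (k : ℕ) : lv a K (k + 1) = lv a K k + lc a k K := Finset.sum_range_succ _ _

theorem lv_mono {k k' : ℕ} (h : k ≤ k') : lv a K k ≤ lv a K k' :=
  Finset.sum_le_sum_of_subset (Finset.range_mono h)

theorem lv_eq_sum_min (k : ℕ) : lv a K k = ∑ t ∈ Finset.range K, min (a t) k := by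
  rw [lv]
  simp only [lc]
  rw [Finset.sum_comm]
  refine Finset.sum_congr rfl fun t _ => ?_
  rw [← Finset.card_filter]
  have : (Finset.range k).filter (· < a t) = Finset.range (min (a t) k) := by
    ext i
    simp
    omega
  rw [this, Finset.card_range]

theorem lv_le (k : ℕ) : lv a K k ≤ ∑ t ∈ Finset.range K, a t := by
  rw [lv_eq_sum_min]
  exact Finset.sum_le_sum fun t _ => min_le_left _ _

/-- No chain is longer than the sum of all chains, so this level is beyond all of them. -/
theorem lv_total : lv a K (∑ t ∈ Finset.range K, a t) = ∑ t ∈ Finset.range K, a t := by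
  rw [lv_eq_sum_min]
  refine Finset.sum_congr rfl fun t ht => min_eq_left ?_
  exact Finset.single_le_sum (f := a) (fun _ _ => Nat.zero_le _) ht

theorem pos_succ {k u : ℕ} (h : k < a u) : pos a K k (u + 1) = pos a K k u + 1 := by
  rw [pos, lc_succ, if_pos h, pos]
  omega

theorem pos_succ_eq (k u : ℕ) :
    pos a K k (u + 1) = pos a K k u + if k < a u then 1 else 0 := by
  rw [pos, lc_succ, pos, add_assoc]

theorem pos_le_lv {k u : ℕ} (hu : u ≤ K) : pos a K k u ≤ lv a K (k + 1) := by
  rw [pos, lv_succ]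
  have := lc_mono (a := a) (k := k) hu
  omega

theorem pos_lt_total {k u : ℕ} (hu : u < K) (h : k < a u) :
    pos a K k u < ∑ t ∈ Finset.range K, a t := by
  have h1 := pos_succ (K := K) h
  have h2 := pos_le_lv (a := a) (k := k) (show u + 1 ≤ K by omega)
  have h3 := lv_le (a := a) (K := K) (k + 1)
  omega

theorem pos_lt {k u k' u' : ℕ} (hu : u < K) (h : k < a u)
    (hlt : k < k' ∨ k = k' ∧ u < u') : pos a K k u < pos a K k' u' := by
  have h1 := pos_succ (K := K) h
  rcases hlt with h2 | ⟨rfl, h2⟩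
  · have h3 := pos_le_lv (a := a) (k := k) (show u + 1 ≤ K by omega)
    have h4 := lv_mono (a := a) (K := K) (show k + 1 ≤ k' by omega)
    have h5 : pos a K k' u' = lv a K k' + lc a k' u' := rfl
    omega
  · have h3 := lc_mono (a := a) (k := k) (show u + 1 ≤ u' by omega)
    have h4 : pos a K k u' = lv a K k + lc a k u' := rfl
    have h5 : pos a K k (u + 1) = lv a K k + lc a k (u + 1) := rfl
    omega

theorem pos_inj {k u k' u' : ℕ} (hu : u < K) (h : k < a u) (hu' : u' < K) (h' : k' < a u')
    (he : pos a K k u = pos a K k' u') : k = k' ∧ u = u' := by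
  rcases lt_trichotomy k k' with h1 | rfl | h1
  · have := pos_lt hu h (u' := u') (Or.inl h1)
    omega
  · rcases lt_trichotomy u u' with h2 | rfl | h2
    · have := pos_lt hu h (Or.inr ⟨rfl, h2⟩)
      omega
    · exact ⟨rfl, rfl⟩
    · have := pos_lt hu' h' (Or.inr ⟨rfl, h2⟩)
      omega
  · have := pos_lt hu' h' (u' := u) (Or.inl h1)
    omega

/-- A discrete intermediate value theorem, without monotonicity. -/
theorem exists_step {f : ℕ → ℕ} {h : ℕ} (h0 : f 0 ≤ h) {m : ℕ} (hm : h < f m) :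
    ∃ i < m, f i ≤ h ∧ h < f (i + 1) := by
  induction m with
  | zero => omega
  | succ m ih =>
    by_cases h1 : h < f m
    · obtain ⟨i, h2, h3⟩ := ih h1
      exact ⟨i, by omega, h3⟩
    · exact ⟨m, by omega, by omega, hm⟩

/-- `exists_step` is used twice: for the level that contains the position, and for the chain within
this level. -/
theorem exists_pos {h : ℕ} (hh : h < ∑ t ∈ Finset.range K, a t) :
    ∃ k u, u < K ∧ k < a u ∧ pos a K k u = h := by
  rw [← lv_total] at hh
  obtain ⟨k, -, h1, h2⟩ := exists_step (f := lv a K) (by simp [lv_zero]) hh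
  rw [lv_succ] at h2
  obtain ⟨u, hu, h3, h4⟩ := exists_step (f := fun u => lv a K k + lc a k u) (m := K)
    (by simpa [lc_zero] using h1) h2
  simp only [lc_succ] at h4
  by_cases hk : k < a u
  · rw [if_pos hk] at h4
    exact ⟨k, u, hu, hk, by rw [pos]; omega⟩
  · rw [if_neg hk] at h4
    omega

open Classical in
/-- Whether the chain member at a position in level order has a successor in its chain. -/
noncomputable def hasNext (a : ℕ → ℕ) (K h : ℕ) : Bool :=
  decide (∃ k u, u < K ∧ k + 1 < a u ∧ pos a K k u = h)

theorem hasNext_pos {k u : ℕ} (hu : u < K) (h : k < a u) :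
    hasNext a K (pos a K k u) = decide (k + 1 < a u) := by
  rw [hasNext]
  refine decide_eq_decide.2 ⟨?_, fun h1 => ⟨k, u, hu, h1, rfl⟩⟩
  rintro ⟨k', u', hu', h1, h2⟩
  obtain ⟨rfl, rfl⟩ := pos_inj hu' (by omega) hu h h2
  exact h1

/-- Level order is the order of a queue: it starts with the heads of the nonempty chains, and each
processed member that has a successor appends it. So the successor of a member is found behind the
`lc a 0 K` heads and the successors of all members before it. This makes navigation by popcounts
possible, and it shows that the queue of `lightBlock` has its tail in the right place. -/
theorem sum_hasNext (k : ℕ) : ∀ u ≤ K,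
    ∑ h ∈ Finset.range (pos a K k u), (hasNext a K h).toNat + lc a 0 K = pos a K (k + 1) u := by
  have step : ∀ k u, u < K →
      ∑ h ∈ Finset.range (pos a K k u), (hasNext a K h).toNat + lc a 0 K = pos a K (k + 1) u →
      ∑ h ∈ Finset.range (pos a K k (u + 1)), (hasNext a K h).toNat + lc a 0 K =
        pos a K (k + 1) (u + 1) := by
    intro k u hu ih
    rw [pos_succ_eq (k + 1)]
    by_cases h : k < a u
    · rw [pos_succ h, Finset.sum_range_succ, hasNext_pos hu h]
      by_cases h1 : k + 1 < a u
      · rw [if_pos h1, decide_eq_true h1, Bool.toNat_true]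
        omega
      · rw [if_neg h1, decide_eq_false h1, Bool.toNat_false]
        omega
    · have h1 : ¬ k + 1 < a u := by omega
      rw [pos_succ_eq, if_neg h, if_neg h1]
      exact ih
  induction k with
  | zero =>
    intro u hu
    induction u with
    | zero => simp [pos, lc_zero, lv_zero, lv_succ]
    | succ u ih => exact step 0 u hu (ih (by omega))
  | succ k ihk =>
    intro u hu
    induction u with
    | zero =>
      -- The end of a level is the beginning of the next one.
      have := ihk K le_rfl
      rw [pos, ← lv_succ, pos, ← lv_succ] at this
      simpa [pos, lc_zero] using this
    | succ u ih => exact step (k + 1) u hu (ih (by omega))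

end LevelOrder

/-! ### Recovering the counts from the result of the first pass. -/

section Count

variable {σ : ℕ} {T : List (Fin σ)} {F : List (List (Fin σ))} {w M : ℕ}

/-- Three cases. The edge to a full inner node carries a point for every character, so the count is
a difference of string depths. Below a full node or the root, the unary counter of an edge that is
not full, or that leads to a leaf, is valid. Below a node that is not full there are no points at
all. -/
theorem countCmd_runs (ok : Ok T w M) (hF : IsGreedy T F) {s : St} (hE : Env T s)
    (hm : Edges T F s.mem) {v : List (Fin σ)} (hv : v ∈ nodeSet T)
    (hsv : s.reg .v = number T v) :
    Runs T w M countCmd s fun s' t => s'.reg .c = cnt T F v ∧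
      t ≤ (if v ∈ F then 8 * v.length else 0) + 2 * cnt T F v + 30 := by
  have hT := ok.text
  have hbig := ok.big
  have hle := ok.le
  have hP := hF.prefixClosed_self
  refine Runs.set_seq 0 rfl (by simp) (Runs.ite (by simp) ?_ ?_)
  · intro h
    have h0 : number T v = number T [] := by simpa [hsv, number_nil] using h
    obtain rfl := number_inj hv nil_mem_nodeSet h0
    refine Runs.set 0 rfl (by simp) ?_
    have := dep_le F ([] : List (Fin σ))
    simp at this
    simp [cnt, this]
  intro h
  have h0 : v ≠ [] := by
    rintro rfl
    simp [hsv, number_nil] at h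
  have hpl := length_parent_lt hv h0
  have hpi := parent_mem_innerSet hT hv h0
  have hpn := parent_mem (T := T) v
  have hxM : xB T + T.length + 1 ≤ M := by omega
  refine Runs.ite ⟨by simp, safe_xfull hT hv (by simpa using hsv) (by simp) ok.one_le ok.lt
    (by simpa [hE.xB] using hxM)⟩ ?_ ?_
  · intro hc
    obtain ⟨hvF, hvl⟩ := (xfull_pos_iff hT hm (m := s.set .c 0) (by simpa using hE.xB) hv h0
      (e := V.v) (by simpa using hsv)).1 hc
    refine Runs.set_seq (number T v) (by simp [hsv]) (by simp) ?_
    refine Runs.bind (depthCmd_runs ok (mem_innerSet.2 ⟨hv, hvl⟩) (by simp)) ?_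
    rintro s1 t1 ⟨hD1, ht1⟩ hf1
    have hv1 := hf1.reg .v (by decide)
    simp [hsv] at hv1
    have hlen := length_le_of_mem_nodeSet hv
    refine Runs.set_seq v.length (by simp [hD1]) (by simp) ?_
    refine Runs.set_seq (number T (parent T v)) (by simp [hv1, nodeAt_number hv]) (by simp) ?_
    refine Runs.bind (depthCmd_runs ok hpi (by simp)) ?_
    rintro s2 t2 ⟨hD2, ht2⟩ hf2
    have hc2 := hf2.reg .c (by decide)
    simp at hc2
    have hcnt : cnt T F v = v.length - (parent T v).length := by
      have h1 := (hP.le_dep_iff (S := v) (List.length_pos_iff.2 h0) le_rfl).2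
        (by rwa [List.take_length])
      have h2 := dep_le F v
      rw [cnt, le_antisymm h2 h1]
    refine Runs.set (v.length - (parent T v).length) (by simp [hc2, hD2])
      (by simp [hc2, hD2]; omega) ⟨by simp [hcnt], ?_⟩
    rw [if_pos hvF]
    omega
  intro hc
  have hnf : ¬ (v ∈ F ∧ v ∉ leafSet T) := mt (xfull_pos_iff hT hm (m := s.set .c 0)
    (by simpa using hE.xB) hv h0 (e := V.v) (by simpa using hsv)).2 hc
  refine Runs.set_seq (number T (parent T v)) (by simp [hsv, nodeAt_number hv]) (by simp) ?_
  have hfl : ∀ Q : St → ℕ → Prop, (∀ fl t, t ≤ 2 → (0 < fl ↔ parent T v = [] ∨ parent T v ∈ F) →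
      Q (((s.set .c 0).set .u (number T (parent T v))).set .fl fl) t) →
      Runs T w M (.ite (.eq V.u 0) (V.fl ≔ 1) (V.fl ≔ xfull V.u))
        ((s.set .c 0).set .u (number T (parent T v))) Q := by
    intro Q hQ
    refine Runs.ite (by simp) ?_ ?_
    · intro hc1
      have h1 : number T (parent T v) = number T [] := by simpa [number_nil] using hc1
      have h2 := number_inj hpn nil_mem_nodeSet h1
      exact Runs.set 1 rfl (by simp) (hQ 1 2 le_rfl (by simp [h2]))
    · intro hc1
      have h1 : parent T v ≠ [] := by
        intro h1
        simp [h1, number_nil] at hc1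
      refine Runs.set _ rfl (safe_xfull hT hpn (by simp) (by simp) ok.one_le ok.lt
        (by simpa [hE.xB] using hxM)) (hQ _ 2 le_rfl ?_)
      rw [xfull_pos_iff hT (m := (s.set .c 0).set .u (number T (parent T v))) (by simpa using hm)
        (by simpa using hE.xB) hpn h1 (by simp)]
      simp [h1, (mem_innerSet.1 hpi).2]
  refine Runs.bind (hfl (fun s' t => ∃ fl, t ≤ 2 ∧ (0 < fl ↔ parent T v = [] ∨ parent T v ∈ F) ∧
    s' = ((s.set .c 0).set .u (number T (parent T v))).set .fl fl)
    fun fl t h1 h2 => ⟨fl, h1, h2, rfl⟩) ?_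
  rintro s1 t1 ⟨fl, ht1, hfl, rfl⟩ -
  refine Runs.ite (by simp) ?_ ?_
  · intro hc1
    have hpF := hfl.1 (by simpa using hc1)
    have hcl := hF.cnt_le_leaves hT le_rfl hv ∅ (by simp)
    rw [List.take_length, Finset.card_empty] at hcl
    have hcnt := hm.counter v hv h0 hpF (by
      by_contra h1
      rw [not_or, not_not] at h1
      exact hnf h1)
    have hlr := lr_le_rr' hT hv
    have hrr := rr_lt' hT hv
    have hcB := Ok.cB_eq T
    refine Runs.set_seq (lr T v) (by simp [hsv, nodeAt_number hv]) (by simp) ?_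
    refine Runs.set_seq (rr T v) (by simp [hsv, nodeAt_number hv]) (by simp) ?_
    refine Runs.set_seq (lr T v) (by simp) (by simp) ?_
    generalize cnt T F v = k at *
    refine Runs.bind (Q₁ := fun s' t => s'.reg .i = lr T v + k ∧ t ≤ 2 * k + 1)
      (Runs.loop (fun g s' => g ≤ k ∧ s'.reg .i = lr T v + g) (fun g => 2 * (k - g)) 0
        ⟨by omega, by simp⟩ ?_ ?_ ?_) ?_
    · rintro g s' ⟨hg, hi⟩ hf
      have e1 := hf.reg .cB (by decide)
      have e2 := hf.reg .r (by decide)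
      simp [hE.cB] at e1 e2
      simp [e1, e2, hi, blk_one]
      have := ok.one_le
      have h5 : (s'.mem (cB T + (lr T v + g))).toNat ≤ 1 := Bool.toNat_le _
      have h6 : (s'.mem (cB T + (lr T v + g))).toNat * (rr T v + 1 - (lr T v + g)) ≤
          1 * (rr T v + 1 - (lr T v + g)) := Nat.mul_le_mul_right _ h5
      omega
    · rintro g s' ⟨hg, hi⟩ hf hc
      have hgk : g < k := by
        by_contra hgk
        have e1 := hf.reg .cB (by decide)
        have e2 := hf.reg .r (by decide)
        have e3 := hf.mem rfl
        simp [hE.cB] at e1 e2 e3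
        simp [e1, e2, hi, blk_one, e3] at hc
        have := hcnt (lr T v + g) (by omega)
        simp [hgk] at this
        simp [this] at hc
      refine Runs.set (lr T v + (g + 1)) (by simp [hi, add_assoc]) (by simp [hi]; omega)
        ⟨g + 1, ⟨by omega, by simp⟩, by omega⟩
    · rintro s' t g ⟨hg, hi⟩ hf hc ht
      have hgk : g = k := by
        by_contra hgk
        have e1 := hf.reg .cB (by decide)
        have e2 := hf.reg .r (by decide)
        have e3 := hf.mem rfl
        simp [hE.cB] at e1 e2 e3
        apply hc
        have h1 : g < k := by omega
        have := hcnt (lr T v + g) (by omega)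
        simp [e1, e2, hi, blk_one, e3, this, h1]
        omega
      subst hgk
      exact ⟨hi, by omega⟩
    · rintro s2 t2 ⟨hi2, ht2⟩ hf2
      have e2 := hf2.reg .l (by decide)
      simp at e2
      refine Runs.set k (by simp [hi2, e2]) (by simp [hi2, e2]) ⟨by simp, ?_⟩
      omega
  · intro hc1
    have hpF := mt hfl.2 (by simpa using hc1)
    rw [not_or] at hpF
    have h1 := hP.cnt_eq_zero hpF.1 hpF.2
    refine Runs.set 0 rfl (by simp) ⟨by simp [h1], ?_⟩
    omega

end Count

/-! ### Tables of a single block. -/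

section Build

variable {σ : ℕ} {T : List (Fin σ)} {F : List (List (Fin σ))} {w M : ℕ}

theorem Edges.congr {P : List (List (Fin σ))} {m m' : ℕ → Bool} (hT : IsText T)
    (h : Edges T P m) (hm : ∀ A, xB T ≤ A → A < xB T + 2 * T.length → m' A = m A) :
    Edges T P m' := by
  refine ⟨fun v hv h0 => ?_, fun v hv h0 h1 h2 i hi => ?_⟩
  · have := innerRank_lt hT hv
    rw [hm _ (by omega) (by omega)]
    exact h.full v hv h0
  · have := rr_lt' hT hv
    have := Ok.cB_eq T
    rw [hm _ (by omega) (by omega)]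
    exact h.counter v hv h0 h1 h2 i hi

theorem Ok.ell_le (ok : Ok T w M) : ell T ≤ w := by
  have h1 := ok.kk_le
  have h2 : kk T = 4 * ell T := rfl
  omega

theorem th_eq (T : List (Fin σ)) : th T = (kk T + 1) * ell T := rfl
theorem ptB_eq (T : List (Fin σ)) : ptB T = th T + th T * ell T := rfl
theorem hB_eq (T : List (Fin σ)) : hB T = ptB T + (nN T / kk T + 2) * ell T := rfl
theorem xB_eq (T : List (Fin σ)) : xB T = hB T + nN T + kk T := rfl

theorem Ok.kk_lt_th (ok : Ok T w M) : kk T < th T := by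
  have := ok.ell_pos
  rw [th_eq]
  nlinarith

/-- The number of steps that are spent on a node of the suffix tree. -/
def nodeCost (T : List (Fin σ)) (F : List (List (Fin σ))) (i : ℕ) : ℕ :=
  (if nodeAt T i ∈ F then 8 * (nodeAt T i).length else 0) + 2 * arr T F i + 50

theorem psum_add_sum (X u : ℕ) :
    psum T F X + ∑ t ∈ Finset.range u, arr T F (X + t) = psum T F (X + u) := by
  rw [psum, psum, Finset.sum_range_add]

theorem psum_lt_two_pow (hT : IsText T) (hF : IsGreedy T F) (i : ℕ) :
    psum T F i < 2 ^ ell T :=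
  (psum_le hT hF i).trans_lt (hF.length_le.trans_lt lt_two_pow_ell)

theorem arr_le_length (hT : IsText T) (hF : IsGreedy T F) (i : ℕ) : arr T F i ≤ F.length := by
  have h1 := psum_le hT hF (i + 1)
  rw [psum_succ] at h1
  omega

/-- The last block may extend beyond the last node; the missing nodes count as edges without points,
in agreement with `arr`. -/
theorem countNode_runs (ok : Ok T w M) (hF : IsGreedy T F) {s : St} (hE : Env T s)
    (hm : Edges T F s.mem) {i : ℕ} (hsv : s.reg .v = i) :
    Runs T w M (.ite (.lt V.v V.N) countCmd (V.c ≔ 0)) s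
      fun s' t => s'.reg .c = arr T F i ∧ t + 19 ≤ nodeCost T F i := by
  refine Runs.ite (by simp) ?_ ?_
  · intro h
    have hi : i < (nodeSet T).card := by simpa [hsv, hE.N, nN] using h
    obtain ⟨h1, h2⟩ := exists_number_eq hi
    refine (countCmd_runs ok hF hE hm h1 (by rw [hsv, h2])).mono ?_
    rintro s' t ⟨h3, h4⟩ -
    rw [nodeCost, arr, if_pos hi]
    exact ⟨h3, by omega⟩
  · intro h
    have hi : ¬ i < (nodeSet T).card := by
      intro hi
      exact h (by simpa [hsv, hE.N, nN] using hi)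
    refine Runs.set 0 rfl (by simp) ⟨by simp [arr, hi], ?_⟩
    rw [nodeCost]
    omega

/-- The state while the counts of a block are computed. -/
structure Counting (T : List (Fin σ)) (F : List (List (Fin σ))) (X : ℕ) (s : St) (j : ℕ)
    (s' : St) : Prop where
  le : j ≤ kk T
  rj : s'.reg .j = j
  L : psum T F X + s'.reg .L = psum T F (X + j)
  tail : s'.reg .tail = lc (fun u => arr T F (X + u)) 0 j
  p : ∀ i < j, blk s'.mem (i * ell T) (ell T) = psum T F (X + i)
  q : ∀ u < j, 0 < arr T F (X + u) →
    blk s'.mem (th T + lc (fun u => arr T F (X + u)) 0 u * ell T) (ell T) = arr T F (X + u)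
  h : ∀ u < kk T, s'.mem (hB T + (X + u)) = decide (u < j ∧ 0 < arr T F (X + u))
  rest : ∀ A, ptB T ≤ A → (A < hB T + X ∨ hB T + (X + kk T) ≤ A) → s'.mem A = s.mem A

theorem counting_step (ok : Ok T w M) (hF : IsGreedy T F) {s : St} {X : ℕ} (hX : X ≤ nN T) {j : ℕ} {s0 s1 : St}
    (hI : Counting T F X s j s0) (hj : j < kk T) (hE1 : Env T s1)
    (hm1 : s1.mem = wr s0.mem (j * ell T) (ell T) (psum T F (X + j)))
    (hc1 : s1.reg .c = arr T F (X + j)) (hv1 : s1.reg .v = X + j) (hj1 : s1.reg .j = j)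
    (hL1 : s1.reg .L = s0.reg .L) (ht1 : s1.reg .tail = s0.reg .tail) :
    Runs T w M (.ite (.lt 0 V.c)
        (.store (V.hB + V.v) 1 1 ;; .store (V.qB + V.tail * V.ell) V.ell V.c ;;
          V.tail ≔ V.tail + 1)
        (V.c ≔ 0) ;;
      V.L ≔ V.L + V.c ;; V.j ≔ V.j + 1) s1
      fun s' t => Counting T F X s (j + 1) s' ∧ t ≤ 6 := by
  have hT := ok.text
  have hbig := ok.big
  have hle := ok.le
  have hell := ok.ell_le
  have hep := ok.ell_pos
  have h1w := ok.one_le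
  have hkt := ok.kk_lt_th
  have e1 := entry_le (l := ell T) (show j < kk T + 1 by omega)
  rw [← th_eq] at e1
  have e2 := ptB_eq T
  have e3 := hB_eq T
  have e4 := xB_eq T
  have hLB : s0.reg .L ≤ T.length := by
    have h1 := hI.L
    have h2 := psum_le hT hF (X + j)
    have := hF.length_le
    omega
  have harr := arr_le_length hT hF (X + j)
  have hzn := hF.length_le
  have htl : lc (fun u => arr T F (X + u)) 0 j ≤ j := lc_le _ _
  have e5 := entry_le (l := ell T)
    (show lc (fun u => arr T F (X + u)) 0 j < th T by omega)
  have hps := psum_lt_two_pow hT hF (X + j)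
  have hab : arr T F (X + j) < 2 ^ ell T :=
    (harr.trans hzn).trans_lt lt_two_pow_ell
  have hp : ∀ i < j + 1, blk s1.mem (i * ell T) (ell T) = psum T F (X + i) := by
    intro i hi
    rw [hm1]
    rcases Nat.lt_succ_iff_lt_or_eq.1 hi with h1 | rfl
    · have := entry_le (l := ell T) h1
      rw [blk_wr_disj (by omega), hI.p i h1]
    · exact blk_wr_same hps
  have hge : ∀ A, th T ≤ A → s1.mem A = s0.mem A := fun A hA => by
    rw [hm1, wr_of_disj (by omega)]
  have hq : ∀ u < j, 0 < arr T F (X + u) →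
      blk s1.mem (th T + lc (fun u => arr T F (X + u)) 0 u * ell T) (ell T) =
        arr T F (X + u) := by
    intro u hu hu0
    rw [← hI.q u hu hu0]
    exact blk_congr fun A hA _ => hge A (by omega)
  have tailend : ∀ (s2 : St) (t : ℕ), s2.reg .L = s0.reg .L → s2.reg .c = arr T F (X + j) →
      s2.reg .j = j → s2.reg .tail = lc (fun u => arr T F (X + u)) 0 (j + 1) →
      (∀ i < j + 1, blk s2.mem (i * ell T) (ell T) = psum T F (X + i)) →
      (∀ u < j + 1, 0 < arr T F (X + u) →
        blk s2.mem (th T + lc (fun u => arr T F (X + u)) 0 u * ell T) (ell T) =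
          arr T F (X + u)) →
      (∀ u < kk T, s2.mem (hB T + (X + u)) = decide (u < j + 1 ∧ 0 < arr T F (X + u))) →
      (∀ A, ptB T ≤ A → (A < hB T + X ∨ hB T + (X + kk T) ≤ A) → s2.mem A = s.mem A) →
      t ≤ 4 →
      Runs T w M (V.L ≔ V.L + V.c ;; V.j ≔ V.j + 1) s2
        fun s' t' => Counting T F X s (j + 1) s' ∧ t + t' ≤ 6 := by
    intro s2 t h1 h2 h3 h4 h5 h6 h7 h8 ht
    have hn : psum T F (X + (j + 1)) = psum T F X + (s0.reg .L + arr T F (X + j)) := by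
      rw [← add_assoc X, psum_succ, ← hI.L, add_assoc]
    refine Runs.set_seq (s0.reg .L + arr T F (X + j)) (by simp [h1, h2]) (by simp [h1, h2]; omega) ?_
    refine Runs.set (j + 1) (by simp [h3]) (by simp [h3]; omega) ?_
    refine ⟨⟨by omega, by simp, by simp [hn], by simpa using h4, by simpa using h5,
      by simpa using h6, by simpa using h7, by simpa using h8⟩, by omega⟩
  refine Runs.bind (Q₁ := fun s2 t => s2.reg .L = s0.reg .L ∧ s2.reg .c = arr T F (X + j) ∧
      s2.reg .j = j ∧ s2.reg .tail = lc (fun u => arr T F (X + u)) 0 (j + 1) ∧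
      (∀ i < j + 1, blk s2.mem (i * ell T) (ell T) = psum T F (X + i)) ∧
      (∀ u < j + 1, 0 < arr T F (X + u) →
        blk s2.mem (th T + lc (fun u => arr T F (X + u)) 0 u * ell T) (ell T) =
          arr T F (X + u)) ∧
      (∀ u < kk T, s2.mem (hB T + (X + u)) = decide (u < j + 1 ∧ 0 < arr T F (X + u))) ∧
      (∀ A, ptB T ≤ A → (A < hB T + X ∨ hB T + (X + kk T) ≤ A) → s2.mem A = s.mem A) ∧
      t ≤ 4) ?_ fun s2 t ⟨h1, h2, h3, h4, h5, h6, h7, h8, h9⟩ _ =>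
        tailend s2 t h1 h2 h3 h4 h5 h6 h7 h8 h9
  refine Runs.ite (by simp) ?_ ?_
  · intro hc
    have hpos : 0 < arr T F (X + j) := by simpa [hc1] using hc
    refine Runs.store_seq (by simp [hE1.hB, hv1]; omega) ?_
    refine Runs.store_seq (by simp [hE1.qB, hE1.ell, ht1, hI.tail]; omega) ?_
    refine Runs.set (lc (fun u => arr T F (X + u)) 0 (j + 1))
      (by simp [ht1, hI.tail, lc_succ, hpos]) (by simp [ht1, hI.tail]; omega) ?_
    simp only [St.set_reg, St.set_mem, reduceCtorEq, if_false, hL1, hc1, hj1, true_and,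
      eval_add, eval_var, hE1.hB, hE1.qB, hE1.ell, ht1, hI.tail, hv1, eval_mul, eval_lit_1,
      if_true]
    refine ⟨fun i hi => ?_, fun u hu hu0 => ?_, fun u hu => ?_, fun A hA hA' => ?_, by omega⟩
    · have := entry_le (l := ell T) (show i < kk T + 1 by omega)
      rw [← th_eq] at this
      rw [blk_wr_disj (by omega), blk_wr_disj (by omega), hp i hi]
    · rcases Nat.lt_succ_iff_lt_or_eq.1 hu with h1 | rfl
      · have h2 := lc_mono (a := fun u => arr T F (X + u)) (k := 0) (show u + 1 ≤ j by omega)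
        rw [lc_succ, if_pos hu0] at h2
        have h3 := entry_le (l := ell T) (show lc (fun u => arr T F (X + u)) 0 u <
          lc (fun u => arr T F (X + u)) 0 j by omega)
        rw [blk_wr_entry (by omega), blk_wr_disj (by omega), hq u h1 hu0]
      · exact blk_wr_same hab
    · rw [wr_of_disj (by omega), wr_one, hge _ (by omega), hI.h u hu]
      by_cases huj : u = j
      · subst huj
        simp [hpos]
      · rw [if_neg (by omega)]
        exact decide_eq_decide.2 (and_congr_left fun _ => by omega)
    · rw [wr_of_disj (by omega), wr_of_disj (by omega), hge _ (by omega), hI.rest A hA hA']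
  · intro hc
    have hpos : arr T F (X + j) = 0 := by simpa [hc1] using hc
    refine Runs.set 0 (by simp) (by simp) ?_
    simp only [St.set_reg, St.set_mem, reduceCtorEq, if_false, hL1, hj1, true_and, if_true,
      ht1, hI.tail, hpos]
    refine ⟨by simp [lc_succ, hpos], hp, fun u hu hu0 => ?_, fun u hu => ?_, fun A hA hA' => ?_,
      by omega⟩
    · rcases Nat.lt_succ_iff_lt_or_eq.1 hu with h1 | rfl
      · exact hq u h1 hu0
      · omega
    · rw [hge _ (by omega), hI.h u hu]
      refine decide_eq_decide.2 ?_
      by_cases huj : u = j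
      · subst huj
        omega
      · omega
    · rw [hge _ (by omega), hI.rest A hA hA']

/-- The tables after the counts of a block have been computed. -/
structure Counted (T : List (Fin σ)) (F : List (List (Fin σ))) (X : ℕ) (s s' : St) : Prop where
  L : psum T F X + s'.reg .L = psum T F (X + kk T)
  tail : s'.reg .tail = lc (fun u => arr T F (X + u)) 0 (kk T)
  p : ∀ i ≤ kk T, blk s'.mem (i * ell T) (ell T) = psum T F (X + i)
  q : ∀ u < kk T, 0 < arr T F (X + u) →
    blk s'.mem (th T + lc (fun u => arr T F (X + u)) 0 u * ell T) (ell T) = arr T F (X + u)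
  h : ∀ u < kk T, s'.mem (hB T + (X + u)) = decide (0 < arr T F (X + u))
  rest : ∀ A, ptB T ≤ A → (A < hB T + X ∨ hB T + (X + kk T) ≤ A) → s'.mem A = s.mem A

theorem blockCounts_runs (ok : Ok T w M) (hF : IsGreedy T F) {s : St} (hE : Env T s)
    (hm : Edges T F s.mem) {X : ℕ} (hX : X ≤ nN T) (hx : s.reg .x = X)
    (hS : s.reg .S = psum T F X) (hH : ∀ u < kk T, s.mem (hB T + (X + u)) = false) :
    Runs T w M blockCounts s fun s' t => Counted T F X s s' ∧
      t ≤ ∑ u ∈ Finset.range (kk T), nodeCost T F (X + u) + 5 := by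
  have hT := ok.text
  have hbig := ok.big
  have hle := ok.le
  have hell := ok.ell_le
  have hep := ok.ell_pos
  have hkt := ok.kk_lt_th
  have e2 := ptB_eq T
  have e3 := hB_eq T
  have e4 := xB_eq T
  have hzn := hF.length_le
  have hLB : ∀ {j} {s' : St}, Counting T F X s j s' → s'.reg .L ≤ T.length := by
    intro j s' hI
    have h1 := hI.L
    have h2 := psum_le hT hF (X + j)
    omega
  refine Runs.set_seq 0 rfl (by simp) (Runs.set_seq 0 rfl (by simp)
    (Runs.set_seq 0 rfl (by simp) ?_))
  have hpX := psum_le hT hF X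
  have hE0 := ((hE.set (x := .j) 0 (by decide)).set (x := .L) 0 (by decide)).set (x := .tail) 0
    (by decide)
  refine Runs.bind (Q₁ := fun s' t => Counting T F X s (kk T) s' ∧
    t ≤ ∑ u ∈ Finset.range (kk T), nodeCost T F (X + u) + 1) (Runs.loop (Counting T F X s)
    (fun j => ∑ u ∈ Finset.range (kk T), nodeCost T F (X + u) -
      ∑ u ∈ Finset.range j, nodeCost T F (X + u)) 0 ?_ ?_ ?_ ?_) ?_
  · exact ⟨by omega, by simp, by simp, by simp [lc_zero], by simp, by simp, by simpa using hH,
      by simp⟩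
  · intros
    simp
  · rintro j s0 hI hf hc
    have hE1 := hE0.frame hf (by decide)
    have hx1 := hf.reg .x (by decide)
    have hS1 := hf.reg .S (by decide)
    simp [hx, hS] at hx1 hS1
    have hjk : j < kk T := by simpa [hI.rj, hE1.K] using hc
    have e1 := entry_le (l := ell T) (show j < kk T + 1 by omega)
    rw [← th_eq] at e1
    have hL1 := hLB hI
    refine Runs.store_seq (by simp [hE1.pB, hE1.ell, hI.rj, hS1]; omega) ?_
    simp only [eval_add, eval_var, eval_mul, hE1.pB, hE1.ell, hI.rj, hS1, hI.L, zero_add]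
    refine Runs.set_seq (X + j) (by simp [hx1, hI.rj]) (by simp [hx1, hI.rj]; omega) ?_
    have hm1 : Edges T F (wr s0.mem (j * ell T) (ell T) (psum T F (X + j))) :=
      hm.congr hT fun A hA _ => by
        rw [wr_of_disj (by omega), hI.rest A (by omega) (by omega)]
    refine Runs.bind (countNode_runs ok hF ((hE1.mem _).set _ (by decide)) (i := X + j) hm1
      (by simp)) ?_
    rintro s2 t2 ⟨hc2, ht2⟩ hf2
    have hE2 := ((hE1.mem _).set (x := .v) (X + j) (by decide)).frame hf2 (by decide)
    have h3 := hf2.reg .v (by decide)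
    have h4 := hf2.reg .j (by decide)
    have h5 := hf2.reg .L (by decide)
    have h6 := hf2.reg .tail (by decide)
    simp only [St.set_reg, reduceCtorEq, if_false, if_true] at h3 h4 h5 h6
    refine (counting_step ok hF hX hI hjk hE2 (hf2.mem rfl) hc2 h3 (h4.trans hI.rj) h5
      h6).mono ?_
    rintro s3 t3 ⟨h7, h8⟩ -
    refine ⟨j + 1, h7, ?_⟩
    have h9 : ∑ u ∈ Finset.range (j + 1), nodeCost T F (X + u) ≤
        ∑ u ∈ Finset.range (kk T), nodeCost T F (X + u) :=
      Finset.sum_le_sum_of_subset (Finset.range_mono (by omega))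
    rw [Finset.sum_range_succ] at h9 ⊢
    omega
  · rintro s' t j hI hf hc ht
    have hE1 := hE0.frame hf (by decide)
    have hjk : j = kk T := by
      have h1 : ¬ j < kk T := by simpa [hI.rj, hE1.K] using hc
      have := hI.le
      omega
    subst hjk
    refine ⟨hI, ?_⟩
    simp at ht
    omega
  · rintro s1 t1 ⟨hI, ht1⟩ hf
    have hE1 := hE0.frame hf (by decide)
    have hS1 := hf.reg .S (by decide)
    simp [hS] at hS1
    have e1 := entry_le (l := ell T) (show kk T < kk T + 1 by omega)
    rw [← th_eq] at e1
    have hL1 := hLB hI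
    refine Runs.store (by simp [hE1.pB, hE1.ell, hE1.K, hS1]; omega) ?_
    simp only [eval_add, eval_var, eval_mul, hE1.pB, hE1.ell, hE1.K, hS1, hI.L, zero_add]
    refine ⟨⟨hI.L, hI.tail, fun i hi => ?_, fun u hu hu0 => ?_, fun u hu => ?_, fun A hA hA' => ?_⟩,
      by omega⟩
    · rcases hi.lt_or_eq with h1 | rfl
      · have := entry_le (l := ell T) h1
        rw [blk_wr_disj (by omega), hI.p i h1]
      · exact blk_wr_same (psum_lt_two_pow hT hF _)
    · rw [blk_wr_disj (by omega), hI.q u hu hu0]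
    · dsimp only
      rw [wr_of_disj (by omega), hI.h u hu]
      simp [hu]
    · dsimp only
      rw [wr_of_disj (by omega), hI.rest A hA hA']

/-- The queue holds, for each member in level order, the number of members that remain in its chain.
The bits record which members have a successor; only ones are written, so the region must be zero
before. -/
theorem lightBlock_runs (ok : Ok T w M) {s : St} (hE : Env T s) {a : ℕ → ℕ} {S L eB : ℕ}
    (hS : s.reg .S = S) (hL : s.reg .L = L) (heB : s.reg .eB = eB)
    (hsum : ∑ t ∈ Finset.range (kk T), a t = L) (hlt : L < th T)
    (htail : s.reg .tail = lc a 0 (kk T))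
    (hq : ∀ u < kk T, 0 < a u → blk s.mem (th T + lc a 0 u * ell T) (ell T) = a u)
    (ha : ∀ u, a u < 2 ^ ell T) (hz : ∀ h < L, s.mem (eB + (S + h)) = false)
    (hM : eB + S + L ≤ M) (hxe : xB T ≤ eB) :
    Runs T w M lightBlock s fun s' t => (∀ h < L, s'.mem (eB + (S + h)) = hasNext a (kk T) h) ∧
      (∀ A, ptB T ≤ A → (A < eB + S ∨ eB + S + L ≤ A) → s'.mem A = s.mem A) ∧
      t ≤ 7 * L + 2 := by
  have hT := ok.text
  have hbig := ok.big
  have hle := ok.le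
  have hell := ok.ell_le
  have h1w := ok.one_le
  have e2 := ptB_eq T
  have e3 := hB_eq T
  have e4 := xB_eq T
  refine Runs.set_seq 0 rfl (by simp) ?_
  refine Runs.loop (fun h s' => h ≤ L ∧ s'.reg .h = h ∧
      s'.reg .tail = ∑ i ∈ Finset.range h, (hasNext a (kk T) i).toNat + lc a 0 (kk T) ∧
      (∀ k u, u < kk T → k < a u → pos a (kk T) k u < s'.reg .tail →
        blk s'.mem (th T + pos a (kk T) k u * ell T) (ell T) = a u - k) ∧
      (∀ i < L, s'.mem (eB + (S + i)) = (decide (i < h) && hasNext a (kk T) i)) ∧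
      (∀ A, ptB T ≤ A → (A < eB + S ∨ eB + S + L ≤ A) → s'.mem A = s.mem A))
    (fun h => 7 * (L - h)) 0 ?_ ?_ ?_ ?_
  · refine ⟨by omega, by simp, by simp [htail], fun k u hu hk hp => ?_, by simpa using hz, by simp⟩
    -- At the beginning the queue contains the heads only, and all members of later levels have
    -- positions behind them.
    have hk0 : k = 0 := by
      by_contra h0
      simp [htail] at hp
      have h1 := lv_mono (a := a) (K := kk T) (show 1 ≤ k by omega)
      rw [show (1 : ℕ) = 0 + 1 from rfl, lv_succ] at h1
      rw [pos] at hp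
      omega
    subst hk0
    simpa [pos, lv_zero] using hq u hu hk
  · intros
    simp
  · rintro h s0 ⟨h1, h2, h3, h4, h5, h6⟩ hf hc
    have hE0 := (hE.set (x := .h) 0 (by decide)).frame hf (by decide)
    have hS0 := hf.reg .S (by decide)
    have hL0 := hf.reg .L (by decide)
    have heB0 := hf.reg .eB (by decide)
    simp [hS, hL, heB] at hS0 hL0 heB0
    have hhL : h < L := by simpa [h2, hL0] using hc
    obtain ⟨k, u, hu, hk, hp⟩ := exists_pos (hsum.symm ▸ hhL)
    -- When the member at level `k` of chain `u` is processed, the tail of the queue is the position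
    -- at which the successor belongs.
    have htl : s0.reg .tail = pos a (kk T) (k + 1) u := by
      rw [h3, ← hp]
      exact sum_hasNext k u hu.le
    have hpt := pos_lt hu hk (k' := k + 1) (u' := u) (Or.inl (by omega))
    have hqc := h4 k u hu hk (by omega)
    rw [hp] at hqc
    have e5 := entry_le (l := ell T) (show h < th T by omega)
    have hnx := hasNext_pos hu hk
    rw [hp] at hnx
    refine Runs.set_seq (a u - k) (by simp [hE0.qB, hE0.ell, h2, hqc])
      (by simp [hE0.qB, hE0.ell, h2]; omega) ?_
    refine Runs.bind (Q₁ := fun s1 t => s1.reg .h = h ∧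
      s1.reg .tail = ∑ i ∈ Finset.range (h + 1), (hasNext a (kk T) i).toNat + lc a 0 (kk T) ∧
      (∀ k u, u < kk T → k < a u → pos a (kk T) k u < s1.reg .tail →
        blk s1.mem (th T + pos a (kk T) k u * ell T) (ell T) = a u - k) ∧
      (∀ i < L, s1.mem (eB + (S + i)) = (decide (i < h + 1) && hasNext a (kk T) i)) ∧
      (∀ A, ptB T ≤ A → (A < eB + S ∨ eB + S + L ≤ A) → s1.mem A = s.mem A) ∧ t ≤ 4) ?_ ?_
    · refine Runs.ite (by simp) ?_ ?_
      · intro hc1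
        have hk1 : k + 1 < a u := by
          have : 1 < a u - k := by simpa using hc1
          omega
        have hpL := pos_lt_total hu hk1
        rw [hsum] at hpL
        have e6 := entry_le (l := ell T) (show pos a (kk T) (k + 1) u < th T by omega)
        refine Runs.store_seq (by simp [heB0, hS0, h2]; omega) ?_
        refine Runs.store_seq (by simp [hE0.qB, hE0.ell, htl]; omega) ?_
        refine Runs.set (pos a (kk T) (k + 1) u + 1) (by simp [htl]) (by simp [htl]; omega) ?_
        simp only [St.set_reg, St.set_mem, reduceCtorEq, if_false, if_true, h2, true_and,
          eval_add, eval_var, heB0, hS0, eval_mul, hE0.qB, hE0.ell, htl, eval_sub, eval_lit_1]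
        refine ⟨?_, fun k' u' hu' hk' hp' => ?_, fun i hi => ?_, fun A hA hA' => ?_, by omega⟩
        · rw [Finset.sum_range_succ, hnx, decide_eq_true hk1, ← htl, h3]
          simp
          omega
        · by_cases he : pos a (kk T) k' u' = pos a (kk T) (k + 1) u
          · obtain ⟨rfl, rfl⟩ := pos_inj hu' hk' hu hk1 he
            rw [blk_wr_same (by have := ha u'; omega)]
            omega
          · have e7 := entry_le (l := ell T) (show pos a (kk T) k' u' < th T by omega)
            rw [blk_wr_entry (Ne.symm he), blk_wr_disj (by omega),
              h4 k' u' hu' hk' (by omega)]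
        · rw [wr_of_disj (by omega), wr_one, h5 i hi]
          by_cases hih : i = h
          · subst hih
            simp [hnx, hk1]
          · rw [if_neg (by omega)]
            congr 1
            exact decide_eq_decide.2 (by omega)
        · rw [wr_of_disj (by omega), wr_of_disj (by omega), h6 A hA hA']
      · intro hc1
        have hk1 : ¬ k + 1 < a u := by
          intro hk1
          apply hc1
          simp
          omega
        refine Runs.set 0 rfl (by simp) ?_
        refine ⟨by simp [h2], ?_, by simpa using h4, fun i hi => ?_, by simpa using h6, by omega⟩
        · rw [Finset.sum_range_succ, hnx, decide_eq_false hk1]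
          simpa using h3
        · simp only [St.set_mem]
          rw [h5 i hi]
          by_cases hih : i = h
          · subst hih
            simp [hnx, hk1]
          · congr 1
            exact decide_eq_decide.2 (by omega)
    · rintro s1 t1 ⟨h7, h8, h9, h10, h11, ht⟩ -
      have := ok.kk_lt_th
      refine Runs.set (h + 1) (by simp [h7]) (by simp [h7]; omega) ⟨h + 1, ⟨by omega, by simp,
        by simpa using h8, by simpa using h9, by simpa using h10, by simpa using h11⟩, by omega⟩
  · rintro s' t h ⟨h1, h2, h3, h4, h5, h6⟩ hf hc ht
    have hL0 := hf.reg .L (by decide)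
    simp [hL] at hL0
    have hhL : h = L := by
      have : ¬ h < L := by simpa [h2, hL0] using hc
      omega
    subst hhL
    exact ⟨fun i hi => by rw [h5 i hi]; simp [hi], h6, by omega⟩

/-- A heavy block owns at least `th T` bits of the region, and this threshold is exactly the size of
a table of `kk T + 1` prefix sums of `ell T` bits. -/
theorem heavyBlock_runs (ok : Ok T w M) {s : St} (hE : Env T s) {f : ℕ → ℕ} {S L eB : ℕ}
    (hS : s.reg .S = S) (heB : s.reg .eB = eB) (hlt : th T ≤ L)
    (hp : ∀ i ≤ kk T, blk s.mem (i * ell T) (ell T) = f i) (hf2 : ∀ i, f i < 2 ^ ell T)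
    (hM : eB + S + L ≤ M) (hxe : xB T ≤ eB) :
    Runs T w M heavyBlock s fun s' t =>
      (∀ i ≤ kk T, blk s'.mem (eB + S + i * ell T) (ell T) = f i) ∧
      (∀ A, ptB T ≤ A → (A < eB + S ∨ eB + S + L ≤ A) → s'.mem A = s.mem A) ∧
      t ≤ 3 * kk T + 6 := by
  have hT := ok.text
  have hbig := ok.big
  have hle := ok.le
  have hell := ok.ell_le
  have e2 := ptB_eq T
  have e3 := hB_eq T
  have e4 := xB_eq T
  refine Runs.set_seq 0 rfl (by simp) ?_
  refine Runs.loop (fun j s' => j ≤ kk T + 1 ∧ s'.reg .j = j ∧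
      (∀ i < j, blk s'.mem (eB + S + i * ell T) (ell T) = f i) ∧
      (∀ A, (A < eB + S ∨ eB + S + L ≤ A) → s'.mem A = s.mem A))
    (fun j => 3 * (kk T + 1 - j)) 0 ⟨by omega, by simp, by simp, by simp⟩ ?_ ?_ ?_
  · rintro j s0 - hf
    have hK0 := hf.reg .K (by decide)
    simp [hE.K] at hK0
    simp [hK0]
    omega
  · rintro j s0 ⟨h1, h2, h3, h4⟩ hf hc
    have hE0 := (hE.set (x := .j) 0 (by decide)).frame hf (by decide)
    have hS0 := hf.reg .S (by decide)
    have heB0 := hf.reg .eB (by decide)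
    simp [hS, heB] at hS0 heB0
    have hj : j < kk T + 1 := by simpa [h2, hE0.K] using hc
    have e1 := entry_le (l := ell T) hj
    rw [← th_eq] at e1
    refine Runs.store_seq (by simp [hE0.pB, hE0.ell, h2, heB0, hS0]; omega) ?_
    simp only [eval_add, eval_var, eval_mul, eval_load, hE0.pB, hE0.ell, h2, heB0, hS0, zero_add]
    have hv : blk s0.mem (j * ell T) (ell T) = f j := by
      rw [← hp j (by omega)]
      exact blk_congr fun A _ hA => h4 A (by omega)
    rw [hv]
    refine Runs.set (j + 1) (by simp [h2]) (by simp [h2]; omega)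
      ⟨j + 1, ⟨by omega, by simp, fun i hi => ?_, fun A hA => ?_⟩, by omega⟩
    · simp only [St.set_mem]
      rcases Nat.lt_succ_iff_lt_or_eq.1 hi with h5 | rfl
      · rw [blk_wr_entry (by omega), h3 i h5]
      · exact blk_wr_same (hf2 _)
    · simp only [St.set_mem]
      rw [wr_of_disj (by omega), h4 A hA]
  · rintro s' t j ⟨h1, h2, h3, h4⟩ hf hc ht
    have hK0 := hf.reg .K (by decide)
    simp [hE.K] at hK0
    have hj : j = kk T + 1 := by
      have : ¬ j < kk T + 1 := by simpa [h2, hK0] using hc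
      omega
    subst hj
    exact ⟨fun i hi => h3 i (by omega), fun A _ hA => h4 A hA, by omega⟩

end Build

/-! ### Tables of all blocks. -/

section Build

variable {σ : ℕ} {T : List (Fin σ)} {F : List (List (Fin σ))} {w M : ℕ}

/-- The tables for the block of nodes that starts with the node `X`. -/
structure Block (T : List (Fin σ)) (F : List (List (Fin σ))) (eB X : ℕ) (m : ℕ → Bool) :
    Prop where
  bit : ∀ u < kk T, m (hB T + (X + u)) = decide (0 < arr T F (X + u))
  light : psum T F (X + kk T) < psum T F X + th T → ∀ h, psum T F X + h < psum T F (X + kk T) →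
    m (eB + (psum T F X + h)) = hasNext (fun u => arr T F (X + u)) (kk T) h
  heavy : psum T F X + th T ≤ psum T F (X + kk T) → ∀ j ≤ kk T,
    blk m (eB + psum T F X + j * ell T) (ell T) = psum T F (X + j)

theorem Block.congr {eB X : ℕ} {m m' : ℕ → Bool} (h : Block T F eB X m)
    (h1 : ∀ A, hB T + X ≤ A → A < hB T + (X + kk T) → m' A = m A)
    (h2 : ∀ A, eB + psum T F X ≤ A → A < eB + psum T F (X + kk T) → m' A = m A) :
    Block T F eB X m' := by
  refine ⟨fun u hu => ?_, fun hl i hi => ?_, fun hl j hj => ?_⟩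
  · rw [h1 _ (by omega) (by omega), h.bit u hu]
  · rw [h2 _ (by omega) (by omega), h.light hl i hi]
  · rw [← h.heavy hl j hj]
    have e1 := entry_le (l := ell T) (show j < kk T + 1 by omega)
    rw [← th_eq] at e1
    exact blk_congr fun A _ _ => h2 A (by omega) (by omega)

/-- The state while the tables are built, when `b` blocks are finished. -/
structure Building (T : List (Fin σ)) (F : List (List (Fin σ))) (eB : ℕ) (s : St) (b : ℕ)
    (s' : St) : Prop where
  le : b * kk T < nN T + kk T
  x : s'.reg .x = b * kk T
  y : s'.reg .y = b
  S : s'.reg .S = psum T F (b * kk T)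
  ptr : ∀ i < b, blk s'.mem (ptB T + i * ell T) (ell T) = psum T F (i * kk T)
  block : ∀ i < b, Block T F eB (i * kk T) s'.mem
  hz : ∀ A, hB T + b * kk T ≤ A → A < xB T → s'.mem A = false
  ez : ∀ A, eB + psum T F (b * kk T) ≤ A → s'.mem A = false
  rest : ∀ A, xB T ≤ A → A < eB → s'.mem A = s.mem A

/-- A bound for the time that is spent on a node when the tables are built. -/
def buildCost (T : List (Fin σ)) (F : List (List (Fin σ))) (i : ℕ) : ℕ :=
  nodeCost T F i + 7 * arr T F i + 20

theorem fillBlock_runs (ok : Ok T w M) (hF : IsGreedy T F) {s : St} (hE : Env T s) {eB X : ℕ}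
    (heB : s.reg .eB = eB) (hxe : xB T ≤ eB) (heM : eB + F.length ≤ M)
    {s1 : St} (hC : Counted T F X s1 s)
    (hS : s.reg .S = psum T F X) (hX : X ≤ nN T)
    (hz : ∀ A, eB + psum T F X ≤ A → s.mem A = false) :
    Runs T w M (.ite (.lt V.L V.Th) lightBlock heavyBlock) s fun s' t =>
      Block T F eB X s'.mem ∧
      (∀ A, ptB T ≤ A → (A < eB + psum T F X ∨ eB + psum T F (X + kk T) ≤ A) →
        s'.mem A = s.mem A) ∧
      t ≤ 7 * s.reg .L + 3 * kk T + 8 := by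
  have hL := hC.L
  have hsum := psum_add_sum (T := T) (F := F) X (kk T)
  have hpz := psum_le ok.text hF (X + kk T)
  have e3 := hB_eq T
  have e4 := xB_eq T
  refine Runs.ite (by simp) ?_ ?_
  · intro hc
    have hlt : s.reg .L < th T := by simpa [hE.Th] using hc
    refine (lightBlock_runs ok hE hS rfl heB (a := fun u => arr T F (X + u)) (by omega) hlt hC.tail
      hC.q (fun u => (arr_le_length ok.text hF _).trans_lt
        (hF.length_le.trans_lt lt_two_pow_ell)) (fun h hh => hz _ (by omega)) (by omega)
      hxe).mono ?_
    rintro s' t ⟨h1, h2, h3⟩ -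
    refine ⟨⟨fun u hu => ?_, fun _ h hh => h1 h (by omega), fun h4 => by omega⟩,
      fun A hA hA' => h2 A hA (by omega), by omega⟩
    rw [h2 _ (by omega) (by omega), hC.h u hu]
  · intro hc
    have hlt : th T ≤ s.reg .L := by simpa [hE.Th] using hc
    refine (heavyBlock_runs ok hE hS heB hlt (f := fun i => psum T F (X + i)) hC.p
      (fun i => psum_lt_two_pow ok.text hF _) (by omega) hxe).mono ?_
    rintro s' t ⟨h1, h2, h3⟩ -
    refine ⟨⟨fun u hu => ?_, fun h4 => by omega, fun _ => h1⟩,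
      fun A hA hA' => h2 A hA (by omega), by omega⟩
    rw [h2 _ (by omega) (by omega), hC.h u hu]

/-- A block touches, apart from scratch space, only its own pointer, its own node bits and its own
part of the region at `eB`. So the finished blocks keep their tables and the counters remain
readable. -/
theorem building_step (ok : Ok T w M) (hF : IsGreedy T F) {s : St} (hm : Edges T F s.mem)
    {eB : ℕ} (hxe : xB T + 2 * T.length ≤ eB) (heM : eB + F.length ≤ M) {b : ℕ} {s0 : St}
    (hE : Env T s0) (heB : s0.reg .eB = eB) (hI : Building T F eB s b s0)
    (hb : b * kk T < nN T) :
    Runs T w M (.store (V.ptB + V.y * V.ell) V.ell V.S ;; blockCounts ;;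
      .ite (.lt V.L V.Th) lightBlock heavyBlock ;;
      V.S ≔ V.S + V.L ;; V.x ≔ V.x + V.K ;; V.y ≔ V.y + 1) s0 fun s' t =>
      Building T F eB s (b + 1) s' ∧
      t + 1 ≤ ∑ u ∈ Finset.range (kk T), buildCost T F (b * kk T + u) := by
  have hT := ok.text
  have hbig := ok.big
  have hle := ok.le
  have hell := ok.ell_le
  have hkp := ok.kk_pos
  have e2 := ptB_eq T
  have e3 := hB_eq T
  have e4 := xB_eq T
  have hzn := hF.length_le
  have hNn := ok.nN_le
  have hkth := ok.kk_lt_th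
  have hbd : b ≤ nN T / kk T := (Nat.le_div_iff_mul_le hkp).2 hb.le
  have e5 := entry_le (l := ell T) (show b < nN T / kk T + 2 by omega)
  have hbk : b ≤ b * kk T := Nat.le_mul_of_pos_right b hkp
  have hpX := psum_le hT hF (b * kk T)
  have hpXk := psum_le hT hF (b * kk T + kk T)
  have hpm := psum_mono (T := T) (F := F) (show b * kk T ≤ b * kk T + kk T by omega)
  have hmul : (b + 1) * kk T = b * kk T + kk T := by ring
  have hsum := psum_add_sum (T := T) (F := F) (b * kk T) (kk T)
  have hold : ∀ i < b, i * kk T + kk T ≤ b * kk T := fun i hi => entry_le hi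
  have hps := psum_lt_two_pow hT hF (b * kk T)
  refine Runs.store_seq (by simp [hE.ptB, hE.ell, hI.y]; omega) ?_
  simp only [eval_add, eval_var, eval_mul, hE.ptB, hE.ell, hI.y, hI.S]
  set m1 := wr s0.mem (ptB T + b * ell T) (ell T) (psum T F (b * kk T)) with hm1
  have hd1 : ∀ A, (A < ptB T ∨ hB T ≤ A) → m1 A = s0.mem A := fun A hA => by
    rw [hm1, wr_of_disj (by omega)]
  have hptr : ∀ i < b + 1, blk m1 (ptB T + i * ell T) (ell T) = psum T F (i * kk T) := by
    intro i hi
    rcases Nat.lt_succ_iff_lt_or_eq.1 hi with h1 | rfl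
    · rw [hm1, blk_wr_entry (by omega), hI.ptr i h1]
    · exact blk_wr_same hps
  have hE1 := hE.mem m1
  refine Runs.bind (blockCounts_runs ok hF hE1 (X := b * kk T) ?_ hb.le hI.x hI.S ?_) ?_
  · exact hm.congr hT fun A hA hA' => by
      dsimp only
      rw [hd1 A (by omega), hI.rest A hA (by omega)]
  · intro u hu
    dsimp only
    rw [hd1 _ (by omega), hI.hz _ (by omega) (by omega)]
  rintro s2 t2 ⟨hC, ht2⟩ hf2
  have hE2 := hE1.frame hf2 (by decide)
  have heB2 := hf2.reg .eB (by decide)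
  have hS2 := hf2.reg .S (by decide)
  have hx2 := hf2.reg .x (by decide)
  have hy2 := hf2.reg .y (by decide)
  simp only [heB, hI.S, hI.x, hI.y] at heB2 hS2 hx2 hy2
  have hL2 := hC.L
  refine Runs.bind (fillBlock_runs ok hF hE2 heB2 (by omega) heM hC hS2 hb.le ?_) ?_
  · intro A hA
    rw [hC.rest A (by omega) (by omega)]
    dsimp only
    rw [hd1 A (by omega), hI.ez A hA]
  rintro s3 t3 ⟨hB3, hr3, ht3⟩ hf3
  have hE3 := hE2.frame hf3 (by decide)
  have hS3 := hf3.reg .S (by decide)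
  have hx3 := hf3.reg .x (by decide)
  have hy3 := hf3.reg .y (by decide)
  have hL3 := hf3.reg .L (by decide)
  rw [hS2] at hS3
  rw [hx2] at hx3
  rw [hy2] at hy3
  have hchain : ∀ A, ptB T ≤ A → (A < hB T + b * kk T ∨ hB T + (b * kk T + kk T) ≤ A) →
      (A < eB + psum T F (b * kk T) ∨ eB + psum T F (b * kk T + kk T) ≤ A) →
      s3.mem A = m1 A := fun A h1 h2 h3 => by
    rw [hr3 A h1 h3, hC.rest A h1 h2]
  refine Runs.set_seq (psum T F (b * kk T + kk T)) (by simp [hS3, hL3, hL2])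
    (by simp [hS3, hL3, hL2]; omega) ?_
  refine Runs.set_seq (b * kk T + kk T) (by simp [hx3, hE3.K]) (by simp [hx3, hE3.K]; omega) ?_
  refine Runs.set (b + 1) (by simp [hy3]) (by simp [hy3]; omega) ⟨⟨by omega, by simp [hmul],
    by simp, by simp [hmul], fun i hi => ?_, fun i hi => ?_, fun A hA hA' => ?_, fun A hA => ?_,
    fun A hA hA' => ?_⟩, ?_⟩
  · have h1 := entry_le (l := ell T) (show i < nN T / kk T + 2 by omega)
    rw [← hptr i hi]
    exact blk_congr fun A h2 h3 => hchain A (by omega) (by omega) (by omega)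
  · rcases Nat.lt_succ_iff_lt_or_eq.1 hi with h1 | rfl
    · have h2 := hold i h1
      have h3 := psum_mono (T := T) (F := F) h2
      exact (hI.block i h1).congr
        (fun A h4 h5 => (hchain A (by omega) (by omega) (by omega)).trans (hd1 A (by omega)))
        (fun A h4 h5 => (hchain A (by omega) (by omega) (by omega)).trans (hd1 A (by omega)))
    · exact hB3
  · simp only [St.set_mem]
    rw [hchain A (by omega) (by omega) (by omega), hd1 A (by omega), hI.hz A (by omega) hA']
  · simp only [St.set_mem]
    rw [hmul] at hA
    rw [hchain A (by omega) (by omega) (by omega), hd1 A (by omega), hI.ez A (by omega)]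
  · simp only [St.set_mem]
    rw [hchain A (by omega) (by omega) (by omega), hd1 A (by omega), hI.rest A hA hA']
  · have h1 : ∑ u ∈ Finset.range (kk T), buildCost T F (b * kk T + u) =
        ∑ u ∈ Finset.range (kk T), nodeCost T F (b * kk T + u) +
          7 * ∑ u ∈ Finset.range (kk T), arr T F (b * kk T + u) + kk T * 20 := by
      simp only [buildCost, Finset.sum_add_distrib, Finset.mul_sum, Finset.sum_const,
        Finset.card_range, smul_eq_mul]
    -- The surplus of 20 steps per node pays for the table of a heavy block and for the constant
    -- overhead, since a block has at least four nodes.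
    have h2 : 4 ≤ kk T := by
      have := ok.ell_pos
      unfold kk
      omega
    omega

/-- The tables. -/
structure Tables (T : List (Fin σ)) (F : List (List (Fin σ))) (eB : ℕ) (m : ℕ → Bool) :
    Prop where
  ptr : ∀ i, i * kk T < nN T + kk T →
    blk m (ptB T + i * ell T) (ell T) = psum T F (i * kk T)
  block : ∀ i, i * kk T < nN T → Block T F eB (i * kk T) m

/-- Full nodes are distinct factors, so eight times their lengths sum up to at most `8 n`; the
points contribute at most `9 n` and every node contributes 70. -/
theorem sum_buildCost_le (ok : Ok T w M) (hF : IsGreedy T F) (m : ℕ) :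
    ∑ i ∈ Finset.range m, buildCost T F i ≤ 17 * T.length + 70 * m := by
  have h1 : ∑ i ∈ Finset.range m, (if nodeAt T i ∈ F then (nodeAt T i).length else 0) ≤
      T.length := by
    refine le_trans ?_ (sum_length_full_le hF)
    refine Finset.sum_le_sum_of_ne_zero fun i _ hi => ?_
    rw [Finset.mem_range]
    by_contra h
    apply hi
    rw [nodeAt, nodeList, List.getElem?_eq_none (by rw [Finset.length_sort]; omega)]
    simp
  have h2 : ∑ i ∈ Finset.range m, arr T F i ≤ T.length :=
    (psum_le ok.text hF m).trans hF.length_le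
  have h3 : ∑ i ∈ Finset.range m, buildCost T F i =
      8 * ∑ i ∈ Finset.range m, (if nodeAt T i ∈ F then (nodeAt T i).length else 0) +
        9 * ∑ i ∈ Finset.range m, arr T F i + 70 * m := by
    rw [Finset.mul_sum, Finset.mul_sum, ← Finset.sum_add_distrib]
    have h4 : 70 * m = ∑ i ∈ Finset.range m, 70 := by simp [mul_comm]
    rw [h4, ← Finset.sum_add_distrib]
    refine Finset.sum_congr rfl fun i _ => ?_
    rw [buildCost, nodeCost]
    split <;> ring
  omega

theorem kk_le (T : List (Fin σ)) : kk T ≤ 4 * T.length := by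
  have : ell T ≤ T.length := Nat.size_le.2 Nat.lt_two_pow_self
  unfold kk
  omega

theorem build_runs (ok : Ok T w M) (hF : IsGreedy T F) {s : St} (hE : Env T s)
    (hm : Counters T F s.mem) {eB : ℕ} (heB : s.reg .eB = eB)
    (hxe : xB T + 2 * T.length ≤ eB) (heM : eB + F.length ≤ M) :
    Runs T w M build s fun s' t => Tables T F eB s'.mem ∧
      (∀ A, eB + F.length ≤ A → s'.mem A = false) ∧
      (∀ A, xB T ≤ A → A < eB → s'.mem A = s.mem A) ∧ t ≤ 500 * T.length + 10 := by
  have hT := ok.text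
  have hbig := ok.big
  have hle := ok.le
  have hell := ok.ell_le
  have hkp := ok.kk_pos
  have e3 := hB_eq T
  have e4 := xB_eq T
  have hNn := ok.nN_le
  have hk4 := kk_le T
  -- The number of nodes is rounded up to whole blocks.
  have hcost := sum_buildCost_le ok hF ((nN T / kk T + 1) * kk T)
  have hdm : nN T / kk T * kk T ≤ nN T := Nat.div_mul_le_self _ _
  rw [add_mul, one_mul] at hcost
  refine Runs.set_seq 0 rfl (by simp) (Runs.set_seq 0 rfl (by simp)
    (Runs.set_seq 0 rfl (by simp) ?_))
  have hE0 := ((hE.set (x := .S) 0 (by decide)).set (x := .x) 0 (by decide)).set (x := .y) 0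
    (by decide)
  refine Runs.bind (Q₁ := fun s' t => ∃ b, Building T F eB s b s' ∧ nN T ≤ b * kk T ∧
    t ≤ ∑ i ∈ Finset.range ((nN T / kk T + 1) * kk T), buildCost T F i + 1)
    (Runs.loop (Building T F eB s)
    (fun b => ∑ i ∈ Finset.range ((nN T / kk T + 1) * kk T), buildCost T F i -
      ∑ i ∈ Finset.range (b * kk T), buildCost T F i) 0 ?_ ?_ ?_ ?_) ?_
  · refine ⟨by omega, by simp, by simp, by simp [psum], by simp, by simp, fun A h1 h2 => ?_,
      fun A h1 => ?_, by simp⟩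
    · exact hm.rest A (Or.inl h2)
    · exact hm.rest A (Or.inr (by omega))
  · intros
    simp
  · intro b s0 hI hf hc
    have hE1 := hE0.frame hf (by decide)
    have heB1 := hf.reg .eB (by decide)
    simp [heB] at heB1
    have hb : b * kk T < nN T := by simpa [hI.x, hE1.N] using hc
    refine (building_step ok hF hm.toEdges hxe heM hE1 heB1 hI hb).mono ?_
    rintro s' t ⟨h1, h2⟩ -
    refine ⟨b + 1, h1, ?_⟩
    have hbd : b ≤ nN T / kk T := (Nat.le_div_iff_mul_le hkp).2 hb.le
    have h3 : ∑ i ∈ Finset.range ((b + 1) * kk T), buildCost T F i ≤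
        ∑ i ∈ Finset.range ((nN T / kk T + 1) * kk T), buildCost T F i :=
      Finset.sum_le_sum_of_subset (Finset.range_mono (Nat.mul_le_mul_right _ (by omega)))
    rw [add_mul b, one_mul, Finset.sum_range_add] at h3 ⊢
    omega
  · intro s' t b hI hf hc ht
    have hE1 := hE0.frame hf (by decide)
    refine ⟨b, hI, by simpa [hI.x, hE1.N] using hc, ?_⟩
    simp at ht
    omega
  · rintro s1 t1 ⟨b, hI, hb, ht1⟩ hf
    have hE1 := hE0.frame hf (by decide)
    have hbl := hI.le
    have hbd : b ≤ nN T / kk T + 1 := by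
      rcases Nat.eq_zero_or_pos b with h | h
      · rw [h]
        exact Nat.zero_le _
      · have h1 := hI.le
        obtain ⟨c, rfl⟩ : ∃ c, b = c + 1 := ⟨b - 1, by omega⟩
        rw [add_mul, one_mul] at h1
        have := (Nat.le_div_iff_mul_le hkp (x := c)).2 (by omega : c * kk T ≤ nN T)
        omega
    have e5 := entry_le (l := ell T) (show b < nN T / kk T + 2 by omega)
    have hpX := psum_le hT hF (b * kk T)
    refine Runs.store (by simp [hE1.ptB, hE1.ell, hI.y]; omega) ?_
    simp only [eval_add, eval_var, eval_mul, hE1.ptB, hE1.ell, hI.y, hI.S]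
    rw [add_mul, one_mul] at ht1
    refine ⟨⟨fun i hi => ?_, fun i hi => ?_⟩, fun A hA => ?_, fun A hA hA' => ?_, by omega⟩
    · have hib : i < b + 1 := by
        by_contra h1
        have := Nat.mul_le_mul_right (kk T) (show b + 1 ≤ i by omega)
        rw [add_mul, one_mul] at this
        omega
      rcases Nat.lt_succ_iff_lt_or_eq.1 hib with h1 | rfl
      · rw [blk_wr_entry (by omega), hI.ptr i h1]
      · exact blk_wr_same (psum_lt_two_pow hT hF _)
    · have hib : i < b := by
        by_contra h1
        have := Nat.mul_le_mul_right (kk T) (show b ≤ i by omega)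
        omega
      exact (hI.block i hib).congr (fun A h1 h2 => wr_of_disj (by omega))
        (fun A h1 h2 => wr_of_disj (by omega))
    · rw [wr_of_disj (by omega)]
      exact hI.ez A (by omega)
    · rw [wr_of_disj (by omega)]
      exact hI.rest A hA hA'

theorem Tables.congr (ok : Ok T w M) (hF : IsGreedy T F) {eB : ℕ} {m m' : ℕ → Bool}
    (h : Tables T F eB m) (h1 : ∀ A, A < xB T → m' A = m A)
    (h2 : ∀ A, eB ≤ A → A < eB + F.length → m' A = m A) : Tables T F eB m' := by
  have hkp := ok.kk_pos
  have e3 := hB_eq T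
  have e4 := xB_eq T
  refine ⟨fun i hi => ?_, fun i hi => ?_⟩
  · have hib : i < nN T / kk T + 2 := by
      rcases Nat.eq_zero_or_pos i with h | h
      · rw [h]
        exact Nat.succ_pos _
      · obtain ⟨c, rfl⟩ : ∃ c, i = c + 1 := ⟨i - 1, by omega⟩
        rw [add_mul, one_mul] at hi
        have := (Nat.le_div_iff_mul_le hkp (x := c)).2 (by omega : c * kk T ≤ nN T)
        omega
    have e5 := entry_le (l := ell T) hib
    rw [← h.ptr i hi]
    exact blk_congr fun A h3 h4 => h1 A (by omega)
  · have h3 := psum_le ok.text hF (i * kk T + kk T)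
    exact (h.block i hi).congr (fun A h4 h5 => h1 A (by omega))
      (fun A h4 h5 => h2 A (by omega) (by omega))

theorem clearCmd_runs (ok : Ok T w M) {s : St} (hE : Env T s) :
    Runs T w M clearCmd s fun s' t =>
      (∀ A, s'.mem A = if xB T ≤ A ∧ A < xB T + 2 * T.length then false else s.mem A) ∧
      t ≤ 6 * T.length + 2 := by
  have hbig := ok.big
  have hle := ok.le
  refine Runs.set_seq 0 rfl (by simp) ?_
  refine Runs.loop (fun g s' => g ≤ 2 * T.length ∧ s'.reg .j = g ∧
    ∀ a, s'.mem a = if xB T ≤ a ∧ a < xB T + g then false else s.mem a)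
    (fun g => 3 * (2 * T.length - g)) 0 ?_ ?_ ?_ ?_
  · refine ⟨by omega, by simp, fun a => ?_⟩
    rw [if_neg (by omega)]
    rfl
  · rintro g s' ⟨hg, h1, h2⟩ hf
    have e1 := hf.reg .n (by decide)
    simp [hE.n] at e1
    simp [e1]
    omega
  · rintro g s' ⟨hg, h1, h2⟩ hf hc
    have e1 := hf.reg .n (by decide)
    have e2 := hf.reg .xB (by decide)
    simp [hE.n, hE.xB] at e1 e2
    have hgk : g < 2 * T.length := by
      have : g < T.length + T.length := by simpa [h1, e1] using hc
      omega
    refine Runs.store_seq ?_ ?_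
    · simp [e2, h1]
      have := ok.one_le
      omega
    refine Runs.set (g + 1) (by simp [h1]) (by simp [h1]; omega)
      ⟨g + 1, ⟨by omega, by simp, fun a => ?_⟩, by omega⟩
    simp only [St.set_mem, eval_add, eval_var, e2, h1, eval_lit_0, eval_lit_1, wr_one, h2]
    by_cases h3 : a = xB T + g
    · rw [if_pos h3, if_pos (by omega), Nat.zero_testBit]
    · rw [if_neg h3]
      exact if_congr (by omega) rfl rfl
  · rintro s' t g ⟨hg, h1, h2⟩ hf hc ht
    have e1 := hf.reg .n (by decide)
    simp [hE.n] at e1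
    have hgk : g = 2 * T.length := by
      have : ¬ g < T.length + T.length := by simpa [h1, e1] using hc
      omega
    subst hgk
    exact ⟨h2, by omega⟩

end Build

/-! ### Slots of the LZ trie nodes and constant-time moves along an edge. -/

section Cursor

variable {σ : ℕ} (T : List (Fin σ)) (F : List (List (Fin σ)))

/-- The first node of the block of the node `v`. -/
def blockStart (v : ℕ) : ℕ := v / kk T * kk T

/-- Whether the node `v` is in a block with few LZ trie nodes. -/
def IsLight (v : ℕ) : Prop :=
  psum T F (blockStart T v + kk T) < psum T F (blockStart T v) + th T

open Classical in
/-- The position at which data is stored for the `k`-th LZ trie node on the edge to `v`. -/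
noncomputable def slotOf (v k : ℕ) : ℕ :=
  if IsLight T F v then
    psum T F (blockStart T v) +
      pos (fun u => arr T F (blockStart T v + u)) (kk T) k (v - blockStart T v)
  else psum T F v + k

/-- The cursor is at the `k`-th LZ trie node on the edge to `v`, or behind the last one. -/
structure Cursor (v k : ℕ) (s : St) : Prop where
  ex : s.reg .ex = (decide (k < arr T F v)).toNat
  slot : s.reg .slot = slotOf T F v k
  light : IsLight T F v → s.reg .hv = 0 ∧
    s.reg .st = psum T F (blockStart T v) +
      lv (fun u => arr T F (blockStart T v + u)) (kk T) k ∧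
    s.reg .st2 = psum T F (blockStart T v) +
      lv (fun u => arr T F (blockStart T v + u)) (kk T) (k + 1)
  heavy : ¬ IsLight T F v → s.reg .hv = 1 ∧ s.reg .st2 = psum T F (v + 1)

variable {T F} {w M : ℕ}

theorem Cursor.congr {v k : ℕ} {s s' : St} (h : Cursor T F v k s)
    (hr : ∀ x ∈ [V.ex, V.slot, V.hv, V.st, V.st2], s'.reg x = s.reg x) : Cursor T F v k s' := by
  simp only [List.forall_mem_cons] at hr
  obtain ⟨h1, h2, h3, h4, h5, -⟩ := hr
  exact ⟨h1.trans h.ex, h2.trans h.slot, by rw [h3, h4, h5]; exact h.light,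
    by rw [h3, h5]; exact h.heavy⟩

theorem blockStart_le (v : ℕ) : blockStart T v ≤ v := Nat.div_mul_le_self _ _

theorem lt_blockStart (ok : Ok T w M) (v : ℕ) : v < blockStart T v + kk T := by
  have h1 := Nat.div_add_mod v (kk T)
  have h2 := Nat.mod_lt v ok.kk_pos
  rw [blockStart, mul_comm]
  omega

/-- Slots are permuted only within a block: each one stays in the range that pre-order assigns to
the block. The disjointness of these ranges gives injectivity, and their size bounds the
displacement. -/
theorem slotOf_bounds (ok : Ok T w M) {v k : ℕ} (h : k < arr T F v) :
    psum T F (blockStart T v) ≤ slotOf T F v k ∧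
      slotOf T F v k < psum T F (blockStart T v + kk T) := by
  have h1 := blockStart_le (T := T) v
  have h2 := lt_blockStart ok v
  rw [slotOf]
  split_ifs with hl
  · have h3 := pos_lt_total (a := fun u => arr T F (blockStart T v + u)) (K := kk T) (k := k)
      (u := v - blockStart T v) (by omega) (by simpa [Nat.add_sub_cancel' h1] using h)
    have h4 := psum_add_sum (T := T) (F := F) (blockStart T v) (kk T)
    omega
  · have h3 := psum_mono (T := T) (F := F) h1
    have h4 := psum_mono (T := T) (F := F) (show v + 1 ≤ blockStart T v + kk T by omega)
    rw [psum_succ] at h4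
    omega

theorem slotOf_lt (ok : Ok T w M) (hF : IsGreedy T F) {v k : ℕ} (h : k < arr T F v) :
    slotOf T F v k < F.length :=
  (slotOf_bounds ok h).2.trans_le (psum_le ok.text hF _)

/-- Equal slots lie in the same block; inside a block, level order (`pos_inj`) or pre-order
separates the points. -/
theorem slotOf_inj (ok : Ok T w M) {v k v' k' : ℕ} (h : k < arr T F v) (h' : k' < arr T F v')
    (he : slotOf T F v k = slotOf T F v' k') : v = v' ∧ k = k' := by
  have h1 := slotOf_bounds ok h
  have h2 := slotOf_bounds ok h'
  have hb : blockStart T v = blockStart T v' := by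
    rcases lt_trichotomy (v / kk T) (v' / kk T) with h3 | h3 | h3
    · have := psum_mono (T := T) (F := F) (entry_le (l := kk T) h3)
      simp only [blockStart] at h1 h2
      omega
    · rw [blockStart, h3, blockStart]
    · have := psum_mono (T := T) (F := F) (entry_le (l := kk T) h3)
      simp only [blockStart] at h1 h2
      omega
  have e1 := blockStart_le (T := T) v
  have e2 := lt_blockStart ok v
  have e3 := blockStart_le (T := T) v'
  have e4 := lt_blockStart ok v'
  rw [slotOf, slotOf] at he
  have hll : IsLight T F v ↔ IsLight T F v' := by rw [IsLight, IsLight, hb]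
  by_cases hl : IsLight T F v
  · rw [if_pos hl, if_pos (hll.1 hl), hb] at he
    have h3 := pos_inj (a := fun u => arr T F (blockStart T v' + u)) (K := kk T)
      (u := v - blockStart T v') (u' := v' - blockStart T v') (k := k) (k' := k') (by omega)
      (by simpa [Nat.add_sub_cancel' (hb ▸ e1)] using h) (by omega)
      (by simpa [Nat.add_sub_cancel' e3] using h') (by omega)
    omega
  · rw [if_neg hl, if_neg (fun h => hl (hll.2 h))] at he
    rcases lt_trichotomy v v' with h3 | rfl | h3
    · have := psum_mono (T := T) (F := F) (show v + 1 ≤ v' by omega)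
      rw [psum_succ] at this
      omega
    · exact ⟨rfl, by omega⟩
    · have := psum_mono (T := T) (F := F) (show v' + 1 ≤ v by omega)
      rw [psum_succ] at this
      omega

theorem ones_bit {eB v : ℕ} {m : ℕ → Bool}
    (hBl : Block T F eB (blockStart T v) m) {u : ℕ} (hu : u ≤ kk T) :
    ones m (hB T + blockStart T v) u = lc (fun u => arr T F (blockStart T v + u)) 0 u := by
  refine Finset.sum_congr rfl fun t ht => ?_
  rw [Finset.mem_range] at ht
  rw [add_assoc, hBl.bit t (by omega)]
  by_cases h : 0 < arr T F (blockStart T v + t) <;> simp [h]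

/-- Subtract the identity `sum_hasNext` for the beginning of the level from the one for chain `u`.
What remains is a count over at most `kk T` bits, which a single popcount can do. -/
theorem ones_next {eB v k u : ℕ} {m : ℕ → Bool}
    (hBl : Block T F eB (blockStart T v) m) (hl : IsLight T F v) (hu : u ≤ kk T) :
    ones m (eB + (psum T F (blockStart T v) +
      lv (fun u => arr T F (blockStart T v + u)) (kk T) k))
      (lc (fun u => arr T F (blockStart T v + u)) k u) =
      lc (fun u => arr T F (blockStart T v + u)) (k + 1) u := by
  generalize ha : (fun u => arr T F (blockStart T v + u)) = a
  have h1 := sum_hasNext (a := a) (K := kk T) k u hu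
  have h2 := sum_hasNext (a := a) (K := kk T) k 0 (Nat.zero_le _)
  have h3 := pos_le_lv (a := a) (K := kk T) (k := k) hu
  have h4 := lv_le (a := a) (K := kk T) (k + 1)
  have h5 := psum_add_sum (T := T) (F := F) (blockStart T v) (kk T)
  rw [pos, Finset.sum_range_add] at h1
  simp only [pos, lc_zero, add_zero] at h1 h2 h3
  have h6 : ones m (eB + (psum T F (blockStart T v) + lv a (kk T) k)) (lc a k u) =
      ∑ i ∈ Finset.range (lc a k u), (hasNext a (kk T) (lv a (kk T) k + i)).toNat := by
    refine Finset.sum_congr rfl fun i hi => ?_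
    rw [Finset.mem_range] at hi
    have h7 : ∑ t ∈ Finset.range (kk T), a t =
        ∑ t ∈ Finset.range (kk T), arr T F (blockStart T v + t) := by rw [← ha]
    rw [← ha] at h3 h4 hi ⊢
    rw [← hBl.light hl _ (by rw [← ha] at h7; omega), add_assoc, add_assoc]
  rw [h6]
  omega

theorem firstCmd_runs (ok : Ok T w M) (hF : IsGreedy T F) {s : St} (hE : Env T s) {eB v : ℕ}
    (hx : xB T ≤ eB)
    (heB : s.reg .eB = eB) (heM : eB + F.length ≤ M) (hT : Tables T F eB s.mem)
    (hv : v < nN T) (hsv : s.reg .v = v) :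
    Runs T w M firstCmd s fun s' t => Cursor T F v 0 s' ∧ t ≤ 10 := by
  have hbig := ok.big
  have hle := ok.le
  have hell := ok.ell_le
  have hkw := ok.kk_le
  have h1w := ok.one_le
  have hkp := ok.kk_pos
  have e2 := ptB_eq T
  have e3 := hB_eq T
  have e4 := xB_eq T
  have hNn := ok.nN_le
  have hk4 := kk_le T
  have b1 := blockStart_le (T := T) v
  have b2 := lt_blockStart ok v
  have hbs : v / kk T * kk T = blockStart T v := rfl
  have hd : v / kk T ≤ nN T / kk T := Nat.div_le_div_right hv.le
  have hp1 := hT.ptr (v / kk T) (by rw [hbs]; omega)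
  have hp2 := hT.ptr (v / kk T + 1) (by rw [add_mul, one_mul, hbs]; omega)
  have hBl := hT.block (v / kk T) (by rw [hbs]; omega)
  rw [hbs] at hp1 hBl
  rw [add_mul (v / kk T) 1 (kk T), one_mul, hbs] at hp2
  have p1 := psum_le ok.text hF (blockStart T v + kk T)
  have p2 := psum_mono (T := T) (F := F) (show blockStart T v ≤ blockStart T v + kk T by omega)
  have p3 := psum_mono (T := T) (F := F) b1
  have p4 := psum_mono (T := T) (F := F) (show v + 1 ≤ blockStart T v + kk T by omega)
  have hzn := hF.length_le
  have e5 := entry_le (l := ell T) (show v / kk T < nN T / kk T + 2 by omega)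
  have e6 := entry_le (l := ell T) (show v / kk T + 1 < nN T / kk T + 2 by omega)
  have hvd : v / kk T ≤ v := Nat.div_le_self _ _
  refine Runs.set_seq (v / kk T) (by simp [hsv, hE.K]) (by simp) ?_
  refine Runs.set_seq (v - blockStart T v) (by simp [hsv, hE.K, hbs])
    (by simp [hsv, hE.K, hbs]; omega) ?_
  refine Runs.set_seq (psum T F (blockStart T v)) (by simp [hE.ptB, hE.ell, hp1])
    (by simp [hE.ptB, hE.ell]; omega) ?_
  refine Runs.set_seq (psum T F (blockStart T v + kk T) - psum T F (blockStart T v))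
    (by simp [hE.ptB, hE.ell, hp2])
    (by simp [hE.ptB, hE.ell, hp2]; omega) ?_
  have hlc : ∀ k u, lc (fun u => arr T F (blockStart T v + u)) k u ≤ u := lc_le
  have h1 := hlc 0 (kk T)
  have h2 := hlc 0 (v - blockStart T v)
  have hvb : blockStart T v + (v - blockStart T v) = v := by omega
  refine Runs.ite (by simp) ?_ ?_
  · intro hc
    have hl : IsLight T F v := by
      have h3 : psum T F (blockStart T v + kk T) - psum T F (blockStart T v) < th T := by
        simpa [hE.Th] using hc
      rw [IsLight]
      omega
    refine Runs.set_seq 0 rfl (by simp) ?_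
    refine Runs.set_seq (psum T F (blockStart T v)) (by simp) (by simp) ?_
    refine Runs.set_seq (psum T F (blockStart T v) +
      lc (fun u => arr T F (blockStart T v + u)) 0 (kk T))
      (by simp [hE.hB, hE.K, hbs, popcount_blk, ones_bit hBl])
      (by simp [hE.hB, hE.K, hbs, popcount_blk, ones_bit hBl]; omega) ?_
    have h3 := ones_bit hBl (u := v - blockStart T v) (by omega)
    refine Runs.set_seq (psum T F (blockStart T v) +
      lc (fun u => arr T F (blockStart T v + u)) 0 (v - blockStart T v))
      (by simp [hE.hB, hE.K, hbs, popcount_blk, h3])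
      (by simp [hE.hB, hE.K, hbs, popcount_blk, h3]; omega) ?_
    have h4 := hBl.bit (v - blockStart T v) (by omega)
    rw [hvb] at h4
    refine Runs.set (decide (0 < arr T F v)).toNat
      (by simp [hE.hB, hsv, blk_one, h4]) (by simp [hE.hB, hsv]; omega) ?_
    refine ⟨⟨by simp, ?_, fun _ => by simp [lv_zero, lv_succ], fun h => absurd hl h⟩, by omega⟩
    simp [slotOf, if_pos hl, pos, lv_zero]
  · intro hc
    have hl : ¬ IsLight T F v := by
      intro hl
      apply hc
      rw [IsLight] at hl
      simp [hE.Th]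
      omega
    have hl' : psum T F (blockStart T v) + th T ≤ psum T F (blockStart T v + kk T) := by
      rw [IsLight] at hl
      omega
    have h3 := hBl.heavy hl' (v - blockStart T v) (by omega)
    have h4 := hBl.heavy hl' (v - blockStart T v + 1) (by omega)
    rw [hvb] at h3
    rw [← add_assoc, hvb] at h4
    have e7 := entry_le (l := ell T) (show v - blockStart T v < kk T + 1 by omega)
    have e8 := entry_le (l := ell T) (show v - blockStart T v + 1 < kk T + 1 by omega)
    rw [← th_eq] at e7 e8
    refine Runs.set_seq 1 rfl (by simp) ?_
    refine Runs.set_seq (psum T F v) (by simp [heB, hE.ell, h3])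
      (by simp [heB, hE.ell]; omega) ?_
    refine Runs.set_seq (psum T F (v + 1)) (by simp [heB, hE.ell, h4])
      (by simp [heB, hE.ell]; omega) ?_
    rw [psum_succ]
    refine Runs.ite (by simp) ?_ ?_
    · intro hc1
      have h5 : 0 < arr T F v := by simpa using hc1
      refine Runs.set 1 rfl (by simp) ⟨⟨by simp [h5], by simp [slotOf, if_neg hl],
        fun h => absurd h hl, fun _ => by simp [psum_succ]⟩, by omega⟩
    · intro hc1
      have h5 : ¬ 0 < arr T F v := by simpa using hc1
      refine Runs.set 0 rfl (by simp) ⟨⟨by simp [h5], by simp [slotOf, if_neg hl],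
        fun h => absurd h hl, fun _ => by simp [psum_succ]⟩, by omega⟩

/-- In a light block, `st` and `st2` are the beginnings of the current and the next level. The
successor bits from `st` up to the slot give the offset in the next level; those of the whole level
give the size of the next level. In a heavy block the points of an edge are consecutive. -/
theorem nextCmd_runs (ok : Ok T w M) (hF : IsGreedy T F) {s : St} {eB v k : ℕ}
    (heB : s.reg .eB = eB) (heM : eB + F.length ≤ M) (hT : Tables T F eB s.mem)
    (hv : v < nN T) (hk : k < arr T F v) (hC : Cursor T F v k s) :
    Runs T w M nextCmd s fun s' t => Cursor T F v (k + 1) s' ∧ t ≤ 8 := by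
  have hbig := ok.big
  have hkw := ok.kk_le
  have h1w := ok.one_le
  have b1 := blockStart_le (T := T) v
  have b2 := lt_blockStart ok v
  have hbs : v / kk T * kk T = blockStart T v := rfl
  have hBl := hT.block (v / kk T) (by rw [hbs]; omega)
  rw [hbs] at hBl
  have hzn := hF.length_le
  have hsl := slotOf_lt ok hF hk
  have p1 := psum_le ok.text hF (blockStart T v + kk T)
  have hvb : blockStart T v + (v - blockStart T v) = v := by omega
  refine Runs.ite (by simp) ?_ ?_
  · intro hc
    have hl : IsLight T F v := by
      by_contra hl
      have h1 := (hC.heavy hl).1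
      simp [h1] at hc
    obtain ⟨h1, h2, h3⟩ := hC.light hl
    have h4 := hC.slot
    have h5 := fun u (hu : u ≤ kk T) => ones_next (k := k) hBl hl hu
    have h6 := psum_add_sum (T := T) (F := F) (blockStart T v) (kk T)
    rw [slotOf, if_pos hl] at h4 hsl
    have hlt : psum T F (blockStart T v + kk T) < psum T F (blockStart T v) + th T := hl
    have hlight := hBl.light hlt
    generalize ha : (fun u => arr T F (blockStart T v + u)) = a at *
    have hka : k < a (v - blockStart T v) := by rw [← ha]; simpa [hvb] using hk
    have hav : a (v - blockStart T v) = arr T F v := by rw [← ha]; simp [hvb]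
    have hsum : (Finset.range (kk T)).sum a =
        ∑ t ∈ Finset.range (kk T), arr T F (blockStart T v + t) := by rw [← ha]
    have h7 := pos_lt_total (K := kk T) (by omega) hka
    have h8 := lv_le (a := a) (K := kk T) (k + 1)
    have h8' := lv_le (a := a) (K := kk T) (k + 1 + 1)
    rw [hsum] at h7 h8 h8'
    have h9 := hlight (pos a (kk T) k (v - blockStart T v)) (by omega)
    rw [hasNext_pos (by omega) hka, hav] at h9
    have h10 := lc_le (a := a) k (v - blockStart T v)
    have h11 := lc_le (a := a) k (kk T)
    have h12 := h5 (v - blockStart T v) (by omega)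
    have h13 := h5 (kk T) le_rfl
    have h14 := lv_succ (a := a) (K := kk T) k
    have h15 := lv_succ (a := a) (K := kk T) (k + 1)
    have h16 : lc a (k + 1) (v - blockStart T v) ≤ lc a (k + 1) (kk T) := lc_mono (by omega)
    have h17 : lc a k (v - blockStart T v) ≤ lc a k (kk T) := lc_mono (by omega)
    have hpos : pos a (kk T) k (v - blockStart T v) =
      lv a (kk T) k + lc a k (v - blockStart T v) := rfl
    -- The numbers of bits to be counted are numbers of chains, hence at most `kk T` and thus at
    -- most a word.
    have d1 : psum T F (blockStart T v) + pos a (kk T) k (v - blockStart T v) -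
        (psum T F (blockStart T v) + lv a (kk T) k) = lc a k (v - blockStart T v) := by
      omega
    have d2 : psum T F (blockStart T v) + lv a (kk T) (k + 1) -
        (psum T F (blockStart T v) + lv a (kk T) k) = lc a k (kk T) := by
      omega
    refine Runs.set_seq (decide (k + 1 < arr T F v)).toNat (by simp [heB, h4, blk_one, h9])
      (by simp [heB, h4]; omega) ?_
    refine Runs.set_seq (lc a (k + 1) (v - blockStart T v))
      (by simp [heB, h4, h2, popcount_blk, d1, h12])
      (by simp [heB, h4, h2, d1]; omega) ?_
    refine Runs.set_seq (psum T F (blockStart T v) + pos a (kk T) (k + 1) (v - blockStart T v))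
      (by simp [h3, pos, add_assoc]) (by simp [h3]; omega) ?_
    refine Runs.set_seq (lc a (k + 1) (kk T))
      (by simp [heB, h3, h2, popcount_blk, d2, h13])
      (by simp [heB, h3, h2, d2]; omega) ?_
    refine Runs.set_seq (psum T F (blockStart T v) + lv a (kk T) (k + 1)) (by simp [h3])
      (by simp) ?_
    refine Runs.set (psum T F (blockStart T v) + lv a (kk T) (k + 1 + 1)) (by simp [h3, h15, add_assoc])
      (by simp [h3]; omega) ?_
    refine ⟨⟨by simp, by simp [slotOf, if_pos hl, ha], fun _ => by simp [h1, ha],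
      fun h => absurd hl h⟩, by omega⟩
  · intro hc
    have hl : ¬ IsLight T F v := by
      intro hl
      have h1 := (hC.light hl).1
      simp [h1] at hc
    obtain ⟨h1, h2⟩ := hC.heavy hl
    have h4 := hC.slot
    rw [slotOf, if_neg hl] at h4
    rw [slotOf, if_neg hl] at hsl
    rw [psum_succ] at h2
    refine Runs.set_seq (psum T F v + (k + 1)) (by simp [h4, add_assoc])
      (by simp [h4]; omega) ?_
    refine Runs.ite (by simp) ?_ ?_
    · intro hc1
      have h5 : k + 1 < arr T F v := by simpa [h2] using hc1
      refine Runs.set 1 rfl (by simp) ⟨⟨by simp [h5], by simp [slotOf, if_neg hl],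
        fun h => absurd h hl, fun _ => by simp [h1, h2, psum_succ]⟩, by omega⟩
    · intro hc1
      have h5 : ¬ k + 1 < arr T F v := by simpa [h2] using hc1
      refine Runs.set 0 rfl (by simp) ⟨⟨by simp [h5], by simp [slotOf, if_neg hl],
        fun h => absurd h hl, fun _ => by simp [h1, h2, psum_succ]⟩, by omega⟩

end Cursor

/-! ### Second pass: finding the node of the next factor. -/

section PassTwo

variable {σ : ℕ} {T : List (Fin σ)} {F : List (List (Fin σ))} {w M : ℕ}

/-- The addresses and sizes of the arrays with the indices and the characters of the factors. -/
structure Arrays where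
  aS : ℕ
  cS : ℕ
  wa : ℕ
  wc : ℕ
  eB : ℕ

/-- The arrays are where they should be. -/
structure Arrays.Valid (R : Arrays) (T : List (Fin σ)) (F : List (List (Fin σ))) (w M : ℕ) :
    Prop where
  xB_le : xB T ≤ R.aS
  aS_le : R.aS + F.length * R.wa ≤ R.cS
  cS_le : R.cS + F.length * R.wc ≤ R.eB
  le_eB : xB T + 2 * T.length ≤ R.eB
  le : R.eB + F.length ≤ M
  lt : F.length < 2 ^ R.wa
  wa_le : R.wa ≤ w
  wc_le : R.wc ≤ w

/-- The addresses and sizes of the arrays are in their registers. -/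
structure Arrays.Regs (R : Arrays) (F : List (List (Fin σ))) (s : St) : Prop where
  aS : s.reg .aS = R.aS
  cS : s.reg .cS = R.cS
  wa : s.reg .wa = R.wa
  wc : s.reg .wc = R.wc
  eB : s.reg .eB = R.eB
  z : s.reg .z = F.length

def arrayVars : List V := [.aS, .cS, .wa, .wc, .eB, .z]

theorem Arrays.Regs.congr {R : Arrays} {s s' : St} (h : R.Regs F s)
    (hr : ∀ x ∈ arrayVars, s'.reg x = s.reg x) : R.Regs F s' := by
  simp only [arrayVars, List.forall_mem_cons] at hr
  obtain ⟨h1, h2, h3, h4, h5, h6, -⟩ := hr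
  exact ⟨h1.trans h.aS, h2.trans h.cS, h3.trans h.wa, h4.trans h.wc, h5.trans h.eB, h6.trans h.z⟩

theorem Arrays.Regs.frame {R : Arrays} {c : Cmd} {s s' : St} (h : R.Regs F s) (hf : Frame c s s')
    (hc : ∀ x ∈ arrayVars, x ∉ c.mods) : R.Regs F s' :=
  h.congr fun x hx => hf.reg x (hc x hx)

theorem Arrays.Regs.set {R : Arrays} {s : St} (h : R.Regs F s) {x : V} (a : ℕ)
    (hx : x ∉ arrayVars) : R.Regs F (s.set x a) :=
  h.congr fun y hy => by rw [St.set_reg, if_neg (by rintro rfl; exact hx hy)]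

/-- The contents of the arrays after `x` factors. -/
structure Filled (R : Arrays) (T : List (Fin σ)) (F : List (List (Fin σ))) (x : ℕ)
    (m : ℕ → Bool) : Prop where
  index : ∀ v k, k < arr T F v → ∀ (y : ℕ) (hy : y < F.length), F[y] = edgeNode T v k →
    blk m (R.aS + slotOf T F v k * R.wa) R.wa = if y < x then y + 1 else 0
  char : ∀ v k, k < arr T F v → ∀ (y : ℕ) (hy : y < F.length), F[y] = edgeNode T v k → y < x →
    ∀ (f' : List (Fin σ)) (c : Fin σ), F[y] = f' ++ [c] → (c : ℕ) < 2 ^ R.wc →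
      blk m (R.cS + slotOf T F v k * R.wc) R.wc = c

/-- `y` is the index of the proper prefix of length `t` of the factor with index `x`. -/
def Refers (F : List (List (Fin σ))) (x : ℕ) (hx : x < F.length) (t y : ℕ) : Prop :=
  t = 0 ∧ y = 0 ∨ ∃ (i : ℕ) (hi : i < x), F[i] = F[x].take t ∧ y = i + 1

/-- The state in the search for the LZ trie node of the factor with index `x`: after `t` characters
(with the cursor on an edge, or at its end), or at the end. -/
def Searching (T : List (Fin σ)) (F : List (List (Fin σ))) (x : ℕ) (hx : x < F.length) :
    Option (ℕ × Bool) → St → Prop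
  | none, s => s.reg .go = 0 ∧ s.reg .p = rk T (startPos F x + (F[x].length - 1)) ∧
      Refers F x hx (F[x].length - 1) (s.reg .y) ∧
      ∃ v k, k < arr T F v ∧ edgeNode T v k = F[x] ∧ s.reg .slot = slotOf T F v k
  | some (t, true), s => s.reg .go = 1 ∧ t < F[x].length ∧ s.reg .p = rk T (startPos F x + t) ∧
      Refers F x hx t (s.reg .y) ∧ ∃ d k, s.reg .d = d ∧
        d < (path T (T.drop (startPos F x))).length ∧
        Cursor T F (number T (levelAnc T (T.drop (startPos F x)) d)) k s ∧
        k < arr T F (number T (levelAnc T (T.drop (startPos F x)) d)) ∧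
        (parent T (levelAnc T (T.drop (startPos F x)) d)).length + k = t
  | some (t, false), s => s.reg .go = 1 ∧ t < F[x].length ∧
      s.reg .p = rk T (startPos F x + t) ∧ Refers F x hx t (s.reg .y) ∧ s.reg .ex = 0 ∧
      ∃ d, s.reg .d = d ∧ d < (path T (T.drop (startPos F x))).length ∧
        (levelAnc T (T.drop (startPos F x)) d).length = t

theorem edgeNode_eq_take {v S : List (Fin σ)} {k : ℕ} (hv : v ∈ nodeSet T) (hvS : v <+: S)
    (hk : (parent T v).length + k + 1 ≤ v.length) :
    edgeNode T (number T v) k = S.take ((parent T v).length + k + 1) := by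
  rw [edgeNode, nodeAt_number hv, List.prefix_iff_eq_take.1 hvS, List.take_take,
    ← List.prefix_iff_eq_take.1 hvS, min_eq_left hk]

theorem IsGreedy.take_mem_self (hF : IsGreedy T F) {x : ℕ} (hx : x < F.length) {t : ℕ}
    (h0 : 0 < t) (ht : t ≤ F[x].length) : (T.drop (startPos F x)).take t ∈ F := by
  rcases ht.lt_or_eq with h | rfl
  · exact List.mem_of_mem_take ((hF.take_mem_iff hx h0).2 h)
  · rw [← List.prefix_iff_eq_take.1 (hF.prefix_drop hx)]
    exact List.getElem_mem hx

theorem IsGreedy.exists_last (hT : IsText T) (hF : IsGreedy T F) {x : ℕ} (hx : x < F.length) :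
    ∃ c : Fin σ, F[x] = F[x].take (F[x].length - 1) ++ [c] ∧
      chr T (rk T (startPos F x + (F[x].length - 1))) = c := by
  have h1 := hF.length_pos hx
  have h2 := hF.startPos_add_le hx
  have h3 := (hF.prefix_drop hx).getElem (i := F[x].length - 1) (by omega)
  rw [List.getElem_drop] at h3
  refine ⟨F[x][F[x].length - 1], ?_, ?_⟩
  · conv_lhs => rw [← List.take_length (l := F[x])]
    conv_lhs => rw [show F[x].length = F[x].length - 1 + 1 by omega]
    rw [List.take_succ_eq_append_getElem (by omega)]
  · rw [chr_rk hT (by omega), h3]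

/-- The tables describe the final trie, so all nonempty prefixes of `F[x]`, including `F[x]` itself,
are points on the way down. The proper ones already have an index and `F[x]` does not; so the walk
stops exactly at its node, with the index of the longest proper prefix at hand. Every character
costs 40 units of the potential, 20 of which are kept for the possible change to the next edge. -/
theorem findCmd_runs (ok : Ok T w M) (hF : IsGreedy T F) {R : Arrays} (hR : R.Valid T F w M)
    {x : ℕ} (hx : x < F.length) {s : St} (hE : Env T s) (hr : R.Regs F s)
    (hm : Filled R T F x s.mem) (ht : Tables T F R.eB s.mem)
    (hp : s.reg .p = rk T (startPos F x)) :
    Runs T w M findCmd s fun s' t => Searching T F x hx none s' ∧ t ≤ 40 * F[x].length + 30 := by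
  have hT := ok.text
  have hbig := ok.big
  have hle := ok.le
  have hst := hF.startPos_lt hx
  have hpos := hF.length_pos hx
  have hadd := hF.startPos_add_le hx
  have hfS := hF.prefix_drop hx
  have hlenS : (T.drop (startPos F x)).length = T.length - startPos F x := List.length_drop
  have hSn := leafSet_subset (hT.drop_mem_leafSet hst)
  have htake := fun {t : ℕ} => hF.take_mem_iff hx (t := t)
  have htF := fun {t : ℕ} => hF.take_mem_self hx (t := t)
  have hpl : (path T (T.drop (startPos F x))).length ≤ T.length + 1 := by
    have h1 : (path T (T.drop (startPos F x))).length ≤ (T.drop (startPos F x)).length + 1 := by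
      rw [path, ← List.length_inits]
      exact List.length_filter_le _ _
    omega
  have hzn := hF.length_le
  refine Runs.set_seq (number T (T.drop (startPos F x)))
    (by simp [hp, Query.answer, leafSelect_rk hT hst]) (by simp) ?_
  refine Runs.set_seq 0 rfl (by simp) (Runs.set_seq 0 rfl (by simp)
    (Runs.set_seq 0 rfl (by simp) (Runs.set_seq 1 rfl (by simp) ?_)))
  have hE0 := ((((hE.set (x := .lf) (number T (T.drop (startPos F x))) (by decide)).set
    (x := .d) 0 (by decide)).set (x := .y) 0 (by decide)).set (x := .ex) 0 (by decide)).set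
    (x := .go) 1 (by decide)
  have hr0 := ((((hr.set (x := .lf) (number T (T.drop (startPos F x))) (by decide)).set
    (x := .d) 0 (by decide)).set (x := .y) 0 (by decide)).set (x := .ex) 0 (by decide)).set
    (x := .go) 1 (by decide)
  refine Runs.loop (Searching T F x hx) (fun g => match g with
    | none => 0
    | some (t, true) => 40 * (F[x].length - t)
    | some (t, false) => 40 * (F[x].length - t) + 20) (some (0, false)) ?_ ?_ ?_ ?_
  · exact ⟨by simp, hpos, by simp [hp], Or.inl ⟨rfl, by simp⟩, by simp, 0, by simp,
      length_path_pos _, by simp [levelAnc_zero]⟩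
  · intros
    simp
  · intro g s1 hI hf hc
    have hE1 := hE0.frame hf (by decide)
    have hr1 := hr0.frame hf (by decide)
    have hm1 : s1.mem = s.mem := hf.mem rfl
    have hlf := hf.reg .lf (by decide)
    simp at hlf
    match g, hI with
    | none, hI => simp [hI.1] at hc
    | some (t, false), ⟨h1, h2, h3, h4, h5, d, h6, h7, h8⟩ =>
      have hd : d + 1 < (path T (T.drop (startPos F x))).length := by
        by_contra hd
        have h9 := levelAnc_last hSn
        rw [show (path T (T.drop (startPos F x))).length - 1 = d by omega] at h9
        rw [h9] at h8
        omega
      have hvn := levelAnc_mem (T := T) (T.drop (startPos F x)) (d + 1)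
      have hvS := levelAnc_prefix (T := T) (T.drop (startPos F x)) (d + 1)
      have hpar := parent_levelAnc hd
      have hlen := length_levelAnc_lt (show d < d + 1 by omega) hd
      refine Runs.ite (by simp) (fun _ => ?_) (fun h => absurd h5 (by simpa using h))
      refine Runs.set_seq (d + 1) (by simp [h6]) (by simp [h6]; omega) ?_
      refine Runs.set_seq (number T (levelAnc T (T.drop (startPos F x)) (d + 1)))
        (by simp [hlf, nodeAt_number hSn]) (by simp) ?_
      refine (firstCmd_runs ok hF ((hE1.set _ (by decide)).set _ (by decide))
        (hR.xB_le.trans ?_) (by simpa using hr1.eB) hR.le (by simpa [hm1] using ht)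
        (number_lt hvn) (by simp)).mono ?_
      · have := hR.aS_le
        have := hR.cS_le
        omega
      rintro s2 t2 ⟨h9, ht2⟩ hf2
      have e1 := hf2.reg .go (by decide)
      have e2 := hf2.reg .p (by decide)
      have e3 := hf2.reg .y (by decide)
      have e4 := hf2.reg .d (by decide)
      simp at e1 e2 e3 e4
      -- The prefix that is one character longer is still a factor, so the next edge carries at
      -- least one point and the cursor is valid.
      have h10 := lt_arr_of_edge hF hvn (htF (t := t + 1) (by omega) (by omega))
        (List.prefix_of_prefix_length_le (List.take_prefix _ _) hvS
              (by rw [List.length_take]; omega))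
        (by rw [hpar, h8, List.length_take]; omega)
      have h11 : ((T.drop (startPos F x)).take (t + 1)).length = t + 1 := by
        rw [List.length_take]
        omega
      rw [hpar, h8, h11, show t + 1 - t - 1 = 0 by omega] at h10
      refine ⟨some (t, true), ⟨e1.trans h1, h2, e2.trans h3, by rw [e3]; exact h4, d + 1, 0, e4,
        hd, h9, h10.1, by rw [hpar, h8, add_zero]⟩, ?_⟩
      dsimp only
      omega
    | some (t, true), ⟨h1, h2, h3, h4, d, k, h6, h7, h8, h9, h10⟩ =>
      have hvn := levelAnc_mem (T := T) (T.drop (startPos F x)) d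
      have hvS := levelAnc_prefix (T := T) (T.drop (startPos F x)) d
      obtain ⟨v, hvd⟩ : ∃ v, levelAnc T (T.drop (startPos F x)) d = v := ⟨_, rfl⟩
      rw [hvd] at hvn hvS h8 h9 h10
      have hsp := edgeNode_spec hF h9
      rw [nodeAt_number hvn] at hsp
      obtain ⟨hs1, hs2, hs3⟩ := hsp
      have hlen := hs3.length_le
      rw [hs2] at hlen
      have hek := edgeNode_eq_take hvn hvS hlen
      rw [h10] at hek
      obtain ⟨y, hy, hyF⟩ := List.getElem_of_mem hs1
      have hA := hm.index _ _ h9 y hy hyF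
      rw [← hm1] at hA
      have hsl := slotOf_lt ok hF h9
      have hex := h8.ex
      rw [decide_eq_true h9] at hex
      have hslot := h8.slot
      have e5 := entry_le (l := R.wa) hsl
      have b1 := hR.aS_le
      have b2 := hR.cS_le
      have b3 := hR.le
      have b4 := hR.wa_le
      -- An entry is nonzero exactly if its node belongs to an earlier factor, that is, if the
      -- prefix it stands for is a proper prefix of `F[x]`.
      have hyx : y < x ↔ t + 1 < F[x].length := by
        rw [← htake (Nat.succ_pos t), ← hek, ← hyF]
        constructor
        · intro h
          exact List.mem_iff_getElem.2 ⟨y, by simp; omega, by simp⟩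
        · intro h
          obtain ⟨i, hi, h11⟩ := List.mem_iff_getElem.1 h
          rw [List.getElem_take] at h11
          have h12 := (hF.nodup.getElem_inj_iff).1 h11
          simp at hi
          omega
      refine Runs.ite (by simp) (fun h => by simp [hex] at h) (fun _ => ?_)
      refine Runs.set_seq (if y < x then y + 1 else 0) (by simp [hr1.aS, hr1.wa, hslot, hA])
        (by simp [hr1.aS, hr1.wa, hslot]; omega) ?_
      refine Runs.ite (by simp) ?_ ?_
      · intro hc1
        have h11 : ¬ y < x := by
          intro h11
          simp [h11] at hc1
        have h12 : t + 1 = F[x].length := by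
          have := mt hyx.2 h11
          omega
        refine Runs.set 0 rfl (by simp) ⟨none, ⟨by simp, ?_, ?_, number T v, k, h9, ?_, ?_⟩, ?_⟩
        · simp [h3, ← h12]
        · simpa [← h12] using h4
        · rw [hek, h12]
          exact (List.prefix_iff_eq_take.1 hfS).symm
        · simpa using hslot
        · dsimp only
          omega
      · intro hc1
        have h11 : y < x := by
          by_contra h11
          simp [h11] at hc1
        have h12 := hyx.1 h11
        refine Runs.set_seq (y + 1) (by simp [h11]) (by simp) ?_
        refine Runs.set_seq (rk T (startPos F x + (t + 1))) (by simp [h3, psi_rk hT, add_assoc])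
          (by simp) ?_
        refine (nextCmd_runs ok hF (by simpa using hr1.eB) hR.le (by simpa [hm1] using ht)
          (number_lt hvn) h9 (h8.congr (by simp))).mono ?_
        rintro s2 t2 ⟨h13, ht2⟩ hf2
        have e1 := hf2.reg .go (by decide)
        have e2 := hf2.reg .p (by decide)
        have e3 := hf2.reg .y (by decide)
        have e4 := hf2.reg .d (by decide)
        simp at e1 e2 e3 e4
        have href : Refers F x hx (t + 1) (y + 1) := by
          refine Or.inr ⟨y, h11, ?_, rfl⟩
          rw [hyF, hek, List.prefix_iff_eq_take.1 hfS, List.take_take, min_eq_left h12.le]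
        by_cases h14 : k + 1 < arr T F (number T v)
        · refine ⟨some (t + 1, true), ⟨e1.trans h1, h12, e2, by rw [e3]; exact href, d, k + 1,
            e4.trans h6, h7, ?_⟩, ?_⟩
          · rw [hvd]
            exact ⟨h13, h14, by omega⟩
          · dsimp only
            omega
        -- When the points of the edge are exhausted before the factor ends, the end of the edge has
        -- been reached: otherwise the next prefix would be a further point on it.
        · have h15 : v.length = t + 1 := by
            by_contra h15
            have h16 := lt_arr_of_edge hF hvn (htF (t := t + 2) (by omega) (by omega))
              (List.prefix_of_prefix_length_le (List.take_prefix _ _) hvS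
              (by rw [List.length_take]; omega))
              (by rw [List.length_take]; omega)
            have h17 : ((T.drop (startPos F x)).take (t + 2)).length = t + 2 := by
              rw [List.length_take]
              omega
            rw [h17, show t + 2 - (parent T v).length - 1 = k + 1 by omega] at h16
            exact h14 h16.1
          refine ⟨some (t + 1, false), ⟨e1.trans h1, h12, e2, by rw [e3]; exact href, ?_, d,
            e4.trans h6, h7, ?_⟩, ?_⟩
          · rw [h13.ex, decide_eq_false h14]
            rfl
          · rw [hvd, h15]
          · dsimp only
            omega
  · intro s' t g hI hf hc ht
    match g, hI with
    | none, hI =>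
      dsimp only at ht
      exact ⟨hI, by omega⟩
    | some (t, true), hI => simp [hI.1] at hc
    | some (t, false), hI => simp [hI.1] at hc

end PassTwo

/-! ### Second pass: all factors and their codes. -/

section PassTwoLoop

variable {σ : ℕ} {T : List (Fin σ)} {F : List (List (Fin σ))} {w M : ℕ}

theorem Runs.emitFresh {c : Exp} {s : St} {Q : St → ℕ → Prop} (hc : c.Safe T w M s)
    (h : Q { s with out := s.out ++ [Code.fresh (c.eval T s)] } 1) :
    Runs T w M (.emitFresh c) s Q :=
  ⟨_, _, .emitFresh hc, h⟩

theorem Runs.emitRef {y c : Exp} {s : St} {Q : St → ℕ → Prop} (hy : y.Safe T w M s)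
    (hc : c.Safe T w M s)
    (h : Q { s with out := s.out ++ [Code.ref (y.eval T s) (c.eval T s)] } 1) :
    Runs T w M (.emitRef y c) s Q :=
  ⟨_, _, .emitRef hy hc, h⟩

/-- Different LZ trie nodes have different slots, so exactly one entry of each array is affected. -/
theorem Filled.step (ok : Ok T w M) (hF : IsGreedy T F) {R : Arrays} (hR : R.Valid T F w M)
    {x : ℕ} (hx : x < F.length) {m : ℕ → Bool} (h : Filled R T F x m) {v k : ℕ}
    (hk : k < arr T F v) (hvk : edgeNode T v k = F[x]) {f' : List (Fin σ)} {c : Fin σ}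
    (hc : F[x] = f' ++ [c]) :
    Filled R T F (x + 1) (wr (wr m (R.aS + slotOf T F v k * R.wa) R.wa (x + 1))
      (R.cS + slotOf T F v k * R.wc) R.wc c) := by
  have h1 := hR.aS_le
  have h2 := hR.lt
  have hself : ∀ {v' k' y : ℕ} (hk' : k' < arr T F v') (hy : y < F.length),
      F[y] = edgeNode T v' k' → slotOf T F v k = slotOf T F v' k' → y = x := by
    intro v' k' y hk' hy hyF he
    obtain ⟨rfl, rfl⟩ := slotOf_inj ok hk hk' he
    exact (hF.nodup.getElem_inj_iff).1 (hyF.trans hvk)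
  have hother : ∀ {v' k' y : ℕ} (hk' : k' < arr T F v') (hy : y < F.length),
      F[y] = edgeNode T v' k' → slotOf T F v k ≠ slotOf T F v' k' → y ≠ x := by
    rintro v' k' y hk' hy hyF he rfl
    obtain ⟨rfl, rfl⟩ := edgeNode_inj hF hk hk' (hvk.trans hyF)
    exact he rfl
  have hlt := fun {v' k' : ℕ} (hk' : k' < arr T F v') =>
    entry_le (l := R.wa) (slotOf_lt ok hF hk')
  refine ⟨fun v' k' hk' y hy hyF => ?_, fun v' k' hk' y hy hyF hyx f'' c' hc' hcl => ?_⟩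
  · have h3 := hlt hk'
    rw [blk_wr_disj (by omega)]
    by_cases he : slotOf T F v k = slotOf T F v' k'
    · obtain rfl := hself hk' hy hyF he
      rw [← he, blk_wr_same (by omega), if_pos (by omega)]
    · have h4 := hother hk' hy hyF he
      rw [blk_wr_entry he, h.index v' k' hk' y hy hyF]
      exact if_congr (by omega) rfl rfl
  · by_cases he : slotOf T F v k = slotOf T F v' k'
    · obtain rfl := hself hk' hy hyF he
      obtain ⟨-, h5⟩ := List.append_inj' (hc.symm.trans hc') rfl
      obtain rfl : c = c' := by simpa using h5
      rw [← he, blk_wr_same hcl]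
    · have h4 := hother hk' hy hyF he
      have h3 := hlt hk
      rw [blk_wr_entry he, blk_wr_disj (by omega)]
      exact h.char v' k' hk' y hy hyF (by omega) f'' c' hc' hcl

/-- The output stream contains the codes of the first `x` factors. -/
def Emitted (F : List (List (Fin σ))) (x : ℕ) (out : List Code) : Prop :=
  out.length = x ∧ ∀ (y : ℕ) (hy : y < F.length), y < x →
    (∃ c : Fin σ, F[y] = [c] ∧ out[y]? = some (Code.fresh c)) ∨
    (∃ (i : ℕ) (hi : i < y) (c : Fin σ), F[y] = F[i] ++ [c] ∧ out[y]? = some (Code.ref (i + 1) c))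

theorem Emitted.step {x : ℕ} (hx : x < F.length) {out : List Code} (h : Emitted F x out)
    {e : Code} (he : (∃ c : Fin σ, F[x] = [c] ∧ e = Code.fresh c) ∨
      ∃ (i : ℕ) (hi : i < x) (c : Fin σ), F[x] = F[i] ++ [c] ∧ e = Code.ref (i + 1) c) :
    Emitted F (x + 1) (out ++ [e]) := by
  refine ⟨by simp [h.1], fun y hy hyx => ?_⟩
  rcases (Nat.lt_succ_iff_lt_or_eq.1 hyx) with h1 | rfl
  · rw [List.getElem?_append_left (by rw [h.1]; exact h1)]
    exact h.2 y hy h1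
  · have h2 : (out ++ [e])[y]? = some e := by rw [← h.1]; simp
    rw [h2]
    rcases he with ⟨c, h3, rfl⟩ | ⟨i, hi, c, h3, rfl⟩
    · exact Or.inl ⟨c, h3, rfl⟩
    · exact Or.inr ⟨i, hi, c, h3, rfl⟩

theorem Emitted.isCoding {out : List Code} (h : Emitted F F.length out) : IsCoding F out :=
  ⟨h.1, fun y hy => h.2 y hy hy⟩

theorem pass2_runs (ok : Ok T w M) (hF : IsGreedy T F) {R : Arrays} (hR : R.Valid T F w M)
    {s : St} (hE : Env T s) (hr : R.Regs F s) (ho : s.out = [])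
    (hm : Filled R T F 0 s.mem) (ht : Tables T F R.eB s.mem) :
    Runs T w M pass2 s fun s' t => IsCoding F s'.out ∧ Filled R T F F.length s'.mem ∧
      (∀ A, A < R.aS ∨ R.eB ≤ A → s'.mem A = s.mem A) ∧ t ≤ 100 * T.length + 3 := by
  have hT := ok.text
  have hbig := ok.big
  have hle := ok.le
  have hzn := hF.length_le
  have b0 := hR.xB_le
  have b1 := hR.aS_le
  have b2 := hR.cS_le
  have b3 := hR.le
  have b4 := hR.wa_le
  have b5 := hR.wc_le
  refine Runs.set_seq 0 rfl (by simp) (Runs.set_seq (rk T 0) (by simp [hE.first]) (by simp) ?_)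
  have hE0 := (hE.set (x := .x) 0 (by decide)).set (x := .p) (rk T 0) (by decide)
  have hr0 := (hr.set (x := .x) 0 (by decide)).set (x := .p) (rk T 0) (by decide)
  refine Runs.loop (fun x s' => x ≤ F.length ∧ s'.reg .x = x ∧
      s'.reg .p = rk T (startPos F x) ∧ Filled R T F x s'.mem ∧ Emitted F x s'.out ∧
      ∀ A, A < R.aS ∨ R.eB ≤ A → s'.mem A = s.mem A)
    (fun x => 40 * (T.length - startPos F x) + 60 * (F.length - x)) 0 ?_ ?_ ?_ ?_
  · exact ⟨Nat.zero_le _, by simp, by simp [startPos_zero], hm, ⟨by simp [ho], by simp⟩,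
      fun _ _ => rfl⟩
  · intros
    simp
  · rintro x s1 ⟨-, h2, h3, h4, h5, h6⟩ hf hc
    have hE1 := hE0.frame hf (by decide)
    have hr1 := hr0.frame hf (by decide)
    have hx : x < F.length := by simpa [h2, hr1.z] using hc
    have hadd := hF.startPos_add_le hx
    have hpos := hF.length_pos hx
    have hsucc := startPos_succ hx
    have ht1 : Tables T F R.eB s1.mem := ht.congr ok hF (fun A hA => h6 A (Or.inl (by omega)))
      (fun A hA _ => h6 A (Or.inr hA))
    obtain ⟨c, hc1, hc2⟩ := hF.exists_last hT hx
    refine Runs.set_seq (x + 1) (by simp [h2]) (by simp [h2]; omega) ?_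
    refine Runs.bind (findCmd_runs ok hF hR hx (hE1.set _ (by decide)) (hr1.set _ (by decide))
      h4 ht1 (by simpa using h3)) ?_
    rintro s2 t2 ⟨⟨-, e1, e2, v, k, hk, hvk, e3⟩, ht2⟩ hf2
    have hr2 := (hr1.set (x := .x) (x + 1) (by decide)).frame hf2 (by decide)
    have e4 := hf2.reg .x (by decide)
    have e5 := hf2.mem rfl
    have e6 := hf2.out rfl
    simp at e4 e5 e6
    have hsl := slotOf_lt ok hF hk
    have h7 := entry_le (l := R.wa) hsl
    have h8 := entry_le (l := R.wc) hsl
    refine Runs.set_seq c (by simp [e1, hc2]) (by simp) ?_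
    refine Runs.store_seq (by simp [hr2.aS, hr2.wa, e3]; omega) ?_
    refine Runs.store_seq (by simp [hr2.cS, hr2.wc, e3]; omega) ?_
    refine Runs.set_seq (rk T (startPos F (x + 1))) ?_ (by simp) ?_
    · simp only [eval_xpsi, eval_var, St.set_reg, reduceCtorEq, if_false, e1, psi_rk hT, hsucc]
      congr 1
      omega
    have hfill := h4.step ok hF hR hx hk hvk hc1
    have hmem : ∀ A, A < R.aS ∨ R.eB ≤ A →
        wr (wr s1.mem (R.aS + slotOf T F v k * R.wa) R.wa (x + 1))
          (R.cS + slotOf T F v k * R.wc) R.wc c A = s.mem A := by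
      intro A hA
      rw [wr_of_disj (by omega), wr_of_disj (by omega)]
      exact h6 A hA
    have hfin : ∀ {s' : St} {e : Code} {t : ℕ}, s'.reg .x = x + 1 →
        s'.reg .p = rk T (startPos F (x + 1)) →
        s'.mem = wr (wr s1.mem (R.aS + slotOf T F v k * R.wa) R.wa (x + 1))
          (R.cS + slotOf T F v k * R.wc) R.wc c →
        s'.out = s1.out ++ [e] →
        ((∃ c : Fin σ, F[x] = [c] ∧ e = Code.fresh c) ∨
          ∃ (i : ℕ) (hi : i < x) (c : Fin σ), F[x] = F[i] ++ [c] ∧ e = Code.ref (i + 1) c) →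
        t ≤ 40 * F[x].length + 50 →
        ∃ x', (x' ≤ F.length ∧ s'.reg .x = x' ∧
          s'.reg .p = rk T (startPos F x') ∧ Filled R T F x' s'.mem ∧ Emitted F x' s'.out ∧
          ∀ A, A < R.aS ∨ R.eB ≤ A → s'.mem A = s.mem A) ∧
          t + 1 + (40 * (T.length - startPos F x') + 60 * (F.length - x')) ≤
            40 * (T.length - startPos F x) + 60 * (F.length - x) := by
      intro s' e t g1 g2 g3 g4 g5 g6
      refine ⟨x + 1, ⟨hx, g1, g2, g3 ▸ hfill, g4 ▸ h5.step hx g5, g3 ▸ hmem⟩, ?_⟩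
      omega
    have hlast : ∀ {y : ℕ}, Refers F x hx (F[x].length - 1) y →
        (y = 0 ∧ F[x] = [c]) ∨ ∃ (i : ℕ) (hi : i < x), y = i + 1 ∧ F[x] = F[i] ++ [c] := by
      rintro y (⟨g1, rfl⟩ | ⟨i, hi, g1, rfl⟩)
      · left
        rw [g1] at hc1
        exact ⟨rfl, by simpa using hc1⟩
      · exact Or.inr ⟨i, hi, rfl, g1 ▸ hc1⟩
    have hy := hlast e2
    refine Runs.ite (by simp) ?_ ?_
    · intro hc3
      have hy0 : s2.reg .y = 0 := by simpa using hc3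
      rcases hy with ⟨-, hy⟩ | ⟨i, hi, g1, -⟩
      · refine Runs.emitFresh (by simp) (hfin (e := Code.fresh c) (by simp [e4]) (by simp) ?_ ?_
          (Or.inl ⟨c, hy, rfl⟩) (by omega))
        · simp [hr2.aS, hr2.cS, hr2.wa, hr2.wc, e3, e4, e5]
        · simp [e6]
      · omega
    · intro hc3
      have hy0 : s2.reg .y ≠ 0 := by simpa using hc3
      rcases hy with ⟨g1, -⟩ | ⟨i, hi, g1, hy⟩
      · omega
      · refine Runs.emitRef (by simp) (by simp) (hfin (e := Code.ref (i + 1) c) (by simp [e4])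
          (by simp) ?_ ?_ (Or.inr ⟨i, hi, c, hy, rfl⟩) (by omega))
        · simp [hr2.aS, hr2.cS, hr2.wa, hr2.wc, e3, e4, e5]
        · simp [e6, g1]
  · rintro s' t x ⟨h1, h2, h3, h4, h5, h6⟩ hf hc ht
    have hr1 := hr0.frame hf (by decide)
    have hx : ¬ x < F.length := by simpa [h2, hr1.z] using hc
    obtain rfl : x = F.length := by omega
    refine ⟨h5.isCoding, h4, h6, ?_⟩
    rw [startPos_zero] at ht
    omega

end PassTwoLoop

/-! ### The two passes together. -/

section Engine

variable {σ : ℕ} {T : List (Fin σ)} {F : List (List (Fin σ))} {w M : ℕ}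

theorem IsText.card_le (hT : IsText T) : σ ≤ T.length := by
  have h1 : T.toFinset = Finset.univ := by
    ext c
    simp [hT.1 c]
  have h2 := T.toFinset_card_le
  rwa [h1, Finset.card_univ, Fintype.card_fin] at h2

/-- The rightmost leaf starts with the largest character. -/
theorem childRank_rmostLeaf (hT : IsText T) :
    childRank T (levelAnc T (rmostLeaf T []) 1) + 1 = σ := by
  have hinf : ([] : List (Fin σ)) <:+: T := List.nil_infix
  obtain ⟨j, hj, hjr⟩ := hT.mem_leafSet.1 (mem_leavesBelow.1 (rmostLeaf_mem hT hinf)).1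
  have h1 := chr_rk hT hj
  rw [chr, leafSelect_rk hT hj, ← hjr] at h1
  have h2 := T[j].isLt
  obtain ⟨i, hi, hic⟩ := List.getElem_of_mem (hT.1 ⟨σ - 1, by omega⟩)
  have h3 : T.drop i ≤ T.drop j := by
    rw [← hjr]
    exact le_rmostLeaf (mem_leavesBelow.2 ⟨hT.drop_mem_leafSet hi, List.nil_prefix⟩)
  rw [List.drop_eq_getElem_cons hi, List.drop_eq_getElem_cons hj] at h3
  have h4 : T[i] ≤ T[j] := by
    by_contra h
    exact h3.not_gt (List.cons_lt_cons_iff.2 (Or.inl (not_le.1 h)))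
  rw [hic, Fin.le_def] at h4
  simp only at h4
  omega

theorem widths0_runs (ok : Ok T w M) (hF : IsGreedy T F) {s : St}
    (hz : s.reg .z = F.length) :
    Runs T w M widths0 s fun s' t => s'.reg .wa = F.length.size ∧ s'.reg .wc = 0 ∧
      t ≤ 8 * T.length + 10 := by
  have hbig := ok.big
  have hzn := hF.length_le
  refine Runs.bind (sizeCmd_runs (m := F.length) (by decide) (by omega) (by simp) (by simp [hz])) ?_
  rintro s1 t1 ⟨h1, ht1⟩ -
  exact Runs.set 0 rfl (by simp) ⟨by simpa using h1, by simp, by omega⟩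

theorem widths1_runs (ok : Ok T w M) (hF : IsGreedy T F) {s : St}
    (hz : s.reg .z = F.length) :
    Runs T w M widths1 s fun s' t => s'.reg .wa = F.length.size ∧ s'.reg .wc = σ.size ∧
      t ≤ 8 * T.length + 10 := by
  have hbig := ok.big
  have hzn := hF.length_le
  have hT := ok.text
  have hsn := hT.card_le
  have hch := childRank_rmostLeaf hT
  refine Runs.bind (sizeCmd_runs (m := F.length) (by decide) (by omega) (by simp) (by simp [hz])) ?_
  rintro s1 t1 ⟨h1, ht1⟩ -
  have h2 : childRank T (levelAnc T (nodeAt T (number T (rmostLeaf T []))) 1) + 1 = σ := by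
    rw [nodeAt_number (rmostLeaf_mem_nodeSet _), hch]
  have h3 : childRank T (nodeAt T (number T (levelAnc T (nodeAt T (number T (rmostLeaf T []))) 1))) + 1
      = σ := by
    rw [nodeAt_number (levelAnc_mem _ _), h2]
  refine Runs.set_seq σ (by simp [Query.answer, nodeAt_zero, h3])
    (by simp [Query.answer, nodeAt_zero, h3]; omega) ?_
  refine (sizeCmd_runs (m := σ) (by decide) (by omega) (by simp) (by simp)).mono ?_
  rintro s2 t2 ⟨h4, ht2⟩ hf2
  have e1 := hf2.reg .wa (by decide)
  simp at e1
  exact ⟨e1.trans h1, h4, by omega⟩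

/-- The arrays of the engine. -/
def layout (T : List (Fin σ)) (F : List (List (Fin σ))) (wa wc : ℕ) : Arrays where
  aS := xB T + th T * wa
  cS := xB T + th T * wa + F.length * wa + th T * wc
  wa := wa
  wc := wc
  -- The second bound keeps the tables clear of the counters, which are read while the tables are
  -- built.
  eB := max (xB T + th T * wa + F.length * wa + th T * wc + F.length * wc) (xB T + 2 * T.length)

/-- The engine has computed the factorization. -/
structure Engine (T : List (Fin σ)) (F : List (List (Fin σ))) (R : Arrays) (s : St) : Prop where
  env : Env T s
  regs : R.Regs F s
  aB : s.reg .aB = xB T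
  chB : s.reg .chB = R.aS + F.length * R.wa
  coding : IsCoding F s.out
  filled : Filled R T F F.length s.mem
  tables : Tables T F R.eB s.mem
  rest : ∀ A, R.eB + F.length ≤ A → s.mem A = false

theorem blk_eq_zero {m : ℕ → Bool} {a l : ℕ} (h : ∀ i, a ≤ i → i < a + l → m i = false) :
    blk m a l = 0 := by
  refine Finset.sum_eq_zero fun i hi => ?_
  rw [Finset.mem_range] at hi
  rw [h _ (by omega) (by omega)]
  rfl

theorem layoutCmd_runs {s : St} (hE : Env T s) (hz : s.reg .z = F.length) {wa wc : ℕ}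
    (hwa : s.reg .wa = wa) (hwc : s.reg .wc = wc) (hM : (layout T F wa wc).eB ≤ M)
    (hw : M < 2 ^ w) :
    Runs T w M layoutCmd s fun s' t => (layout T F wa wc).Regs F s' ∧ s'.reg .aB = xB T ∧
      s'.reg .chB = (layout T F wa wc).aS + F.length * (layout T F wa wc).wa ∧ t ≤ 10 := by
  simp only [layout] at hM
  have h1 := le_max_left (xB T + th T * wa + F.length * wa + th T * wc + F.length * wc)
    (xB T + 2 * T.length)
  have h2 := le_max_right (xB T + th T * wa + F.length * wa + th T * wc + F.length * wc)
    (xB T + 2 * T.length)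
  refine Runs.set_seq (xB T) (by simp [hE.xB]) (by simp) ?_
  refine Runs.set_seq (xB T + th T * wa) (by simp [hE.xB, hE.Th, hwa])
    (by simp [hE.xB, hE.Th, hwa]; omega) ?_
  refine Runs.set_seq (xB T + th T * wa + F.length * wa) (by simp [hz, hwa])
    (by simp [hz, hwa]; omega) ?_
  refine Runs.set_seq (xB T + th T * wa + F.length * wa + th T * wc) (by simp [hE.Th, hwc])
    (by simp [hE.Th, hwc]; omega) ?_
  refine Runs.set_seq (xB T + th T * wa + F.length * wa + th T * wc + F.length * wc)
    (by simp [hz, hwc]) (by simp [hz, hwc]; omega) ?_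
  refine Runs.ite (by simp [hE.xB, hE.n]; omega) ?_ ?_
  · intro hc
    have hc' : xB T + th T * wa + F.length * wa + th T * wc + F.length * wc <
        xB T + T.length + T.length := by simpa [hE.xB, hE.n] using hc
    refine Runs.set (xB T + 2 * T.length) (by simp [hE.xB, hE.n]; omega)
      (by simp [hE.xB, hE.n]; omega) ⟨⟨by simp [layout], by simp [layout], by simp [layout, hwa],
        by simp [layout, hwc], ?_, by simp [hz]⟩, by simp, by simp [layout], by omega⟩
    simp only [St.set_reg, if_true, layout]
    omega
  · intro hc
    have hc' : ¬ xB T + th T * wa + F.length * wa + th T * wc + F.length * wc <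
        xB T + T.length + T.length := by simpa [hE.xB, hE.n] using hc
    refine Runs.set 0 rfl (by simp) ⟨⟨by simp [layout], by simp [layout], by simp [layout, hwa],
        by simp [layout, hwc], ?_, by simp [hz]⟩, by simp, by simp [layout], by omega⟩
    simp [layout]
    omega

/-- The parts are linked by zero memory: the counters start from zero, the tables are built in
untouched memory by writing ones, and after the counters are cleared, all indices are zero, which
means that no factor has been entered. -/
theorem engine_runs (ok : Ok T w M) (hF : IsGreedy T F) {widths : Cmd} {wa wc : ℕ}
    (hR : (layout T F wa wc).Valid T F w M)
    (hwid : ∀ s : St, s.reg .z = F.length → Runs T w M widths s fun s' t =>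
      s'.reg .wa = wa ∧ s'.reg .wc = wc ∧ t ≤ 8 * T.length + 10)
    (hmods : ∀ x ∈ V.z :: envVars, x ∉ widths.mods) (hst : widths.stores = false)
    (hem : widths.emits = false) {s : St} (hs : ∀ a, s.mem a = false) (ho : s.out = []) :
    Runs T w M (engine widths) s fun s' t => Engine T F (layout T F wa wc) s' ∧
      t ≤ 1000 * T.length := by
  have hn := ok.text.length_pos
  have b0 := hR.xB_le
  have b1 := hR.aS_le
  have b2 := hR.cS_le
  have b3 := hR.le
  refine Runs.bind (setup_runs ok s) ?_
  rintro s1 t1 ⟨hE1, ht1⟩ hf1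
  have em1 := hf1.mem rfl
  have eo1 := hf1.out rfl
  refine Runs.bind (pass1_runs ok hF hE1 fun a => by rw [em1, hs]) ?_
  rintro s2 t2 ⟨hz2, hm2, ht2⟩ hf2
  have hE2 := hE1.frame hf2 (by decide)
  have eo2 := hf2.out rfl
  refine Runs.bind (hwid s2 hz2) ?_
  rintro s3 t3 ⟨hwa, hwc, ht3⟩ hf3
  have hE3 := hE2.frame hf3 fun x hx => hmods x (List.mem_cons_of_mem _ hx)
  have hz3 := (hf3.reg .z (hmods _ (List.mem_cons_self ..))).trans hz2
  have em3 := hf3.mem hst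
  have eo3 := hf3.out hem
  refine Runs.bind (layoutCmd_runs hE3 hz3 hwa hwc (by omega) ok.lt) ?_
  rintro s4 t4 ⟨hr4, haB4, hch4, ht4⟩ hf4
  have hE4 := hE3.frame hf4 (by decide)
  have em4 := hf4.mem rfl
  have eo4 := hf4.out rfl
  have hm4 : Counters T F s4.mem := by rw [em4, em3]; exact hm2
  refine Runs.bind (build_runs ok hF hE4 hm4 hr4.eB hR.le_eB hR.le) ?_
  rintro s5 t5 ⟨htab, hrest, hkeep, ht5⟩ hf5
  have hE5 := hE4.frame hf5 (by decide)
  have hr5 := hr4.frame hf5 (by decide)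
  have haB5 := (hf5.reg .aB (by decide)).trans haB4
  have hch5 := (hf5.reg .chB (by decide)).trans hch4
  have eo5 := hf5.out rfl
  refine Runs.bind (clearCmd_runs ok hE5) ?_
  rintro s6 t6 ⟨hm6, ht6⟩ hf6
  have hE6 := hE5.frame hf6 (by decide)
  have hr6 := hr5.frame hf6 (by decide)
  have haB6 := (hf6.reg .aB (by decide)).trans haB5
  have hch6 := (hf6.reg .chB (by decide)).trans hch5
  have eo6 := hf6.out rfl
  have hle := hR.le_eB
  -- The counters have been cleared, and nothing was written between them and the tables.
  have hz6 : ∀ A, xB T ≤ A → A < (layout T F wa wc).eB → s6.mem A = false := by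
    intro A h1 h2
    rw [hm6]
    split_ifs with h3
    · rfl
    · rw [hkeep A h1 h2]
      exact hm4.rest A (Or.inr (by omega))
  have htab6 : Tables T F (layout T F wa wc).eB s6.mem :=
    htab.congr ok hF (fun A hA => by rw [hm6, if_neg (by omega)])
      (fun A hA _ => by rw [hm6, if_neg (by omega)])
  have hfill : Filled (layout T F wa wc) T F 0 s6.mem := by
    refine ⟨fun v k hk y hy hyF => ?_, fun _ _ _ _ _ _ h => absurd h (Nat.not_lt_zero _)⟩
    have h1 := entry_le (l := (layout T F wa wc).wa) (slotOf_lt ok hF hk)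
    rw [if_neg (Nat.not_lt_zero _)]
    exact blk_eq_zero fun i h2 h3 => hz6 i (by omega) (by omega)
  refine (pass2_runs ok hF hR hE6 hr6 (by rw [eo6, eo5, eo4, eo3, eo2, eo1, ho]) hfill htab6).mono ?_
  rintro s7 t7 ⟨hcod, hfill7, hm7, ht7⟩ hf7
  refine ⟨⟨hE6.frame hf7 (by decide), hr6.frame hf7 (by decide),
    (hf7.reg .aB (by decide)).trans haB6, (hf7.reg .chB (by decide)).trans hch6, hcod, hfill7,
    htab6.congr ok hF (fun A hA => hm7 A (Or.inl (by omega))) (fun A hA _ => hm7 A (Or.inr hA)),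
    fun A hA => ?_⟩, by omega⟩
  rw [hm7 A (Or.inr (by omega)), hm6, if_neg (by omega), hrest A hA]

end Engine

/-! ### Positions of the opening parentheses. -/

section Parentheses

variable {σ : ℕ}

/-- `B` is the balanced parenthesis sequence of a forest whose nodes have, in pre-order, the
depths `L`, where the roots have depth `d`. -/
structure IsBP (B : List Bool) (L : List ℕ) (d : ℕ) : Prop where
  length : B.length = 2 * L.length
  -- These bounds keep the positions of one forest apart from those of its neighbours when sequences
  -- are concatenated.
  le : ∀ i x, L[i]? = some x → d ≤ x ∧ x ≤ i + d
  -- The opening parenthesis of the node with pre-order rank `i` and depth `x` is preceded by `i`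
  -- opening parentheses, all but `x - d` of which have been closed.
  iff : ∀ q < B.length, B[q]? = some true ↔ ∃ i x, L[i]? = some x ∧ q + x = 2 * i + d

theorem IsBP.nil (d : ℕ) : IsBP [] [] d := ⟨rfl, by simp, by simp⟩

theorem IsBP.append {B B' : List Bool} {L L' : List ℕ} {d : ℕ} (h : IsBP B L d)
    (h' : IsBP B' L' d) : IsBP (B ++ B') (L ++ L') d := by
  have hl := h.length
  have hl' := h'.length
  refine ⟨by simp [hl, hl']; omega, fun i x hx => ?_, fun q hq => ?_⟩
  · rcases lt_or_ge i L.length with hi | hi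
    · rw [List.getElem?_append_left hi] at hx
      exact h.le i x hx
    · rw [List.getElem?_append_right hi] at hx
      have := h'.le _ x hx
      omega
  · rw [List.length_append] at hq
    rcases lt_or_ge q B.length with hqB | hqB
    · rw [List.getElem?_append_left hqB, h.iff q hqB]
      constructor
      · rintro ⟨i, x, h1, h2⟩
        exact ⟨i, x, by rw [List.getElem?_append_left (List.getElem?_eq_some_iff.1 h1).1, h1], h2⟩
      · rintro ⟨i, x, h1, h2⟩
        rcases lt_or_ge i L.length with hi | hi
        · rw [List.getElem?_append_left hi] at h1
          exact ⟨i, x, h1, h2⟩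
        · rw [List.getElem?_append_right hi] at h1
          have := h'.le _ x h1
          omega
    · rw [List.getElem?_append_right hqB, h'.iff _ (by omega)]
      constructor
      · rintro ⟨i, x, h1, h2⟩
        exact ⟨L.length + i, x, by rw [List.getElem?_append_right (by omega), Nat.add_sub_cancel_left,
          h1], by omega⟩
      · rintro ⟨i, x, h1, h2⟩
        rcases lt_or_ge i L.length with hi | hi
        · rw [List.getElem?_append_left hi] at h1
          have := h.le _ x h1
          omega
        · rw [List.getElem?_append_right hi] at h1
          exact ⟨_, x, h1, by omega⟩

theorem IsBP.flatMap {α : Type*} {d : ℕ} {f : α → List Bool} {g : α → List ℕ} {l : List α}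
    (h : ∀ a ∈ l, IsBP (f a) (g a) d) : IsBP (l.flatMap f) (l.flatMap g) d := by
  induction l with
  | nil => exact .nil d
  | cons a l ih =>
    rw [List.flatMap_cons, List.flatMap_cons]
    exact (h a (List.mem_cons_self ..)).append (ih fun b hb => h b (List.mem_cons_of_mem _ hb))

theorem IsBP.wrap {B : List Bool} {L : List ℕ} {d : ℕ} (h : IsBP B L (d + 1)) :
    IsBP (true :: B ++ [false]) (d :: L) d := by
  have hl := h.length
  refine ⟨by simp [hl]; omega, fun i x hx => ?_, fun q hq => ?_⟩
  · cases i with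
    | zero => simp at hx; omega
    | succ i =>
      have := h.le i x (by simpa using hx)
      omega
  · rw [List.cons_append]
    cases q with
    | zero =>
      simp only [List.getElem?_cons_zero, true_iff]
      exact ⟨0, d, by simp, by omega⟩
    | succ q =>
      rw [List.getElem?_cons_succ]
      rcases lt_or_ge q B.length with hqB | hqB
      · rw [List.getElem?_append_left hqB, h.iff q hqB]
        constructor
        · rintro ⟨i, x, h1, h2⟩
          exact ⟨i + 1, x, by simpa using h1, by omega⟩
        · rintro ⟨i, x, h1, h2⟩
          cases i with
          | zero => simp at h1; omega
          | succ i => exact ⟨i, x, by simpa using h1, by omega⟩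
      · obtain rfl : q = B.length := by simp at hq; omega
        simp only [List.getElem?_append_right le_rfl, Nat.sub_self, List.getElem?_cons_zero,
          Option.some.injEq, Bool.false_eq_true, false_iff, not_exists, not_and]
        intro i x h1 h2
        cases i with
        | zero => simp at h1; omega
        | succ i =>
          rw [List.getElem?_cons_succ] at h1
          have h3 := (List.getElem?_eq_some_iff.1 h1).1
          have := h.le i x h1
          omega

/-- The nodes of the subtree of the LZ trie that is rooted at `S`, in pre-order. -/
def lzPreorder (F : List (List (Fin σ))) : ℕ → List (Fin σ) → List (List (Fin σ))
  | 0, _ => []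
  | h + 1, S => S :: ((List.finRange σ).filter fun c => S ++ [c] ∈ F).flatMap
      fun c => lzPreorder F h (S ++ [c])

variable {F : List (List (Fin σ))}

theorem isBP_lzTrieBP (h : ℕ) (S : List (Fin σ)) :
    IsBP (lzTrieBP F h S) ((lzPreorder F h S).map List.length) S.length := by
  induction h generalizing S with
  | zero => exact .nil _
  | succ h ih =>
    rw [lzTrieBP, lzPreorder, List.map_cons, List.map_flatMap]
    refine IsBP.wrap (IsBP.flatMap fun c _ => ?_)
    have := ih (S ++ [c])
    rwa [List.length_append, List.length_singleton] at this

theorem mem_lzPreorder (hF : PrefixClosed F) {h : ℕ} {S x : List (Fin σ)} :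
    x ∈ lzPreorder F h S ↔ (x = S ∨ x ∈ F) ∧ S <+: x ∧ x.length < S.length + h := by
  induction h generalizing S with
  | zero =>
    simp only [lzPreorder, List.not_mem_nil, add_zero, false_iff, not_and, not_lt]
    exact fun _ h => h.length_le
  | succ h ih =>
    simp only [lzPreorder, List.mem_cons, List.mem_flatMap, List.mem_filter, List.mem_finRange,
      true_and, decide_eq_true_eq, ih, List.length_append, List.length_singleton]
    constructor
    · rintro (rfl | ⟨c, h1, h2, h3, h4⟩)
      · exact ⟨Or.inl rfl, List.prefix_rfl, by omega⟩
      · refine ⟨Or.inr ?_, (List.prefix_append _ _).trans h3, by omega⟩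
        rcases h2 with rfl | h2
        · exact h1
        · exact h2
    · rintro ⟨h1, ⟨t, rfl⟩, h3⟩
      cases t with
      | nil => simp
      | cons c t =>
        right
        have h2 : S ++ c :: t ∈ F := by simpa using h1
        refine ⟨c, ?_, Or.inr h2, ⟨t, by simp⟩, by simp at h3 ⊢; omega⟩
        have := hF.take_mem _ h2 (S.length + 1) (by omega)
        rwa [List.take_length_add_append, List.take_succ_cons, List.take_zero] at this

theorem pairwise_lzPreorder (hF : PrefixClosed F) (h : ℕ) (S : List (Fin σ)) :
    (lzPreorder F h S).Pairwise (· < ·) := by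
  induction h generalizing S with
  | zero => exact List.Pairwise.nil
  | succ h ih =>
    rw [lzPreorder, List.pairwise_cons, List.pairwise_flatMap]
    refine ⟨fun x hx => ?_, fun c _ => ih _, ?_⟩
    · simp only [List.mem_flatMap, mem_lzPreorder hF] at hx
      obtain ⟨c, -, -, h1, -⟩ := hx
      refine lt_of_isPrefix ((List.prefix_append _ _).trans h1) ?_
      have := h1.length_le
      simp at this
      omega
    · refine ((List.pairwise_lt_finRange σ).filter _).imp fun {c c'} hc x hx y hy => ?_
      rw [mem_lzPreorder hF] at hx hy
      obtain ⟨-, ⟨t, rfl⟩, -⟩ := hx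
      obtain ⟨-, ⟨u, rfl⟩, -⟩ := hy
      rw [List.append_assoc, List.append_assoc]
      exact lt_of_append_cons hc

/-- The traversal lists its nodes in strictly increasing order, and below the root it lists exactly
the factors; so it is their sorted list. The bound `n` makes the recursion deep enough. -/
theorem lzPreorder_nil (hF : PrefixClosed F) {n : ℕ} (hn : ∀ f ∈ F, f.length ≤ n) :
    lzPreorder F (n + 1) [] = [] :: lzTrieNodes F := by
  have h1 := pairwise_lzPreorder hF (n + 1) []
  have h2 : ∃ l, lzPreorder F (n + 1) [] = [] :: l := ⟨_, rfl⟩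
  obtain ⟨l, hl⟩ := h2
  rw [hl, List.pairwise_cons] at h1
  rw [hl]
  congr 1
  have h3 : l.toFinset = F.toFinset := by
    ext x
    rw [List.mem_toFinset, List.mem_toFinset]
    have h4 := mem_lzPreorder hF (h := n + 1) (S := []) (x := x)
    rw [hl] at h4
    simp only [List.mem_cons, List.nil_prefix, true_and, List.length_nil, zero_add] at h4
    have h5 : x ∈ l → x ≠ [] := fun h => (h1.1 x h).ne'
    constructor
    · intro h
      have := (h4.1 (Or.inr h)).1
      exact this.resolve_left (h5 h)
    · intro h
      have := h4.2 ⟨Or.inr h, by have := hn x h; omega⟩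
      exact this.resolve_left fun e => hF.nil_notMem (e ▸ h)
  rw [lzTrieNodes, ← h3, (List.toFinset_sort (· ≤ ·) (h1.2.imp fun h => h.ne)).2
    (h1.2.imp fun h => h.le)]

/-- The positions of the opening parentheses of the LZ trie. -/
theorem lzTrieBP_getElem? {T : List (Fin σ)} (hF : IsGreedy T F) :
    (lzTrieBP F (F.flatten.length + 1) []).length = 2 * (F.length + 1) ∧
    (∀ (j : ℕ) (f : List (Fin σ)), (lzTrieNodes F)[j]? = some f → f.length ≤ j + 1) ∧
    ∀ q < 2 * (F.length + 1), (lzTrieBP F (F.flatten.length + 1) [])[q]? = some true ↔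
      q = 0 ∨ ∃ (j : ℕ) (f : List (Fin σ)), (lzTrieNodes F)[j]? = some f ∧
        q + f.length = 2 * (j + 1) := by
  have hn : ∀ f ∈ F, f.length ≤ F.flatten.length := fun f hf => by
    rw [List.length_flatten]
    exact List.single_le_sum (fun _ _ => Nat.zero_le _) _ (List.mem_map_of_mem hf)
  have h := isBP_lzTrieBP (F := F) (F.flatten.length + 1) []
  rw [lzPreorder_nil hF.prefixClosed_self hn] at h
  have h1 : (lzTrieNodes F).length = F.length := by
    rw [lzTrieNodes, Finset.length_sort, List.toFinset_card_of_nodup hF.nodup]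
  have h2 : (lzTrieBP F (F.flatten.length + 1) []).length = 2 * (F.length + 1) := by
    rw [h.length, List.length_map, List.length_cons, h1]
  refine ⟨h2, fun j f hf => ?_, fun q hq => ?_⟩
  · exact (h.le (j + 1) f.length (by simp [hf])).2
  · rw [h.iff q (h2 ▸ hq)]
    constructor
    · rintro ⟨i, x, h3, h4⟩
      cases i with
      | zero => simp at h3 h4; omega
      | succ i =>
        simp only [List.map_cons, List.getElem?_cons_succ, List.getElem?_map,
          Option.map_eq_some_iff] at h3
        obtain ⟨f, h5, rfl⟩ := h3
        exact Or.inr ⟨i, f, h5, by simpa using h4⟩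
    · rintro (rfl | ⟨j, f, h3, h4⟩)
      · exact ⟨0, 0, by simp, by simp⟩
      · exact ⟨j + 1, f.length, by simp [h3], by simpa using h4⟩

end Parentheses

/-! ### Bringing the arrays into pre-order. -/

section Finish

variable {σ : ℕ} {T : List (Fin σ)} {F : List (List (Fin σ))} {w M : ℕ}

theorem psum_add_lt {v k : ℕ} (h : k < arr T F v) : psum T F v + k < psum T F (v + 1) := by
  rw [psum_succ]
  omega

theorem psum_add_inj {v k v' k' : ℕ} (h : k < arr T F v) (h' : k' < arr T F v')
    (he : psum T F v + k = psum T F v' + k') : v = v' ∧ k = k' := by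
  have h1 := psum_add_lt h
  have h2 := psum_add_lt h'
  rcases lt_trichotomy v v' with h3 | rfl | h3
  · have := psum_mono (T := T) (F := F) (show v + 1 ≤ v' by omega)
    omega
  · exact ⟨rfl, by omega⟩
  · have := psum_mono (T := T) (F := F) (show v' + 1 ≤ v by omega)
    omega

/-- A gap of `th T` entries suffices to bring the entries into pre-order. -/
theorem psum_add_lt_slotOf (ok : Ok T w M) {v k : ℕ} (h : k < arr T F v) :
    psum T F v + k < slotOf T F v k + th T := by
  have h1 := psum_add_lt h
  have h2 := slotOf_bounds ok h
  have h3 := psum_mono (T := T) (F := F)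
    (show v + 1 ≤ blockStart T v + kk T from lt_blockStart ok v)
  by_cases hl : IsLight T F v
  · have hl' : psum T F (blockStart T v + kk T) < psum T F (blockStart T v) + th T := hl
    omega
  · have h4 : 0 < th T := by
      have := ok.kk_lt_th
      omega
    rw [slotOf, if_neg hl]
    omega

/-- The memory when the data of the first `J` nodes of the LZ trie is in its final place. -/
structure Moved (R : Arrays) (T : List (Fin σ)) (F : List (List (Fin σ))) (J : ℕ)
    (m : ℕ → Bool) : Prop where
  index : ∀ v k, k < arr T F v → ∀ (y : ℕ) (hy : y < F.length), F[y] = edgeNode T v k →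
    blk m (if psum T F v + k < J then xB T + (psum T F v + k) * R.wa
      else R.aS + slotOf T F v k * R.wa) R.wa = y + 1
  char : ∀ v k, k < arr T F v → ∀ (f' : List (Fin σ)) (c : Fin σ), edgeNode T v k = f' ++ [c] →
    blk m (if psum T F v + k < J then R.aS + F.length * R.wa + (psum T F v + k) * R.wc
      else R.cS + slotOf T F v k * R.wc) R.wc = c
  bit : ∀ q, m (R.eB + F.length + q) = true ↔ q = 0 ∨ ∃ v k, k < arr T F v ∧
    psum T F v + k < J ∧ q + (edgeNode T v k).length = 2 * (psum T F v + k + 1)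

/-- The arrays are preceded by gaps, and there is room for all characters and the parentheses. -/
structure Arrays.Gaps (R : Arrays) (T : List (Fin σ)) (F : List (List (Fin σ))) (M : ℕ) :
    Prop where
  aS : xB T + th T * R.wa = R.aS
  cS : R.aS + F.length * R.wa + th T * R.wc = R.cS
  lt : σ < 2 ^ R.wc
  le : R.eB + F.length + 2 * (F.length + 1) ≤ M

/-- The nodes are moved in pre-order, and the target of the `J`-th one lies below the slots of all
nodes that are still to be moved, thanks to the gaps. Of the parentheses, only the opening ones are
written, as the memory is zero. -/
theorem Moved.step (ok : Ok T w M) (hF : IsGreedy T F) {R : Arrays} (hR : R.Valid T F w M)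
    (hG : R.Gaps T F M) {J v k y : ℕ} {m : ℕ → Bool} (h : Moved R T F J m) (hk : k < arr T F v)
    (hJ : psum T F v + k = J) (hy : y < F.length) (hyF : F[y] = edgeNode T v k)
    {f' : List (Fin σ)} {c : Fin σ} (hc : edgeNode T v k = f' ++ [c])
    (hl : (edgeNode T v k).length ≤ J + 1) :
    Moved R T F (J + 1) (wr (wr (wr m (xB T + J * R.wa) R.wa (y + 1))
      (R.aS + F.length * R.wa + J * R.wc) R.wc c)
      (R.eB + F.length + (2 * (J + 1) - (edgeNode T v k).length)) 1 1) := by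
  have hT := ok.text
  have g1 := hG.aS
  have g2 := hG.cS
  have g3 := hR.cS_le
  have g4 := hR.lt
  have g5 := hG.lt
  have hJz : J < F.length := by
    have h1 := psum_le hT hF (v + 1)
    have h2 := psum_add_lt hk
    omega
  have e1 := entry_le (l := R.wa) hJz
  have e2 := entry_le (l := R.wc) hJz
  have hrank : ∀ {v' k'}, k' < arr T F v' → psum T F v' + k' < F.length := by
    intro v' k' hk'
    have h1 := psum_le hT hF (v' + 1)
    have h2 := psum_add_lt hk'
    omega
  refine ⟨fun v' k' hk' y' hy' hyF' => ?_, fun v' k' hk' f'' c' hc' => ?_, fun q => ?_⟩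
  · have hr := hrank hk'
    have hs := slotOf_lt ok hF hk'
    have hsg := psum_add_lt_slotOf ok hk'
    have e3 := entry_le (l := R.wa) hr
    have e4 := entry_le (l := R.wa) hs
    have h0 := h.index v' k' hk' y' hy' hyF'
    rcases lt_trichotomy (psum T F v' + k') J with h1 | h1 | h1
    · rw [if_pos h1] at h0
      rw [if_pos (by omega), blk_wr_disj (by omega), blk_wr_disj (by omega),
        blk_wr_entry (by omega), h0]
    · obtain ⟨rfl, rfl⟩ := psum_add_inj hk' hk (h1.trans hJ.symm)
      obtain rfl : y = y' := (hF.nodup.getElem_inj_iff).1 (hyF.trans hyF'.symm)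
      rw [if_pos (by omega), blk_wr_disj (by omega), blk_wr_disj (by omega), h1,
        blk_wr_same (by omega)]
    · rw [if_neg (by omega)] at h0
      -- In units of entries from the beginning of the gap, the source is at `slotOf T F v' k' + th
      -- T`, behind the target `J`.
      have e5 := entry_le (l := R.wa) (show J < slotOf T F v' k' + th T by omega)
      rw [add_mul] at e5
      rw [if_neg (by omega), blk_wr_disj (by omega), blk_wr_disj (by omega),
        blk_wr_disj (by omega), h0]
  · have hr := hrank hk'
    have hs := slotOf_lt ok hF hk'
    have hsg := psum_add_lt_slotOf ok hk'
    have e3 := entry_le (l := R.wc) hr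
    have e4 := entry_le (l := R.wc) hs
    have h0 := h.char v' k' hk' f'' c' hc'
    rcases lt_trichotomy (psum T F v' + k') J with h1 | h1 | h1
    · rw [if_pos h1] at h0
      rw [if_pos (by omega), blk_wr_disj (by omega), blk_wr_entry (by omega),
        blk_wr_disj (by omega), h0]
    · obtain ⟨rfl, rfl⟩ := psum_add_inj hk' hk (h1.trans hJ.symm)
      obtain ⟨-, h5⟩ := List.append_inj' (hc.symm.trans hc') rfl
      obtain rfl : c = c' := by simpa using h5
      have := c.isLt
      rw [if_pos (by omega), blk_wr_disj (by omega), h1, blk_wr_same (by omega)]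
    · rw [if_neg (by omega)] at h0
      have e5 := entry_le (l := R.wc) (show J < slotOf T F v' k' + th T by omega)
      rw [add_mul] at e5
      rw [if_neg (by omega), blk_wr_disj (by omega), blk_wr_disj (by omega),
        blk_wr_disj (by omega), h0]
  · rw [wr_one]
    by_cases hq : q = 2 * (J + 1) - (edgeNode T v k).length
    · rw [if_pos (by omega)]
      simp only [Nat.testBit_zero, Nat.one_mod, decide_true, true_iff]
      exact Or.inr ⟨v, k, hk, by omega, by omega⟩
    · rw [if_neg (by omega), wr_of_disj (by omega), wr_of_disj (by omega), h.bit q]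
      refine or_congr Iff.rfl ⟨?_, ?_⟩
      · rintro ⟨v', k', h1, h2, h3⟩
        exact ⟨v', k', h1, by omega, h3⟩
      · rintro ⟨v', k', h1, h2, h3⟩
        refine ⟨v', k', h1, ?_, h3⟩
        by_contra h4
        obtain ⟨rfl, rfl⟩ := psum_add_inj h1 hk (by omega)
        omega

/-- The registers that are not changed while the LZ trie is brought into its final form. -/
structure Finishing (T : List (Fin σ)) (F : List (List (Fin σ))) (R : Arrays) (s : St) : Prop where
  env : Env T s
  regs : R.Regs F s
  aB : s.reg .aB = xB T
  chB : s.reg .chB = R.aS + F.length * R.wa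
  bp : s.reg .bp = R.eB + F.length

def finishVars : List V := envVars ++ arrayVars ++ [.aB, .chB, .bp]

theorem Finishing.congr {R : Arrays} {s s' : St} (h : Finishing T F R s)
    (hr : ∀ x ∈ finishVars, s'.reg x = s.reg x) : Finishing T F R s' := by
  refine ⟨h.env.congr fun x hx => hr x (by simp [finishVars, hx]),
    h.regs.congr fun x hx => hr x (by simp [finishVars, hx]), ?_, ?_, ?_⟩
  · exact (hr _ (by decide)).trans h.aB
  · exact (hr _ (by decide)).trans h.chB
  · exact (hr _ (by decide)).trans h.bp

theorem Finishing.frame {R : Arrays} {c : Cmd} {s s' : St} (h : Finishing T F R s)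
    (hf : Frame c s s') (hc : ∀ x ∈ finishVars, x ∉ c.mods) : Finishing T F R s' :=
  h.congr fun x hx => hf.reg x (hc x hx)

theorem Finishing.set {R : Arrays} {s : St} (h : Finishing T F R s) {x : V} (a : ℕ)
    (hx : x ∉ finishVars) : Finishing T F R (s.set x a) :=
  h.congr fun y hy => by rw [St.set_reg, if_neg (by rintro rfl; exact hx hy)]

theorem moveChain_runs (ok : Ok T w M) (hF : IsGreedy T F) {R : Arrays} (hR : R.Valid T F w M)
    (hG : R.Gaps T F M) {v : ℕ} {s : St} (hv : v < nN T) (hfin : Finishing T F R s)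
    (hm : Moved R T F (psum T F v) s.mem) (ht : Tables T F R.eB s.mem) (hC : Cursor T F v 0 s)
    (hi : s.reg .i = psum T F v) (hD : s.reg .D = (parent T (nodeAt T v)).length) :
    Runs T w M moveChain s fun s' t => Moved R T F (psum T F (v + 1)) s'.mem ∧
      Tables T F R.eB s'.mem ∧ s'.reg .i = psum T F (v + 1) ∧ t ≤ 20 * arr T F v + 1 := by
  have hT := ok.text
  have hbig := ok.big
  have hle := ok.le
  have hzn := hF.length_le
  have g1 := hG.aS
  have g2 := hG.cS
  have g3 := hR.cS_le
  have g4 := hR.wa_le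
  have g5 := hR.wc_le
  have g6 := hG.le
  have h1w := ok.one_le
  have hpv := psum_succ (T := T) (F := F) v
  have hpz := psum_le hT hF (v + 1)
  refine Runs.loop (fun k s' => k ≤ arr T F v ∧ Moved R T F (psum T F v + k) s'.mem ∧
    Tables T F R.eB s'.mem ∧ Cursor T F v k s' ∧ s'.reg .i = psum T F v + k ∧
    s'.reg .D = (parent T (nodeAt T v)).length + k) (fun k => 20 * (arr T F v - k)) 0 ?_ ?_ ?_ ?_
  · exact ⟨Nat.zero_le _, hm, ht, hC, hi, hD⟩
  · intros
    simp
  · rintro k s1 ⟨-, h2, h3, h4, h5, h6⟩ hf hc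
    have hfin1 := hfin.frame hf (by decide)
    have hr1 := hfin1.regs
    have hk : k < arr T F v := by
      by_contra hk
      have := h4.ex
      rw [decide_eq_false hk] at this
      simp [this] at hc
    obtain ⟨hs1, hs2, hs3⟩ := edgeNode_spec hF hk
    obtain ⟨y, hy, hyF⟩ := List.getElem_of_mem hs1
    obtain ⟨c, hc1, -⟩ := hF.exists_last hT hy
    rw [hyF] at hc1
    have hidx := h2.index v k hk y hy hyF
    have hchr := h2.char v k hk _ c hc1
    rw [if_neg (lt_irrefl _)] at hidx hchr
    -- The depth is at most the pre-order rank, so the position of the parenthesis is computed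
    -- without underflow.
    have hlen := (lzTrieBP_getElem? hF).2.1 _ _ (lzTrieNodes_getElem? hT hF hk)
    have hstep := h2.step ok hF hR hG hk rfl hy hyF hc1 hlen
    have hslot := h4.slot
    have hsl := slotOf_lt ok hF hk
    have e1 := entry_le (l := R.wa) hsl
    have e2 := entry_le (l := R.wc) hsl
    have hJ : psum T F v + k < F.length := by omega
    have e3 := entry_le (l := R.wa) hJ
    have e4 := entry_le (l := R.wc) hJ
    generalize hJd : psum T F v + k = J at *
    refine Runs.store_seq ?_ ?_
    · simp [hfin1.aB, h5, hr1.wa, hr1.aS, hslot]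
      omega
    have hmem1 : wr s1.mem (s1.reg .aB + s1.reg .i * s1.reg .wa) (s1.reg .wa)
        (blk s1.mem (s1.reg .aS + s1.reg .slot * s1.reg .wa) (s1.reg .wa)) =
        wr s1.mem (xB T + J * R.wa) R.wa (y + 1) := by
      rw [hfin1.aB, h5, hr1.wa, hr1.aS, hslot, hidx]
    simp only [eval_add, eval_var, eval_mul, eval_load]
    rw [hmem1]
    refine Runs.store_seq ?_ ?_
    · simp [hfin1.chB, h5, hr1.wc, hr1.cS, hslot]
      omega
    have hmem2 : wr (wr s1.mem (xB T + J * R.wa) R.wa (y + 1))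
        (s1.reg .chB + s1.reg .i * s1.reg .wc) (s1.reg .wc)
        (blk (wr s1.mem (xB T + J * R.wa) R.wa (y + 1))
          (s1.reg .cS + s1.reg .slot * s1.reg .wc) (s1.reg .wc)) =
        wr (wr s1.mem (xB T + J * R.wa) R.wa (y + 1))
          (R.aS + F.length * R.wa + J * R.wc) R.wc c := by
      rw [hfin1.chB, h5, hr1.wc, hr1.cS, hslot, blk_wr_disj (by omega), hchr]
    simp only [eval_add, eval_var, eval_mul, eval_load]
    rw [hmem2]
    refine Runs.set_seq (J + 1) (by simp [h5]) (by simp [h5]; omega) ?_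
    refine Runs.set_seq (edgeNode T v k).length (by simp [h6]; omega)
      (by simp [h6]; omega) ?_
    refine Runs.store_seq ?_ ?_
    · simp [hfin1.bp]
      omega
    simp only [eval_add, eval_var, eval_sub, eval_lit_1, St.set_reg, St.set_mem, reduceCtorEq,
      if_true, if_false, hfin1.bp]
    have hJ2 : J + 1 + (J + 1) = 2 * (J + 1) := by omega
    rw [hJ2]
    have htab : Tables T F R.eB (wr (wr (wr s1.mem (xB T + J * R.wa) R.wa (y + 1))
        (R.aS + F.length * R.wa + J * R.wc) R.wc c)
        (R.eB + F.length + (2 * (J + 1) - (edgeNode T v k).length)) 1 1) :=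
      h3.congr ok hF (fun A hA => by
        rw [wr_of_disj (by omega), wr_of_disj (by omega), wr_of_disj (by omega)])
        (fun A hA hA' => by
        rw [wr_of_disj (by omega), wr_of_disj (by omega), wr_of_disj (by omega)])
    refine (nextCmd_runs ok hF (by simp [hr1.eB]) hR.le htab hv hk (h4.congr (by simp))).mono ?_
    rintro s2 t2 ⟨h7, ht2⟩ hf2
    have em := hf2.mem rfl
    have ei := hf2.reg .i (by decide)
    have eD := hf2.reg .D (by decide)
    simp at em ei eD
    refine ⟨k + 1, ⟨by omega, ?_, by rw [em]; exact htab, h7, by rw [ei]; omega,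
      by rw [eD]; omega⟩, by omega⟩
    rw [em, ← add_assoc, hJd]
    exact hstep
  · rintro s' t k ⟨h1, h2, h3, h4, h5, h6⟩ hf hc ht
    have hk : ¬ k < arr T F v := by
      intro hk
      have := h4.ex
      rw [decide_eq_true hk] at this
      simp [this] at hc
    obtain rfl : k = arr T F v := by omega
    rw [hpv]
    exact ⟨h2, h3, h5, by omega⟩

end Finish

/-! ### Bringing the arrays into pre-order: all edges. -/

section FinishLoop

variable {σ : ℕ} {T : List (Fin σ)} {F : List (List (Fin σ))} {w M : ℕ}

/-- A bound for the time that is spent on a node when the LZ trie is brought into its final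
form. -/
def finishCost (T : List (Fin σ)) (F : List (List (Fin σ))) (v : ℕ) : ℕ :=
  30 + 4 * (if 0 < arr T F v then (parent T (nodeAt T v)).length + 1 else 0) + 20 * arr T F v

/-- At most `2 n` nodes cost 30 each, the string depths of the upper ends cost `4 n` by
`sum_length_parent_le`, and at most `n` points cost 20 each. -/
theorem sum_finishCost_le (ok : Ok T w M) (hF : IsGreedy T F) :
    ∑ v ∈ Finset.range (nN T), finishCost T F v ≤ 84 * T.length := by
  have hT := ok.text
  have h1 := sum_length_parent_le hF
  have h2 := psum_card hT hF
  have h3 := hF.length_le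
  have h4 := ok.nN_le
  unfold psum at h2
  simp only [finishCost, Finset.sum_add_distrib, ← Finset.mul_sum, Finset.sum_const,
    Finset.card_range, smul_eq_mul]
  unfold nN at h4 ⊢
  omega

theorem Engine.moved (ok : Ok T w M) (hF : IsGreedy T F) {R : Arrays} (hR : R.Valid T F w M)
    (hG : R.Gaps T F M) {s : St} (h : Engine T F R s) :
    Moved R T F 0 (wr s.mem (R.eB + F.length) 1 1) := by
  have h1 := hR.aS_le
  have h2 := hR.cS_le
  refine ⟨fun v k hk y hy hyF => ?_, fun v k hk f' c hc => ?_, fun q => ?_⟩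
  · have e1 := entry_le (l := R.wa) (slotOf_lt ok hF hk)
    have h3 := h.filled.index v k hk y hy hyF
    rw [if_pos hy] at h3
    rw [if_neg (Nat.not_lt_zero _), blk_wr_disj (by omega), h3]
  · have e1 := entry_le (l := R.wc) (slotOf_lt ok hF hk)
    obtain ⟨y, hy, hyF⟩ := List.getElem_of_mem (edgeNode_spec hF hk).1
    rw [if_neg (Nat.not_lt_zero _), blk_wr_disj (by omega)]
    exact h.filled.char v k hk y hy hyF hy f' c (hyF.trans hc) (c.isLt.trans hG.lt)
  · rw [wr_one, h.rest _ (by omega)]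
    by_cases hq : q = 0 <;> simp [hq]

theorem finish_runs (ok : Ok T w M) (hF : IsGreedy T F) {R : Arrays} (hR : R.Valid T F w M)
    (hG : R.Gaps T F M) {s : St} (hs : Engine T F R s) :
    Runs T w M finish s fun s' t => Finishing T F R s' ∧ Moved R T F F.length s'.mem ∧
      s'.reg .t = R.eB + F.length + (2 * F.length + 1) ∧ s'.reg .i = 1 ∧ s'.reg .j = 0 ∧
      t ≤ 100 * T.length := by
  have hT := ok.text
  have hn := hT.length_pos
  have hbig := ok.big
  have hNn := ok.nN_le
  have g6 := hG.le
  have h1w := ok.one_le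
  have hcost := sum_finishCost_le ok hF
  have hxe : xB T ≤ R.eB := by
    have := hR.le_eB
    omega
  refine Runs.set_seq (R.eB + F.length) (by simp [hs.regs.eB, hs.regs.z])
    (by simp [hs.regs.eB, hs.regs.z]; omega) ?_
  refine Runs.store_seq (by simp; omega) ?_
  simp only [eval_var, eval_lit_1, St.set_reg, St.set_mem, if_true]
  have hm := hs.moved ok hF hR hG
  have htab : Tables T F R.eB (wr s.mem (R.eB + F.length) 1 1) :=
    hs.tables.congr ok hF (fun A hA => wr_of_disj (by omega)) (fun A hA hA' => wr_of_disj (by omega))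
  refine Runs.set_seq 0 rfl (by simp) (Runs.set_seq 0 rfl (by simp) ?_)
  refine Runs.bind (Q₁ := fun s' t => Finishing T F R s' ∧ Moved R T F F.length s'.mem ∧
    t ≤ ∑ v ∈ Finset.range (nN T), finishCost T F v + 1) (Runs.loop (fun v s' => v ≤ nN T ∧
      Finishing T F R s' ∧ s'.reg .v = v ∧ s'.reg .i = psum T F v ∧
      Moved R T F (psum T F v) s'.mem ∧ Tables T F R.eB s'.mem)
    (fun v => ∑ i ∈ Finset.range (nN T), finishCost T F i -
      ∑ i ∈ Finset.range v, finishCost T F i) 0 ?_ ?_ ?_ ?_) ?_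
  · refine ⟨Nat.zero_le _, ⟨?_, ?_, ?_, ?_, ?_⟩, by simp, by simp [psum], by simpa [psum] using hm,
      by simpa using htab⟩
    · exact (((hs.env.set _ (by decide)).mem _).set _ (by decide)).set _ (by decide)
    · exact ((hs.regs.set (x := .bp) (R.eB + F.length) (by decide)).congr
        (s' := { s.set .bp (R.eB + F.length) with mem := wr s.mem (R.eB + F.length) 1 1 })
        fun _ _ => rfl).set _ (by decide) |>.set _ (by decide)
    · simpa using hs.aB
    · simpa using hs.chB
    · simp
  · intros
    simp
  · rintro v s1 ⟨-, h2, h3, h4, h5, h6⟩ hf hc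
    have hv : v < nN T := by simpa [h3, h2.env.N] using hc
    have hsum : ∑ i ∈ Finset.range (v + 1), finishCost T F i ≤
        ∑ i ∈ Finset.range (nN T), finishCost T F i :=
      Finset.sum_le_sum_of_subset (Finset.range_mono hv)
    rw [Finset.sum_range_succ] at hsum
    refine Runs.bind (firstCmd_runs ok hF h2.env hxe h2.regs.eB hR.le h6 hv h3) ?_
    rintro s2 t2 ⟨h7, ht2⟩ hf2
    have hfin2 := h2.frame hf2 (by decide)
    have em2 := hf2.mem rfl
    have ev2 := (hf2.reg .v (by decide)).trans h3
    have ei2 := (hf2.reg .i (by decide)).trans h4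
    refine Runs.bind (Q₁ := fun s' t => Finishing T F R s' ∧ s'.reg .v = v ∧
      s'.reg .i = psum T F (v + 1) ∧ Moved R T F (psum T F (v + 1)) s'.mem ∧
      Tables T F R.eB s'.mem ∧ t + 12 ≤ finishCost T F v) ?_ ?_
    · refine Runs.ite (by simp) ?_ ?_
      · intro hc2
        have hk : 0 < arr T F v := by
          by_contra hk
          have := h7.ex
          rw [decide_eq_false hk] at this
          simp [this] at hc2
        obtain ⟨hs1, hs2, hs3⟩ := edgeNode_spec hF hk
        have hv0 : nodeAt T v ≠ [] := by
          intro h0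
          have := hs3.length_le
          rw [h0, List.length_nil] at this
          omega
        have hvn : nodeAt T v ∈ nodeSet T := nodeAt_mem _
        refine Runs.set_seq (number T (parent T (nodeAt T v))) (by simp [ev2]) (by simp) ?_
        refine Runs.bind (depthCmd_runs ok (parent_mem_innerSet hT hvn hv0) (by simp)) ?_
        rintro s3 t3 ⟨h8, ht3⟩ hf3
        have em3 := hf3.mem rfl
        have ei3 := (hf3.reg .i (by decide)).trans
          ((by simp : (s2.set V.u (number T (parent T (nodeAt T v)))).reg .i = s2.reg .i).trans ei2)
        have hC3 : Cursor T F v 0 s3 := (h7.congr (s' := s2.set V.u (number T (parent T (nodeAt T v))))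
          (by simp)).congr fun x hx => hf3.reg x (by revert x; decide)
        have hfin3 := (hfin2.set (x := .u) (number T (parent T (nodeAt T v))) (by decide)).frame
          hf3 (by decide)
        have em : s3.mem = s1.mem := em3.trans em2
        refine (moveChain_runs ok hF hR hG hv hfin3 (by rw [em]; exact h5) (by rw [em]; exact h6)
          hC3 ei3 h8).mono ?_
        rintro s4 t4 ⟨h9, h10, h11, ht4⟩ hf4
        have ev3 := hf3.reg .v (by decide)
        have ev4 := hf4.reg .v (by decide)
        simp at ev3
        refine ⟨hfin3.frame hf4 (by decide), by rw [ev4, ev3, ev2], h11, h9, h10, ?_⟩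
        rw [finishCost, if_pos hk]
        omega
      · intro hc2
        have hk : arr T F v = 0 := by
          by_contra hk
          have := h7.ex
          rw [decide_eq_true (Nat.pos_of_ne_zero hk)] at this
          simp [this] at hc2
        have hps : psum T F (v + 1) = psum T F v := by rw [psum_succ, hk, add_zero]
        refine Runs.set 0 rfl (by simp) ⟨hfin2.set _ (by decide), by simpa using ev2, ?_, ?_, ?_, ?_⟩
        · simpa [hps] using ei2
        · rw [hps]
          simpa [em2] using h5
        · simpa [em2] using h6
        · rw [finishCost]
          omega
    · rintro s3 t3 ⟨h8, h9, h10, h11, h12, ht3⟩ hf3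
      refine Runs.set (v + 1) (by simp [h9]) (by simp [h9]; omega)
        ⟨v + 1, ⟨hv, h8.set _ (by decide), by simp, by simpa using h10, by simpa using h11,
          by simpa using h12⟩, ?_⟩
      rw [Finset.sum_range_succ]
      omega
  · rintro s' t v ⟨h1, h2, h3, h4, h5, h6⟩ hf hc ht
    have hv : ¬ v < nN T := by simpa [h3, h2.env.N] using hc
    obtain rfl : v = nN T := by omega
    refine ⟨h2, ?_, ?_⟩
    · rw [← psum_card hT hF]
      exact h5
    · simp at ht
      omega
  · rintro s1 t1 ⟨h1, h2, ht1⟩ hf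
    refine Runs.set_seq (R.eB + F.length + (2 * F.length + 1))
      (by simp [h1.bp, h1.regs.z]; omega) (by simp [h1.bp, h1.regs.z]; omega) ?_
    refine Runs.set_seq 1 (by simp) (by simp) (Runs.set 0 rfl (by simp) ?_)
    exact ⟨((h1.set _ (by decide)).set _ (by decide)).set _ (by decide), by simpa using h2,
      by simp, by simp, by simp, by omega⟩

end FinishLoop

/-! ### Space bounds. -/

section Space

variable {σ : ℕ} {T : List (Fin σ)} {F : List (List (Fin σ))} {w M : ℕ}

theorem size_eq_log {m : ℕ} (hm : 0 < m) : m.size = Nat.log 2 m + 1 := by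
  apply le_antisymm
  · rw [Nat.size_le]
    exact Nat.lt_pow_succ_log_self (by norm_num) m
  · rw [Nat.succ_le_iff, Nat.lt_size]
    exact Nat.pow_log_le_self 2 hm.ne'

theorem size_le_logb {m : ℕ} (hm : 0 < m) : (m.size : ℝ) ≤ Real.logb 2 m + 1 := by
  rw [size_eq_log hm]
  push_cast
  have := Real.natLog_le_logb m 2
  push_cast at this
  linarith

theorem size_cube_isLittleO :
    (fun n : ℕ => (n.size : ℝ) ^ 3) =o[atTop] (fun n : ℕ => (n : ℝ)) := by
  have h1 : (fun n : ℕ => (n.size : ℝ) ^ 3) =O[atTop] fun n : ℕ => Real.log n ^ 3 := by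
    -- From `n = 3` on, the number of digits is at most `3 * Real.log n`.
    refine IsBigO.of_bound 27 ?_
    filter_upwards [eventually_ge_atTop 3] with n hn
    have h2 := size_le_logb (show 0 < n by omega)
    have h3 : 1 ≤ Real.log n := by
      rw [Real.le_log_iff_exp_le (by positivity)]
      have h4 : (3 : ℝ) ≤ n := by exact_mod_cast hn
      linarith [Real.exp_one_lt_d9]
    have h5 : Real.logb 2 n ≤ 2 * Real.log n := by
      rw [Real.logb, div_le_iff₀ (Real.log_pos (by norm_num))]
      nlinarith [Real.log_two_gt_d9]
    rw [Real.norm_of_nonneg (by positivity), Real.norm_of_nonneg (by positivity),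
      show (27 : ℝ) * Real.log n ^ 3 = (3 * Real.log n) ^ 3 by ring]
    exact pow_le_pow_left₀ (by positivity) (by linarith) 3
  exact h1.trans_isLittleO
    ((Real.isLittleO_pow_log_id_atTop (n := 3)).comp_tendsto tendsto_natCast_atTop_atTop)

theorem extra_isLittleO {wordSize : ℕ → ℕ} (C : ℕ)
    (h : (fun n => (wordSize n : ℝ)) =o[atTop] (fun n : ℕ => (n : ℝ))) :
    (fun n : ℕ => 64 * (n.size : ℝ) ^ 3 + 64 + C * (wordSize n : ℝ)) =o[atTop]
      (fun n : ℕ => (n : ℝ)) := by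
  refine ((size_cube_isLittleO.const_mul_left 64).add ?_).add (h.const_mul_left C)
  exact isLittleO_const_left.2 (Or.inr (by
    simpa [Function.comp_def] using tendsto_natCast_atTop_atTop (R := ℝ)))

/-- There are at most `2 n` node bits, and a pointer of `ell T` bits for every `4 * ell T` nodes
adds about `n / 2` bits; the rest is polylogarithmic. The factor 2 avoids fractions. -/
theorem two_mul_xB_le (hT : IsText T) : 2 * xB T ≤ 5 * T.length + 32 * ell T ^ 3 := by
  have hell : 0 < ell T := Nat.size_pos.2 hT.length_pos
  have hN : nN T ≤ 2 * T.length := hT.card_nodeSet_le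
  have h1 : nN T / kk T * kk T ≤ nN T := Nat.div_mul_le_self _ _
  rw [show kk T = 4 * ell T from rfl] at h1
  have h2 : nN T / (4 * ell T) * (4 * ell T) = 4 * (nN T / (4 * ell T) * ell T) := by ring
  have h3 := Nat.pow_le_pow_right hell (show 1 ≤ 3 by norm_num)
  have h4 := Nat.pow_le_pow_right hell (show 2 ≤ 3 by norm_num)
  have h5 : xB T = 4 * ell T ^ 3 + 5 * ell T ^ 2 + ell T + nN T / (4 * ell T) * ell T +
      2 * ell T + nN T + 4 * ell T := by
    simp only [xB_eq, hB_eq, ptB_eq, th_eq, show kk T = 4 * ell T from rfl]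
    ring
  rw [pow_one] at h3
  omega

theorem th_mul_le (hT : IsText T) {m : ℕ} (hm : m ≤ ell T) : th T * m ≤ 5 * ell T ^ 3 := by
  have hell : 0 < ell T := Nat.size_pos.2 hT.length_pos
  have h4 := Nat.pow_le_pow_right hell (show 2 ≤ 3 by norm_num)
  calc th T * m ≤ th T * ell T := Nat.mul_le_mul_left _ hm
    _ = 4 * ell T ^ 3 + ell T ^ 2 := by
      rw [th_eq, show kk T = 4 * ell T from rfl]
      ring
    _ ≤ _ := by omega

/-- The maximum reflects the sharing of memory: the arrays of the second pass and the `2 n` bits of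
the first one are never needed together. -/
theorem two_mul_layout_le (hT : IsText T) {wa wc : ℕ} (ha : wa ≤ ell T) (hc : wc ≤ ell T) :
    2 * (layout T F wa wc).eB ≤ 5 * T.length + 52 * ell T ^ 3 +
      max (2 * (F.length * wa + F.length * wc)) (4 * T.length) := by
  have h1 := two_mul_xB_le hT
  have h2 := th_mul_le hT ha
  have h3 := th_mul_le hT hc
  simp only [layout]
  omega

theorem IsGreedy.length_pos' (hT : IsText T) (hF : IsGreedy T F) : 0 < F.length := by
  by_contra h
  have h1 := hF.flatten
  rw [List.eq_nil_of_length_eq_zero (show F.length = 0 by omega)] at h1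
  have := hT.length_pos
  rw [← h1] at this
  simp at this

/-- With words of `10 * ell T` bits, all addresses and all intermediate results fit in a word. -/
theorem layout_valid (hT : IsText T) (hF : IsGreedy T F) {wa wc : ℕ} (hz : F.length < 2 ^ wa)
    (ha : wa ≤ ell T) (hc : wc ≤ ell T) (hw : 10 * ell T ≤ w)
    (hM : (layout T F wa wc).eB + F.length ≤ M)
    (hM' : M ≤ (layout T F wa wc).eB + F.length + 2 * (F.length + 1)) :
    Ok T w M ∧ (layout T F wa wc).Valid T F w M := by
  have hn := hT.length_pos
  have hell : 0 < ell T := Nat.size_pos.2 hn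
  have hzn := hF.length_le
  have hzp := hF.length_pos' hT
  have h1 := two_mul_layout_le (F := F) hT ha hc
  have h2 : xB T + 2 * T.length ≤ (layout T F wa wc).eB := le_max_right _ _
  have h3 : xB T + th T * wa + F.length * wa + th T * wc + F.length * wc ≤
    (layout T F wa wc).eB := le_max_left _ _
  refine ⟨⟨hT, ?_, ?_, ?_⟩, ?_, ?_, h3, h2, hM, hz, ?_, ?_⟩
  · rw [show kk T = 4 * ell T from rfl]
    omega
  · have h4 : ell T ≤ T.length := Nat.size_le.2 Nat.lt_two_pow_self
    have h5 : T.length < 2 ^ ell T := lt_two_pow_ell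
    have h6 : F.length * wa ≤ T.length ^ 2 := by
      rw [sq]
      exact Nat.mul_le_mul hzn (by omega)
    have h7 : F.length * wc ≤ T.length ^ 2 := by
      rw [sq]
      exact Nat.mul_le_mul hzn (by omega)
    have h8 := Nat.pow_le_pow_left h4 3
    have h9 := Nat.pow_le_pow_right hn (show 1 ≤ 3 by norm_num)
    have h10 := Nat.pow_le_pow_right hn (show 2 ≤ 3 by norm_num)
    have h11 : 0 < T.length ^ 3 := by positivity
    rw [pow_one] at h9
    -- All quantities are at most cubic in `n`, so `7 + 3 * ell T` bits suffice, which is at most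
    -- `10 * ell T`; hence the constant 10 for the word size.
    have h12 : M + 16 * T.length + 64 ≤ 128 * T.length ^ 3 := by omega
    calc M + 16 * T.length + 64 ≤ 128 * T.length ^ 3 := h12
      _ < 128 * (2 ^ ell T) ^ 3 :=
        Nat.mul_lt_mul_of_pos_left (Nat.pow_lt_pow_left h5 (by norm_num)) (by norm_num)
      _ = 2 ^ (7 + 3 * ell T) := by
        rw [pow_add, mul_comm 3, pow_mul]
        norm_num
      _ ≤ 2 ^ w := Nat.pow_le_pow_right (by norm_num) (by omega)
  · omega
  · exact Nat.le_add_right _ _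
  · exact Nat.le_add_right _ _
  · exact ha.trans (by omega)
  · exact hc.trans (by omega)

/-- If the array of indices is larger than the counters, rounding its entries up and the successor
bits cost at most `z` bits each, and `5n/2 + 2z` is at most `9n/2`. Otherwise the total is `9n/2 +
z`. -/
theorem space_codes_le (hT : IsText T) (hF : IsGreedy T F) :
    (((layout T F F.length.size 0).eB + F.length : ℕ) : ℝ) ≤
      5 * T.length + F.length * Real.logb 2 F.length + (64 * (T.length.size : ℝ) ^ 3 + 64) := by
  have hzn := hF.length_le
  have hzp := hF.length_pos' hT
  have h1 := two_mul_layout_le (F := F) hT (Nat.size_le_size hzn) (Nat.zero_le (ell T))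
  have h2 := size_le_logb hzp
  have h3 : (F.length : ℝ) ≤ T.length := by exact_mod_cast hzn
  have h4 : (F.length : ℝ) * F.length.size ≤ F.length * (Real.logb 2 F.length + 1) :=
    mul_le_mul_of_nonneg_left h2 (Nat.cast_nonneg _)
  -- For more than one factor the logarithm is at least 1; the summand 1 covers a single factor.
  -- This absorbs half of the `z` successor bits in the case that the counters dominate.
  have h5 : (F.length : ℝ) ≤ F.length * Real.logb 2 F.length + 1 := by
    rcases Nat.lt_or_ge 1 F.length with h | h
    · have h6 : (1 : ℝ) ≤ Real.logb 2 F.length := by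
        rw [Real.le_logb_iff_rpow_le (by norm_num) (by exact_mod_cast hzp), Real.rpow_one]
        exact_mod_cast h
      nlinarith [(Nat.cast_nonneg F.length : (0 : ℝ) ≤ F.length)]
    · have h6 : F.length = 1 := by omega
      simp [h6]
  have h7 : (0 : ℝ) ≤ (ell T : ℝ) ^ 3 := by positivity
  rw [show T.length.size = ell T from rfl]
  rw [mul_zero, add_zero] at h1
  rcases le_total (2 * (F.length * F.length.size)) (4 * T.length) with h | h
  · rw [max_eq_right h] at h1
    have h8 : (2 : ℝ) * (layout T F F.length.size 0).eB ≤
        5 * T.length + 52 * (ell T : ℝ) ^ 3 + 4 * T.length := by exact_mod_cast h1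
    push_cast
    linarith
  · rw [max_eq_left h] at h1
    have h8 : (2 : ℝ) * (layout T F F.length.size 0).eB ≤
        5 * T.length + 52 * (ell T : ℝ) ^ 3 + 2 * (F.length * F.length.size) := by exact_mod_cast h1
    push_cast
    linarith

/-- Rounding up the entries of both arrays costs `2 z` bits, the successor bits `z` and the
parentheses `2 z + 2`. Of these, `3 z` are in the bound, and the remaining `2 z` fit into `7n/2`,
the difference between `6n` and `5n/2`. If the counters dominate, `9n/2 + 3z` and lower order terms
are used. -/
theorem space_trie_le (hT : IsText T) (hF : IsGreedy T F) :
    (((layout T F F.length.size σ.size).eB + F.length + 2 * (F.length + 1) : ℕ) : ℝ) ≤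
      6 * T.length + F.length * (Real.logb 2 σ + Real.logb 2 F.length + 3) +
        (64 * (T.length.size : ℝ) ^ 3 + 64) := by
  have hzn := hF.length_le
  have hzp := hF.length_pos' hT
  have hσn := hT.card_le
  have hσp : 0 < σ := by
    obtain ⟨c, -⟩ := List.exists_mem_of_length_pos hT.length_pos
    exact c.pos
  have h1 := two_mul_layout_le (F := F) hT (Nat.size_le_size hzn) (Nat.size_le_size hσn)
  have h3 : (F.length : ℝ) ≤ T.length := by exact_mod_cast hzn
  have h4 : (F.length : ℝ) * F.length.size ≤ F.length * (Real.logb 2 F.length + 1) :=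
    mul_le_mul_of_nonneg_left (size_le_logb hzp) (Nat.cast_nonneg _)
  have h5 : (F.length : ℝ) * σ.size ≤ F.length * (Real.logb 2 σ + 1) :=
    mul_le_mul_of_nonneg_left (size_le_logb hσp) (Nat.cast_nonneg _)
  have h6 : 0 ≤ F.length * Real.logb 2 F.length :=
    mul_nonneg (Nat.cast_nonneg _) (Real.logb_nonneg (by norm_num) (by exact_mod_cast hzp))
  have h6' : 0 ≤ F.length * Real.logb 2 σ :=
    mul_nonneg (Nat.cast_nonneg _) (Real.logb_nonneg (by norm_num) (by exact_mod_cast hσp))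
  have h7 : (0 : ℝ) ≤ (ell T : ℝ) ^ 3 := by positivity
  rw [show T.length.size = ell T from rfl]
  rcases le_total (2 * (F.length * F.length.size + F.length * σ.size)) (4 * T.length) with h | h
  · rw [max_eq_right h] at h1
    have h8 : (2 : ℝ) * (layout T F F.length.size σ.size).eB ≤
        5 * T.length + 52 * (ell T : ℝ) ^ 3 + 4 * T.length := by exact_mod_cast h1
    push_cast
    linarith
  · rw [max_eq_left h] at h1
    have h8 : (2 : ℝ) * (layout T F F.length.size σ.size).eB ≤
        5 * T.length + 52 * (ell T : ℝ) ^ 3 +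
          2 * (F.length * F.length.size + F.length * σ.size) := by exact_mod_cast h1
    push_cast
    linarith

end Space

/-! ### Runs on the word RAM and the stored trie. -/

section Result

variable {σ : ℕ} {T : List (Fin σ)} {F : List (List (Fin σ))} {w M : ℕ}

theorem exists_psum_add_eq (hT : IsText T) (hF : IsGreedy T F) {i : ℕ} (hi : i < F.length) :
    ∃ v k, k < arr T F v ∧ psum T F v + k = i ∧ (lzTrieNodes F)[i]? = some (edgeNode T v k) := by
  have h1 : (lzTrieNodes F).length = F.length := by
    rw [lzTrieNodes, Finset.length_sort, List.toFinset_card_of_nodup hF.nodup]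
  have h2 : ∀ f ∈ lzTrieNodes F, f ∈ F := fun f hf => by
    rwa [lzTrieNodes, Finset.mem_sort, List.mem_toFinset] at hf
  obtain ⟨v, k, hk, h3⟩ := exists_edgeNode_eq hT hF
    (h2 _ (List.getElem_mem (h1 ▸ hi : i < (lzTrieNodes F).length)))
  have h4 := lzTrieNodes_getElem? hT hF hk
  have h5 : (lzTrieNodes F)[i]? = some (edgeNode T v k) := by
    rw [h3, List.getElem?_eq_getElem]
  refine ⟨v, k, hk, ?_, h5⟩
  have hnd : (lzTrieNodes F).Nodup := Finset.sort_nodup _ _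
  have h6 := (List.getElem?_eq_some_iff.1 h4).1
  exact (List.getElem?_inj h6 hnd).1 (h4.trans h5.symm)

theorem storesLZTrie_of_moved (ok : Ok T w M) (hF : IsGreedy T F) {R : Arrays}
    (hR : R.Valid T F w M) (hG : R.Gaps T F M) {s : St} (hfin : Finishing T F R s)
    (hm : Moved R T F F.length s.mem) {r : State} (hr : ∀ x : V, r.reg x.idx = s.reg x)
    (hrm : r.mem = s.mem) (hu : R.eB + F.length + 2 * (F.length + 1) ≤ r.used) :
    StoresLZTrie w F r := by
  have hT := ok.text
  have g1 := hG.aS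
  have g2 := hG.cS
  have g3 := hR.cS_le
  have r0 : r.reg 0 = R.eB + F.length := (hr .bp).trans hfin.bp
  have r1 : r.reg 1 = xB T := (hr .aB).trans hfin.aB
  have r2 : r.reg 2 = R.wa := (hr .wa).trans hfin.regs.wa
  have r3 : r.reg 3 = R.aS + F.length * R.wa := (hr .chB).trans hfin.chB
  have r4 : r.reg 4 = R.wc := (hr .wc).trans hfin.regs.wc
  have r5 : r.reg 5 = F.length := (hr .z).trans hfin.regs.z
  have hblk : ∀ a l, r.block a l = blk s.mem a l := fun a l => by rw [State.block, hrm, blk]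
  refine ⟨r5, ⟨by omega, fun i hi => ?_⟩, ⟨?_, by rw [r1, r2]; omega, fun i hi => ?_⟩,
    ⟨?_, by rw [r3, r4]; omega, fun i hi => ?_⟩⟩
  · obtain ⟨h1, -, h2⟩ := lzTrieBP_getElem? hF
    have h3 := h2 i hi
    have h4 := hm.bit i
    rw [r0, hrm]
    have h5 : (lzTrieBP F (F.flatten.length + 1) [])[i]? = some true ↔
        s.mem (R.eB + F.length + i) = true := by
      rw [h3, h4]
      refine or_congr Iff.rfl ⟨?_, ?_⟩
      · rintro ⟨j, f, h6, h7⟩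
        have hj : j < F.length := by
          have h8 := (List.getElem?_eq_some_iff.1 h6).1
          rwa [lzTrieNodes, Finset.length_sort, List.toFinset_card_of_nodup hF.nodup] at h8
        obtain ⟨v, k, hk, rfl, h8⟩ := exists_psum_add_eq hT hF hj
        obtain rfl : edgeNode T v k = f := by simpa using h8.symm.trans h6
        exact ⟨v, k, hk, hj, h7⟩
      · rintro ⟨v, k, hk, -, h7⟩
        exact ⟨_, _, lzTrieNodes_getElem? hT hF hk, h7⟩
    rw [List.getElem?_eq_getElem (h1 ▸ hi)] at h5 ⊢
    simp only [Option.some.injEq] at h5 ⊢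
    exact Bool.eq_iff_iff.2 h5
  · rw [r2]
    exact hR.wa_le
  · obtain ⟨v, k, hk, rfl, h8⟩ := exists_psum_add_eq hT hF hi
    obtain ⟨y, hy, hyF⟩ := List.getElem_of_mem (edgeNode_spec hF hk).1
    have h9 := hm.index v k hk y hy hyF
    rw [if_pos hi] at h9
    exact ⟨y, hy, by rw [h8, hyF], by rw [hblk, r1, r2, h9]⟩
  · rw [r4]
    exact hR.wc_le
  · obtain ⟨v, k, hk, rfl, h8⟩ := exists_psum_add_eq hT hF hi
    obtain ⟨y, hy, hyF⟩ := List.getElem_of_mem (edgeNode_spec hF hk).1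
    obtain ⟨c, hc, -⟩ := hF.exists_last hT hy
    rw [hyF] at hc
    have h9 := hm.char v k hk _ c hc
    rw [if_pos hi] at h9
    exact ⟨_, c, by rw [h8, ← hc], by rw [hblk, r3, r4, h9]⟩

theorem sim_init (w M : ℕ) : Sim w M ⟨fun _ => 0, fun _ => false, []⟩ State.init :=
  ⟨fun _ => rfl, fun _ => Nat.two_pow_pos w, rfl, rfl, Nat.zero_le _⟩

theorem Runs.exec_compile (ok : Ok T w M) {c : Cmd} {Q : St → ℕ → Prop}
    (h : Runs T w M c ⟨fun _ => 0, fun _ => false, []⟩ Q) :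
    ∃ s t r t', Q s t ∧ Exec T w c.compile State.init r t' ∧ t' ≤ c.cost * t ∧ Sim w M s r := by
  obtain ⟨s, t, h1, h2⟩ := h
  have hbig := ok.big
  obtain ⟨r, t', h3, h4, h5⟩ := h1.exec_compile (by omega)
    (fun q a b => (answer_le ok.text q a b).trans_lt (by omega)) _ le_rfl _ (sim_init w M)
  exact ⟨s, t, r, t', h2, h3, h4, h5⟩

theorem ten_mul_ell_le {wordSize : ℕ → ℕ} (h : ∀ n, 10 * (Nat.log 2 n + 1) ≤ wordSize n)
    (hT : IsText T) : 10 * ell T ≤ wordSize T.length := by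
  rw [ell, size_eq_log hT.length_pos]
  exact h _

theorem exec_codes (hT : IsText T) (hF : IsGreedy T F) (hw : 10 * ell T ≤ w) :
    ∃ (s : State) (t : ℕ), Exec T w (engine widths0).compile State.init s t ∧
      t ≤ (engine widths0).cost * 1000 * T.length ∧ IsCoding F s.out ∧
      s.used ≤ (layout T F F.length.size 0).eB + F.length := by
  obtain ⟨ok, hR⟩ := layout_valid hT hF (Nat.lt_size_self _) (Nat.size_le_size hF.length_le)
    (Nat.zero_le _) hw le_rfl (Nat.le_add_right _ _)
  obtain ⟨s, t, r, t', ⟨h1, h2⟩, h3, h4, h5⟩ := (engine_runs ok hF hR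
    (fun s hz => widths0_runs ok hF hz) (by decide) rfl rfl
    (s := ⟨fun _ => 0, fun _ => false, []⟩) (fun _ => rfl) rfl).exec_compile ok
  refine ⟨r, t', h3, h4.trans ?_, by rw [h5.out]; exact h1.coding, h5.used⟩
  rw [mul_assoc]
  exact Nat.mul_le_mul_left _ h2

/-- The program that stores the LZ trie. The last instruction writes the last parenthesis. -/
def trieProg : Prog :=
  .seq (engine widths1 ;; finish).compile (.instr (.store V.t.idx V.i.idx V.j.idx))

theorem exec_trie (hT : IsText T) (hF : IsGreedy T F) (hw : 10 * ell T ≤ w) :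
    ∃ (s : State) (t : ℕ), Exec T w trieProg State.init s t ∧
      t ≤ ((engine widths1 ;; finish).cost * 1100 + 1) * T.length ∧ StoresLZTrie w F s ∧
      s.used ≤ (layout T F F.length.size σ.size).eB + F.length + 2 * (F.length + 1) := by
  have hn := hT.length_pos
  obtain ⟨ok, hR⟩ := layout_valid hT hF (Nat.lt_size_self _) (Nat.size_le_size hF.length_le)
    (Nat.size_le_size hT.card_le) hw (Nat.le_add_right _ _) le_rfl
  have hG : (layout T F F.length.size σ.size).Gaps T F
      ((layout T F F.length.size σ.size).eB + F.length + 2 * (F.length + 1)) :=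
    ⟨rfl, rfl, Nat.lt_size_self _, le_rfl⟩
  have h1w := ok.one_le
  have heng := engine_runs ok hF hR (fun s hz => widths1_runs ok hF hz) (by decide) rfl rfl
    (s := ⟨fun _ => 0, fun _ => false, []⟩) (fun _ => rfl) rfl
  generalize layout T F F.length.size σ.size = R at *
  have hrun : Runs T w (R.eB + F.length + 2 * (F.length + 1)) (engine widths1 ;; finish)
      ⟨fun _ => 0, fun _ => false, []⟩ fun s t => Finishing T F R s ∧ Moved R T F F.length s.mem ∧
        s.reg .t = R.eB + F.length + (2 * F.length + 1) ∧ s.reg .i = 1 ∧ s.reg .j = 0 ∧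
        t ≤ 1100 * T.length := by
    refine heng.bind ?_
    rintro s1 t1 ⟨h1, ht1⟩ -
    refine (finish_runs ok hF hR hG h1).mono ?_
    rintro s2 t2 ⟨h2, h3, h4, h5, h6, h7⟩ -
    exact ⟨h2, h3, h4, h5, h6, by omega⟩
  obtain ⟨s, t, r, t', ⟨h1, h2, ht, hi, hj, h3⟩, h4, h5, h6⟩ := hrun.exec_compile ok
  -- The last parenthesis closes the root, and its bit is already zero. The final store leaves the
  -- memory as it is; its purpose is that this bit counts as used.
  have hlast : s.mem (R.eB + F.length + (2 * F.length + 1)) = false := by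
    rw [← Bool.not_eq_true, h2.bit]
    rintro (h | ⟨v, k, h7, h8, h9⟩)
    · omega
    · omega
  refine ⟨_, _, .seq h4 (.instr _ _), ?_, storesLZTrie_of_moved ok hF hR hG h1 h2 ?_ ?_ ?_, ?_⟩
  · rw [add_mul, one_mul, mul_assoc]
    have := Nat.mul_le_mul_left (engine widths1 ;; finish).cost h3
    omega
  · exact h6.reg
  · funext a
    simp only [Instr.step, State.write, State.touch, h6.reg, ht, hi, hj, min_eq_left h1w, h6.mem]
    split_ifs with h
    · obtain rfl : a = R.eB + F.length + (2 * F.length + 1) := by omega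
      rw [hlast, Nat.zero_testBit]
    · rfl
  · simp only [Instr.step, State.write, State.touch, h6.reg, ht, hi, min_eq_left h1w]
    omega
  · have := h6.used
    simp only [Instr.step, State.write, State.touch, h6.reg, ht, hi, min_eq_left h1w]
    omega

end Result

end LZCics

theorem mainTheorem3 :
    -- streaming the coded factors
    (∃ (P : Prog) (c₀ a : ℕ), ∀ wordSize : ℕ → ℕ,
      (∀ n, c₀ * (Nat.log 2 n + 1) ≤ wordSize n) →
      (fun n => (wordSize n : ℝ)) =o[atTop] (fun n : ℕ => (n : ℝ)) →
      ∃ g : ℕ → ℝ, g =o[atTop] (fun n : ℕ => (n : ℝ)) ∧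
        ∀ (σ : ℕ) (T : List (Fin σ)), IsText T →
          ∃ F : List (List (Fin σ)), IsLZ78 T F ∧
            ∃ (s : State) (t : ℕ),
              Exec T (wordSize T.length) P State.init s t ∧
              t ≤ a * T.length ∧
              IsCoding F s.out ∧
              (workingSpace (wordSize T.length) P s : ℝ) ≤
                5 * T.length + F.length * Real.logb 2 F.length + g T.length) ∧
    -- storing the LZ trie explicitly
    (∃ (P : Prog) (c₀ a : ℕ), ∀ wordSize : ℕ → ℕ,
      (∀ n, c₀ * (Nat.log 2 n + 1) ≤ wordSize n) →
      (fun n => (wordSize n : ℝ)) =o[atTop] (fun n : ℕ => (n : ℝ)) →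
      ∃ g : ℕ → ℝ, g =o[atTop] (fun n : ℕ => (n : ℝ)) ∧
        ∀ (σ : ℕ) (T : List (Fin σ)), IsText T →
          ∃ F : List (List (Fin σ)), IsLZ78 T F ∧
            ∃ (s : State) (t : ℕ),
              Exec T (wordSize T.length) P State.init s t ∧
              t ≤ a * T.length ∧
              StoresLZTrie (wordSize T.length) F s ∧
              (workingSpace (wordSize T.length) P s : ℝ) ≤
                6 * T.length
                  + F.length * (Real.logb 2 σ + Real.logb 2 F.length + 3)
                  + g T.length) := by
  refine ⟨⟨(engine widths0).compile, 10, (engine widths0).cost * 1000, fun wordSize hw ho =>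
    ⟨_, extra_isLittleO (engine widths0).compile.numRegs ho, fun σ T hT => ?_⟩⟩,
    ⟨trieProg, 10, (engine widths1 ;; finish).cost * 1100 + 1, fun wordSize hw ho =>
    ⟨_, extra_isLittleO trieProg.numRegs ho, fun σ T hT => ?_⟩⟩⟩
  · obtain ⟨F, hF⟩ := hT.exists_isGreedy
    obtain ⟨s, t, h1, h2, h3, h4⟩ := exec_codes hT hF (ten_mul_ell_le hw hT)
    refine ⟨F, hF.isLZ78, s, t, h1, h2, h3, ?_⟩
    have h5 := space_codes_le hT hF
    have h6 : (s.used : ℝ) ≤ ((layout T F F.length.size 0).eB + F.length : ℕ) := by exact_mod_cast h4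
    rw [workingSpace]
    push_cast at h5 h6 ⊢
    linarith
  · obtain ⟨F, hF⟩ := hT.exists_isGreedy
    obtain ⟨s, t, h1, h2, h3, h4⟩ := exec_trie hT hF (ten_mul_ell_le hw hT)
    refine ⟨F, hF.isLZ78, s, t, h1, h2, h3, ?_⟩
    have h5 := space_trie_le hT hF
    have h6 : (s.used : ℝ) ≤
        ((layout T F F.length.size σ.size).eB + F.length + 2 * (F.length + 1) : ℕ) := by
      exact_mod_cast h4
    rw [workingSpace]
    push_cast at h5 h6 ⊢
    linarith
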